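/- **Setting.** Let $R_0$ be a commutative ring of characteristic $2$, let $\Lambda_1=\mathbb Z_{\ge0}\langle e_1,\dots,e_r\rangle$, $\Lambda_2=\mathbb Z_{\ge0}\langle f_1,\dots,f_s\rangle$, $\Lambda=\Lambda_1\oplus\Lambda_2$, and $R=R_0[V_1,\dots,V_s,W_1,\dots,W_r]$. For a weight $w$ let $|w|$ be the sum of its coordinates. **Trees.** A *stably weighted tree* is a rooted planar tree with $n\ge 0$ inputs, one output, and internal vertices (possibly without incoming edges) carrying weights, such that each internal vertex has valence $>2$ or nonzero weight; there is at least one internal vertex. If $w$ is the total weight and $v$ the number of internal vertices, its dimension is $n+2|w|-v-1$. $X^{n,w}$ is the free module on these trees, with differential $\partial T$ the sum over all stably weighted trees with a chosen edge whose contraction gives $T$ (contraction adds weights). $\Psi_n^w$ is the tree with one internal vertex, and $T\circ_iS$ is gluing of the output of $S$ to the $i$-th input of $T$. $\tilde X$ is obtained by adding the strand $\downarrow$ (one input, no vertex) and the tree $\top$ (no input), both of weight and dimension $0$; $\downarrow$ is a unit for gluing, and $\top$ is a strict unit: $\downarrow\circ_1\top=\top$, and $T\circ_i\top$ is $T$ with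 the $i$-th input deleted and the vertex below it suppressed if this vertex is a $\Psi_2^0$, and is $0$ otherwise. **Bimodule trees.** $XB^{n,j,w}$ is the analogous complex of stably weighted trees with $n+1+j$ inputs, the $(n+1)$-st being distinguished, of total weight $w\in\Lambda$. Weights are in $\Lambda$ for vertices on the path from the distinguished input to the output (the spine), in $\Lambda_2$ to the left of the spine, and in $\Lambda_1$ to its right; edge expansions are required to respect this. Inputs and edges to the left of the spine, like those to its right, are numbered in the direction away from the spine, and trees are glued to left or right inputs with this orientation. $\Psi_{n|j}^w$ denotes the bimodule tree with one internal vertex. **Diagonals.** A *weighted algebra diagonal* with seed $c=(c_1,\dots,c_r,c'_1,\dots,c'_s)$, $c_i,c_i'\in R_0$, is an $R$-linear chain map $\Gamma$ from $\bigoplus_{n,w} X^{n,w}$ (weights in $\Lambda$, coefficients in $R$) to the $R$-span of the pairs $S\otimes T$ of generators of $\tilde X$, $S$ with weights in $\Lambda_1$ and $T$ with weights in $\Lambda_2$, preserving the number of inputs in each factor and the dimension, such that: each term $V^aW^b\,S\otimes T$ of $\Gamma(U)$ satisfies $\mathrm{wt}(S)+\sum a_if_i=\mathrm{wt}(T)+\sum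 b_ie_i=\mathrm{wt}(U)$; $\Gamma(T\circ_iS)=\Gamma(T)\circ_i\Gamma(S)$ for all stably weighted $T,S$ and all $i$; $\Gamma(\Psi_2^0)=\Psi_2^0\otimes\Psi_2^0$, $\Gamma(\Psi_0^{e_i})=c_iW_i\,\Psi_0^{e_i}\otimes\top$, $\Gamma(\Psi_0^{f_i})=c'_iV_i\,\top\otimes\Psi_0^{f_i}$; and in each term of $\Gamma(U)$ at most one factor is $\top$ or $\downarrow$. Put $\gamma^{n,w}=\Gamma(\Psi_n^w)$, and for $w=\sum k_ie_i+\sum l_if_i$ put $\kappa^w=\prod(c_iW_i)^{k_i}\prod(c'_iV_i)^{l_i}$. **Primitives.** For $(S_i,T_i)$ with $S_i$ in $\tilde X$ and $T_i$ a bimodule tree let $$\mathrm{CR}^v\big((S_1,T_1),\dots,(S_k,T_k)\big)=\Psi_k^v\circ(S_1,\dots,S_k)\otimes T,$$ where $T$ is obtained by gluing the output of $T_{i-1}$ to the distinguished input of $T_i$ for $2\le i\le k$ (for $k=0$, $T$ is the strand). Let $(S,T)\circ_L(S',T')=\sum_i(S\circ_iS',T\circ_iT')$, the sum over the inputs of $S$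 and the left inputs of $T$, and let $(S,T)\circ_RS'=\sum_i(S,T\circ_iS')$, the sum over the right inputs of $T$. All these are extended multilinearly. A *weighted bimodule diagonal primitive compatible with $\Gamma$* is a family $$p^{n,j,w}\in\bigoplus_{w_1\in\Lambda_1,\ w_2\in\Lambda,\ w_1+w_2\le w}\tilde X^{n,w_1}\otimes XB^{n,j,w_2}\qquad(n,j\ge0,\ w\in\Lambda)$$ with coefficients in $R$ such that for all $n,j,w$ $$\partial p^{n,j,w}=\sum_{\substack{k\ge0,\ v+\sum w_i=w\\ \sum n_i=n,\ \sum j_i=j}}\kappa^v\,\mathrm{CR}^v(p^{n_1,j_1,w_1},\dots,p^{n_k,j_k,w_k})+\sum_{\substack{w_1+w_2=w\\ n_1+n_2=n+1}}p^{n_2,j,w_2}\circ_L\gamma^{n_1,w_1}+\sum_{\substack{w_1+w_2=w\\ j_1+j_2=j+1}}\kappa^{w_1}\,p^{n,j_2,w_2}\circ_R\Psi_{j_1}^{w_1},$$ where in the first sum $v\in\Lambda_1$ with $v\neq0$ or $k\ge2$, in the second $w_1\in\Lambda$ with $w_1\ne0$ or $n_1\ge2$, in the third $w_1\in\Lambda_1$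 with $w_1\neq0$ or $j_1\ge2$ (that is, only stable corollas occur; $p^{0,0,0}=0$, so all sums are finite), and such that $$p^{1,0,0}=\downarrow\otimes\Psi_{1|0}^0,\qquad p^{0,1,0}=\top\otimes\Psi_{0|1}^0,\qquad p^{0,0,\varepsilon}=\kappa^{\varepsilon}\,\top\otimes\Psi_{0|0}^{\varepsilon}\ \text{ for each basis vector }\varepsilon\in\{e_1,\dots,e_r,f_1,\dots,f_s\}.$$ **Proposition.** For every seed $c$ and every weighted algebra diagonal $\Gamma$ with seed $c$ there exists a weighted bimodule diagonal primitive compatible with $\Gamma$. -/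

import Mathlib

/-! Weighted trees, weighted algebra diagonals and weighted bimodule diagonal primitives.

A weight space with basis indexed by a finite type `ι` is `ι → ℕ`.  All coefficient rings have
characteristic two, so no signs appear. -/

noncomputable section

namespace WeightedTrees

open MvPolynomial

/-! ### Weighted planar trees -/

/-- Rooted planar trees whose internal vertices carry weights in `ι → ℕ`.  `leaf` is an edge ending
in an input; `leaf` alone is the one-input tree without internal vertex (the strand, `↓`).
`node w cs` is an internal vertex of weight `w` whose subtrees are `cs`, from left to right;
`node w []` is a popsicle. -/
inductive WTree (ι : Type) : Type
  | leaf : WTree ι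
  | node (w : ι → ℕ) (children : List (WTree ι)) : WTree ι

/-- The size `|w|` of a weight. -/
def size {ι : Type} [Fintype ι] (w : ι → ℕ) : ℕ := ∑ i, w i

/-- A weight of the first weight space, as an element of the sum of the two weight spaces. -/
def ofFst {ι₁ ι₂ : Type} (v : ι₁ → ℕ) : ι₁ ⊕ ι₂ → ℕ := Sum.elim v 0

/-- A weight of the second weight space, as an element of the sum of the two weight spaces. -/
def ofSnd {ι₁ ι₂ : Type} (v : ι₂ → ℕ) : ι₁ ⊕ ι₂ → ℕ := Sum.elim 0 v

/-- A vertex of weight `w` with `n` incoming edges (so of valence `n + 1`) is stable. -/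
def StableVertex {ι : Type} (n : ℕ) (w : ι → ℕ) : Prop := w ≠ 0 ∨ 2 ≤ n

instance {ι : Type} [Fintype ι] (n : ℕ) (w : ι → ℕ) : Decidable (StableVertex n w) :=
  inferInstanceAs (Decidable (w ≠ 0 ∨ 2 ≤ n))

namespace WTree

variable {ι : Type}

mutual
/-- Number of inputs. -/
def inputs : WTree ι → ℕ
  | leaf => 1
  | node _ cs => inputsList cs
/-- Number of inputs of a forest. -/
def inputsList : List (WTree ι) → ℕ
  | [] => 0
  | t :: ts => inputs t + inputsList ts
end

mutual
/-- Total weight. -/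
def weight : WTree ι → (ι → ℕ)
  | leaf => 0
  | node w cs => w + weightList cs
/-- Total weight of a forest. -/
def weightList : List (WTree ι) → (ι → ℕ)
  | [] => 0
  | t :: ts => weight t + weightList ts
end

mutual
/-- Number of internal vertices. -/
def vertices : WTree ι → ℕ
  | leaf => 0
  | node _ cs => 1 + verticesList cs
/-- Number of internal vertices of a forest. -/
def verticesList : List (WTree ι) → ℕ
  | [] => 0
  | t :: ts => vertices t + verticesList ts
end

mutual
/-- All internal vertices are stable. -/
def Stable : WTree ι → Prop
  | leaf => True
  | node w cs => StableVertex cs.length w ∧ StableList cs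
/-- All internal vertices of a forest are stable. -/
def StableList : List (WTree ι) → Prop
  | [] => True
  | t :: ts => Stable t ∧ StableList ts
end

/-- The dimension `n + 2|w| - v - 1`. -/
def dim [Fintype ι] (T : WTree ι) : ℤ :=
  (T.inputs : ℤ) + 2 * (size T.weight : ℤ) - (T.vertices : ℤ) - 1

/-- `T` is a generator of the complex of stably weighted trees (the strand is not one). -/
def IsGenerator (T : WTree ι) : Prop := T.Stable ∧ T ≠ leaf

/-- The corolla `Ψ_n^w`. -/
def corolla (n : ℕ) (w : ι → ℕ) : WTree ι := node w (List.replicate n leaf)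

section Differential

variable (R : Type*) [CommRing R] [Fintype ι] [DecidableEq ι]

/-- Sum of the trees obtained by inserting an edge at the root vertex of `node w cs`: a
contiguous block of `cs`, possibly empty, together with a part `w'` of the weight, is moved to a
new vertex; both resulting vertices have to be stable. -/
def splitRoot (w : ι → ℕ) (cs : List (WTree ι)) : WTree ι →₀ R :=
  ∑ w' ∈ Finset.Icc 0 w, ∑ a ∈ Finset.range (cs.length + 1),
    ∑ b ∈ Finset.range (cs.length - a + 1),
      if StableVertex b w' ∧ StableVertex (cs.length - b + 1) (w - w') then
        Finsupp.single
          (node (w - w') (cs.take a ++ node w' ((cs.drop a).take b) :: cs.drop (a + b))) 1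
      else 0

mutual
/-- The differential on trees: the sum over all edge expansions. -/
def bd : WTree ι → (WTree ι →₀ R)
  | leaf => 0
  | node w cs => splitRoot R w cs + (bdList cs).mapDomain (node w)
/-- The differential on forests. -/
def bdList : List (WTree ι) → (List (WTree ι) →₀ R)
  | [] => 0
  | t :: ts => (bd t).mapDomain (fun t' => t' :: ts) + (bdList ts).mapDomain (fun ts' => t :: ts')
end

end Differential

end WTree

/-! ### Extended trees -/

/-- The generators of the extended complex: the trees (among them the strand `↓`, which is
`tree leaf`), and the tree `⊤` without inputs. -/
inductive XTree (ι : Type) : Type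
  | top : XTree ι
  | tree (T : WTree ι) : XTree ι

namespace XTree

variable {ι : Type}

/-- Number of inputs. -/
def inputs : XTree ι → ℕ
  | top => 0
  | tree T => T.inputs

/-- Total weight. -/
def weight : XTree ι → (ι → ℕ)
  | top => 0
  | tree T => T.weight

/-- Stability; `⊤` and `↓` are stable. -/
def Stable : XTree ι → Prop
  | top => True
  | tree T => T.Stable

/-- `T` is a generator of the complex of stably weighted trees, that is, neither `⊤` nor `↓`. -/
def IsGenerator : XTree ι → Prop
  | top => False
  | tree T => T.IsGenerator

/-- Dimension; `⊤` has dimension `0`. -/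
def dim [Fintype ι] : XTree ι → ℤ
  | top => 0
  | tree T => T.dim

/-- The list of underlying trees, if none of the entries is `⊤`. -/
def trees? : List (XTree ι) → Option (List (WTree ι))
  | [] => some []
  | top :: _ => none
  | tree T :: l => (trees? l).map (fun ts => T :: ts)

/-- `Ψ_m^w ∘ (S_1, …, S_m)`.  The result `none` stands for `0`.  The tree `⊤` is a strict unit:
gluing it to an input of `Ψ_2^0` deletes this input and forgets the vertex, which has become
two-valent; gluing it to any other corolla gives `0`. -/
def join [Fintype ι] (w : ι → ℕ) (l : List (XTree ι)) : Option (XTree ι) :=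
  match trees? l with
  | some ts => some (tree (.node w ts))
  | none =>
    if w = 0 then
      match l with
      | [top, S] => some S
      | [S, top] => some S
      | _ => none
    else none

end XTree

mutual
/-- `T ∘_i S`: glue `S` to the `i`-th input of `T`, inputs being numbered from left to right starting
with `0`; `none` stands for `0`. -/
def WTree.graft {ι : Type} [Fintype ι] : WTree ι → ℕ → XTree ι → Option (XTree ι)
  | .leaf, i, S => if i = 0 then some S else none
  | .node w cs, i, S => (WTree.graftList cs i S).bind (XTree.join w)
/-- Gluing into a forest. -/
def WTree.graftList {ι : Type} [Fintype ι] :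
    List (WTree ι) → ℕ → XTree ι → Option (List (XTree ι))
  | [], _, _ => none
  | t :: ts, i, S =>
    if i < t.inputs then (t.graft i S).map (fun t' => t' :: ts.map XTree.tree)
    else (WTree.graftList ts (i - t.inputs) S).map (fun ts' => XTree.tree t :: ts')
end

/-- `T ∘_i S` for extended trees. -/
def XTree.graft {ι : Type} [Fintype ι] : XTree ι → ℕ → XTree ι → Option (XTree ι)
  | .top, _, _ => none
  | .tree T, i, S => T.graft i S

/-- The differential on extended trees. -/
def XTree.bd (R : Type*) [CommRing R] {ι : Type} [Fintype ι] [DecidableEq ι] :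
    XTree ι → (XTree ι →₀ R)
  | .top => 0
  | .tree T => (T.bd R).mapDomain .tree

/-! ### Bimodule trees -/

/-- Trees with a distinguished input.  The spine is the path from it to the output.  Vertices to the
left of the spine carry weights in `ι₂ → ℕ`, vertices to its right weights in `ι₁ → ℕ`, and vertices on
it weights in `ι₁ ⊕ ι₂ → ℕ`.  `strand` is the distinguished input alone; `node w L T K` is a spine
vertex of weight `w` with the tree `T` above it on the spine, left subtrees `L` and right subtrees `K`.
Both lists are ordered starting from the spine, and on both sides of the spine the subtrees at a
vertex and the inputs are numbered in the direction away from the spine. -/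
inductive BTree (ι₁ ι₂ : Type) : Type
  | strand : BTree ι₁ ι₂
  | node (w : ι₁ ⊕ ι₂ → ℕ) (left : List (WTree ι₂)) (above : BTree ι₁ ι₂)
      (right : List (WTree ι₁)) : BTree ι₁ ι₂

namespace BTree

variable {ι₁ ι₂ : Type}

/-- Number of inputs left of the distinguished one. -/
def leftInputs : BTree ι₁ ι₂ → ℕ
  | strand => 0
  | node _ L T _ => T.leftInputs + WTree.inputsList L

/-- Number of inputs right of the distinguished one. -/
def rightInputs : BTree ι₁ ι₂ → ℕ
  | strand => 0
  | node _ _ T K => T.rightInputs + WTree.inputsList K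

/-- Total weight. -/
def weight : BTree ι₁ ι₂ → (ι₁ ⊕ ι₂ → ℕ)
  | strand => 0
  | node w L T K => w + T.weight + Sum.elim (WTree.weightList K) (WTree.weightList L)

/-- All internal vertices are stable. -/
def Stable : BTree ι₁ ι₂ → Prop
  | strand => True
  | node w L T K =>
    StableVertex (L.length + 1 + K.length) w ∧ T.Stable ∧ WTree.StableList L ∧ WTree.StableList K

/-- `T` is a generator of the complex of stably weighted bimodule trees. -/
def IsGenerator (T : BTree ι₁ ι₂) : Prop := T.Stable ∧ T ≠ strand

section Differential

variable (R : Type*) [CommRing R] [Fintype ι₁] [DecidableEq ι₁] [Fintype ι₂] [DecidableEq ι₂]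

/-- Sum of the trees obtained by inserting an edge at the spine vertex of `node w L T K`: the new
edge lies to the left of the spine, to the right of the spine, or on the spine. -/
def splitSpine (w : ι₁ ⊕ ι₂ → ℕ) (L : List (WTree ι₂)) (T : BTree ι₁ ι₂) (K : List (WTree ι₁)) :
    BTree ι₁ ι₂ →₀ R :=
  (∑ w' ∈ Finset.Icc 0 (w ∘ Sum.inr), ∑ a ∈ Finset.range (L.length + 1),
    ∑ b ∈ Finset.range (L.length - a + 1),
      if StableVertex b w' ∧
          StableVertex (L.length - b + 1 + 1 + K.length) (w - ofSnd w') then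
        Finsupp.single (node (w - ofSnd w')
          (L.take a ++ .node w' ((L.drop a).take b) :: L.drop (a + b)) T K) 1
      else 0)
  + (∑ w' ∈ Finset.Icc 0 (w ∘ Sum.inl), ∑ a ∈ Finset.range (K.length + 1),
    ∑ b ∈ Finset.range (K.length - a + 1),
      if StableVertex b w' ∧
          StableVertex (L.length + 1 + (K.length - b + 1)) (w - ofFst w') then
        Finsupp.single (node (w - ofFst w') L T
          (K.take a ++ .node w' ((K.drop a).take b) :: K.drop (a + b))) 1
      else 0)
  + ∑ w' ∈ Finset.Icc 0 w, ∑ a ∈ Finset.range (L.length + 1), ∑ b ∈ Finset.range (K.length + 1),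
      if StableVertex (a + 1 + b) w' ∧
          StableVertex (L.length - a + 1 + (K.length - b)) (w - w') then
        Finsupp.single
          (node (w - w') (L.drop a) (node w' (L.take a) T (K.take b)) (K.drop b)) 1
      else 0

/-- The differential on bimodule trees: the sum over all edge expansions. -/
def bd : BTree ι₁ ι₂ → (BTree ι₁ ι₂ →₀ R)
  | strand => 0
  | node w L T K =>
    splitSpine R w L T K
    + (WTree.bdList R L).mapDomain (fun L' => node w L' T K)
    + (bd T).mapDomain (fun T' => node w L T' K)
    + (WTree.bdList R K).mapDomain (fun K' => node w L T K')

end Differential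

/-- A spine vertex with extended trees glued to its left and right inputs; `⊤` is a strict unit. -/
def join [Fintype ι₁] [Fintype ι₂] (w : ι₁ ⊕ ι₂ → ℕ) (L : List (XTree ι₂)) (T : BTree ι₁ ι₂)
    (K : List (XTree ι₁)) : Option (BTree ι₁ ι₂) :=
  match XTree.trees? L, XTree.trees? K with
  | some L', some K' => some (node w L' T K')
  | _, _ => if w = 0 ∧ L.length + K.length = 1 then some T else none

/-- Glue `S` to the `i`-th left input (counted from the distinguished input outwards, from `0`);
`none` stands for `0`. -/
def graftLeft [Fintype ι₁] [Fintype ι₂] :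
    BTree ι₁ ι₂ → ℕ → XTree ι₂ → Option (BTree ι₁ ι₂)
  | strand, _, _ => none
  | node w L T K, i, S =>
    if i < T.leftInputs then (T.graftLeft i S).map (fun T' => node w L T' K)
    else (WTree.graftList L (i - T.leftInputs) S).bind
      (fun L' => join w L' T (K.map XTree.tree))

/-- Glue `S` to the `i`-th right input (counted from the distinguished input outwards, from `0`). -/
def graftRight [Fintype ι₁] [Fintype ι₂] :
    BTree ι₁ ι₂ → ℕ → XTree ι₁ → Option (BTree ι₁ ι₂)
  | strand, _, _ => none
  | node w L T K, i, S =>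
    if i < T.rightInputs then (T.graftRight i S).map (fun T' => node w L T' K)
    else (WTree.graftList K (i - T.rightInputs) S).bind
      (fun K' => join w (L.map XTree.tree) T K')

/-- Glue the output of `S` to the distinguished input of `T`. -/
def plug : BTree ι₁ ι₂ → BTree ι₁ ι₂ → BTree ι₁ ι₂
  | strand, S => S
  | node w L T K, S => node w L (T.plug S) K

/-- The joining of `T_1, …, T_m` along their spines: the output of `T_{i-1}` is glued to the
distinguished input of `T_i`. -/
def centralJoin (l : List (BTree ι₁ ι₂)) : BTree ι₁ ι₂ :=
  l.foldl (fun acc T => T.plug acc) strand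

/-- The corolla with `n` left inputs, `j` right inputs and weight `w`. -/
def corolla (n j : ℕ) (w : ι₁ ⊕ ι₂ → ℕ) : BTree ι₁ ι₂ :=
  node w (List.replicate n .leaf) strand (List.replicate j .leaf)

end BTree

/-! ### Linear combinations of pairs of trees

The tensor product of two free modules is the free module on the pairs of generators. -/

section Pairs

variable (R : Type*) [CommRing R]

/-- An optional generator as an element of the free module; `none` is `0`. -/
def ofOption {A : Type*} : Option A → (A →₀ R)
  | none => 0
  | some a => Finsupp.single a 1

variable {R}

/-- Bilinear extension of a partial operation on generators. -/
def bilin {A B C : Type*} (f : A → B → Option C) (x : A →₀ R) (y : B →₀ R) : C →₀ R :=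
  x.sum fun a r => y.sum fun b r' => (r * r') • ofOption R (f a b)

/-- `x_1 ⊗ ⋯ ⊗ x_k` in the free module on lists of generators. -/
def listTensor {A : Type*} : List (A →₀ R) → (List A →₀ R)
  | [] => Finsupp.single [] 1
  | x :: xs => bilin (fun a l => some (a :: l)) x (listTensor xs)

/-- The differential on a tensor product of two free complexes with differentials `d` and `d'`. -/
def bdPair {A B : Type*} (d : A → (A →₀ R)) (d' : B → (B →₀ R)) (x : A × B →₀ R) : A × B →₀ R :=
  x.sum fun g r =>
    r • ((d g.1).mapDomain (fun a => (a, g.2)) + (d' g.2).mapDomain (fun b => (g.1, b)))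

variable {ι₁ ι₂ : Type} [Fintype ι₁] [Fintype ι₂]

/-- `(S, T) ∘_i (S', T') = (S ∘_i S', T ∘_i T')`, bilinearly extended. -/
def compPair (i : ℕ) : (XTree ι₁ × XTree ι₂ →₀ R) → (XTree ι₁ × XTree ι₂ →₀ R) →
    (XTree ι₁ × XTree ι₂ →₀ R) :=
  bilin fun g h => (g.1.graft i h.1).bind fun a => (g.2.graft i h.2).map fun b => (a, b)

/-- `(S, T) ∘_{L,i} (S', T')`, bilinearly extended: gluing at the `i`-th input of `S` and at the
`i`-th left input of `T`. -/
def compL (i : ℕ) : (XTree ι₁ × BTree ι₁ ι₂ →₀ R) → (XTree ι₁ × XTree ι₂ →₀ R) →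
    (XTree ι₁ × BTree ι₁ ι₂ →₀ R) :=
  bilin fun g h => (g.1.graft i h.1).bind fun a => (g.2.graftLeft i h.2).map fun b => (a, b)

/-- `(S, T) ∘_{R,i} S'`, linearly extended: gluing `S'` at the `i`-th right input of `T`. -/
def compR (i : ℕ) (x : XTree ι₁ × BTree ι₁ ι₂ →₀ R) (S' : XTree ι₁) :
    XTree ι₁ × BTree ι₁ ι₂ →₀ R :=
  x.sum fun g r => r • ofOption R ((g.2.graftRight i S').map fun b => (g.1, b))

/-- The multilinear operation sending `(S_1, T_1), …, (S_k, T_k)` to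
`Ψ_k^v ∘ (S_1, …, S_k) ⊗ (joining of T_1, …, T_k along their spines)`. -/
def CR (v : ι₁ → ℕ) (xs : List (XTree ι₁ × BTree ι₁ ι₂ →₀ R)) : XTree ι₁ × BTree ι₁ ι₂ →₀ R :=
  (listTensor xs).sum fun l r =>
    r • ofOption R ((XTree.join v (l.map Prod.fst)).map
      fun S => (S, BTree.centralJoin (l.map Prod.snd)))

end Pairs

/-! ### Weighted algebra diagonals -/

/-- The ground ring `R₀[V, W]`.  The variable `X (inl i)` is `W_i`, attached to the basis weight `e_i`
of the first weight space `ι₁ → ℕ`; the variable `X (inr i)` is `V_i`, attached to the basis weight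
`f_i` of the second weight space `ι₂ → ℕ`. -/
abbrev GroundRing (R₀ : Type*) [CommRing R₀] (ι₁ ι₂ : Type) : Type _ := MvPolynomial (ι₁ ⊕ ι₂) R₀

/-- A weighted algebra diagonal whose seed consists of the elements `c_i W_i Ψ_0^{e_i} ⊗ ⊤` and
`c_i V_i ⊤ ⊗ Ψ_0^{f_i}`.  The linear map `Γ` is given on the free module on all trees; only its values
on stably weighted trees are constrained, and only these are ever used. -/
structure WeightedAlgebraDiagonal (R₀ : Type*) [CommRing R₀] (ι₁ ι₂ : Type) [Fintype ι₁]
    [DecidableEq ι₁] [Fintype ι₂] [DecidableEq ι₂] (c : ι₁ ⊕ ι₂ → R₀) where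
  /-- The diagonal. -/
  Γ : (WTree (ι₁ ⊕ ι₂) →₀ GroundRing R₀ ι₁ ι₂) →ₗ[GroundRing R₀ ι₁ ι₂]
    (XTree ι₁ × XTree ι₂ →₀ GroundRing R₀ ι₁ ι₂)
  /-- `Γ` takes values in (extended) stably weighted trees with the same number of inputs. -/
  target : ∀ T : WTree (ι₁ ⊕ ι₂), T.IsGenerator → ∀ g ∈ (Γ (Finsupp.single T 1)).support,
    g.1.Stable ∧ g.2.Stable ∧ g.1.inputs = T.inputs ∧ g.2.inputs = T.inputs
  /-- Dimension preservation. -/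
  dim_eq : ∀ T : WTree (ι₁ ⊕ ι₂), T.IsGenerator → ∀ g ∈ (Γ (Finsupp.single T 1)).support,
    g.1.dim + g.2.dim = T.dim
  /-- Weight preservation: a monomial `V^s W^t` counts as `∑ s_i f_i` for the first grading and as
  `∑ t_i e_i` for the second. -/
  weight_eq : ∀ T : WTree (ι₁ ⊕ ι₂), T.IsGenerator → ∀ g ∈ (Γ (Finsupp.single T 1)).support,
    ∀ m ∈ (Γ (Finsupp.single T 1) g).support,
      Sum.elim g.1.weight (fun i => m (Sum.inr i)) = T.weight ∧
      Sum.elim (fun i => m (Sum.inl i)) g.2.weight = T.weight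
  /-- `Γ` is a chain map. -/
  chain : ∀ T : WTree (ι₁ ⊕ ι₂), T.IsGenerator →
    Γ (T.bd (GroundRing R₀ ι₁ ι₂)) =
      bdPair (XTree.bd (GroundRing R₀ ι₁ ι₂)) (XTree.bd (GroundRing R₀ ι₁ ι₂))
        (Γ (Finsupp.single T 1))
  /-- Stacking: `Γ(T ∘_i S) = Γ(T) ∘_i Γ(S)`. -/
  stacking : ∀ T S U : WTree (ι₁ ⊕ ι₂), T.IsGenerator → S.IsGenerator → ∀ i < T.inputs,
    T.graft i (.tree S) = some (.tree U) →
      Γ (Finsupp.single U 1) = compPair i (Γ (Finsupp.single T 1)) (Γ (Finsupp.single S 1))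
  /-- Nondegeneracy. -/
  nondeg : Γ (Finsupp.single (.corolla 2 0) 1) =
    Finsupp.single (.tree (.corolla 2 0), .tree (.corolla 2 0)) 1
  seed_left : ∀ i : ι₁, Γ (Finsupp.single (.corolla 0 (Pi.single (Sum.inl i) 1)) 1) =
    Finsupp.single (.tree (.corolla 0 (Pi.single i 1)), .top) (C (c (Sum.inl i)) * X (Sum.inl i))
  seed_right : ∀ i : ι₂, Γ (Finsupp.single (.corolla 0 (Pi.single (Sum.inr i) 1)) 1) =
    Finsupp.single (.top, .tree (.corolla 0 (Pi.single i 1))) (C (c (Sum.inr i)) * X (Sum.inr i))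
  /-- In each term at most one factor is `⊤` or `↓`. -/
  image : ∀ T : WTree (ι₁ ⊕ ι₂), T.IsGenerator → ∀ g ∈ (Γ (Finsupp.single T 1)).support,
    g.1.IsGenerator ∨ g.2.IsGenerator

/-! ### Weighted bimodule diagonal primitives -/

section Primitives

variable {R₀ : Type*} [CommRing R₀] {ι₁ ι₂ : Type} [Fintype ι₁] [DecidableEq ι₁] [Fintype ι₂]
  [DecidableEq ι₂] {c : ι₁ ⊕ ι₂ → R₀}

/-- `γ^{n,w} = Γ(Ψ_n^w)`. -/
def WeightedAlgebraDiagonal.γ (D : WeightedAlgebraDiagonal R₀ ι₁ ι₂ c) (n : ℕ) (w : ι₁ ⊕ ι₂ → ℕ) :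
    XTree ι₁ × XTree ι₂ →₀ GroundRing R₀ ι₁ ι₂ :=
  D.Γ (Finsupp.single (.corolla n w) 1)

/-- The coefficient `κ^w` attached to a weight by the seed `c`: the product of the
`(c_i W_i)^{w_i}` over the `e_i` and the `(c_i V_i)^{w_i}` over the `f_i`. -/
def seedCoeff (c : ι₁ ⊕ ι₂ → R₀) (w : ι₁ ⊕ ι₂ → ℕ) : GroundRing R₀ ι₁ ι₂ :=
  ∏ i, (C (c i) * X i) ^ w i

/-- A family `p^{n,j,w}` of linear combinations of pairs of trees. -/
abbrev PrimitiveFamily (R₀ : Type*) [CommRing R₀] (ι₁ ι₂ : Type) : Type _ :=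
  ℕ → ℕ → (ι₁ ⊕ ι₂ → ℕ) → (XTree ι₁ × BTree ι₁ ι₂ →₀ GroundRing R₀ ι₁ ι₂)

/-- The sum of all `κ^v CR^v(p^{n_1,j_1,w_1}, …, p^{n_k,j_k,w_k})` with `v + ∑ w_i = w`, `∑ n_i = n`,
`∑ j_i = j`, over all `k ≥ 0` and all `v` for which `Ψ_k^v` is stable and all triples
`(n_i, j_i, w_i)` other than `(0, 0, 0)`.  These triples have sum at most `(n, j, w)`, so `k` is at most
`n + j + |w|`. -/
def sumCR (c : ι₁ ⊕ ι₂ → R₀) (p : PrimitiveFamily R₀ ι₁ ι₂) (n j : ℕ) (w : ι₁ ⊕ ι₂ → ℕ) :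
    XTree ι₁ × BTree ι₁ ι₂ →₀ GroundRing R₀ ι₁ ι₂ :=
  ∑ k ∈ Finset.range (n + j + size w + 1),
    ∑ v ∈ (Finset.Icc 0 (w ∘ Sum.inl)).filter (StableVertex k),
      ∑ f ∈ (Fintype.piFinset fun _ : Fin k =>
          Finset.range (n + 1) ×ˢ Finset.range (j + 1) ×ˢ Finset.Icc 0 w).filter
          (fun f => (∀ a, f a ≠ 0) ∧ (0, 0, ofFst v) + ∑ a, f a = (n, j, w)),
        seedCoeff c (ofFst v) • CR v (List.ofFn fun a => p (f a).1 (f a).2.1 (f a).2.2)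

/-- The sum of all `p^{n_2,j,w_2} ∘_L γ^{n_1,w_1}` with `n_1 + n_2 = n + 1`, `w_1 + w_2 = w`. -/
def sumL (D : WeightedAlgebraDiagonal R₀ ι₁ ι₂ c) (p : PrimitiveFamily R₀ ι₁ ι₂) (n j : ℕ)
    (w : ι₁ ⊕ ι₂ → ℕ) : XTree ι₁ × BTree ι₁ ι₂ →₀ GroundRing R₀ ι₁ ι₂ :=
  ∑ n' ∈ Finset.HasAntidiagonal.antidiagonal (n + 1),
    ∑ w₁ ∈ (Finset.Icc 0 w).filter (StableVertex n'.1),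
      ∑ i ∈ Finset.range n'.2, compL i (p n'.2 j (w - w₁)) (D.γ n'.1 w₁)

/-- The sum of all `κ^{w_1} p^{n,j_2,w_2} ∘_R Ψ_{j_1}^{w_1}` with `j_1 + j_2 = j + 1`,
`w_1 + w_2 = w`. -/
def sumR (c : ι₁ ⊕ ι₂ → R₀) (p : PrimitiveFamily R₀ ι₁ ι₂) (n j : ℕ) (w : ι₁ ⊕ ι₂ → ℕ) :
    XTree ι₁ × BTree ι₁ ι₂ →₀ GroundRing R₀ ι₁ ι₂ :=
  ∑ j' ∈ Finset.HasAntidiagonal.antidiagonal (j + 1),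
    ∑ w₁ ∈ (Finset.Icc 0 (w ∘ Sum.inl)).filter (StableVertex j'.1),
      ∑ i ∈ Finset.range j'.2,
        seedCoeff c (ofFst w₁) •
          compR i (p n j'.2 (w - ofFst w₁)) (.tree (.corolla j'.1 w₁))

/-- `p` is a weighted bimodule diagonal primitive compatible with the weighted algebra diagonal
`D`. -/
structure IsBimoduleDiagonalPrimitive (D : WeightedAlgebraDiagonal R₀ ι₁ ι₂ c)
    (p : PrimitiveFamily R₀ ι₁ ι₂) : Prop where
  /-- `p^{n,j,w}` lies in the sum of the `X^{n,w_1} ⊗ XB^{n,j,w_2}` with `w_1 + w_2 ≤ w`, where the first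
  factor may be `⊤` or `↓`. -/
  mem : ∀ n j w, ∀ g ∈ (p n j w).support,
    g.1.Stable ∧ g.1.inputs = n ∧
    g.2.IsGenerator ∧ g.2.leftInputs = n ∧ g.2.rightInputs = j ∧
    ofFst g.1.weight + g.2.weight ≤ w
  /-- Compatibility with the diagonal. -/
  compat : ∀ n j w,
    bdPair (XTree.bd (GroundRing R₀ ι₁ ι₂)) (BTree.bd (GroundRing R₀ ι₁ ι₂)) (p n j w) =
      sumCR c p n j w + sumL D p n j w + sumR c p n j w
  /-- Base cases. -/
  base_left : p 1 0 0 = Finsupp.single (.tree .leaf, .corolla 1 0 0) 1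
  base_right : p 0 1 0 = Finsupp.single (.top, .corolla 0 1 0) 1
  base_weight : ∀ i : ι₁ ⊕ ι₂, p 0 0 (Pi.single i 1) =
    Finsupp.single (.top, .corolla 0 0 (Pi.single i 1)) (C (c i) * X i)

end Primitives

end WeightedTrees

end

-- Everything has characteristic two, so no signs occur. Give `p^{n,j,w}` the degree `n + j + 2|w|`;
-- its dimension is to be one less. Pairs (extended tree, bimodule tree) carry a curved
-- homotopy-associative structure (`diagonalOp`). Its part of degree `d` consists of the operations
-- `κ^v CR^v` with `2|v| = d` (for `k = 0` this is a curvature term) and of a unary operation. The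
-- latter collects the differential, for `d = 0`, and the insertions of `γ^{n,w}` at left inputs and
-- of `κ^w Ψ_n^w` at right inputs with `n + 2|w| = d + 1`. If `P_N` is the sum of all `p` of degree
-- `N`, the compatibility equations are exactly the components of one Maurer–Cartan equation for
-- `P`, evaluated on the geometric series of words in `P`.
--
-- The structure relation (`sum_totalOp`) comes from four facts. The differential of a corolla
-- applied to trees is the sum of its two-vertex expansions and of the differentials of its
-- arguments, also in the presence of the strict unit (`lin_bd_corollaOp`, `lin_bd_spineOp`). The
-- elements `γ` solve `dγ = γ ∘ γ`, because `Γ` is a chain map compatible with stacking; the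
-- corollas `κ^w Ψ_n^w` do so because `κ` is multiplicative. Insertions are derivations of `CR`.
-- Insertions on the two sides commute.
--
-- Then obstruction theory applies. If the equation holds below degree `N`, its part of degree `N`
-- is a cycle (`lin_maurerCartan_eq_zero`), and adding to `P_N` an element bounding it solves the
-- equation in degree `N`. The obstruction has dimension `N - 2`, so all that is needed is that for
-- `N ≥ 3` each cycle of degree `N` and dimension `N - 2` with matching inputs is a boundary
-- (`exists_pairBd_eq`).
--
-- For this the bimodule factor is first simplified by a discrete Morse argument. Certain edges next
-- to the spine are contracted; the resulting partial matching `contract` gives a homotopy, and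
-- iterating `id + ∂h + h∂` moves every tree to linear combinations of words: trees whose vertices
-- all lie on the spine, have weight zero and carry at most one leaf on each side (`mem_reducible`).
-- Among pairs with a word as second factor, dimension `N - 2` is extremal. Apart from one small
-- case with first factor `↓`, the first factor must be a corolla and each vertex of the word must
-- have a left leaf. Cycles of such words have no right inputs, and a corolla of degree at least
-- three has a nonzero differential which nothing else can cancel. Hence a cycle of this kind is
-- zero (`eq_zero_of_word`).
--
-- The degrees one and two are written down by hand (`lowPart`, `maurerCartan_lowPart`). This is
-- where the shape of the seeds matters: the curvature `κ^{e_i} Ψ_0^{e_i} ⊗ strand` cancels against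
-- the insertion of `c_i W_i Ψ_0^{e_i} ⊗ ⊤` into `↓ ⊗ Ψ_{1|0}^0`, since `⊤` turns `Ψ_{1|0}^0` into
-- the strand. The primitive is the family of homogeneous components of `P`.

noncomputable section
namespace WeightedTrees

open Finset.HasAntidiagonal renaming antidiagonal → anti, mem_antidiagonal → mem_anti
open Option renaming bind_assoc → bassoc, bind_congr → bcongr, map_bind → mbind
open Finset (sum_congr sum_eq_zero range sum_add_distrib mem_union mem_range sum_eq_single Icc
  mem_image mem_filter mem_sigma mem_Icc mem_product sum_bij' sum_range_succ sum_comm mem_univ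
  mem_singleton mem_biUnion sum_sigma' sum_filter Ico smul_sum)
open Finsupp (single support_add mem_support_finsetSum mapDomain_support support_single_subset
  mapDomain_add mem_support_iff mapDomain_zero mapDomain_single finsetSum_apply support_finsetSum
  single_mem_supported mapDomain_finsetSum linearCombination_apply mapDomain_comp mapDomain)
open Option (bind_some map_eq_some_iff bind_eq_some_iff)
open List (map_cons length_cons replicate sum_cons length_append map_append nil_append
  length_eq_zero_iff replicate_succ length_drop ofFn length_pos_of_ne_nil take_append_drop)
open Prod (fst snd)
open Sum (inl inr)
open XTree WTree BTree

/-- Weights of spine vertices. -/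
local notation:36 I:37 " ⊎ " J:37 => I ⊕ J → ℕ

/-- Pairs consisting of an extended tree and a bimodule tree. -/
local notation:36 I:37 " ⨳ " J:37 => XTree I × BTree I J

/-! ### Linear extension -/

section Lin

variable (R : Type*) [CommRing R] {α β V W : Type*} [AddCommGroup V] [Module R V]
  [AddCommGroup W] [Module R W]

/-- The linear extension of a map defined on a basis. -/
abbrev lin (f : α → V) : (α →₀ R) →ₗ[R] V := Finsupp.linearCombination R f

variable {R}

lemma lin_single (f : α → V) (a : α) (r : R) : lin R f (single a r) = r • f a :=
  Finsupp.linearCombination_single R r a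

lemma lin_one (f : α → V) (a : α) : lin R f (single a 1) = f a := by
  simp [lin]

lemma lin_ofOption (f : α → V) (o : Option α) : lin R f (ofOption R o) = o.elim 0 f := by
  cases o <;> simp [ofOption, lin]

lemma lin_mapDomain (f : β → V) (g : α → β) (x : α →₀ R) :
    lin R f (x.mapDomain g) = lin R (fun a => f (g a)) x :=
  Finsupp.linearCombination_mapDomain R g x

lemma lin_ext {f g : (α →₀ R) →ₗ[R] V} (h : ∀ a, f (single a 1) = g (single a 1))
    (x : α →₀ R) : f x = g x := by
  have : f = g := Finsupp.lhom_ext' fun a => LinearMap.ext_ring (h a)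
  rw [this]

lemma map_lin (g : V →ₗ[R] W) (f : α → V) (x : α →₀ R) :
    g (lin R f x) = lin R (fun a => g (f a)) x :=
  lin_ext (f := g ∘ₗ lin R f) (g := lin R fun a => g (f a)) (fun a => by simp [lin]) x

lemma lin_lin (g : β → V) (f : α → β →₀ R) (x : α →₀ R) :
    lin R g (lin R f x) = lin R (fun a => lin R g (f a)) x :=
  map_lin _ _ _

lemma lin_add (f g : α → V) (x : α →₀ R) :
    lin R (fun a => f a + g a) x = lin R f x + lin R g x :=
  lin_ext (f := lin R fun a => f a + g a) (g := lin R f + lin R g) (fun a => by simp [lin]) x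

lemma lin_smul (r : R) (f : α → V) (x : α →₀ R) :
    lin R (fun a => r • f a) x = r • lin R f x :=
  lin_ext (f := lin R fun a => r • f a) (g := r • lin R f) (fun a => by simp [lin]) x

lemma lin_sum {I : Type*} (s : Finset I) (f : I → α → V) (x : α →₀ R) :
    lin R (fun a => ∑ i ∈ s, f i a) x = ∑ i ∈ s, lin R (f i) x :=
  (lin_ext (f := lin R fun a => ∑ i ∈ s, f i a) (g := ∑ i ∈ s, lin R (f i))
    (fun a => by simp [lin]) x).trans (LinearMap.sum_apply _ _ _)

lemma lin_zero (x : α →₀ R) : lin R (fun _ => (0 : V)) x = 0 := by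
  simp [lin, linearCombination_apply]

lemma lin_single_id (x : α →₀ R) : lin R (fun a => single a (1 : R)) x = x :=
  lin_ext (f := lin R fun a => single a (1 : R)) (g := LinearMap.id)
    (fun a => by simp [lin]) x

lemma map_eq_lin (g : α → β) (x : α →₀ R) :
    x.mapDomain g = lin R (fun a => single (g a) 1) x :=
  lin_ext (f := Finsupp.lmapDomain R R g) (g := lin R fun a => single (g a) 1)
    (fun a => by simp [lin]) x

lemma lin_congr {f g : α → V} {x : α →₀ R} (h : ∀ a ∈ x.support, f a = g a) :
    lin R f x = lin R g x := by
  simp only [lin, linearCombination_apply]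
  exact Finsupp.sum_congr fun a ha => by rw [h a ha]

lemma lin_eq_zero {f : α → V} {x : α →₀ R} (h : ∀ a ∈ x.support, f a = 0) : lin R f x = 0 := by
  rw [lin_congr h, lin_zero]

lemma lin_comm (F : α → β → V) (x : α →₀ R) (y : β →₀ R) :
    lin R (fun a => lin R (fun b => F a b) y) x = lin R (fun b => lin R (fun a => F a b) x) y := by
  refine lin_ext (f := lin R fun a => lin R (fun b => F a b) y)
    (g := (lin R fun a => (lin R fun b => F a b)).flip y) (fun a => by simp [lin]) x |>.trans ?_
  refine lin_ext (f := (lin R fun a => (lin R fun b => F a b)) x)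
    (g := lin R fun b => lin R (fun a => F a b) x) (fun b => ?_) y
  rw [lin_one]
  exact (map_lin (LinearMap.applyₗ (single b (1 : R))) _ x).trans (by simp [lin])

lemma lin_mem {p : Submodule R V} {f : α → V} {x : α →₀ R} (h : ∀ a ∈ x.support, f a ∈ p) :
    lin R f x ∈ p := by
  simp only [lin, linearCombination_apply]
  exact Submodule.finsuppSum_mem _ _ _ _ fun a ha => p.smul_mem _ (h a (by simpa using ha))

lemma mem_lin {f : α → β →₀ R} {x : α →₀ R} {b : β} (h : b ∈ (lin R f x).support) :
    ∃ a ∈ x.support, b ∈ (f a).support := by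
  by_contra hc
  push Not at hc
  rw [mem_support_iff] at h
  refine h ?_
  have := lin_mem (p := LinearMap.ker (Finsupp.lapply b : (β →₀ R) →ₗ[R] R)) (f := f) (x := x)
    fun a ha => by simpa using hc a ha
  simpa using this

lemma mem_ofOption {o : Option α} {a : α} (h : a ∈ (ofOption R o).support) :
    o = some a := by
  cases o with
  | none => simp [ofOption] at h
  | some b =>
    have := support_single_subset h
    simp at this
    rw [this]

lemma bilin_eq_lin {γ : Type*} (f : α → β → Option γ) (x : α →₀ R) (y : β →₀ R) :
    bilin f x y = lin R (fun a => lin R (fun b => ofOption R (f a b)) y) x := by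
  simp only [bilin, lin, linearCombination_apply, Finsupp.smul_sum, smul_smul]

variable (R) in
lemma add_self [CharP R 2] (x : V) : x + x = 0 := by
  rw [← two_smul R x, CharTwo.two_eq_zero, zero_smul]

lemma eq_of_add_eq_zero_of_charTwo (R : Type*) [CommRing R] {V : Type*} [AddCommGroup V]
    [Module R V] [CharP R 2] {x y : V} (h : x + y = 0) : x = y := by
  have := add_self R y
  calc x = x + (y + y) := by rw [this, add_zero]
    _ = y := by rw [← add_assoc, h, zero_add]

lemma mem_add {x y : α →₀ R} {a : α} (h : a ∈ (x + y).support) :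
    a ∈ x.support ∨ a ∈ y.support := by
  classical exact mem_union.1 (support_add h)

end Lin

/-! ### Sums over the ways to cut a list -/

section Cuts

variable {X Y V : Type*} [AddCommMonoid V]

/-- The sum of `F a c` over all decompositions `l = a ++ c`. -/
def cutSum (l : List X) (F : List X → List X → V) : V :=
  ∑ a ∈ range (l.length + 1), F (l.take a) (l.drop a)

/-- The sum of `F a b c` over all decompositions `l = a ++ b ++ c`. -/
def threeSum (l : List X) (F : List X → List X → List X → V) : V :=
  cutSum l fun a r => cutSum r fun b c => F a b c

@[simp] lemma cutSum_nil (F : List X → List X → V) : cutSum [] F = F [] [] := by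
  simp [cutSum]

lemma cutSum_cons (x : X) (l : List X) (F : List X → List X → V) :
    cutSum (x :: l) F = F [] (x :: l) + cutSum l fun a c => F (x :: a) c := by
  simp only [cutSum, length_cons]
  rw [Finset.sum_range_succ']
  simp [add_comm]

lemma cutSum_congr {l : List X} {F G : List X → List X → V}
    (h : ∀ a c, a ++ c = l → F a c = G a c) : cutSum l F = cutSum l G :=
  sum_congr rfl fun _ _ => h _ _ (take_append_drop _ _)

lemma cutSum_zero (l : List X) : cutSum l (fun _ _ => (0 : V)) = 0 := by simp [cutSum]

lemma cutSum_eq_zero {l : List X} {F : List X → List X → V}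
    (h : ∀ a c, a ++ c = l → F a c = 0) : cutSum l F = 0 := by
  rw [cutSum_congr h, cutSum_zero]

lemma cutSum_add (l : List X) (F G : List X → List X → V) :
    cutSum l (fun a c => F a c + G a c) = cutSum l F + cutSum l G := by
  simp [cutSum, sum_add_distrib]

lemma cutSum_sum {I : Type*} (s : Finset I) (l : List X) (F : I → List X → List X → V) :
    cutSum l (fun a c => ∑ i ∈ s, F i a c) = ∑ i ∈ s, cutSum l (F i) := by
  simp only [cutSum]
  exact sum_comm

lemma map_cutSum {V' G : Type*} [AddCommMonoid V'] [FunLike G V V'] [AddMonoidHomClass G V V']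
    (g : G) (l : List X) (F : List X → List X → V) :
    g (cutSum l F) = cutSum l fun a c => g (F a c) := by
  simp only [cutSum, map_sum]

lemma cutSum_map (f : X → Y) (l : List X) (F : List Y → List Y → V) :
    cutSum (l.map f) F = cutSum l fun a c => F (a.map f) (c.map f) := by
  simp [cutSum, List.map_take, List.map_drop]

lemma cutSum_append_cons (l : List X) (x : X) (m : List X) (F : List X → List X → V) :
    cutSum (l ++ x :: m) F =
      cutSum l (fun a c => F a (c ++ x :: m)) + cutSum m fun a c => F (l ++ x :: a) c := by
  induction l generalizing F with
  | nil => simp [cutSum_cons]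
  | cons y l ih => simp [cutSum_cons, ih, add_assoc]

lemma cutSum_assoc (l : List X) (F : List X → List X → List X → V) :
    cutSum l (fun a r => cutSum r fun b c => F a b c) =
      cutSum l fun r c => cutSum r fun a b => F a b c := by
  induction l generalizing F with
  | nil => simp
  | cons x l ih =>
    simp only [cutSum_cons, cutSum_add, cutSum_nil, ih]
    abel

lemma cutSum_comm (l : List X) (m : List Y) (F : List X → List X → List Y → List Y → V) :
    cutSum l (fun a c => cutSum m fun a' c' => F a c a' c') =
      cutSum m fun a' c' => cutSum l fun a c => F a c a' c' := by
  simp only [cutSum]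
  exact sum_comm

lemma cutSum_ite_nil_left (l : List X) (f : List X → List X → V) :
    cutSum l (fun a c => if a = [] then f a c else 0) = f [] l := by
  cases l <;> simp [cutSum_cons, cutSum_zero]

lemma cutSum_eq_left {l : List X} {F : List X → List X → V}
    (h : ∀ a c, a ++ c = l → a ≠ [] → F a c = 0) : cutSum l F = F [] l := by
  rw [← cutSum_ite_nil_left l F]
  refine cutSum_congr fun a c hac => ?_
  split_ifs with ha
  · rfl
  · exact h a c hac ha

lemma cutSum_eq_right {l : List X} {F : List X → List X → V}
    (h : ∀ a c, a ++ c = l → c ≠ [] → F a c = 0) : cutSum l F = F l [] := by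
  induction l generalizing F with
  | nil => simp
  | cons x l ih =>
    rw [cutSum_cons, h [] (x :: l) rfl (by simp), zero_add]
    exact ih fun a c hac hc => h _ _ (by simp [hac]) hc

lemma threeSum_congr {l : List X} {F G : List X → List X → List X → V}
    (h : ∀ a b c, a ++ b ++ c = l → F a b c = G a b c) : threeSum l F = threeSum l G :=
  cutSum_congr fun a r har => cutSum_congr fun b c hbc => h a b c (by rw [List.append_assoc, hbc, har])

lemma threeSum_eq_zero {l : List X} {F : List X → List X → List X → V}
    (h : ∀ a b c, a ++ b ++ c = l → F a b c = 0) : threeSum l F = 0 := by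
  rw [threeSum_congr h]
  simp [threeSum, cutSum_zero]

lemma threeSum_add (l : List X) (F G : List X → List X → List X → V) :
    threeSum l (fun a b c => F a b c + G a b c) = threeSum l F + threeSum l G := by
  simp [threeSum, cutSum_add]

lemma threeSum_sum {I : Type*} (s : Finset I) (l : List X)
    (F : I → List X → List X → List X → V) :
    threeSum l (fun a b c => ∑ i ∈ s, F i a b c) = ∑ i ∈ s, threeSum l (F i) := by
  simp [threeSum, cutSum_sum]

lemma map_threeSum {V' G : Type*} [AddCommMonoid V'] [FunLike G V V'] [AddMonoidHomClass G V V']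
    (g : G) (l : List X) (F : List X → List X → List X → V) :
    g (threeSum l F) = threeSum l fun a b c => g (F a b c) := by
  simp only [threeSum, map_cutSum]

lemma threeSum_map (f : X → Y) (l : List X) (F : List Y → List Y → List Y → V) :
    threeSum (l.map f) F = threeSum l fun a b c => F (a.map f) (b.map f) (c.map f) := by
  simp [threeSum, cutSum_map]

/-- The marked letter `x` falls into the third, the first or the middle block, in the order of the
three summands. -/
lemma threeSum_append_cons (l : List X) (x : X) (m : List X)
    (F : List X → List X → List X → V) :
    threeSum (l ++ x :: m) F =
      threeSum l (fun a b c => F a b (c ++ x :: m))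
        + threeSum m (fun a b c => F (l ++ x :: a) b c)
        + cutSum l fun a b => cutSum m fun b' c => F a (b ++ x :: b') c := by
  simp only [threeSum, cutSum_append_cons, cutSum_add]
  abel

@[simp] lemma threeSum_nil (F : List X → List X → List X → V) : threeSum [] F = F [] [] [] := by
  simp [threeSum]

/-- The whole list as the only nonzero term. -/
lemma threeSum_eq_whole {l : List X} {F : List X → List X → List X → V}
    (h : ∀ a b c, a ++ b ++ c = l → (a ≠ [] ∨ c ≠ []) → F a b c = 0) :
    threeSum l F = F [] l [] := by
  rw [threeSum, cutSum_eq_left, cutSum_eq_right]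
  · exact fun b c hbc hc => h [] b c (by simpa using hbc) (Or.inr hc)
  · exact fun a r har ha => cutSum_eq_zero fun b c hbc => h a b c (by simp [hbc, har]) (Or.inl ha)

/-- Cutting the outer blocks again, or first cutting out a larger middle block. -/
lemma threeSum_five (l : List X) (F : List X → List X → List X → List X → List X → V) :
    threeSum l (fun a b c => cutSum a fun a₁ a₂ => cutSum c fun c₁ c₂ => F a₁ a₂ b c₁ c₂) =
      threeSum l fun a r c => threeSum r fun a₂ b c₁ => F a a₂ b c₁ c := by
  simp only [threeSum]
  have e1 : ∀ r : List X, ∀ a : List X, (cutSum r fun b c => cutSum a fun a₁ a₂ =>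
      cutSum c fun c₁ c₂ => F a₁ a₂ b c₁ c₂) = cutSum a fun a₁ a₂ => cutSum r fun b c =>
      cutSum c fun c₁ c₂ => F a₁ a₂ b c₁ c₂ := fun r a => by rw [cutSum_comm]
  simp only [e1]
  rw [← cutSum_assoc l fun a₁ a₂ r => cutSum r fun b c => cutSum c fun c₁ c₂ => F a₁ a₂ b c₁ c₂]
  refine cutSum_congr fun a r _ => ?_
  rw [← cutSum_assoc r fun a₂ s c => cutSum s fun b c₁ => F a a₂ b c₁ c]
  refine cutSum_congr fun a₂ s _ => ?_
  rw [cutSum_assoc]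

/-- The two ways to choose two disjoint blocks. -/
lemma threeSum_disjoint (l : List X)
    (F : List X → List X → List X → List X → List X → V) :
    threeSum l (fun a b c => threeSum a fun a₁ a₂ a₃ => F a₁ a₂ a₃ b c) =
      threeSum l fun a b c => threeSum c fun c₁ c₂ c₃ => F a b c₁ c₂ c₃ := by
  simp only [threeSum]
  have e1 : ∀ r : List X, ∀ a : List X, (cutSum r fun b c => cutSum a fun a₁ s =>
      cutSum s fun a₂ a₃ => F a₁ a₂ a₃ b c) = cutSum a fun a₁ s => cutSum r fun b c =>
      cutSum s fun a₂ a₃ => F a₁ a₂ a₃ b c := fun r a => by rw [cutSum_comm]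
  simp only [e1]
  rw [← cutSum_assoc l fun a₁ s r => cutSum r fun b c => cutSum s fun a₂ a₃ => F a₁ a₂ a₃ b c]
  refine cutSum_congr fun a r _ => ?_
  have e2 : ∀ s t : List X, (cutSum t fun b c => cutSum s fun a₂ a₃ => F a a₂ a₃ b c)
      = cutSum s fun a₂ a₃ => cutSum t fun b c => F a a₂ a₃ b c := fun s t => by rw [cutSum_comm]
  simp only [e2]
  rw [← cutSum_assoc r fun a₂ a₃ t => cutSum t fun b c => F a a₂ a₃ b c]

end Cuts

lemma cutSum_lin {R : Type*} [CommRing R] {X α V : Type*} [AddCommGroup V] [Module R V]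
    (l : List X) (F : List X → List X → α → V) (x : α →₀ R) :
    lin R (fun a => cutSum l fun b c => F b c a) x = cutSum l fun b c => lin R (F b c) x := by
  simp only [cutSum, lin_sum]

lemma threeSum_lin {R : Type*} [CommRing R] {X α V : Type*} [AddCommGroup V] [Module R V]
    (l : List X) (F : List X → List X → List X → α → V) (x : α →₀ R) :
    lin R (fun y => threeSum l fun a b c => F a b c y) x
      = threeSum l fun a b c => lin R (F a b c) x := by
  simp only [threeSum, cutSum_lin]

/-! ### Insertions and homotopy-associative structures -/

section Antidiagonal

open Finset (HasAntidiagonal)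

variable {A V : Type*} [AddCommMonoid V]

lemma anti_assoc [AddMonoid A] [HasAntidiagonal A] (n : A) (f : A → A → A → V) :
    ∑ p ∈ anti n, ∑ q ∈ anti p.2, f p.1 q.1 q.2 =
      ∑ p ∈ anti n, ∑ q ∈ anti p.1, f q.1 q.2 p.2 := by
  rw [sum_sigma', sum_sigma']
  refine sum_bij' (fun x _ => ⟨(x.1.1 + x.2.1, x.2.2), (x.1.1, x.2.1)⟩)
    (fun x _ => ⟨(x.2.1, x.2.2 + x.1.2), (x.2.2, x.1.2)⟩) ?_ ?_ ?_ ?_ ?_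
  · simp_all [mem_sigma, mem_anti, add_assoc, trivial]
  · rintro ⟨⟨a, b⟩, c, d⟩ h
    simp only [mem_sigma, mem_anti] at h ⊢
    grind
  · simp_all
  · simp_all
  simp

lemma anti_swap' [AddCommMonoid A] [HasAntidiagonal A] (n : A) (f : A → A → V) :
    ∑ p ∈ anti n, f p.1 p.2 = ∑ p ∈ anti n, f p.2 p.1 := by
  refine sum_bij' (fun x _ => x.swap) (fun x _ => x.swap) ?_ ?_ ?_ ?_ ?_ <;>
    simp [add_comm]

/-- Moving an inner summand to the front. -/
lemma anti_left_comm [AddCommMonoid A] [HasAntidiagonal A] (n : A)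
    (f : A → A → A → V) :
    ∑ p ∈ anti n, ∑ q ∈ anti p.2, f p.1 q.1 q.2 =
      ∑ p ∈ anti n, ∑ q ∈ anti p.2, f q.1 p.1 q.2 := by
  rw [anti_assoc, anti_assoc n fun a b c => f b a c]
  exact sum_congr rfl fun p _ => anti_swap' p.1 fun a b => f a b p.2

end Antidiagonal

section Ins

variable {R : Type*} [CommRing R] {X V : Type*} [AddCommGroup V] [Module R V]

/-- The sum of all ways to replace a block `b` of the list by the letter `f b`. -/
def ins (f : List X → X →₀ R) (l : List X) : List X →₀ R :=
  threeSum l fun a b c => (f b).mapDomain fun x => a ++ x :: c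

lemma lin_ins (g : List X → V) (f : List X → X →₀ R) (l : List X) :
    lin R g (ins f l) = threeSum l fun a b c => lin R (fun x => g (a ++ x :: c)) (f b) := by
  simp only [ins, map_threeSum, lin_mapDomain]

lemma ins_add (f g : List X → X →₀ R) (l : List X) :
    ins (fun b => f b + g b) l = ins f l + ins g l := by
  simp only [ins, ← threeSum_add, mapDomain_add]

lemma ins_sum {I : Type*} (s : Finset I) (f : I → List X → X →₀ R) (l : List X) :
    ins (fun b => ∑ i ∈ s, f i b) l = ∑ i ∈ s, ins (f i) l := by
  simp only [ins, ← threeSum_sum, mapDomain_finsetSum]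

lemma ins_eq_zero {f : List X → X →₀ R} {l : List X}
    (h : ∀ a b c, a ++ b ++ c = l → f b = 0) : ins f l = 0 :=
  threeSum_eq_zero fun a b c hl => by rw [h a b c hl, mapDomain_zero]

lemma mem_cutSum {l : List X} {α : Type*} {F : List X → List X → α →₀ R} {y : α}
    (h : y ∈ (cutSum l F).support) : ∃ a c, a ++ c = l ∧ y ∈ (F a c).support := by
  classical
  obtain ⟨i, -, hi⟩ := mem_biUnion.1 (support_finsetSum h)
  grind [take_append_drop]

lemma mem_support_threeSum {l : List X} {α : Type*} {F : List X → List X → List X → α →₀ R}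
    {y : α} (h : y ∈ (threeSum l F).support) :
    ∃ a b c, a ++ b ++ c = l ∧ y ∈ (F a b c).support := by
  obtain ⟨a, r, h1, h2⟩ := mem_cutSum h
  obtain ⟨b, c, h3, h4⟩ := mem_cutSum h2
  grind

lemma mem_support_ins {f : List X → X →₀ R} {l l' : List X} (h : l' ∈ (ins f l).support) :
    ∃ a b c x, a ++ b ++ c = l ∧ x ∈ (f b).support ∧ l' = a ++ x :: c := by
  classical
  obtain ⟨a, b, c, h1, h2⟩ := mem_support_threeSum h
  obtain ⟨x, hx, rfl⟩ := mem_image.1 (mapDomain_support h2)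
  grind

/-- The two replacements take place in disjoint blocks, that by `f` to the left of that by `g`. -/
def insDisjoint (f g : List X → X →₀ R) (l : List X) : List X →₀ R :=
  threeSum l fun a b c => threeSum c fun c₁ c₂ c₃ =>
    lin R (fun x => lin R (fun y => single (a ++ x :: (c₁ ++ y :: c₃)) 1) (g c₂)) (f b)

/-- The replaced block lies left of `x`, lies right of `x`, or contains `x`. Later arguments that
follow one letter of a word (a grafted tree, a `⊤`) all start from this trichotomy. -/
lemma ins_append_cons (f : List X → X →₀ R) (l : List X) (x : X) (m : List X) :
    ins f (l ++ x :: m) = (ins f l).mapDomain (fun l' => l' ++ x :: m)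
      + (ins f m).mapDomain (fun m' => l ++ x :: m')
      + cutSum l fun a b => cutSum m fun b' c =>
        (f (b ++ x :: b')).mapDomain fun y => a ++ y :: c := by
  rw [ins, threeSum_append_cons, map_eq_lin, map_eq_lin, lin_ins, lin_ins]
  simp only [map_eq_lin, List.append_assoc, List.cons_append]

/-- The block replaced by `f` either contains the letter that `g` produced, which is a nested
replacement inside a larger block, or it is disjoint from it, on one side or the other. -/
lemma ins_ins (f g : List X → X →₀ R) (l : List X) :
    lin R (ins f) (ins g l) = ins (fun b => lin R f (ins g b)) l
      + (insDisjoint f g l + insDisjoint g f l) := by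
  have e1 : insDisjoint f g l = threeSum l fun a b c =>
      lin R (fun x => (ins f a).mapDomain fun l' => l' ++ x :: c) (g b) := by
    rw [insDisjoint, ← threeSum_disjoint l fun a₁ a₂ a₃ b c => lin R (fun x => lin R (fun y =>
      single (a₁ ++ x :: (a₃ ++ y :: c)) (1 : R)) (g b)) (f a₂)]
    refine threeSum_congr fun a b c _ => ?_
    simp only [map_eq_lin, lin_ins, threeSum_lin]
    refine threeSum_congr fun a₁ a₂ a₃ _ => ?_
    rw [lin_comm]
    simp
  have e2 : insDisjoint g f l = threeSum l fun a b c =>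
      lin R (fun x => (ins f c).mapDomain fun l' => a ++ x :: l') (g b) := by
    refine threeSum_congr fun a b c _ => ?_
    simp only [map_eq_lin, lin_ins, threeSum_lin]
  have e3 : ins (fun b => lin R f (ins g b)) l = threeSum l fun a b c =>
      cutSum a fun a₁ a₂ => cutSum c fun c₁ c₂ =>
      lin R (fun x => (f (a₂ ++ x :: c₁)).mapDomain fun y => a₁ ++ y :: c₂) (g b) := by
    rw [threeSum_five l fun a₁ a₂ b c₁ c₂ =>
      lin R (fun x => (f (a₂ ++ x :: c₁)).mapDomain fun y => a₁ ++ y :: c₂) (g b)]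
    refine threeSum_congr fun a b c _ => ?_
    simp only [map_eq_lin, lin_ins, map_threeSum, lin_lin]
  rw [lin_ins, e1, e2, e3, ← threeSum_add, ← threeSum_add]
  refine threeSum_congr fun a b c _ => ?_
  simp only [ins_append_cons, lin_add, cutSum_lin]
  abel

/-- Exchanging the two indices interchanges the two kinds of disjoint replacements, so these cancel
modulo two. Hence the square of the coderivation determined by a family is the coderivation of its
quadratic relation. -/
lemma sum_ins_ins [CharP R 2] {I : Type*} [AddCommMonoid I] [Finset.HasAntidiagonal I] (i : I)
    (f : I → List X → X →₀ R) (l : List X) :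
    ∑ p ∈ anti i, lin R (ins (f p.1)) (ins (f p.2) l) =
      ins (fun b => ∑ p ∈ anti i, lin R (f p.1) (ins (f p.2) b)) l := by
  simp only [ins_ins, ins_sum, sum_add_distrib]
  rw [anti_swap' i fun a b => insDisjoint (f a) (f b) l,
    add_self R, add_zero]

/-- A map on letters, extended by zero to lists of any other length. -/
def letterPart {X V : Type*} [AddCommMonoid V] (d : X → V) : List X → V
  | [x] => d x
  | _ => 0

@[simp] lemma letterPart_singleton (d : X → V) (x : X) : letterPart d [x] = d x := rfl

@[simp] lemma letterPart_nil (d : X → V) : letterPart d [] = 0 := rfl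

lemma letterPart_eq_zero (d : X → V) {l : List X} (h : l.length ≠ 1) : letterPart d l = 0 := by
  match l with
  | [] => rfl
  | [x] => simp at h
  | _ :: _ :: _ => rfl

/-- The result of a replacement has a single letter only if the whole word was replaced. -/
lemma lin_letterPart_ins (d : X → V) (f : List X → X →₀ R) (l : List X) :
    lin R (letterPart d) (ins f l) = lin R d (f l) := by
  rw [lin_ins, threeSum_eq_whole]
  · simp
  · intro a b c _ h
    refine lin_eq_zero fun x _ => letterPart_eq_zero _ ?_
    rcases a with _ | ⟨_, a⟩ <;> rcases c with _ | ⟨_, c⟩ <;> simp_all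

lemma ins_letterPart_nil (d : X → X →₀ R) : ins (letterPart d) [] = 0 := by
  simp [ins]

lemma ins_letterPart_cons (d : X → X →₀ R) (x : X) (l : List X) :
    ins (letterPart d) (x :: l) = (d x).mapDomain (fun y => y :: l)
      + (ins (letterPart d) l).mapDomain fun l' => x :: l' := by
  have := ins_append_cons (letterPart d) [] x l
  simp_all [nil_append, ins_letterPart_nil, mapDomain_zero, zero_add, cutSum_nil, add_comm,
    cutSum_eq_left, letterPart_eq_zero]

lemma letterPart_add (d d' : X → V) (l : List X) :
    letterPart (fun x => d x + d' x) l = letterPart d l + letterPart d' l := by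
  match l with
  | [] => simp
  | [x] => rfl
  | _ :: _ :: _ => simp [letterPart]

lemma letterPart_sum {I : Type*} (s : Finset I) (d : I → X → V) (l : List X) :
    letterPart (fun x => ∑ i ∈ s, d i x) l = ∑ i ∈ s, letterPart (d i) l := by
  match l with
  | [] => simp
  | [x] => rfl
  | _ :: _ :: _ => simp [letterPart]

/-- The defining relation of a structure whose operations are the sum of unary operations `D` and
operations `J`. -/
lemma sum_lin_ins_add_letterPart {I : Type*} [AddCommMonoid I] [Finset.HasAntidiagonal I] (i : I)
    (D : I → X → X →₀ R) (J : I → List X → X →₀ R) (l : List X) :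
    ∑ p ∈ anti i, lin R (fun b => J p.1 b + letterPart (D p.1) b)
        (ins (fun b => J p.2 b + letterPart (D p.2) b) l) =
      ∑ p ∈ anti i, lin R (D p.1) (J p.2 l)
      + ∑ p ∈ anti i, lin R (J p.1)
        (ins (fun b => J p.2 b + letterPart (D p.2) b) l)
      + letterPart (fun x => ∑ p ∈ anti i, lin R (D p.1) (D p.2 x)) l := by
  rw [letterPart_sum]
  simp only [lin_add, lin_letterPart_ins, map_add, ← sum_add_distrib]
  refine sum_congr rfl fun p _ => ?_
  have : lin R (D p.1) (letterPart (D p.2) l) = letterPart (fun x => lin R (D p.1) (D p.2 x)) l := by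
    match l with
    | [] => simp
    | [x] => rfl
    | _ :: _ :: _ => simp [letterPart]
  rw [this]
  abel

/-! ### The geometric series and the Maurer–Cartan equation -/

/-- The sum of all words in homogeneous parts of `P` of total degree `N`; the part of degree `0` is
disregarded. -/
def geom (P : ℕ → X →₀ R) : ℕ → (List X →₀ R)
  | 0 => single [] 1
  | N + 1 => ∑ a : Fin (N + 1), lin R (fun x => (geom P (N - a)).mapDomain (x :: ·)) (P (a + 1))

@[simp] lemma geom_zero (P : ℕ → X →₀ R) : geom P 0 = single [] 1 := by
  rw [geom]

lemma geom_succ (P : ℕ → X →₀ R) (N : ℕ) : geom P (N + 1) =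
    ∑ p ∈ anti N,
      lin R (fun x => (geom P p.2).mapDomain (x :: ·)) (P (p.1 + 1)) := by
  rw [geom, Finset.Nat.sum_antidiagonal_eq_sum_range_succ
    (fun i j => lin R (fun x => (geom P j).mapDomain (x :: ·)) (P (i + 1))), Finset.sum_range]

/-- The geometric series is group-like for deconcatenation: cutting a word of the series gives two
independent words of the series, with complementary degrees. -/
lemma lin_cutSum_geom (P : ℕ → X →₀ R) (F : List X → List X → V) (N : ℕ) :
    lin R (fun l => cutSum l F) (geom P N) = ∑ p ∈ anti N,
      lin R (fun a => lin R (F a) (geom P p.2)) (geom P p.1) := by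
  induction N using Nat.strong_induction_on generalizing F with
  | _ N ih =>
  rcases N with _ | N
  · simp
  · rw [Finset.Nat.sum_antidiagonal_succ, geom_zero, lin_one]
    simp only [geom_succ, map_sum, lin_lin, lin_mapDomain, cutSum_cons, lin_add,
      sum_add_distrib]
    congr 1
    have e : ∀ p ∈ anti N,
        lin R (fun x => lin R (fun l => cutSum l fun a c => F (x :: a) c) (geom P p.2)) (P (p.1 + 1))
        = ∑ q ∈ anti p.2, lin R (fun x => lin R (fun a => lin R (F (x :: a))
          (geom P q.2)) (geom P q.1)) (P (p.1 + 1)) := by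
      intro p hp
      have hp' : p.2 < N + 1 := by
        aesop
      rw [← lin_sum]
      simp_all
    rw [sum_congr rfl e, anti_assoc N fun i j k => lin R (fun x => lin R
      (fun a => lin R (F (x :: a)) (geom P k)) (geom P j)) (P (i + 1))]

/-- The sum of all words `a ++ x :: c`, trilinearly extended. -/
def sandwich (x : List X →₀ R) (y : X →₀ R) (z : List X →₀ R) : List X →₀ R :=
  lin R (fun a => lin R (fun c => y.mapDomain fun t => a ++ t :: c) z) x

lemma sandwich_sum {I : Type*} (s : Finset I) (x : List X →₀ R) (y : I → X →₀ R)
    (z : List X →₀ R) : sandwich x (∑ i ∈ s, y i) z = ∑ i ∈ s, sandwich x (y i) z := by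
  simp only [sandwich, mapDomain_finsetSum, lin_sum]

lemma sandwich_zero (x z : List X →₀ R) : sandwich x 0 z = 0 := by
  simp [sandwich, lin_zero]

lemma lin_ins_geom (P : ℕ → X →₀ R) (m : List X → X →₀ R) (N : ℕ) :
    lin R (ins m) (geom P N) = ∑ p ∈ anti N, ∑ q ∈ anti p.2,
      sandwich (geom P p.1) (lin R m (geom P q.1)) (geom P q.2) := by
  have : (ins m : List X → List X →₀ R) = fun l => cutSum l fun a r => cutSum r fun b c =>
      (m b).mapDomain fun x => a ++ x :: c := rfl
  rw [this, lin_cutSum_geom]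
  refine sum_congr rfl fun p _ => ?_
  simp only [lin_cutSum_geom, lin_sum]
  refine sum_congr rfl fun q _ => ?_
  simp only [sandwich]
  refine lin_congr fun a _ => ?_
  rw [lin_comm]
  refine lin_congr fun c _ => ?_
  simp only [map_eq_lin, lin_lin]

/-- The part of degree `N` of the left hand side of the Maurer–Cartan equation. -/
def maurerCartan (m : ℕ → List X → X →₀ R) (P : ℕ → X →₀ R) (N : ℕ) : X →₀ R :=
  ∑ p ∈ anti N, lin R (m p.1) (geom P p.2)

lemma mem_support_geom {P : ℕ → X →₀ R} {G : ℕ → Set X}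
    (hP : ∀ n, ∀ x ∈ (P n).support, x ∈ G n) {N : ℕ} {l : List X}
    (hl : l ∈ (geom P N).support) : ∃ s : List ℕ, s.sum = N ∧ List.Forall₂ (fun x n => x ∈ G n) l s := by
  classical
  induction N using Nat.strong_induction_on generalizing l with
  | _ N ih =>
  rcases N with _ | N
  · rw [geom_zero] at hl
    have := support_single_subset hl
    simp_all
  · rw [geom_succ] at hl
    obtain ⟨p, hp, hl⟩ := mem_biUnion.1 (support_finsetSum hl)
    obtain ⟨x, hx, hl⟩ := mem_lin hl
    obtain ⟨l', hl', rfl⟩ := mem_image.1 (mapDomain_support hl)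
    have hp' := mem_anti.1 hp
    obtain ⟨s, hs, hf⟩ := ih p.2 (by omega) hl'
    exact ⟨(p.1 + 1) :: s, by grind, .cons (hP _ _ hx) hf⟩

lemma geom_congr {P Q : ℕ → X →₀ R} {N : ℕ} (h : ∀ n ≤ N, P n = Q n) : geom P N = geom Q N := by
  induction N using Nat.strong_induction_on with
  | _ N ih =>
  rcases N with _ | N
  · simp
  · simp only [geom_succ]
    refine sum_congr rfl fun p hp => ?_
    grind [mem_anti]

lemma maurerCartan_congr (m : ℕ → List X → X →₀ R) {P Q : ℕ → X →₀ R} {N : ℕ}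
    (h : ∀ n ≤ N, P n = Q n) : maurerCartan m P N = maurerCartan m Q N :=
  sum_congr rfl fun p hp => by
    grind [mem_anti, geom_congr]

/-- Changing the part of degree `N` of `P` changes the Maurer–Cartan expression by the value of the
lowest unary operation. -/
lemma maurerCartan_update (m : ℕ → List X → X →₀ R) (P : ℕ → X →₀ R) (N : ℕ) (y : X →₀ R)
    (h : P (N + 1) = 0) :
    maurerCartan m (Function.update P (N + 1) y) (N + 1) =
      lin R (fun x => m 0 [x]) y + maurerCartan m P (N + 1) := by
  have hlt : ∀ n ≤ N, geom (Function.update P (N + 1) y) n = geom P n := fun n hn =>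
    geom_congr fun k hk => Function.update_of_ne (by omega) _ _
  -- All letters have positive degree, so a word of degree `N + 1` containing the changed part
  -- consists of it alone.
  have htop : geom (Function.update P (N + 1) y) (N + 1) =
      y.mapDomain (fun x => [x]) + geom P (N + 1) := by
    have hmem : ((N, 0) : ℕ × ℕ) ∈ anti N := by simp
    rw [geom_succ, geom_succ, ← Finset.add_sum_erase _ _ hmem, ← Finset.add_sum_erase _ _ hmem]
    simp only [Function.update_self, geom_zero, mapDomain_single, h, map_zero, zero_add,
      ← map_eq_lin]
    congr 1
    refine sum_congr rfl fun p hp => ?_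
    aesop
  rw [maurerCartan, maurerCartan, Finset.Nat.sum_antidiagonal_succ,
    Finset.Nat.sum_antidiagonal_succ, htop, map_add, lin_mapDomain, add_assoc]
  grind [sum_congr, mem_anti]

/-- This is the Bianchi identity. Applying the structure relations to the geometric series expresses
zero through operations on words in which one letter is a part of the Maurer–Cartan expression and
the others come from `P`. When the parts below degree `N` vanish, only the lowest unary operation on
the part of degree `N` survives. -/
lemma lin_maurerCartan_eq_zero (m : ℕ → List X → X →₀ R) (P : ℕ → X →₀ R) (G : Set X)
    (hP : ∀ n, ∀ x ∈ (P n).support, x ∈ G)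
    (hm : ∀ d l, (∀ x ∈ l, x ∈ G) →
      ∑ p ∈ anti d, lin R (m p.1) (ins (m p.2) l) = 0)
    (N : ℕ) (h : ∀ M < N, maurerCartan m P M = 0) :
    lin R (fun x => m 0 [x]) (maurerCartan m P N) = 0 := by
  have h0 : ∑ p ∈ anti N, lin R (fun l => ∑ q ∈ anti p.1,
      lin R (m q.1) (ins (m q.2) l)) (geom P p.2) = 0 := by
    refine sum_eq_zero fun p _ => lin_eq_zero fun l hl => hm _ _ ?_
    obtain ⟨s, -, hs⟩ := mem_support_geom (G := fun _ => G) hP hl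
    clear hl
    induction hs with
    | nil => simp
    | cons hx _ ih => simp_all
  -- Cutting the series into three independent series and summing over the middle one turns the
  -- replaced block into a part of the Maurer–Cartan expression.
  have h1 : ∀ T, ∑ q ∈ anti T, lin R (ins (m q.1)) (geom P q.2) =
      ∑ p ∈ anti T, ∑ q ∈ anti p.2,
        sandwich (geom P p.1) (maurerCartan m P q.1) (geom P q.2) := by
    intro T
    simp only [lin_ins_geom, maurerCartan, sandwich_sum]
    rw [anti_left_comm T fun j a r => ∑ q ∈ anti r,
      sandwich (geom P a) (lin R (m j) (geom P q.1)) (geom P q.2)]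
    refine sum_congr rfl fun p _ => ?_
    rw [anti_assoc p.2 fun j b c => sandwich (geom P p.1) (lin R (m j) (geom P b))
      (geom P c)]
  simp only [lin_sum, ← lin_lin] at h0
  rw [← anti_assoc N fun i j k => lin R (m i) (lin R (ins (m j)) (geom P k))] at h0
  simp only [← map_sum, h1] at h0
  -- In every other term the Maurer–Cartan part in the middle has degree less than `N`; the choices
  -- made here force the outer operation to have degree `0` and the flanking words to be empty.
  rw [sum_eq_single (0, N), sum_eq_single (0, N), sum_eq_single (N, 0)] at h0
  · simpa [sandwich, lin_mapDomain, Function.comp_def] using h0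
  · grind [mem_anti, sandwich_zero]
  · simp
  · intro p hp hne
    have hp' := mem_anti.1 hp
    refine sum_eq_zero fun q hq => ?_
    grind [mem_anti, sandwich_zero]
  · simp
  · intro p hp hne
    have hp' := mem_anti.1 hp
    have : ∑ q ∈ anti p.2, ∑ q' ∈ anti q.2,
        sandwich (geom P q.1) (maurerCartan m P q'.1) (geom P q'.2) = 0 := by
      refine sum_eq_zero fun q hq => sum_eq_zero fun q' hq' => ?_
      grind [mem_anti, sandwich_zero]
    rw [this, map_zero]
  · simp

end Ins

/-! ### Weights -/

section Weights

variable {ι : Type} [Fintype ι] [DecidableEq ι]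

/-- The second entry is the parameter, since the differentials sum over the weight in `Icc 0 w` that
moves to the new vertex and leave `w - v` behind. -/
instance : Finset.HasAntidiagonal (ι → ℕ) where
  antidiagonal w := (Icc 0 w).attach.map
    ⟨fun v => (w - v.1, v.1), fun _ _ h => Subtype.ext (Prod.ext_iff.1 h).2⟩
  mem_antidiagonal := by
    rintro w ⟨a, b⟩
    simp only [Finset.mem_map, Finset.mem_attach, true_and, Subtype.exists, mem_Icc]
    constructor
    · rintro ⟨v, hv, h⟩
      obtain ⟨rfl, rfl⟩ := Prod.ext_iff.1 h
      exact tsub_add_cancel_of_le hv.2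
    · rintro rfl
      exact ⟨b, ⟨zero_le, le_add_self⟩, Prod.ext (add_tsub_cancel_right _ _) rfl⟩

lemma anti_eq_sum_Icc {V : Type*} [AddCommMonoid V] (w : ι → ℕ)
    (f : (ι → ℕ) → (ι → ℕ) → V) :
    ∑ p ∈ anti w, f p.1 p.2 = ∑ v ∈ Icc 0 w, f (w - v) v := by
  refine sum_bij' (fun p _ => p.2) (fun v _ => (w - v, v)) ?_ ?_ ?_ ?_ ?_
  · aesop
  · simp_all [mem_anti, tsub_add_cancel_of_le, mem_Icc]
  · aesop
  · simp
  aesop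

lemma anti_ite_snd {V : Type*} [AddCommMonoid V] (w : ι → ℕ) (f : (ι → ℕ) → V) :
    ∑ p ∈ anti w, (if p.2 = 0 then f p.1 else 0) = f w := by
  rw [sum_eq_single (w, 0)]
  · simp
  · aesop
  · simp

lemma anti_ite_fst {V : Type*} [AddCommMonoid V] (w : ι → ℕ) (f : (ι → ℕ) → V) :
    ∑ p ∈ anti w, (if p.1 = 0 then f p.2 else 0) = f w := by
  rw [anti_swap' w fun a b => if a = 0 then f b else 0, anti_ite_snd]

lemma size_add {ι : Type} [Fintype ι] (v w : ι → ℕ) : size (v + w) = size v + size w := by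
  simp [size, sum_add_distrib]

@[simp] lemma size_zero {ι : Type} [Fintype ι] : size (0 : ι → ℕ) = 0 := by simp [size]

lemma size_eq_zero {ι : Type} [Fintype ι] {w : ι → ℕ} : size w = 0 ↔ w = 0 := by
  simp [size, funext_iff]

end Weights

/-! ### Induction on trees and additive invariants -/

section Trees

variable {ι : Type}

lemma WTree.ind {P : WTree ι → Prop} (leaf : P .leaf)
    (node : ∀ w cs, (∀ t ∈ cs, P t) → P (.node w cs)) (T : WTree ι) : P T :=
  match T with
  | .leaf => leaf
  | .node w cs => node w cs fun t _ => WTree.ind leaf node t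

lemma WTree.stableList_iff (cs : List (WTree ι)) :
    StableList cs ↔ ∀ t ∈ cs, t.Stable := by
  induction cs with
  | nil => simp [StableList]
  | cons t cs ih => simp [StableList, ih]

lemma WTree.stable_node (w : ι → ℕ) (cs : List (WTree ι)) :
    (WTree.node w cs).Stable ↔ StableVertex cs.length w ∧ ∀ t ∈ cs, t.Stable := by
  rw [WTree.Stable, WTree.stableList_iff]

lemma XTree.trees?_map (cs : List (WTree ι)) : trees? (cs.map .tree) = some cs := by
  induction cs with
  | nil => rfl
  | cons t cs ih => simp [trees?, ih]

lemma XTree.trees?_of_top_mem {l : List (XTree ι)} (h : top ∈ l) :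
    trees? l = none := by
  induction l with
  | nil => simp at h
  | cons x l ih =>
    cases x with
    | top => rfl
    | tree T => simp_all [trees?]

/-- This is the basic case distinction for strict units: either there are only genuine trees, or
some `⊤` is marked and its position is followed through the expansions. -/
lemma XTree.eq_map_or_split (l : List (XTree ι)) :
    (∃ cs : List (WTree ι), l = cs.map .tree) ∨ ∃ l₁ l₂, l = l₁ ++ .top :: l₂ := by
  induction l with
  | nil => simp
  | cons x l ih =>
    cases x with
    | top => exact .inr ⟨[], l, rfl⟩
    | tree T =>
      rcases ih with ⟨cs, rfl⟩ | ⟨l₁, l₂, rfl⟩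
      · exact .inl ⟨T :: cs, rfl⟩
      · exact .inr ⟨.tree T :: l₁, l₂, rfl⟩

variable [Fintype ι]

lemma XTree.join_map (v : ι → ℕ) (cs : List (WTree ι)) :
    XTree.join v (cs.map .tree) = some (.tree (.node v cs)) := by
  simp [XTree.join, XTree.trees?_map]

lemma XTree.join_top_cons (v : ι → ℕ) (l : List (XTree ι)) :
    XTree.join v (.top :: l) = if v = 0 then l.head?.bind (fun x => if l.length = 1 then some x else none) else none := by
  have h : trees? (top :: l) = none := rfl
  unfold XTree.join
  rw [h]
  rcases l with _ | ⟨x, _ | ⟨y, l⟩⟩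
  · simp
  · simp
  · simp

/-- The additive invariants of a tree: the number of inputs, the weight, and one more than the
dimension. -/
def XTree.attr (x : XTree ι) : ℕ × (ι → ℕ) × ℤ := (x.inputs, x.weight, x.dim + 1)

/-- The additive invariants of a forest. -/
def XTree.attrs (l : List (XTree ι)) : ℕ × (ι → ℕ) × ℤ := (l.map XTree.attr).sum

lemma XTree.attrs_append (l m : List (XTree ι)) :
    attrs (l ++ m) = attrs l + attrs m := by simp [attrs]

lemma XTree.attrs_cons (x : XTree ι) (l : List (XTree ι)) :
    attrs (x :: l) = x.attr + attrs l := by simp [attrs]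

@[simp] lemma XTree.attrs_nil : attrs ([] : List (XTree ι)) = 0 := rfl

lemma XTree.attr_top : (top : XTree ι).attr = (0, 0, 1) := by
  aesop

lemma XTree.attrs_map (cs : List (WTree ι)) : attrs (cs.map .tree) =
    (inputsList cs, weightList cs,
      (inputsList cs : ℤ) + 2 * size (weightList cs) - verticesList cs) := by
  induction cs with
  | nil =>
    simp [inputsList, weightList, verticesList]
    rfl
  | cons t cs ih =>
    rw [map_cons, XTree.attrs_cons, ih]
    simp only [XTree.attr, XTree.inputs, XTree.weight, XTree.dim, WTree.dim, inputsList,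
      weightList, verticesList, Prod.mk_add_mk, size_add]
    grind

lemma XTree.attr_node (w : ι → ℕ) (cs : List (WTree ι)) :
    (tree (.node w cs)).attr = attrs (cs.map .tree) + (0, w, 2 * (size w : ℤ) - 1) := by
  rw [XTree.attrs_map]
  simp only [XTree.attr, XTree.inputs, XTree.weight, XTree.dim, WTree.dim, WTree.inputs,
      WTree.weight, vertices, size_add, Prod.mk_add_mk]
  grind [Prod.ext, add_comm]

lemma XTree.join_of_top_mem {v : ι → ℕ} {l : List (XTree ι)} {x : XTree ι} (hl : .top ∈ l)
    (h : XTree.join v l = some x) : v = 0 ∧ (l = [.top, x] ∨ l = [x, .top]) := by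
  unfold XTree.join at h
  rw [XTree.trees?_of_top_mem hl] at h
  grind

/-- A vertex contributes its weight and `2|v| - 1`. Additivity survives the unit rule because the
shifted dimension `1` of `⊤` compensates the `-1` of the vertex `Ψ_2^0` that disappears. -/
lemma XTree.attr_join {v : ι → ℕ} {l : List (XTree ι)} {x : XTree ι}
    (h : XTree.join v l = some x) : x.attr = attrs l + (0, v, 2 * (size v : ℤ) - 1) := by
  rcases XTree.eq_map_or_split l with ⟨cs, rfl⟩ | ⟨l₁, l₂, rfl⟩
  · grind [XTree.join_map, XTree.attr_node]
  · obtain ⟨rfl, h' | h'⟩ := XTree.join_of_top_mem (by simp) h <;> simp only [h'] <;>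
      refine Prod.ext ?_ (Prod.ext ?_ ?_) <;>
      simp [attrs, XTree.attr_top]

lemma XTree.stable_join {v : ι → ℕ} {l : List (XTree ι)} {x : XTree ι}
    (h : XTree.join v l = some x) (hv : StableVertex l.length v) (hl : ∀ y ∈ l, y.Stable) :
    x.Stable := by
  rcases XTree.eq_map_or_split l with ⟨cs, rfl⟩ | ⟨l₁, l₂, rfl⟩
  · grind [XTree.join_map, XTree.Stable, WTree.stable_node, List.mem_map_of_mem]
  · obtain ⟨rfl, h | h⟩ := XTree.join_of_top_mem (by simp) h <;> rw [h] at hl <;>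
      exact hl x (by simp)

end Trees

/-! ### The operations on extended trees -/

section Operations

variable (R : Type*) [CommRing R] {ι : Type} [Fintype ι]

/-- The stable corolla of weight `v` applied to a list of extended trees. -/
def corollaOp (v : ι → ℕ) (l : List (XTree ι)) : XTree ι →₀ R :=
  if StableVertex l.length v then ofOption R (XTree.join v l) else 0

variable {R}

lemma corollaOp_map (v : ι → ℕ) (cs : List (WTree ι)) : corollaOp R v (cs.map .tree) =
    if StableVertex cs.length v then single (.tree (.node v cs)) 1 else 0 := by
  simp [corollaOp, XTree.join_map, ofOption]

lemma corollaOp_top_cons (v : ι → ℕ) (l : List (XTree ι)) : corollaOp R v (.top :: l) =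
    if v = 0 then letterPart (fun x => single x 1) l else 0 := by
  rw [corollaOp, XTree.join_top_cons]
  by_cases hv : v = 0
  · subst hv
    rcases l with _ | ⟨x, _ | ⟨y, l⟩⟩ <;> simp [StableVertex, ofOption, letterPart]
  aesop

lemma corollaOp_mid_top (v : ι → ℕ) {l₁ l₂ : List (XTree ι)} (h₁ : l₁ ≠ []) (h₂ : l₂ ≠ []) :
    corollaOp R v (l₁ ++ .top :: l₂) = 0 := by
  rw [corollaOp]
  rcases h : XTree.join v (l₁ ++ .top :: l₂) with _ | x
  · simp [ofOption]
  · obtain ⟨-, h | h⟩ := XTree.join_of_top_mem (by simp) h <;>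
    · have := congrArg List.length h
      grind [List.length_pos_iff]

lemma corollaOp_append_top (v : ι → ℕ) (l : List (XTree ι)) : corollaOp R v (l ++ [.top]) =
    if v = 0 then letterPart (fun x => single x 1) l else 0 := by
  rcases l with _ | ⟨x, _ | ⟨y, l⟩⟩
  · simp [corollaOp_top_cons]
  · have h : trees? [x, top] = none := XTree.trees?_of_top_mem (by simp)
    by_cases hv : v = 0
    · subst hv
      cases x <;> simp [corollaOp, XTree.join, h, StableVertex, ofOption]
    simp_all [corollaOp, XTree.join, ofOption]
  · rw [corollaOp]
    rcases h : XTree.join v (x :: y :: l ++ [top]) with _ | z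
    · aesop
    · obtain ⟨-, h | h⟩ := XTree.join_of_top_mem (by simp) h <;>
      · simp_all

lemma letterPart_zero {X V : Type*} [AddCommMonoid V] (l : List X) :
    letterPart (fun _ => (0 : V)) l = 0 := by
  match l with
  | [] => rfl
  | [x] => rfl
  | _ :: _ :: _ => rfl

variable (R) [DecidableEq ι]

/-- The differential, placed in weight zero. -/
def bdOp (v : ι → ℕ) (x : XTree ι) : XTree ι →₀ R := if v = 0 then x.bd R else 0

/-- The stable corolla of weight `v`, or the differential for the unstable corolla with one input. -/
def treeOp (v : ι → ℕ) (l : List (XTree ι)) : XTree ι →₀ R :=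
  corollaOp R v l + letterPart (bdOp R v) l

variable {R}

lemma bdOp_zero (x : XTree ι) : bdOp R 0 x = x.bd R := if_pos rfl

lemma bdOp_of_ne {v : ι → ℕ} (h : v ≠ 0) (x : XTree ι) : bdOp R v x = 0 := if_neg h

lemma letterPart_bdOp (v : ι → ℕ) (l : List (XTree ι)) :
    letterPart (bdOp R v) l = if v = 0 then letterPart (XTree.bd R) l else 0 := by
  by_cases h : v = 0
  · subst h
    rw [if_pos rfl]
    congr 1
    funext x
    exact bdOp_zero x
  · rw [if_neg h, show bdOp R v = fun _ => 0 from funext (bdOp_of_ne h), letterPart_zero]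

/-- The values of the corollas on a list containing `⊤`. -/
lemma corollaOp_append_top_cons (v : ι → ℕ) (l₁ l₂ : List (XTree ι)) :
    corollaOp R v (l₁ ++ .top :: l₂) =
      (if v = 0 then (if l₁ = [] then letterPart (fun x => single x 1) l₂ else 0) else 0) +
      (if v = 0 then (if l₂ = [] then letterPart (fun x => single x 1) l₁ else 0) else 0) := by
  rcases eq_or_ne l₁ [] with rfl | h₁
  · simp [nil_append, corollaOp_top_cons, eq_or_ne]
  · rcases eq_or_ne l₂ [] with rfl | h₂
    · simp [corollaOp_append_top]
    simp_all [corollaOp_mid_top]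

lemma cutSum_letterPart_left {X V : Type*} [AddCommGroup V] [Module R V] (x : X) (l : List X)
    (F : X → List X → V) :
    cutSum (x :: l) (fun b c => lin R (fun y => F y c)
      (letterPart (fun x => single x (1 : R)) b)) = F x l := by
  simp_all [cutSum_cons, cutSum_eq_left, letterPart_eq_zero, map_zero]

lemma cutSum_letterPart_right {X V : Type*} [AddCommGroup V] [Module R V] (x : X) (l : List X)
    (F : X → List X → V) :
    cutSum (l ++ [x]) (fun a b => lin R (fun y => F y a)
      (letterPart (fun x => single x (1 : R)) b)) = F x l := by
  simp_all [cutSum_append_cons, cutSum_nil, cutSum_eq_right, letterPart_eq_zero, map_zero]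

lemma ins_letterPart_map (cs : List (WTree ι)) :
    ins (letterPart (XTree.bd R)) (cs.map .tree) =
      (bdList R cs).mapDomain (List.map .tree) := by
  induction cs with
  | nil => simp [ins_letterPart_nil, bdList]
  | cons t cs ih =>
    rw [map_cons, ins_letterPart_cons, ih, bdList, mapDomain_add, XTree.bd]
    simp only [← mapDomain_comp, Function.comp_def, map_cons]

lemma length_of_mem_bdList {cs cs' : List (WTree ι)}
    (h : cs' ∈ (bdList R cs).support) : cs'.length = cs.length := by
  classical
  induction cs generalizing cs' with
  | nil => simp [bdList] at h
  | cons t cs ih =>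
    rw [bdList] at h
    rcases mem_add h with h | h
    · obtain ⟨_, -, rfl⟩ := mem_image.1 (mapDomain_support h)
      simp
    · obtain ⟨_, h', rfl⟩ := mem_image.1 (mapDomain_support h)
      simp [ih h']

lemma splitRoot_eq_threeSum (w : ι → ℕ) (cs : List (WTree ι)) :
    splitRoot R w cs = ∑ p ∈ anti w, threeSum cs fun a b c =>
      if StableVertex b.length p.2 ∧ StableVertex (a.length + 1 + c.length) p.1 then
        single (.node p.1 (a ++ .node p.2 b :: c)) 1 else 0 := by
  rw [anti_eq_sum_Icc w fun x y => threeSum cs fun a b c =>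
      if StableVertex b.length y ∧ StableVertex (a.length + 1 + c.length) x then
        single (WTree.node x (a ++ .node y b :: c)) (1 : R) else 0]
  rw [splitRoot]
  refine sum_congr rfl fun w' _ => ?_
  simp only [threeSum, cutSum]
  refine sum_congr rfl fun a ha => ?_
  rw [length_drop]
  refine sum_congr rfl fun b hb => ?_
  grind [mem_range, List.drop_drop]

/-- Here `v = 0` and `l` has at most one letter. A replacement could yield two letters only by
replacing an empty block, and the unstable `Ψ_0^0` contributes nothing there. -/
lemma lin_corollaOp_ins_unstable {v : ι → ℕ} {l : List (XTree ι)}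
    (h : ¬ StableVertex l.length v) {p : (ι → ℕ) × (ι → ℕ)} (hp : p ∈ anti v) :
    lin R (corollaOp R p.1) (ins (treeOp R p.2) l) = 0 := by
  have hv : v = 0 := by by_contra hv; exact h (.inl hv)
  have hl : l.length < 2 := by by_contra hl; exact h (.inr (by omega))
  subst hv
  have hp' := mem_anti.1 hp
  have h1 : p.1 = 0 := by simp_all
  have h2 : p.2 = 0 := by simp_all
  rw [h1, h2]
  refine lin_eq_zero fun l' hl' => ?_
  obtain ⟨a, b, c, x, rfl, hx, rfl⟩ := mem_support_ins hl'
  simp only [length_append] at hl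
  rw [corollaOp, if_neg]
  rintro (h' | h')
  · exact h' rfl
  · have hb : b = [] := by
      grind [length_eq_zero_iff]
    subst hb
    simp [treeOp, corollaOp, StableVertex] at hx

lemma treeOp_append_top_cons (u : ι → ℕ) (b b' : List (XTree ι)) :
    treeOp R u (b ++ .top :: b') = corollaOp R u (b ++ .top :: b') := by
  rw [treeOp, letterPart_bdOp]
  rcases b with _ | ⟨x, b⟩
  · rcases b' with _ | ⟨x, b'⟩
    · simp [XTree.bd]
    · simp [letterPart]
  simp [letterPart_eq_zero]

/-- The blocks containing a given entry `⊤`. -/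
lemma cutSum_corollaOp_append_top_cons {V : Type*} [AddCommGroup V] [Module R V] (u : ι → ℕ)
    (l₁ l₂ : List (XTree ι)) (G : List (XTree ι) → V) :
    cutSum l₁ (fun a b => cutSum l₂ fun b' c =>
      lin R (fun x => G (a ++ x :: c)) (corollaOp R u (b ++ .top :: b'))) =
      if u = 0 then (if l₂ = [] then 0 else G (l₁ ++ l₂)) + (if l₁ = [] then 0 else G (l₁ ++ l₂))
      else 0 := by
  simp only [corollaOp_append_top_cons, map_add, cutSum_add]
  by_cases hp : u = 0
  · simp only [hp, if_true]
    congr 1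
    · rw [cutSum_eq_right]
      · rcases l₂ with _ | ⟨x, l₂⟩
        · simp
        simp [if_true, cutSum_letterPart_left]
      simp_all [cutSum_zero]
    · rw [cutSum_comm, cutSum_eq_left]
      · rcases List.eq_nil_or_concat l₁ with rfl | ⟨l₁, x, rfl⟩
        · simp
        simp [if_true, List.concat_eq_append, cutSum_letterPart_right]
      simp_all [cutSum_zero]
  · simp [hp, cutSum_zero]

/-- The differential of a corolla applied to extended trees. -/
lemma lin_bd_corollaOp [CharP R 2] (v : ι → ℕ) (l : List (XTree ι)) :
    lin R (XTree.bd R) (corollaOp R v l) =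
      ∑ p ∈ anti v, lin R (corollaOp R p.1) (ins (treeOp R p.2) l) := by
  rcases XTree.eq_map_or_split l with ⟨cs, rfl⟩ | ⟨l₁, l₂, rfl⟩
  · by_cases h : StableVertex cs.length v
    · rw [corollaOp_map, if_pos h, lin_one, XTree.bd, WTree.bd, mapDomain_add]
      -- Without `⊤`, the corolla part of `treeOp` gives the edges inserted at the root and its
      -- unary part the edges inserted in the subtrees.
      have hm : ∀ u, treeOp R u = fun b : List (XTree ι) =>
        corollaOp R u b + letterPart (bdOp R u) b := fun _ => rfl
      simp only [hm, ins_add, map_add, sum_add_distrib]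
      congr 1
      · rw [splitRoot_eq_threeSum, mapDomain_finsetSum]
        refine sum_congr rfl fun p _ => ?_
        rw [map_eq_lin, map_threeSum, lin_ins, threeSum_map]
        refine threeSum_congr fun a b c _ => ?_
        rw [corollaOp_map]
        by_cases hb : StableVertex b.length p.2
        · rw [if_pos hb, lin_one, ← map_cons, ← map_append, corollaOp_map]
          simp only [hb, true_and, length_append, length_cons,
            show a.length + (c.length + 1) = a.length + 1 + c.length by omega]
          split_ifs <;> simp
        · simp [hb]
      · have e : ∀ p : (ι → ℕ) × (ι → ℕ), lin R (corollaOp R p.1)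
            (ins (letterPart (bdOp R p.2)) (cs.map tree)) =
            if p.2 = 0 then lin R (corollaOp R p.1) (ins (letterPart (XTree.bd R))
              (cs.map tree)) else 0 := by
          intro p
          have : letterPart (bdOp R p.2) = fun b : List (XTree ι) =>
            if p.2 = 0 then letterPart (XTree.bd R) b else 0 := funext (letterPart_bdOp p.2)
          rw [this]
          by_cases hp : p.2 = 0
          · aesop
          · simp [hp, ins, threeSum, cutSum_zero]
        simp only [e]
        rw [anti_ite_snd v fun u => lin R (corollaOp R u) (ins (letterPart (XTree.bd R))
              (cs.map tree)), ins_letterPart_map, lin_mapDomain,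
          ← mapDomain_comp, map_eq_lin]
        refine lin_congr fun cs' hcs' => ?_
        rw [corollaOp_map, length_of_mem_bdList hcs', if_pos h]
        rfl
    · rw [corollaOp_map, if_neg h, map_zero, sum_eq_zero fun p hp =>
        lin_corollaOp_ins_unstable (by simpa using h) hp]
  · have h1 : ∑ p ∈ anti v, threeSum l₁ (fun a b c => lin R (fun x => corollaOp R p.1
        (a ++ x :: (c ++ .top :: l₂))) (treeOp R p.2 b)) = if l₂ = [] then treeOp R v l₁ else 0 := by
      split_ifs with h
      · subst h
        rw [← anti_ite_fst v fun u => treeOp R u l₁]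
        refine sum_congr rfl fun p _ => ?_
        have : ∀ (a c : List (XTree ι)) x, a ++ x :: (c ++ [top]) =
          (a ++ x :: c) ++ [top] := by simp
        simp only [this, corollaOp_append_top]
        split_ifs
        · rw [← lin_ins, lin_letterPart_ins, lin_single_id]
        · simp [lin_zero, threeSum, cutSum_zero]
      · refine sum_eq_zero fun p _ => threeSum_eq_zero fun a b c _ => lin_eq_zero fun x _ => ?_
        have := corollaOp_mid_top (R := R) p.1 (l₁ := a ++ x :: c) (by simp) h
        simpa using this
    have h2 : ∑ p ∈ anti v, threeSum l₂ (fun a b c => lin R (fun x => corollaOp R p.1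
        (l₁ ++ .top :: a ++ x :: c)) (treeOp R p.2 b)) = if l₁ = [] then treeOp R v l₂ else 0 := by
      split_ifs with h
      · subst h
        rw [← anti_ite_fst v fun u => treeOp R u l₂]
        refine sum_congr rfl fun p _ => ?_
        simp only [nil_append, List.cons_append, corollaOp_top_cons]
        split_ifs
        · rw [← lin_ins, lin_letterPart_ins, lin_single_id]
        · simp [lin_zero, threeSum, cutSum_zero]
      · refine sum_eq_zero fun p _ => threeSum_eq_zero fun a b c _ => lin_eq_zero fun x _ => ?_
        simp_all [corollaOp_mid_top]
    have h3 : ∑ p ∈ anti v, cutSum l₁ (fun a b => cutSum l₂ fun b' c =>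
        lin R (fun x => corollaOp R p.1 (a ++ x :: c)) (treeOp R p.2 (b ++ .top :: b'))) =
        (if l₂ = [] then 0 else corollaOp R v (l₁ ++ l₂)) +
        (if l₁ = [] then 0 else corollaOp R v (l₁ ++ l₂)) := by
      simp only [treeOp_append_top_cons, cutSum_corollaOp_append_top_cons]
      rw [anti_ite_snd v fun u => (if l₂ = [] then 0 else corollaOp R u (l₁ ++ l₂)) +
          (if l₁ = [] then 0 else corollaOp R u (l₁ ++ l₂))]
    simp only [lin_ins, threeSum_append_cons, sum_add_distrib, h1, h2]
    rw [h3]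
    -- If `⊤` has neighbours on both sides, it can be absorbed by either of them, with equal results
    -- that cancel. If it stands at an end, the absorption term cancels the corolla part of `treeOp`
    -- and leaves the differential of a single remaining letter.
    rcases eq_or_ne l₁ [] with rfl | h₁
    · rw [nil_append, corollaOp_top_cons]
      rcases l₂ with _ | ⟨x, _ | ⟨y, l₂⟩⟩
      · simp [add_self R]
      · simp only [treeOp, letterPart_bdOp]
        have := add_self R (corollaOp R v [x])
        by_cases hv : v = 0
        · simp [hv] at this ⊢
          grind
        · simp [hv, this]
      · simp [treeOp, letterPart, add_self R]
    · rcases eq_or_ne l₂ [] with rfl | h₂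
      · rw [corollaOp_append_top]
        rcases l₁ with _ | ⟨x, _ | ⟨y, l₁⟩⟩
        · simp at h₁
        · simp only [treeOp, letterPart_bdOp]
          have := add_self R (corollaOp R v [x])
          by_cases hv : v = 0
          · simp [hv] at this ⊢
            grind
          · simp [hv, this]
        · simp [treeOp, letterPart, add_self R]
      grind [corollaOp_mid_top, add_self]

/-- By `lin_bd_corollaOp` the terms ending with the differential cancel those ending with a corolla.
What is left is the square of the differential on a single letter. -/
lemma sum_treeOp_ins [CharP R 2] (v : ι → ℕ) (l : List (XTree ι)) :
    ∑ p ∈ anti v, lin R (treeOp R p.1) (ins (treeOp R p.2) l) =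
      if v = 0 then letterPart (fun x => lin R (XTree.bd R) (x.bd R)) l else 0 := by
  have := sum_lin_ins_add_letterPart v (bdOp R) (corollaOp R) l
  refine this.trans ?_
  have e (y : (ι → ℕ) → XTree ι →₀ R) : ∑ p ∈ anti v, lin R (bdOp R p.1) (y p.2) =
      lin R (XTree.bd R) (y v) := by
    rw [← anti_ite_fst v fun u => lin R (XTree.bd R) (y u)]
    refine sum_congr rfl fun p _ => ?_
    split_ifs with h
    · rw [h]; congr 2; funext x; exact bdOp_zero x
    · exact lin_eq_zero fun x _ => bdOp_of_ne h x
  rw [e fun u => corollaOp R u l, lin_bd_corollaOp]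
  change _ + ∑ p ∈ anti v, lin R (corollaOp R p.1) (ins (treeOp R p.2) l) + _ = _
  rw [add_self R, zero_add]
  simp only [fun x => e fun u => bdOp R u x]
  by_cases hv : v = 0
  · simp only [hv, if_true, bdOp_zero]
  · simp only [hv, if_false, bdOp_of_ne hv, map_zero, letterPart_zero]

/-- A triple composition of `treeOp` on the word of subtrees is bracketed in two ways. Composing the
two inner operations first gives zero by `sum_ins_ins` and induction; composing the two outer ones
first leaves the square of the differential of the corolla on these subtrees. -/
lemma XTree.lin_bd_bd [CharP R 2] (x : XTree ι) (hx : x.Stable) :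
    lin R (XTree.bd R) (x.bd R) = 0 := by
  cases x with
  | top => simp [XTree.bd]
  | tree T =>
  induction T using WTree.ind with
  | leaf => aesop
  | node w cs ih =>
    obtain ⟨hw, hcs⟩ := (WTree.stable_node w cs).1 hx
    -- The right hand side of `sum_treeOp_ins` concerns one-letter words only, and these are
    -- subtrees covered by the induction hypothesis.
    have key : ∀ (u : ι → ℕ) (b : List (XTree ι)), b.length ≠ 1 ∨ (∀ x ∈ b, x ∈ cs.map tree) →
        ∑ p ∈ anti u, lin R (treeOp R p.1) (ins (treeOp R p.2) b) = 0 := by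
      intro u b hb
      rw [sum_treeOp_ins]
      split_ifs with hu
      · match b, hb with
        | [], _ => rfl
        | [x], hb =>
          obtain ⟨t, ht, rfl⟩ := List.mem_map.1 (hb.resolve_left (by simp) x (by simp))
          exact ih t ht (hcs t ht)
        | _ :: _ :: _, _ => rfl
      · rfl
    have h1 : ∑ p ∈ anti w, lin R (treeOp R p.1) (∑ q ∈ anti p.2,
        lin R (ins (treeOp R q.1)) (ins (treeOp R q.2) (cs.map .tree))) = 0 := by
      refine sum_eq_zero fun p _ => ?_
      rw [sum_ins_ins, ins_eq_zero, map_zero]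
      intro a b c habc
      exact key _ _ (.inr fun x hx => by grind)
    simp only [map_sum, lin_lin] at h1
    rw [anti_assoc w fun i j k => lin R (fun l => lin R (treeOp R i)
      (ins (treeOp R j) l)) (ins (treeOp R k) (cs.map .tree))] at h1
    simp only [← lin_sum] at h1
    have h2 : ∀ p ∈ anti w, lin R (fun l => ∑ q ∈ anti p.1, lin R (treeOp R q.1)
        (ins (treeOp R q.2) l)) (ins (treeOp R p.2) (cs.map .tree)) =
        if p.1 = 0 then lin R (fun x => lin R (XTree.bd R) (x.bd R)) (treeOp R p.2 (cs.map .tree))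
          else 0 := by
      intro p _
      simp only [sum_treeOp_ins]
      split_ifs
      · rw [lin_letterPart_ins]
      · rw [lin_zero]
    rw [sum_congr rfl h2, anti_ite_fst w fun u =>
      lin R (fun x => lin R (XTree.bd R) (x.bd R)) (treeOp R u (cs.map .tree)), treeOp, map_add,
      corollaOp_map, if_pos hw, lin_one] at h1
    have h3 : lin R (fun x => lin R (XTree.bd R) (x.bd R))
        (letterPart (bdOp R w) (cs.map .tree)) = 0 := by
      rw [letterPart_bdOp]
      split_ifs with h0
      · rcases hw with hw | hw
        · exact absurd h0 hw
        grind [letterPart_eq_zero, map_zero]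
      · rw [map_zero]
    grind

end Operations

/-! ### Grafting -/

lemma XTree.ind {ι : Type} {P : XTree ι → Prop} (top : P .top) (leaf : P (.tree .leaf))
    (node : ∀ v (cs : List (WTree ι)), (∀ x ∈ cs.map tree, P x) → P (.tree (.node v cs)))
    (x : XTree ι) : P x := by
  cases x with
  | top => exact top
  | tree T =>
    refine WTree.ind (P := fun T => P (.tree T)) leaf (fun v cs h => node v cs ?_) T
    simpa using h

@[simp] lemma XTree.inputs_top {ι : Type} : (top : XTree ι).inputs = 0 := rfl

section Graft

variable {ι : Type} [Fintype ι]

namespace XTree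

/-- Gluing into a forest of extended trees. -/
def graftForest : List (XTree ι) → ℕ → XTree ι → Option (List (XTree ι))
  | [], _, _ => none
  | x :: l, i, S =>
    if i < x.inputs then (x.graft i S).map (· :: l)
    else (graftForest l (i - x.inputs) S).map (x :: ·)

lemma graftList_eq (cs : List (WTree ι)) (i : ℕ) (S : XTree ι) :
    graftList cs i S = graftForest (cs.map .tree) i S := by
  induction cs generalizing i with
  | nil => aesop
  | cons t cs ih =>
    simp [graftList, graftForest, ih, XTree.inputs, XTree.graft]
    rfl

lemma graft_node (v : ι → ℕ) (cs : List (WTree ι)) (i : ℕ) (S : XTree ι) :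
    (tree (.node v cs)).graft i S = (graftForest (cs.map .tree) i S).bind (join v) := by
  rw [XTree.graft, WTree.graft, graftList_eq]

lemma graft_leaf (i : ℕ) (S : XTree ι) :
    (tree .leaf).graft i S = if i = 0 then some S else none := by
  aesop

lemma attr_leaf : (tree .leaf : XTree ι).attr = (1, 0, 1) := by
  simp [attr, inputs, weight, dim, WTree.dim, WTree.inputs, WTree.weight, vertices]

@[simp] lemma graft_top (i : ℕ) (S : XTree ι) : (top : XTree ι).graft i S = none := rfl

/-- Number of inputs of a forest. -/
def forestInputs (l : List (XTree ι)) : ℕ := (attrs l).1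

@[simp] lemma forestInputs_nil : forestInputs ([] : List (XTree ι)) = 0 := rfl

@[simp] lemma forestInputs_cons (x : XTree ι) (l : List (XTree ι)) :
    forestInputs (x :: l) = x.inputs + forestInputs l := by
  simp [forestInputs, attrs_cons, attr]

@[simp] lemma forestInputs_append (l m : List (XTree ι)) :
    forestInputs (l ++ m) = forestInputs l + forestInputs m := by
  simp [forestInputs, attrs_append]

lemma forestInputs_map (cs : List (WTree ι)) :
    forestInputs (cs.map .tree) = inputsList cs := by
  rw [forestInputs, attrs_map]

lemma inputs_node (v : ι → ℕ) (cs : List (WTree ι)) :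
    (tree (.node v cs)).inputs = forestInputs (cs.map .tree) := by
  rw [forestInputs_map]
  rfl

lemma inputs_join {v : ι → ℕ} {l : List (XTree ι)} {x : XTree ι} (h : join v l = some x) :
    x.inputs = forestInputs l := by
  simpa [attr, forestInputs] using congrArg fst (attr_join h)

lemma graftForest_eq_none_of {l : List (XTree ι)}
    (hl : ∀ x ∈ l, ∀ i S, x.inputs ≤ i → x.graft i S = none) {i : ℕ} (h : forestInputs l ≤ i)
    (S : XTree ι) : graftForest l i S = none := by
  induction l generalizing i with
  | nil => rfl
  | cons x l ih =>
    simp only [forestInputs_cons] at h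
    rw [graftForest, if_neg (by omega),
      ih (fun y hy => hl y (List.mem_cons_of_mem _ hy)) (by omega)]
    rfl

lemma graft_eq_none (x : XTree ι) (i : ℕ) (S : XTree ι) (h : x.inputs ≤ i) :
    x.graft i S = none := by
  induction x using XTree.ind generalizing i S with
  | top => rfl
  | leaf => rw [graft_leaf, if_neg]; simp [XTree.inputs, WTree.inputs] at h; omega
  | node v cs ih =>
    simp_all [graft_node, graftForest_eq_none_of, inputs_node]

lemma graftForest_eq_none {l : List (XTree ι)} {i : ℕ} (h : forestInputs l ≤ i) (S : XTree ι) :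
    graftForest l i S = none :=
  graftForest_eq_none_of (fun x _ i S => graft_eq_none x i S) h S

lemma graftForest_append_cons (l₁ : List (XTree ι)) (x : XTree ι) (l₂ : List (XTree ι)) {j : ℕ}
    (h : j < x.inputs) (S : XTree ι) : graftForest (l₁ ++ x :: l₂) (forestInputs l₁ + j) S =
      (x.graft j S).map fun x' => l₁ ++ x' :: l₂ := by
  induction l₁ with
  | nil => simp [graftForest, h]
  | cons y l₁ ih =>
    rw [List.cons_append, graftForest, if_neg (by simp; omega), forestInputs_cons,
      show y.inputs + forestInputs l₁ + j - y.inputs = forestInputs l₁ + j by omega, ih]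
    aesop

lemma exists_split {l : List (XTree ι)} {i : ℕ} (h : i < forestInputs l) :
    ∃ l₁ x l₂ j, l = l₁ ++ x :: l₂ ∧ i = forestInputs l₁ + j ∧ j < x.inputs := by
  induction l generalizing i with
  | nil => simp at h
  | cons x l ih =>
    by_cases hx : i < x.inputs
    · exact ⟨[], x, l, i, rfl, by simp, hx⟩
    · obtain ⟨l₁, y, l₂, j, rfl, hi, hj⟩ := ih (i := i - x.inputs) (by simp at h; omega)
      exact ⟨x :: l₁, y, l₂, j, rfl, by simp; omega, hj⟩

lemma graftForest_eq_some {l l' : List (XTree ι)} {i : ℕ} {S : XTree ι}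
    (h : graftForest l i S = some l') : ∃ l₁ x l₂ j x', l = l₁ ++ x :: l₂ ∧
      i = forestInputs l₁ + j ∧ j < x.inputs ∧ x.graft j S = some x' ∧ l' = l₁ ++ x' :: l₂ := by
  have hi : i < forestInputs l := by
    grind [graftForest_eq_none]
  obtain ⟨l₁, x, l₂, j, rfl, rfl, hj⟩ := exists_split hi
  grind [graftForest_append_cons, map_eq_some_iff]

lemma length_graftForest {l l' : List (XTree ι)} {i : ℕ} {S : XTree ι}
    (h : graftForest l i S = some l') : l'.length = l.length := by
  obtain ⟨l₁, x, l₂, j, x', rfl, -, -, -, rfl⟩ := graftForest_eq_some h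
  simp

/-- Since `⊤` has no inputs, deleting it together with a `Ψ_2^0` does not shift the numbering, so
gluing may be done before or after the vertex is formed. -/
lemma bind_graft_join (v : ι → ℕ) (l : List (XTree ι)) (i : ℕ) (S : XTree ι) :
    (join v l).bind (fun x => x.graft i S) = (graftForest l i S).bind (join v) := by
  rcases eq_map_or_split l with ⟨cs, rfl⟩ | ⟨l₁, l₂, rfl⟩
  · rw [join_map, bind_some, graft_node]
  · rcases hj : join v (l₁ ++ .top :: l₂) with _ | x
    · rcases hg : graftForest (l₁ ++ .top :: l₂) i S with _ | l'
      · rfl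
      · obtain ⟨m₁, x, m₂, j, x', h, -, hj', hx', rfl⟩ := graftForest_eq_some hg
        -- The entry changed by gluing is not `⊤`, so a `⊤` among the other entries persists. If the
        -- corolla accepts the new list by the unit rule, it would have accepted the old one.
        have hx : x ≠ .top := by aesop
        have ht : top ∈ m₁ ++ m₂ := by
          have : top ∈ m₁ ++ x :: m₂ := by rw [← h]; simp
          grind
        symm
        rw [bind_some, Option.bind_none]
        by_contra hc
        obtain ⟨y, hy⟩ := Option.ne_none_iff_exists'.1 hc
        obtain ⟨rfl, h' | h'⟩ := join_of_top_mem (by grind) hy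
        · rcases m₁ with _ | ⟨z, _ | ⟨z', m₁⟩⟩ <;> simp at h'
          · grind [join, trees?]
          simp_all [join, trees?]
        · rcases m₁ with _ | ⟨z, _ | ⟨z', m₁⟩⟩ <;> simp at h'
          · grind [join, trees?]
          grind [join, trees?]
    · obtain ⟨rfl, h' | h'⟩ := join_of_top_mem (by simp) hj
      · rw [h', bind_some]
        by_cases hi : i < x.inputs
        · rcases h : x.graft i S with _ | y
          · simp [graftForest, hi, h]
          · simp [graftForest, hi, h, join_top_cons]
        simp_all [graftForest, graft_eq_none]
      · rw [h', bind_some]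
        by_cases hi : i < x.inputs
        · rcases h : x.graft i S with _ | y
          · simp [graftForest, hi, h]
          · cases y <;> simp [graftForest, hi, h, join, trees?]
        simp_all [graftForest, graft_eq_none]

lemma attr_graft {x S y : XTree ι} {i : ℕ} (h : x.graft i S = some y) :
    y.attr + (1, 0, 1) = x.attr + S.attr := by
  induction x using XTree.ind generalizing i y with
  | top => cases h
  | leaf =>
    simp_all [graft_leaf, add_comm, attr_leaf]
  | node v cs ih =>
    rw [graft_node, bind_eq_some_iff] at h
    obtain ⟨l', hl', hy⟩ := h
    obtain ⟨l₁, x, l₂, j, x', h, -, -, hx', rfl⟩ := graftForest_eq_some hl'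
    have := ih x (by simp [h]) hx'
    rw [attr_join hy, attr_node, h, attrs_append, attrs_append, attrs_cons, attrs_cons]
    grind

lemma inputs_graft {x S y : XTree ι} {i : ℕ} (h : x.graft i S = some y) :
    y.inputs + 1 = x.inputs + S.inputs := by
  simpa [attr] using congrArg fst (attr_graft h)

lemma stable_graft {x S y : XTree ι} {i : ℕ} (h : x.graft i S = some y) (hx : x.Stable)
    (hS : S.Stable) : y.Stable := by
  induction x using XTree.ind generalizing i y with
  | top => cases h
  | leaf =>
    simp_all [graft_leaf]
  | node v cs ih =>
    rw [graft_node, bind_eq_some_iff] at h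
    obtain ⟨l', hl', hy⟩ := h
    have hlen := length_graftForest hl'
    obtain ⟨l₁, x, l₂, j, x', h, -, -, hx', rfl⟩ := graftForest_eq_some hl'
    simp only [XTree.Stable, stable_node] at hx
    have hs : ∀ z ∈ cs.map tree, z.Stable := by simpa [XTree.Stable] using hx.2
    refine stable_join hy (by grind) fun z hz => ?_
    rw [h] at hs
    simp only [List.mem_append, List.mem_cons] at hz hs
    rcases hz with hz | rfl | hz
    · grind
    · aesop
    simp_all

lemma forest_seq {l : List (XTree ι)} {S : XTree ι} {k : ℕ} {U : XTree ι} (hk : k < S.inputs)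
    (hl : ∀ x ∈ l, ∀ i, i < x.inputs → (x.graft i S).bind (fun u => u.graft (i + k) U) =
      (S.graft k U).bind (fun v => x.graft i v)) {i : ℕ} (hi : i < forestInputs l) :
    (graftForest l i S).bind (fun u => graftForest u (i + k) U) =
      (S.graft k U).bind fun v => graftForest l i v := by
  obtain ⟨l₁, x, l₂, j, rfl, rfl, hj⟩ := exists_split hi
  simp only [graftForest_append_cons _ _ _ hj]
  have := congrArg (Option.map fun x' => l₁ ++ x' :: l₂) (hl x (by simp) j hj)
  rw [mbind, mbind] at this
  rw [show ((fun v => Option.map (fun x' => l₁ ++ x' :: l₂) (x.graft j v))) =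
    Option.map (fun x' => l₁ ++ x' :: l₂) ∘ fun v => x.graft j v from rfl, ← this]
  rcases hx : x.graft j S with _ | x'
  · rfl
  grind [inputs_graft, Option.map_some, bind_some, add_assoc, graftForest_append_cons]

/-- The sequential axiom of an operad: the input `k` of `S` has become the input `i + k` after
gluing. Induction passes through the forest containing the input `i`. -/
lemma graft_seq (x : XTree ι) (i : ℕ) (S : XTree ι) (k : ℕ) (U : XTree ι) (hi : i < x.inputs)
    (hk : k < S.inputs) : (x.graft i S).bind (fun u => u.graft (i + k) U) =
      (S.graft k U).bind (fun v => x.graft i v) := by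
  induction x using XTree.ind generalizing i with
  | top => simp [inputs] at hi
  | leaf =>
    simp_all [inputs, WTree.inputs, graft_leaf]
  | node v cs ih =>
    simp only [graft_node]
    rw [bassoc]
    simp only [bind_graft_join]
    rw [← bassoc, forest_seq hk (fun x hx i hi => ih x hx i hi)
      (by rwa [← inputs_node v]), bassoc]

lemma forest_par {l : List (XTree ι)} {S U : XTree ι}
    (hl : ∀ x ∈ l, ∀ i k, i < k → k < x.inputs →
      (x.graft i S).bind (fun u => u.graft (k + S.inputs - 1) U) =
      (x.graft k U).bind (fun v => v.graft i S)) {i k : ℕ} (hik : i < k)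
    (hk : k < forestInputs l) :
    (graftForest l i S).bind (fun u => graftForest u (k + S.inputs - 1) U) =
      (graftForest l k U).bind fun v => graftForest v i S := by
  induction l generalizing i k with
  | nil => simp at hk
  | cons x l ih =>
    rw [forestInputs_cons] at hk
    have ih' := @ih fun y hy => hl y (List.mem_cons_of_mem _ hy)
    have hl' := hl x (by simp)
    by_cases hkx : k < x.inputs
    · rw [graftForest, if_pos (by omega), graftForest, if_pos hkx]
      have := congrArg (Option.map (· :: l)) (hl' i k hik hkx)
      rw [mbind, mbind] at this
      rcases h1 : x.graft i S with _ | y <;> rcases h2 : x.graft k U with _ | z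
      · rfl
      · rw [h1, h2] at this
        have hz := inputs_graft h2
        simpa [graftForest, show i < z.inputs by omega] using this
      · rw [h1, h2] at this
        have hy := inputs_graft h1
        simpa [graftForest, show k + S.inputs - 1 < y.inputs by omega] using this
      · rw [h1, h2] at this
        have hz := inputs_graft h2
        have hy := inputs_graft h1
        simpa [graftForest, show i < z.inputs by omega,
          show k + S.inputs - 1 < y.inputs by omega] using this
    · by_cases hix : i < x.inputs
      · rw [graftForest, if_pos hix, graftForest, if_neg hkx]
        rcases h1 : x.graft i S with _ | y
        · rcases graftForest l (k - x.inputs) U with _ | l'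
          · rfl
          · simp [graftForest, h1, hix]
        · have hy := inputs_graft h1
          rw [Option.map_some, bind_some, graftForest, if_neg (by omega),
            show k + S.inputs - 1 - y.inputs = k - x.inputs by omega]
          rcases graftForest l (k - x.inputs) U with _ | l'
          · rfl
          · simp [graftForest, h1, hix]
      · rw [graftForest, if_neg hix, graftForest, if_neg hkx]
        have := congrArg (Option.map (x :: ·)) (ih' (i := i - x.inputs) (k := k - x.inputs)
          (by omega) (by omega))
        rw [mbind, mbind] at this
        rw [Option.bind_map, Option.bind_map]
        have e1 : ((fun u => graftForest u (k + S.inputs - 1) U) ∘ fun l' => x :: l') =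
            Option.map (x :: ·) ∘ fun u => graftForest u (k - x.inputs + S.inputs - 1) U := by
          funext u
          simp only [Function.comp, graftForest]
          grind
        have e2 : ((fun v => graftForest v i S) ∘ fun l' => x :: l') =
            Option.map (x :: ·) ∘ fun v => graftForest v (i - x.inputs) S := by
          funext u
          simp only [Function.comp, graftForest]
          rw [if_neg hix]
        rw [e1, e2, this]

/-- The parallel axiom of an operad. Replacing the earlier input `i` by `S` shifts the later input
`k` by `S.inputs - 1`; as `k` is positive, the natural subtraction in `k + S.inputs - 1` does not
truncate. -/
lemma graft_par (x : XTree ι) (i : ℕ) (S : XTree ι) (k : ℕ) (U : XTree ι) (hik : i < k)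
    (hk : k < x.inputs) : (x.graft i S).bind (fun u => u.graft (k + S.inputs - 1) U) =
      (x.graft k U).bind (fun v => v.graft i S) := by
  induction x using XTree.ind generalizing i k with
  | top => simp [inputs] at hk
  | leaf => simp [inputs, WTree.inputs] at hk; omega
  | node v cs ih =>
    simp only [graft_node]
    rw [bassoc, bassoc]
    simp only [bind_graft_join]
    rw [← bassoc, ← bassoc, forest_par
      (fun x hx i k h1 h2 => ih x hx i k h1 h2) hik (by rwa [← inputs_node v])]

end XTree

end Graft

/-! ### The differential and grafting -/

section OfOption

variable {R : Type*} [CommRing R] {α β : Type*}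

@[simp] lemma ofOption_none : ofOption R (none : Option α) = 0 := rfl

@[simp] lemma ofOption_some (a : α) : ofOption R (some a) = single a 1 := rfl

lemma ofOption_bind (o : Option α) (f : α → Option β) :
    ofOption R (o.bind f) = lin R (fun a => ofOption R (f a)) (ofOption R o) := by
  cases o <;> simp [lin]

lemma ofOption_map (o : Option α) (f : α → β) :
    ofOption R (o.map f) = lin R (fun a => single (f a) 1) (ofOption R o) := by
  cases o <;> simp [lin]

end OfOption

section Leibniz

variable {R : Type*} [CommRing R] {ι : Type} [Fintype ι]

lemma corollaOp_eq_lin (v : ι → ℕ) {l l' : List (XTree ι)} (h : l'.length = l.length)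
    (hv : StableVertex l.length v) : corollaOp R v l' = ofOption R (XTree.join v l') := by
  rw [corollaOp, h, if_pos hv]

/-- Grafting into a corolla applied to extended trees. -/
lemma lin_graft_corollaOp (v : ι → ℕ) (l : List (XTree ι)) (i : ℕ) (S : XTree ι) :
    lin R (fun x => ofOption R (x.graft i S)) (corollaOp R v l) =
      lin R (corollaOp R v) (ofOption R (graftForest l i S)) := by
  by_cases hv : StableVertex l.length v
  · rw [corollaOp, if_pos hv, ← ofOption_bind, bind_graft_join, ofOption_bind]
    grind [lin_congr, corollaOp_eq_lin, length_graftForest, mem_ofOption]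
  · rw [corollaOp, if_neg hv, map_zero]
    refine (lin_eq_zero fun l' hl' => ?_).symm
    rw [corollaOp, length_graftForest (mem_ofOption hl'), if_neg hv]

variable [DecidableEq ι]

lemma attr_of_mem_treeOp {v : ι → ℕ} {b : List (XTree ι)} {z : XTree ι}
    (hb : ∀ x ∈ b, ∀ y ∈ (x.bd R).support, y.attr + (0, 0, 1) = x.attr)
    (hz : z ∈ (treeOp R v b).support) :
    z.attr + (0, 0, 1) = attrs b + (0, v, 2 * (size v : ℤ)) := by
  classical
  rcases mem_add hz with hz | hz
  · rw [corollaOp] at hz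
    split_ifs at hz
    · rw [attr_join (mem_ofOption hz), add_assoc]
      simp
    · simp at hz
  · rw [letterPart_bdOp] at hz
    split_ifs at hz with hv
    · rcases b with _ | ⟨x, _ | ⟨y, b⟩⟩
      · aesop
      · simp_all [attrs_cons]
      · simp [letterPart] at hz
    · simp at hz

lemma stable_of_mem_treeOp {v : ι → ℕ} {b : List (XTree ι)} {z : XTree ι}
    (hs : ∀ x ∈ b, x.Stable)
    (hb : ∀ x ∈ b, ∀ y ∈ (x.bd R).support, y.Stable)
    (hz : z ∈ (treeOp R v b).support) : z.Stable := by
  classical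
  rcases mem_add hz with hz | hz
  · grind [corollaOp, stable_join, mem_ofOption]
  · rw [letterPart_bdOp] at hz
    split_ifs at hz with hv
    · rcases b with _ | ⟨x, _ | ⟨y, b⟩⟩
      · aesop
      · simp_all
      · simp [letterPart] at hz
    · simp at hz

namespace XTree

lemma bd_node_of_stable [CharP R 2] {v : ι → ℕ} {cs : List (WTree ι)}
    (h : (tree (.node v cs)).Stable) : (tree (.node v cs)).bd R =
      ∑ p ∈ anti v, lin R (corollaOp R p.1) (ins (treeOp R p.2) (cs.map .tree)) := by
  rw [← lin_bd_corollaOp, corollaOp_map, if_pos (stable_node _ _ |>.1 h).1, lin_one]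

/-- An expansion adds one vertex, and the two vertices share the old weight; nothing else in the
invariants changes. -/
lemma attr_of_mem_bd [CharP R 2] {x y : XTree ι} (hx : x.Stable) (hy : y ∈ (x.bd R).support) :
    y.attr + (0, 0, 1) = x.attr ∧ y.Stable := by
  induction x using XTree.ind generalizing y with
  | top => simp [bd] at hy
  | leaf => simp [bd, WTree.bd] at hy
  | node v cs ih =>
    rw [bd_node_of_stable hx] at hy
    have hs : ∀ x ∈ cs.map tree, x.Stable := by
      simp_all [XTree.Stable, stable_node]
    obtain ⟨p, hp, hy⟩ := mem_support_finsetSum _ hy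
    obtain ⟨l', hl', hy⟩ := mem_lin hy
    obtain ⟨a, b, c, z, hl, hz, rfl⟩ := mem_support_ins hl'
    rw [← hl] at ih hs
    have hz1 := attr_of_mem_treeOp (fun x hx y hy => (ih x (by simp [hx]) (hs x (by simp [hx])) hy).1) hz
    have hz2 := stable_of_mem_treeOp (fun x hx => hs x (by simp [hx]))
      (fun x hx y hy => (ih x (by simp [hx]) (hs x (by simp [hx])) hy).2) hz
    rw [corollaOp] at hy
    split_ifs at hy with hv
    · have hj := mem_ofOption hy
      refine ⟨?_, stable_join hj hv fun u hu => ?_⟩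
      · rw [attr_join hj, attr_node, ← hl, ← mem_anti.1 hp, size_add]
        simp only [attrs_append, attrs_cons]
        rw [show ∀ u : ℕ × (ι → ℕ) × ℤ, attrs a + (z.attr + attrs c) + u + (0, 0, 1) =
          attrs a + attrs c + u + (z.attr + (0, 0, 1)) from fun u => by
            grind, hz1]
        rw [show ∀ u w : ℕ × (ι → ℕ) × ℤ, attrs a + attrs c + u + (attrs b + w) =
          attrs a + attrs b + attrs c + (u + w) from fun u w => by abel]
        congr 1
        simp only [Prod.mk_add_mk, add_zero]
        grind
      grind
    · simp at hy

lemma inputs_of_mem_treeOp [CharP R 2] {v : ι → ℕ} {b : List (XTree ι)} {z : XTree ι}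
    (hb : ∀ x ∈ b, x.Stable) (hz : z ∈ (treeOp R v b).support) : z.inputs = forestInputs b := by
  simpa [attr, forestInputs] using congrArg fst
    (attr_of_mem_treeOp (fun x hx y hy => (attr_of_mem_bd (hb x hx) hy).1) hz)

lemma forestInputs_of_mem_ins [CharP R 2] {v : ι → ℕ} {l l' : List (XTree ι)}
    (hl : ∀ x ∈ l, x.Stable) (h : l' ∈ (ins (treeOp R v) l).support) :
    forestInputs l' = forestInputs l ∧ ∀ x ∈ l', x.Stable := by
  obtain ⟨a, b, c, z, rfl, hz, rfl⟩ := mem_support_ins h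
  refine ⟨?_, fun x hx => ?_⟩
  · have := inputs_of_mem_treeOp (fun x hx => hl x (by simp [hx])) hz
    simp [this]
  · simp only [List.mem_append, List.mem_cons] at hx
    rcases hx with hu | rfl | hu
    · simp_all
    · exact stable_of_mem_treeOp (fun x hx => hl x (by simp [hx]))
        (fun x hx y hy => (attr_of_mem_bd (hl x (by simp [hx])) hy).2) hz
    simp_all

/-- These are the blocks containing the letter `x` into which `S` is glued. A corolla on the block
commutes with gluing. Only the differential of the one-letter block `[x]` does not, and the Leibniz
rule for `x` supplies the correction. -/
lemma lin_treeOp_graft [CharP R 2] {a b b' c : List (XTree ι)} {x S : XTree ι} {j : ℕ}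
    (hs : ∀ z ∈ a ++ b ++ x :: (b' ++ c), z.Stable) (hj : j < x.inputs)
    (hx : lin R (XTree.bd R) (ofOption R (x.graft j S)) =
      lin R (fun y => ofOption R (y.graft j S)) (x.bd R)
        + lin R (fun S' => ofOption R (x.graft j S')) (S.bd R)) (v : ι → ℕ) :
    lin R (fun y => ofOption R (graftForest (a ++ y :: c) (forestInputs (a ++ b) + j) S))
        (treeOp R v (b ++ x :: b')) =
      lin R (fun x' => lin R (fun y => single (a ++ y :: c) 1) (treeOp R v (b ++ x' :: b')))
        (ofOption R (x.graft j S)) + if b = [] then if b' = [] then if v = 0 then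
          lin R (fun S' => lin R (fun y => single (a ++ y :: c) 1)
            (ofOption R (x.graft j S'))) (S.bd R) else 0 else 0 else 0 := by
  have e4 : lin R (fun y => ofOption R (graftForest (a ++ y :: c)
      (forestInputs (a ++ b) + j) S)) (treeOp R v (b ++ x :: b')) =
      lin R (fun y => single (a ++ y :: c) 1)
        (lin R (fun y => ofOption R (y.graft (forestInputs b + j) S))
          (treeOp R v (b ++ x :: b'))) := by
    rw [lin_lin]
    refine lin_congr fun y hy => ?_
    have := inputs_of_mem_treeOp (fun x hx => hs x (by
      grind)) hy
    rw [forestInputs_append, add_assoc, graftForest_append_cons _ _ _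
      (by rw [this]; simp; omega), ofOption_map]
  rw [e4, ← lin_lin (fun y => single (a ++ y :: c) (1 : R))
    (fun x' => treeOp R v (b ++ x' :: b'))]
  unfold treeOp
  rw [map_add, lin_graft_corollaOp, graftForest_append_cons _ _ _ hj, ofOption_map, lin_lin,
    lin_add, map_add, map_add, add_assoc]
  simp only [lin_one]
  congr 1
  simp only [letterPart_bdOp]
  by_cases hv : v = 0
  · rcases b with _ | ⟨u, b⟩
    · rcases b' with _ | ⟨u, b'⟩
      · simp only [hv, if_true, nil_append, letterPart_singleton, forestInputs_nil, zero_add]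
        grind [lin_lin, map_add, add_assoc, add_self, add_zero]
      · simp [letterPart, lin_zero]
    simp [letterPart, XTree.bd, letterPart_eq_zero, lin_zero]
  · simp [hv, lin_zero]

/-- The Leibniz rule for grafting into a forest, given the one for its entries. -/
lemma lin_ins_graftForest_of [CharP R 2] {l : List (XTree ι)} (hs : ∀ x ∈ l, x.Stable)
    {S : XTree ι} (hl : ∀ x ∈ l, ∀ i < x.inputs, lin R (XTree.bd R) (ofOption R (x.graft i S)) =
      lin R (fun y => ofOption R (y.graft i S)) (x.bd R)
        + lin R (fun S' => ofOption R (x.graft i S')) (S.bd R))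
    (v : ι → ℕ) {i : ℕ} (hi : i < forestInputs l) :
    lin R (ins (treeOp R v)) (ofOption R (graftForest l i S)) =
      lin R (fun l' => ofOption R (graftForest l' i S)) (ins (treeOp R v) l)
        + if v = 0 then lin R (fun S' => ofOption R (graftForest l i S')) (S.bd R) else 0 := by
  obtain ⟨l₁, x, l₂, j, rfl, rfl, hj⟩ := exists_split hi
  have hx := hl x (by simp) j hj
  simp only [graftForest_append_cons _ _ _ hj, ofOption_map, lin_lin, lin_one]
  simp only [ins_append_cons, lin_add, map_add, map_cutSum, cutSum_lin, map_eq_lin, lin_lin,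
    lin_one]
  have e1 : lin R (fun l₁' => ofOption R (graftForest (l₁' ++ x :: l₂) (forestInputs l₁ + j) S))
      (ins (treeOp R v) l₁) = lin R (fun x' => lin R (fun l₁' =>
        single (l₁' ++ x' :: l₂) 1) (ins (treeOp R v) l₁)) (ofOption R (x.graft j S)) := by
    rw [lin_comm]
    refine lin_congr fun l' hl' => ?_
    rw [← (forestInputs_of_mem_ins (fun x hx => hs x (by simp [hx])) hl').1,
      graftForest_append_cons _ _ _ hj, ofOption_map]
  have e2 : lin R (fun l₂' => ofOption R (graftForest (l₁ ++ x :: l₂') (forestInputs l₁ + j) S))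
      (ins (treeOp R v) l₂) = lin R (fun x' => lin R (fun l₂' =>
        single (l₁ ++ x' :: l₂') 1) (ins (treeOp R v) l₂)) (ofOption R (x.graft j S)) := by
    rw [lin_comm]
    refine lin_congr fun l' hl' => ?_
    rw [graftForest_append_cons _ _ _ hj, ofOption_map]
  have e3 : ∀ a b b' c, a ++ b = l₁ → b' ++ c = l₂ →
      lin R (fun y => ofOption R (graftForest (a ++ y :: c) (forestInputs l₁ + j) S))
        (treeOp R v (b ++ x :: b')) =
      lin R (fun x' => lin R (fun y => single (a ++ y :: c) 1) (treeOp R v (b ++ x' :: b')))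
        (ofOption R (x.graft j S)) + if b = [] then if b' = [] then if v = 0 then
          lin R (fun S' => lin R (fun y => single (a ++ y :: c) 1)
            (ofOption R (x.graft j S'))) (S.bd R) else 0 else 0 else 0 := by
    rintro a b b' c rfl rfl
    exact lin_treeOp_graft (by simpa using hs) hj hx v
  rw [e1, e2, add_assoc, add_assoc, add_assoc]
  congr 2
  have e5 : ∀ E : List (XTree ι) →₀ R,
      cutSum l₁ (fun a b => cutSum l₂ fun b' c => if b = [] then if b' = [] then
        if v = 0 then lin R (fun S' => lin R (fun y => single (a ++ y :: c) (1 : R))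
            (ofOption R (x.graft j S'))) (S.bd R) else 0 else 0 else 0) = E →
      cutSum l₁ (fun a b => cutSum l₂ fun b' c =>
      lin R (fun y => ofOption R (graftForest (a ++ y :: c) (forestInputs l₁ + j) S))
        (treeOp R v (b ++ x :: b'))) =
      cutSum l₁ (fun a b => cutSum l₂ fun b' c =>
      lin R (fun x' => lin R (fun y => single (a ++ y :: c) 1) (treeOp R v (b ++ x' :: b')))
        (ofOption R (x.graft j S))) + E := by
    rintro E rfl
    simp only [← cutSum_add]
    exact cutSum_congr fun a b hab => cutSum_congr fun b' c hbc => e3 a b b' c hab hbc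
  rw [e5 (if v = 0 then lin R (fun S' => lin R (fun y => single (l₁ ++ y :: l₂) (1 : R))
            (ofOption R (x.graft j S'))) (S.bd R) else 0), add_assoc, add_self R,
    add_zero]
  -- The correction term survives only for the cut with empty `b` and `b'`, where the block is `x`
  -- alone.
  rw [cutSum_eq_right, cutSum_eq_left]
  · simp only [if_true]
  · simp_all
  simp_all [if_false, cutSum_zero]

/-- The Leibniz rule. -/
lemma lin_bd_graft [CharP R 2] {x : XTree ι} (hx : x.Stable) {i : ℕ} (hi : i < x.inputs)
    (S : XTree ι) : lin R (XTree.bd R) (ofOption R (x.graft i S)) =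
      lin R (fun y => ofOption R (y.graft i S)) (x.bd R)
        + lin R (fun S' => ofOption R (x.graft i S')) (S.bd R) := by
  induction x using XTree.ind generalizing i with
  | top => simp at hi
  | leaf =>
    simp_all [inputs, WTree.inputs, bd, WTree.bd, graft_leaf, if_true, map_zero, zero_add,
      ofOption_some, lin_single_id, lin_one]
  | node v cs ih =>
    have hs : ∀ x ∈ cs.map tree, x.Stable := by
      simp_all [XTree.Stable, stable_node]
    have hv : StableVertex (cs.map tree).length v := by
      simpa using (stable_node _ _ |>.1 hx).1
    have e : ∀ S : XTree ι, ofOption R ((tree (.node v cs)).graft i S) =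
        lin R (corollaOp R v) (ofOption R (graftForest (cs.map .tree) i S)) := fun S => by
      rw [← lin_graft_corollaOp, corollaOp_map, if_pos (by simpa using hv), lin_one]
    -- The Leibniz rule for a corolla follows from that for its forest of arguments, because gluing
    -- commutes with forming the vertex and all differentials are sums of `corollaOp` after `ins`.
    rw [bd_node_of_stable hx]
    simp only [e, map_sum, lin_lin, lin_bd_corollaOp, lin_graft_corollaOp, lin_sum]
    have := fun u => lin_ins_graftForest_of hs (fun x hxm i hi => ih x hxm (hs x hxm) hi) u
      (by rwa [← inputs_node v])
    simp only [← lin_lin (corollaOp R _), this, map_add, sum_add_distrib]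
    congr 1
    rw [← anti_ite_snd v fun u => lin R (corollaOp R u) (lin R (fun S' =>
      ofOption R (graftForest (cs.map .tree) i S')) (S.bd R))]
    grind

/-- The Leibniz rule for grafting into a forest. -/
lemma lin_ins_graftForest [CharP R 2] {l : List (XTree ι)} (hs : ∀ x ∈ l, x.Stable)
    (S : XTree ι) (v : ι → ℕ) {i : ℕ} (hi : i < forestInputs l) :
    lin R (ins (treeOp R v)) (ofOption R (graftForest l i S)) =
      lin R (fun l' => ofOption R (graftForest l' i S)) (ins (treeOp R v) l)
        + if v = 0 then lin R (fun S' => ofOption R (graftForest l i S')) (S.bd R) else 0 :=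
  lin_ins_graftForest_of hs (fun x hx _ hi => lin_bd_graft (hs x hx) hi S) v hi

end XTree

end Leibniz

/-! ### Bimodule trees -/

/-- Exchange of the two weight spaces. -/
def swapWeight {I J : Type} (w : I ⊎ J) : J ⊕ I → ℕ := w ∘ Sum.swap

@[simp] lemma swapWeight_swapWeight {I J : Type} (w : I ⊎ J) :
    swapWeight (swapWeight w) = w := by
  funext i
  simp [swapWeight]

lemma swapWeight_add {I J : Type} (v w : I ⊎ J) :
    swapWeight (v + w) = swapWeight v + swapWeight w := rfl

@[simp] lemma swapWeight_eq_zero {I J : Type} {w : I ⊎ J} :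
    swapWeight w = 0 ↔ w = 0 :=
  ⟨fun h => by rw [← swapWeight_swapWeight w, h]; rfl, fun h => by rw [h]; rfl⟩

lemma size_swapWeight {I J : Type} [Fintype I] [Fintype J] (w : I ⊎ J) : size (swapWeight w) = size w := by
  simp [size, swapWeight, add_comm]

section SumWeights

variable {I J : Type} [Fintype I] [DecidableEq I] [Fintype J] [DecidableEq J]
  {V : Type*} [AddCommMonoid V]

lemma anti_swapWeight (w : I ⊎ J) (f : (J ⊕ I → ℕ) → (J ⊕ I → ℕ) → V) :
    ∑ p ∈ anti (swapWeight w), f p.1 p.2 =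
      ∑ p ∈ anti w, f (swapWeight p.1) (swapWeight p.2) := by
  refine sum_bij' (fun p _ => (swapWeight p.1, swapWeight p.2))
    (fun p _ => (swapWeight p.1, swapWeight p.2)) ?_ ?_ ?_ ?_ ?_
  · grind [mem_anti, swapWeight_add, swapWeight_swapWeight]
  · aesop
  all_goals simp

lemma eq_ofSnd_of_comp_inl {I J : Type} {u : I ⊎ J} (h : u ∘ inl = 0) :
    u = ofSnd (u ∘ inr) := by
  funext i
  cases i with
  | inl i => exact congrFun h i
  | inr i => rfl

lemma ofSnd_eq_zero {I J : Type} {u : J → ℕ} : (ofSnd u : I ⊎ J) = 0 ↔ u = 0 := by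
  constructor
  · intro h
    funext i
    exact congrFun h (.inr i)
  aesop

lemma anti_ofSnd (w : I ⊎ J) (f : (I ⊎ J) → (J → ℕ) → V) :
    ∑ p ∈ anti w, (if p.2 ∘ inl = 0 then f p.1 (p.2 ∘ inr) else 0) =
      ∑ u ∈ Icc 0 (w ∘ inr), f (w - ofSnd u) u := by
  rw [anti_eq_sum_Icc w fun x y => if y ∘ inl = 0 then f x (y ∘ inr) else 0,
    ← sum_filter]
  refine sum_bij' (fun u _ => u ∘ inr) (fun u _ => ofSnd u) ?_ ?_ ?_ ?_ ?_
  · intro u hu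
    simp only [mem_filter, mem_Icc] at hu ⊢
    exact ⟨fun _ => Nat.zero_le _, fun i => hu.1.2 _⟩
  · intro u hu
    simp only [mem_filter, mem_Icc] at hu ⊢
    refine ⟨⟨fun _ => Nat.zero_le _, fun i => ?_⟩, rfl⟩
    cases i with
    | inl i => exact Nat.zero_le _
    | inr i => exact hu.2 i
  · intro u hu
    simp only [mem_filter] at hu
    exact (eq_ofSnd_of_comp_inl hu.2).symm
  · intro u _
    rfl
  grind [mem_filter, eq_ofSnd_of_comp_inl]

lemma anti_comp_inr (w : I ⊎ J) (f : (J → ℕ) → (J → ℕ) → V) :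
    ∑ p ∈ anti w, (if p.1 ∘ inl = 0 ∧ p.2 ∘ inl = 0 then
      f (p.1 ∘ inr) (p.2 ∘ inr) else 0) =
      if w ∘ inl = 0 then ∑ p ∈ anti (w ∘ inr), f p.1 p.2 else 0 := by
  split_ifs with h
  · rw [← sum_filter]
    refine sum_bij' (fun p _ => (p.1 ∘ inr, p.2 ∘ inr))
      (fun p _ => (ofSnd p.1, ofSnd p.2)) ?_ ?_ ?_ ?_ ?_
    · aesop
    · intro p hp
      simp only [mem_filter, mem_anti] at hp ⊢
      refine ⟨?_, rfl, rfl⟩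
      rw [eq_ofSnd_of_comp_inl h, ← hp]
      funext i
      cases i <;> rfl
    · intro p hp
      simp only [mem_filter] at hp
      exact Prod.ext (eq_ofSnd_of_comp_inl hp.2.1).symm (eq_ofSnd_of_comp_inl hp.2.2).symm
    · intro p _
      rfl
    simp
  · refine sum_eq_zero fun p hp => if_neg fun hc => h ?_
    rw [← mem_anti.1 hp]
    change p.1 ∘ inl + p.2 ∘ inl = 0
    simp_all

end SumWeights

namespace BTree

-- Reflection of bimodule trees

section Mirror

variable {I J : Type}

/-- Exchange of left and right. -/
def mirror : BTree I J → BTree J I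
  | strand => strand
  | node w L T K => node (swapWeight w) K T.mirror L

@[simp] lemma mirror_mirror (T : BTree I J) : T.mirror.mirror = T := by
  induction T with
  | strand => rfl
  | node w L T K ih => simp [mirror, ih]

lemma mirror_injective : Function.Injective (mirror : BTree I J → BTree J I) :=
  Function.LeftInverse.injective mirror_mirror

lemma stable_mirror {T : BTree I J} : T.mirror.Stable ↔ T.Stable := by
  induction T with
  | strand => aesop
  | node w L T K ih =>
    simp only [mirror, Stable, ih, StableVertex, ne_eq, swapWeight_eq_zero]
    grind

@[simp] lemma leftInputs_mirror (T : BTree I J) : T.mirror.leftInputs = T.rightInputs := by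
  induction T with
  | strand => rfl
  | node w L T K ih => simp [mirror, leftInputs, rightInputs, ih]

@[simp] lemma rightInputs_mirror (T : BTree I J) : T.mirror.rightInputs = T.leftInputs := by
  induction T with
  | strand => rfl
  | node w L T K ih => simp [mirror, leftInputs, rightInputs, ih]

variable [Fintype I] [Fintype J]

lemma join_map (w : I ⊎ J) (L : List (WTree J)) (T : BTree I J) (K : List (WTree I)) :
    join w (L.map .tree) T (K.map .tree) = some (node w L T K) := by
  simp [join, trees?_map]

lemma join_top_left (w : I ⊎ J) {L : List (XTree J)} (h : .top ∈ L)
    (T : BTree I J) (K : List (XTree I)) :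
    join w L T K = if w = 0 ∧ L.length + K.length = 1 then some T else none := by
  unfold join
  rw [trees?_of_top_mem h]

lemma join_mirror (w : I ⊎ J) (L : List (XTree J)) (T : BTree I J)
    (K : List (XTree I)) :
    join (swapWeight w) K T.mirror L = (join w L T K).map mirror := by
  unfold join
  rw [add_comm K.length]
  rcases trees? L with _ | L' <;> rcases trees? K with _ | K' <;>
    simp only [swapWeight_eq_zero] <;> first | (split_ifs <;> rfl) | rfl

lemma join_top_right (w : I ⊎ J) (L : List (XTree J)) (T : BTree I J)
    {K : List (XTree I)} (h : .top ∈ K) :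
    join w L T K = if w = 0 ∧ L.length + K.length = 1 then some T else none := by
  simp_all [join, trees?_of_top_mem, trees?]

end Mirror

-- Spine vertices and their edge expansions

section Ops

variable (R : Type*) [CommRing R] {I J : Type} [Fintype I] [Fintype J]

/-- The stable spine vertex of weight `w` with extended trees glued to its inputs. -/
def spineOp (w : I ⊎ J) (L : List (XTree J)) (T : BTree I J) (K : List (XTree I)) :
    BTree I J →₀ R :=
  if StableVertex (L.length + 1 + K.length) w then ofOption R (join w L T K) else 0

variable {R}

lemma spineOp_map (w : I ⊎ J) (L : List (WTree J)) (T : BTree I J)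
    (K : List (WTree I)) : spineOp R w (L.map .tree) T (K.map .tree) =
      if StableVertex (L.length + 1 + K.length) w then single (node w L T K) 1 else 0 := by
  simp [spineOp, join_map]

lemma spineOp_mirror (w : I ⊎ J) (L : List (XTree J)) (T : BTree I J)
    (K : List (XTree I)) :
    spineOp R (swapWeight w) K T.mirror L = (spineOp R w L T K).mapDomain mirror := by
  unfold spineOp
  rw [join_mirror, ofOption_map, map_eq_lin]
  have : StableVertex (K.length + 1 + L.length) (swapWeight w) ↔
      StableVertex (L.length + 1 + K.length) w := by
    simp only [StableVertex, ne_eq, swapWeight_eq_zero]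
    grind
  grind

lemma spineOp_top_left (w : I ⊎ J) {L : List (XTree J)} (h : .top ∈ L)
    (T : BTree I J) (K : List (XTree I)) :
    spineOp R w L T K = if w = 0 ∧ L.length + K.length = 1 then single T 1 else 0 := by
  rw [spineOp, join_top_left _ h]
  by_cases h' : w = 0 ∧ L.length + K.length = 1
  · rw [if_pos h', if_pos (.inr (by omega))]
    simp [h']
  · simp [h']

variable [DecidableEq J]

variable (R) in
/-- The vertices of weight `u` left of the spine, and the differential if `u = 0`. -/
def leftOp (u : I ⊎ J) (l : List (XTree J)) : XTree J →₀ R :=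
  if u ∘ inl = 0 then treeOp R (u ∘ inr) l else 0

lemma leftOp_eq (u : I ⊎ J) (l : List (XTree J)) : leftOp R u l =
    (if u ∘ inl = 0 then corollaOp R (u ∘ inr) l else 0)
      + if u = 0 then letterPart (XTree.bd R) l else 0 := by
  by_cases h : u ∘ inl = 0
  · rw [leftOp, if_pos h, if_pos h, treeOp, letterPart_bdOp]
    grind [eq_ofSnd_of_comp_inl, ofSnd_eq_zero]
  · rw [leftOp, if_neg h, if_neg h, if_neg, add_zero]
    aesop

variable [DecidableEq I]

variable (R) in
/-- The vertices of weight `u` right of the spine, and the differential if `u = 0`. -/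
def rightOp (u : I ⊎ J) (l : List (XTree I)) : XTree I →₀ R :=
  leftOp R (swapWeight u) l

lemma rightOp_eq (u : I ⊎ J) : rightOp R u = leftOp R (swapWeight u) := rfl

variable (R) in
/-- The edge expansions of a spine vertex whose new edge lies left of the spine. -/
def splitLeft (w : I ⊎ J) (L : List (WTree J)) (T : BTree I J) (K : List (WTree I)) :
    BTree I J →₀ R :=
  ∑ w' ∈ Icc 0 (w ∘ inr), ∑ a ∈ range (L.length + 1),
    ∑ b ∈ range (L.length - a + 1),
      if StableVertex b w' ∧
          StableVertex (L.length - b + 1 + 1 + K.length) (w - ofSnd w') then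
        single (node (w - ofSnd w')
          (L.take a ++ .node w' ((L.drop a).take b) :: L.drop (a + b)) T K) 1
      else 0

/-- Subtrees on both sides are listed from the spine outwards, so the expansions to the right are
literally the reflected expansions to the left of the reflected tree. Only the left side has to be
analysed. -/
lemma splitSpine_eq (w : I ⊎ J) (L : List (WTree J)) (T : BTree I J)
    (K : List (WTree I)) : splitSpine R w L T K = splitLeft R w L T K
      + (splitLeft R (swapWeight w) K T.mirror L).mapDomain mirror
      + ∑ p ∈ anti w, cutSum (L.map .tree) fun a a' => cutSum (K.map .tree) fun b b' =>
        lin R (fun U => spineOp R p.1 a' U b') (spineOp R p.2 a T b) := by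
  rw [splitSpine]
  congr 1
  · congr 1
    rw [splitLeft]
    simp only [mapDomain_finsetSum]
    refine sum_congr rfl fun w' _ => sum_congr rfl fun a _ =>
      sum_congr rfl fun b _ => ?_
    have e : swapWeight w - ofSnd w' = swapWeight (w - ofFst w') := by
      aesop
    have e' : StableVertex (K.length - b + 1 + 1 + L.length) (swapWeight (w - ofFst w')) ↔
        StableVertex (L.length + 1 + (K.length - b + 1)) (w - ofFst w') := by
      simp only [StableVertex, ne_eq, swapWeight_eq_zero]
      grind
    rw [e]
    simp only [e']
    split_ifs
    · simp [mirror]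
    · simp
  · rw [anti_eq_sum_Icc w fun x y => cutSum (L.map .tree) fun a a' =>
      cutSum (K.map .tree) fun b b' => lin R (fun U => spineOp R x a' U b') (spineOp R y a T b)]
    refine sum_congr rfl fun w' _ => ?_
    simp only [cutSum_map]
    simp only [cutSum]
    refine sum_congr rfl fun a ha => sum_congr rfl fun b hb => ?_
    rw [mem_range] at ha hb
    have h1 : (L.take a).length = a := by simp; omega
    have h2 : (K.take b).length = b := by simp; omega
    rw [spineOp_map, h1, h2]
    by_cases h : StableVertex (a + 1 + b) w'
    · rw [if_pos h, lin_one, spineOp_map, length_drop, length_drop]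
      simp [h]
    · simp [h]

/-- The expansions at a spine vertex and in the trees to its left. -/
lemma splitLeft_add {w : I ⊎ J} {L : List (WTree J)} (T : BTree I J)
    {K : List (WTree I)} (h : StableVertex (L.length + 1 + K.length) w) :
    splitLeft R w L T K + (bdList R L).mapDomain (fun L' => node w L' T K) =
      ∑ p ∈ anti w, lin R (fun L' => spineOp R p.1 L' T (K.map .tree))
        (ins (leftOp R p.2) (L.map .tree)) := by
  have hm : ∀ u : I ⊎ J, leftOp R u = fun b : List (XTree J) =>
      (if u ∘ inl = 0 then corollaOp R (u ∘ inr) b else 0)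
        + if u = 0 then letterPart (XTree.bd R) b else 0 := fun u => funext (leftOp_eq u)
  simp only [hm, ins_add, map_add, sum_add_distrib]
  congr 1
  · have e : ∀ p : I ⊎ J × (I ⊎ J),
        lin R (fun L' => spineOp R p.1 L' T (K.map .tree))
        (ins (fun b : List (XTree J) => if p.2 ∘ inl = 0 then corollaOp R (p.2 ∘ inr) b else 0)
          (L.map .tree)) =
        if p.2 ∘ inl = 0 then lin R (fun L' => spineOp R p.1 L' T (K.map .tree))
          (ins (corollaOp R (p.2 ∘ inr)) (L.map .tree)) else 0 := by
      intro p
      split_ifs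
      · rfl
      simp [ins_eq_zero, map_zero]
    simp only [e]
    rw [anti_ofSnd w fun x y => lin R (fun L' => spineOp R x L' T (K.map .tree))
          (ins (corollaOp R y) (L.map .tree)), splitLeft]
    refine sum_congr rfl fun w' _ => ?_
    rw [lin_ins, threeSum_map]
    simp only [threeSum, cutSum]
    refine sum_congr rfl fun a ha => ?_
    rw [length_drop]
    refine sum_congr rfl fun b hb => ?_
    rw [mem_range] at ha hb
    have h1 : ((L.drop a).take b).length = b := by simp; omega
    have h2 : (L.take a).length + (((L.drop a).drop b).length + 1) = L.length - b + 1 := by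
      simp; omega
    rw [corollaOp_map, h1]
    by_cases hb : StableVertex b w'
    · rw [if_pos hb, lin_one, ← map_cons, ← map_append, spineOp_map,
        length_append, length_cons, h2, List.drop_drop]
      simp [hb]
    · simp [hb]
  · have e : ∀ p : I ⊎ J × (I ⊎ J),
        lin R (fun L' => spineOp R p.1 L' T (K.map .tree))
        (ins (fun b : List (XTree J) => if p.2 = 0 then letterPart (XTree.bd R) b else 0) (L.map .tree)) =
        if p.2 = 0 then lin R (fun L' => spineOp R p.1 L' T (K.map .tree))
          (ins (letterPart (XTree.bd R)) (L.map .tree)) else 0 := by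
      intro p
      split_ifs
      · rfl
      simp [ins_eq_zero, map_zero]
    simp only [e]
    rw [anti_ite_snd w fun u => lin R (fun L' => spineOp R u L' T (K.map .tree))
          (ins (letterPart (XTree.bd R)) (L.map .tree)), ins_letterPart_map, lin_mapDomain,
      map_eq_lin]
    refine lin_congr fun cs' hcs' => ?_
    rw [spineOp_map, length_of_mem_bdList hcs', if_pos h]

variable (R) in
/-- The differential of a spine vertex, as a sum of edge expansions left and right of the spine,
above the vertex, and at the vertex on the spine. -/
def spineRel (w : I ⊎ J) (L : List (XTree J)) (T : BTree I J) (K : List (XTree I)) :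
    BTree I J →₀ R :=
  ∑ p ∈ anti w, lin R (fun L' => spineOp R p.1 L' T K)
      (ins (leftOp R p.2) L)
    + ∑ p ∈ anti w, lin R (fun K' => spineOp R p.1 L T K')
      (ins (rightOp R p.2) K)
    + lin R (fun U => spineOp R w L U K) (T.bd R)
    + ∑ p ∈ anti w, cutSum L fun a a' => cutSum K fun b b' =>
      lin R (fun U => spineOp R p.1 a' U b') (spineOp R p.2 a T b)

lemma spineRel_mirror (w : I ⊎ J) (L : List (XTree J)) {T : BTree I J}
    (K : List (XTree I)) (hT : T.mirror.bd R = (T.bd R).mapDomain mirror) :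
    spineRel R (swapWeight w) K T.mirror L = (spineRel R w L T K).mapDomain mirror := by
  rw [spineRel, spineRel, hT]
  rw [anti_swapWeight w fun x y => lin R (fun L' =>
      spineOp R x L' T.mirror L) (ins (leftOp R y) K),
    anti_swapWeight w fun x y => lin R (fun L' =>
      spineOp R x K T.mirror L') (ins (rightOp R y) L),
    anti_swapWeight w fun x y => cutSum K fun a a' => cutSum L fun b b' =>
      lin R (fun U => spineOp R x a' U b') (spineOp R y a T.mirror b)]
  simp only [rightOp_eq, swapWeight_swapWeight]
  simp only [cutSum_comm K]
  simp only [spineOp_mirror, lin_mapDomain, mapDomain_add, mapDomain_finsetSum]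
  simp only [map_eq_lin, lin_lin, map_cutSum]
  abel

/-- Stability of the vertex is needed because `spineRel` tests it again after each expansion in a
side subtree or above, whereas the differential inherits it. -/
lemma bd_node {w : I ⊎ J} {L : List (WTree J)} (T : BTree I J)
    {K : List (WTree I)} (h : StableVertex (L.length + 1 + K.length) w) :
    (node w L T K).bd R = spineRel R w (L.map .tree) T (K.map .tree) := by
  have h' : StableVertex (K.length + 1 + L.length) (swapWeight w) := by
    simp only [StableVertex, ne_eq, swapWeight_eq_zero] at h ⊢
    grind
  have h2 := congrArg (mapDomain mirror) (splitLeft_add (R := R) T.mirror h')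
  rw [anti_swapWeight w fun x y => lin R (fun L' =>
    spineOp R x L' T.mirror (L.map .tree)) (ins (leftOp R y) (K.map .tree)),
    mapDomain_add, mapDomain_finsetSum, ← mapDomain_comp] at h2
  have e1 : mirror ∘ (fun L' => node (swapWeight w) L' T.mirror L) = fun K' => node w L T K' := by
    funext K'
    simp [mirror]
  simp only [e1] at h2
  have e2 : ∀ (x : I ⊎ J) (y : List (XTree I) →₀ R),
      mapDomain mirror (lin R (fun L' => spineOp R (swapWeight x) L' T.mirror
        (L.map .tree)) y) = lin R (fun K' => spineOp R x (L.map .tree) T K') y := by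
    simp [spineOp_mirror, map_eq_lin, lin_lin, lin_one, mirror_mirror, lin_single_id]
  simp only [e2] at h2
  change _ = ∑ p ∈ anti w, lin R (fun K' => spineOp R p.1 (L.map .tree) T K')
        (ins (rightOp R p.2) (K.map .tree)) at h2
  rw [bd, splitSpine_eq, spineRel, ← splitLeft_add T h, ← h2]
  have e3 : lin R (fun U => spineOp R w (L.map .tree) U (K.map .tree)) (T.bd R) =
      (T.bd R).mapDomain fun T' => node w L T' K := by
    rw [map_eq_lin]
    simp_all [lin_congr, spineOp_map, if_pos]
  rw [e3]
  abel

lemma bd_mirror {T : BTree I J} (hT : T.Stable) : T.mirror.bd R = (T.bd R).mapDomain mirror := by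
  induction T with
  | strand => simp [mirror, bd]
  | node w L T K ih =>
    grind [stable_mirror, mirror, Stable, bd_node, spineRel_mirror]

end Ops

end BTree

namespace BTree

/-! ### The differential of bimodule trees -/

section SpineRel

variable {R : Type*} [CommRing R] {I J : Type} [Fintype I] [Fintype J]
  [DecidableEq I] [DecidableEq J]

lemma leftOp_append_top_cons (u : I ⊎ J) (b b' : List (XTree J)) :
    leftOp R u (b ++ .top :: b') =
      if u ∘ inl = 0 then corollaOp R (u ∘ inr) (b ++ .top :: b') else 0 := by
  rw [leftOp, treeOp_append_top_cons]

lemma cutSum_leftOp_append_top_cons {V : Type*} [AddCommGroup V] [Module R V]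
    (u : I ⊎ J) (l₁ l₂ : List (XTree J)) (G : List (XTree J) → V) :
    cutSum l₁ (fun a b => cutSum l₂ fun b' c =>
      lin R (fun x => G (a ++ x :: c)) (leftOp R u (b ++ .top :: b'))) =
      if u = 0 then (if l₂ = [] then 0 else G (l₁ ++ l₂)) + (if l₁ = [] then 0 else G (l₁ ++ l₂))
      else 0 := by
  simp only [leftOp_append_top_cons]
  by_cases h : u ∘ inl = 0
  · simp only [h, if_true]
    rw [cutSum_corollaOp_append_top_cons]
    grind [eq_ofSnd_of_comp_inl, ofSnd_eq_zero]
  · have hu : u ≠ 0 := by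
      aesop
    simp [h, hu, cutSum_zero]

lemma lin_ins_leftOp_nil {w : I ⊎ J} (hw : w = 0)
    {p : I ⊎ J × (I ⊎ J)} (hp : p ∈ anti w) {V : Type*} [AddCommGroup V]
    [Module R V] (G : List (XTree J) → V) : lin R G (ins (leftOp R p.2) []) = 0 := by
  subst hw
  have h2 : p.2 = 0 := by simp_all
  rw [h2, lin_ins, threeSum_nil]
  have : leftOp R (0 : I ⊎ J) [] = 0 := by
    refine (if_pos rfl).trans ?_
    rw [treeOp, corollaOp, if_neg]
    · simp [letterPart]
    · rintro (h | h)
      · exact h rfl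
      · simp at h
  rw [this, map_zero]

/-- A `⊤` beside the spine can be absorbed by its outer neighbour, and by its inner neighbour or, if
it stands next to the spine, by a new spine vertex; likewise the outermost `⊤` can be left at the
lower of two spine vertices. The resulting terms `h3`, `h5`, `h6` cancel pairwise. Only the
differential of the tree above remains, and this is what the unit rule demands. -/
lemma spineRel_top [CharP R 2] (w : I ⊎ J) (l₁ l₂ : List (XTree J)) (T : BTree I J)
    (K : List (XTree I)) : lin R (bd R) (spineOp R w (l₁ ++ .top :: l₂) T K) =
      spineRel R w (l₁ ++ .top :: l₂) T K := by
  have h1 : ∀ p : I ⊎ J × (I ⊎ J), threeSum l₁ (fun a b c => lin R (fun x =>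
      spineOp R p.1 (a ++ x :: (c ++ .top :: l₂)) T K) (leftOp R p.2 b)) = 0 := fun p =>
    threeSum_eq_zero fun a b c _ => lin_eq_zero fun x _ => by
      rw [spineOp_top_left _ (by simp), if_neg]
      grind
  have h2 : ∀ p : I ⊎ J × (I ⊎ J), threeSum l₂ (fun a b c => lin R (fun x =>
      spineOp R p.1 (l₁ ++ .top :: a ++ x :: c) T K) (leftOp R p.2 b)) = 0 := fun p =>
    threeSum_eq_zero fun a b c _ => lin_eq_zero fun x _ => by
      rw [spineOp_top_left _ (by simp), if_neg]
      grind
  have h3 : ∑ p ∈ anti w, lin R (fun L' => spineOp R p.1 L' T K)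
      (ins (leftOp R p.2) (l₁ ++ .top :: l₂)) =
      (if l₂ = [] then 0 else spineOp R w (l₁ ++ l₂) T K) +
        (if l₁ = [] then 0 else spineOp R w (l₁ ++ l₂) T K) := by
    rw [← anti_ite_snd w fun u => (if l₂ = [] then 0 else spineOp R u (l₁ ++ l₂) T K) +
      (if l₁ = [] then 0 else spineOp R u (l₁ ++ l₂) T K)]
    refine sum_congr rfl fun p _ => ?_
    rw [lin_ins, threeSum_append_cons, h1, h2, zero_add, zero_add]
    exact cutSum_leftOp_append_top_cons p.2 l₁ l₂ fun L' => spineOp R p.1 L' T K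
  have h4 : ∑ p ∈ anti w, lin R (fun K' => spineOp R p.1 (l₁ ++ .top :: l₂) T K')
      (ins (rightOp R p.2) K) = 0 := by
    refine sum_eq_zero fun p _ => lin_eq_zero fun K' hK' => ?_
    obtain ⟨a, b, c, x, -, -, rfl⟩ := mem_support_ins hK'
    rw [spineOp_top_left _ (by simp), if_neg]
    grind
  have h5 : ∑ p ∈ anti w, cutSum l₁ (fun a c => cutSum K fun b b' =>
      lin R (fun U => spineOp R p.1 (c ++ .top :: l₂) U b') (spineOp R p.2 a T b)) =
      if l₂ = [] then spineOp R w l₁ T K else 0 := by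
    split_ifs with h
    · rw [← anti_ite_fst w fun u => spineOp R u l₁ T K]
      refine sum_congr rfl fun p _ => ?_
      rw [cutSum_eq_right, cutSum_eq_right]
      · simp only [nil_append, h]
        rw [lin_congr fun U _ => spineOp_top_left _ (by simp) _ _]
        by_cases hp : p.1 = 0
        · simp [hp, lin_single_id]
        · simp [hp, lin_zero]
      · intro b b' _ hb'
        refine lin_eq_zero fun U _ => ?_
        rw [spineOp_top_left _ (by simp), if_neg]
        simp_all
      · intro a c _ hc
        refine cutSum_eq_zero fun b b' _ => lin_eq_zero fun U _ => ?_
        rw [spineOp_top_left _ (by simp), if_neg]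
        grind [length_pos_of_ne_nil, length_append, length_cons]
    · refine sum_eq_zero fun p _ => cutSum_eq_zero fun a c _ =>
        cutSum_eq_zero fun b b' _ => lin_eq_zero fun U _ => ?_
      rw [spineOp_top_left _ (by simp), if_neg]
      grind [length_pos_of_ne_nil, length_append, length_cons]
  have h6 : ∑ p ∈ anti w, cutSum l₂ (fun a c => cutSum K fun b b' =>
      lin R (fun U => spineOp R p.1 c U b') (spineOp R p.2 (l₁ ++ .top :: a) T b)) =
      if l₁ = [] then spineOp R w l₂ T K else 0 := by
    split_ifs with h
    · rw [← anti_ite_snd w fun u => spineOp R u l₂ T K]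
      refine sum_congr rfl fun p _ => ?_
      rw [cutSum_eq_left, cutSum_eq_left]
      · simp only [nil_append, h]
        rw [spineOp_top_left _ (by simp)]
        by_cases hp : p.2 = 0
        · simp [hp]
        · simp [hp]
      · intro b b' _ hb'
        rw [spineOp_top_left _ (by simp), if_neg, map_zero]
        simp_all
      · intro a c _ hc
        refine cutSum_eq_zero fun b b' _ => ?_
        rw [spineOp_top_left _ (by simp), if_neg, map_zero]
        grind [length_pos_of_ne_nil, length_append, length_cons]
    · refine sum_eq_zero fun p _ => cutSum_eq_zero fun a c _ =>
        cutSum_eq_zero fun b b' _ => ?_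
      rw [spineOp_top_left _ (by simp), if_neg, map_zero]
      grind [length_pos_of_ne_nil, length_append, length_cons]
  have h7 : lin R (fun U => spineOp R w (l₁ ++ .top :: l₂) U K) (T.bd R) =
      lin R (bd R) (spineOp R w (l₁ ++ .top :: l₂) T K) := by
    rw [lin_congr fun U _ => spineOp_top_left w (by simp) _ _,
      spineOp_top_left w (by simp)]
    split_ifs
    · rw [lin_single_id, lin_one]
    · rw [lin_zero, map_zero]
  rw [spineRel, h3, h4, h7]
  simp only [cutSum_append_cons, sum_add_distrib]
  rw [h5, h6]
  have key : (if l₂ = [] then 0 else spineOp R w (l₁ ++ l₂) T K) +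
        (if l₁ = [] then 0 else spineOp R w (l₁ ++ l₂) T K) +
      ((if l₂ = [] then spineOp R w l₁ T K else 0) + if l₁ = [] then spineOp R w l₂ T K else 0) =
      0 := by
    rcases eq_or_ne l₁ [] with rfl | h₁ <;> rcases eq_or_ne l₂ [] with rfl | h₂ <;>
      simp [*, add_self R]
  grind

/-- The differential of a spine vertex applied to extended trees. -/
lemma lin_bd_spineOp [CharP R 2] (w : I ⊎ J) (L : List (XTree J)) {T : BTree I J}
    (hT : T.Stable) (K : List (XTree I)) :
    lin R (bd R) (spineOp R w L T K) = spineRel R w L T K := by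
  rcases eq_map_or_split L with ⟨L, rfl⟩ | ⟨l₁, l₂, rfl⟩
  · rcases eq_map_or_split K with ⟨K, rfl⟩ | ⟨l₁, l₂, rfl⟩
    · rw [spineOp_map]
      split_ifs with h
      · rw [lin_one, bd_node _ h]
      -- An unstable spine vertex has weight zero and only the spine edge; then every term of
      -- `spineRel` vanishes as well.
      · have hw : w = 0 := by by_contra hw; exact h (.inl hw)
        have hL : L = [] := length_eq_zero_iff.1 (by by_contra hw; exact h (.inr (by omega)))
        have hK : K = [] := length_eq_zero_iff.1 (by by_contra hw; exact h (.inr (by omega)))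
        have h0 : ∀ U : BTree I J, spineOp R w [] U [] = 0 := fun U => by
          rw [hL, hK] at h
          exact (spineOp_map w [] U []).trans (if_neg h)
        rw [hL, hK, spineRel, List.map_nil, List.map_nil, sum_eq_zero fun p hp =>
          lin_ins_leftOp_nil hw hp _, sum_eq_zero fun p hp => ?_,
          lin_eq_zero fun U _ => h0 U, sum_eq_zero fun p hp => ?_]
        · simp
        · simp_all
        · refine lin_ins_leftOp_nil (p := (swapWeight p.1, swapWeight p.2))
            (w := swapWeight w) (by simpa using hw) ?_ _
          simp_all
    -- A `⊤` on the right of the spine is treated by reflection.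
    · have h := spineRel_top (R := R) (swapWeight w) l₁ l₂ T.mirror (L.map .tree)
      rw [spineOp_mirror, spineRel_mirror _ _ _ (bd_mirror hT), lin_mapDomain] at h
      have h' := congrArg (mapDomain mirror) h
      rw [← mapDomain_comp, show (mirror ∘ mirror : BTree I J → BTree I J) = id from
        funext mirror_mirror, Finsupp.mapDomain_id] at h'
      rw [← h', map_eq_lin, lin_lin]
      refine lin_congr fun U hU => ?_
      have hs : U.Stable := by
        rw [spineOp] at hU
        split_ifs at hU
        · have := mem_ofOption hU
          simp_all [join_top_right]
        · simp at hU
      rw [bd_mirror hs, lin_mapDomain]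
      simp [lin_single_id]
  simp [spineRel_top]

/-- Weights with a component in the first weight space do not act on the left, so this is the
relation for `treeOp`, whose remaining term is the square of the differential on a stable letter. -/
lemma sum_leftOp_ins [CharP R 2] (w : I ⊎ J) {l : List (XTree J)}
    (hl : ∀ x ∈ l, x.Stable) :
    ∑ p ∈ anti w, lin R (leftOp R p.1) (ins (leftOp R p.2) l) = 0 := by
  have e : ∀ p : I ⊎ J × (I ⊎ J), lin R (leftOp R p.1) (ins (leftOp R p.2) l) =
      if p.1 ∘ inl = 0 ∧ p.2 ∘ inl = 0 then
        lin R (treeOp R (p.1 ∘ inr)) (ins (treeOp R (p.2 ∘ inr)) l) else 0 := by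
    intro p
    by_cases h1 : p.1 ∘ inl = 0
    · by_cases h2 : p.2 ∘ inl = 0
      · rw [if_pos ⟨h1, h2⟩, show leftOp R p.1 = treeOp R (p.1 ∘ inr) from
          funext fun l => if_pos h1, show leftOp R p.2 = treeOp R (p.2 ∘ inr) from
          funext fun l => if_pos h2]
      · have h : ins (leftOp R p.2) l = 0 := ins_eq_zero fun _ _ _ _ => if_neg h2
        simp_all
    · rw [if_neg (by tauto)]
      exact lin_eq_zero fun _ _ => if_neg h1
  simp only [e]
  rw [anti_comp_inr w fun x y => lin R (treeOp R x) (ins (treeOp R y) l)]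
  split_ifs
  · rw [sum_treeOp_ins]
    split_ifs
    · rcases l with _ | ⟨x, _ | ⟨y, l⟩⟩
      · rfl
      · exact XTree.lin_bd_bd x (hl x (by simp))
      · rfl
    · rfl
  · rfl

lemma sum_ins_leftOp_ins [CharP R 2] (w : I ⊎ J) {l : List (XTree J)}
    (hl : ∀ x ∈ l, x.Stable) :
    ∑ p ∈ anti w, lin R (ins (leftOp R p.1)) (ins (leftOp R p.2) l) = 0 := by
  rw [sum_ins_ins]
  refine ins_eq_zero fun a b c h => sum_leftOp_ins w fun x hx => hl x ?_
  grind

lemma sum_ins_rightOp_ins [CharP R 2] (w : I ⊎ J) {l : List (XTree I)}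
    (hl : ∀ x ∈ l, x.Stable) :
    ∑ p ∈ anti w, lin R (ins (rightOp R p.1)) (ins (rightOp R p.2) l) = 0 := by
  rw [← swapWeight_swapWeight w, anti_swapWeight (swapWeight w) fun x y =>
    lin R (ins (rightOp R x)) (ins (rightOp R y) l)]
  simp only [rightOp_eq, swapWeight_swapWeight]
  exact sum_ins_leftOp_ins _ hl

/-- Inserting into a list that is then cut. -/
lemma lin_cutSum_ins {X V : Type*} [AddCommGroup V] [Module R V] (F : List X → List X → V)
    (f : List X → X →₀ R) (l : List X) :
    lin R (fun l' => cutSum l' F) (ins f l) =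
      cutSum l (fun a a' => lin R (fun b => F b a') (ins f a))
      + cutSum l fun a a' => lin R (fun b => F a b) (ins f a') := by
  simp only [lin_ins, cutSum_append_cons, lin_add, threeSum_add, cutSum_lin]
  rw [add_comm]
  congr 1
  · simp only [threeSum]
    rw [← cutSum_assoc l fun a r c => cutSum r fun b c' => lin R (fun x => F (a ++ x :: c') c) (f b)]
    refine cutSum_congr fun a r _ => ?_
    simp [cutSum_assoc, lin]
  · simp only [threeSum]
    have e : ∀ a r : List X, (cutSum r fun b c => cutSum a fun a₁ a₂ =>
        lin R (fun x => F a₁ (a₂ ++ x :: c)) (f b)) = cutSum a fun a₁ a₂ => cutSum r fun b c =>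
        lin R (fun x => F a₁ (a₂ ++ x :: c)) (f b) := fun a r => cutSum_comm _ _ _
    simp only [e]
    rw [← cutSum_assoc l fun a₁ a₂ r => cutSum r fun b c =>
      lin R (fun x => F a₁ (a₂ ++ x :: c)) (f b)]

end SpineRel

end BTree

namespace BTree

section BdBd

variable {R : Type*} [CommRing R] {I J : Type} [Fintype I] [Fintype J]

lemma stable_of_mem_spineOp {w : I ⊎ J} {L : List (XTree J)} {T U : BTree I J}
    {K : List (XTree I)} (hL : ∀ x ∈ L, x.Stable) (hT : T.Stable) (hK : ∀ x ∈ K, x.Stable)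
    (hU : U ∈ (spineOp R w L T K).support) : U.Stable := by
  rw [spineOp] at hU
  split_ifs at hU with h
  · have hU := mem_ofOption hU
    rcases eq_map_or_split L with ⟨L, rfl⟩ | ⟨l₁, l₂, rfl⟩
    · rcases eq_map_or_split K with ⟨K, rfl⟩ | ⟨l₁, l₂, rfl⟩
      · rw [join_map] at hU
        cases hU
        refine ⟨by simpa using h, hT, (stableList_iff _).2 ?_, (stableList_iff _).2 ?_⟩
        · simpa [XTree.Stable] using hL
        · simpa [XTree.Stable] using hK
      · rw [join_top_right _ _ _ (by simp)] at hU
        split_ifs at hU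
        cases hU
        exact hT
    · rw [join_top_left _ (by simp)] at hU
      split_ifs at hU
      cases hU
      exact hT
  · simp at hU

variable [DecidableEq I] [DecidableEq J]

lemma stable_of_mem_ins_leftOp [CharP R 2] {u : I ⊎ J} {l l' : List (XTree J)}
    (hl : ∀ x ∈ l, x.Stable) (h : l' ∈ (ins (leftOp R u) l).support) : ∀ x ∈ l', x.Stable := by
  by_cases hu : u ∘ inl = 0
  · rw [show leftOp R u = treeOp R (u ∘ inr) from funext fun _ => if_pos hu] at h
    exact (forestInputs_of_mem_ins hl h).2
  · rw [ins_eq_zero fun _ _ _ _ => by exact if_neg hu] at h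
    simp at h

lemma stable_of_mem_bd [CharP R 2] {T U : BTree I J} (hT : T.Stable)
    (hU : U ∈ (T.bd R).support) : U.Stable := by
  classical
  induction T generalizing U with
  | strand => simp [bd] at hU
  | node w L T K ih =>
    have hL : ∀ x ∈ L.map tree, x.Stable := by
      simpa [XTree.Stable] using (stableList_iff _).1 hT.2.2.1
    have hK : ∀ x ∈ K.map tree, x.Stable := by
      simpa [XTree.Stable] using (stableList_iff _).1 hT.2.2.2
    rw [bd_node _ hT.1, spineRel] at hU
    rcases mem_add hU with hU | hU
    · rcases mem_add hU with hU | hU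
      · rcases mem_add hU with hU | hU
        · obtain ⟨p, -, hU⟩ := mem_support_finsetSum _ hU
          obtain ⟨L', hL', hU⟩ := mem_lin hU
          exact stable_of_mem_spineOp (stable_of_mem_ins_leftOp hL hL') hT.2.1 hK hU
        · obtain ⟨p, -, hU⟩ := mem_support_finsetSum _ hU
          obtain ⟨L', hL', hU⟩ := mem_lin hU
          exact stable_of_mem_spineOp hL hT.2.1 (stable_of_mem_ins_leftOp hK hL') hU
      · obtain ⟨T', hT', hU⟩ := mem_lin hU
        exact stable_of_mem_spineOp hL (ih hT.2.1 hT') hK hU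
    · obtain ⟨p, -, hU⟩ := mem_support_finsetSum _ hU
      obtain ⟨a, a', ha, hU⟩ := mem_cutSum hU
      obtain ⟨b, b', hb, hU⟩ := mem_cutSum hU
      rw [← ha] at hL
      rw [← hb] at hK
      simp only [List.mem_append] at hL hK
      obtain ⟨T', hT', hU⟩ := mem_lin hU
      exact stable_of_mem_spineOp (fun x hx => hL x (.inr hx)) (stable_of_mem_spineOp
        (fun x hx => hL x (.inl hx)) hT.2.1 (fun x hx => hK x (.inl hx)) hT')
        (fun x hx => hK x (.inr hx)) hU

/-- Expanding twice, each time on the left (`A`), on the right (`B`), above (`C`) or on the spine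
(`M`), gives terms that occur in pairs. Two expansions on the same side vanish by the relation for
`leftOp` or `rightOp`, two expansions above by hypothesis. Expansions at different places commute.
One on the side together with one on the spine happens at the lower or at the upper of the two spine
vertices. Two on the spine match by associativity of cutting. -/
lemma lin_bd_spineRel [CharP R 2] (w : I ⊎ J) {L : List (XTree J)} {T : BTree I J}
    {K : List (XTree I)} (hL : ∀ x ∈ L, x.Stable) (hT : T.Stable) (hK : ∀ x ∈ K, x.Stable)
    (hb : lin R (bd R) (T.bd R) = 0) : lin R (bd R) (spineRel R w L T K) = 0 := by
  have two : ∀ x : BTree I J →₀ R, x + x = 0 := fun x => add_self R x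
  -- the four kinds of terms
  let A : (I ⊎ J) → List (XTree J) → BTree I J → List (XTree I) → BTree I J →₀ R :=
    fun w L T K => ∑ p ∈ anti w, lin R (fun L' => spineOp R p.1 L' T K)
      (ins (leftOp R p.2) L)
  let B : (I ⊎ J) → List (XTree J) → BTree I J → List (XTree I) → BTree I J →₀ R :=
    fun w L T K => ∑ p ∈ anti w, lin R (fun K' => spineOp R p.1 L T K')
      (ins (rightOp R p.2) K)
  let C : (I ⊎ J) → List (XTree J) → BTree I J → List (XTree I) → BTree I J →₀ R :=
    fun w L T K => lin R (fun U => spineOp R w L U K) (T.bd R)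
  let M : (I ⊎ J) → List (XTree J) → BTree I J → List (XTree I) → BTree I J →₀ R :=
    fun w L T K => ∑ p ∈ anti w, cutSum L fun a a' => cutSum K fun b b' =>
        lin R (fun U => spineOp R p.1 a' U b') (spineOp R p.2 a T b)
  have hrel : ∀ w L T K, spineRel R w L T K = A w L T K + B w L T K + C w L T K + M w L T K :=
    fun _ _ _ _ => rfl
  have hA : lin R (bd R) (A w L T K) = ∑ p ∈ anti w,
      lin R (fun L' => spineRel R p.1 L' T K) (ins (leftOp R p.2) L) := by
    simp only [A, map_sum, lin_lin]
    exact sum_congr rfl fun p _ => lin_congr fun L' hL' => lin_bd_spineOp _ _ hT _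
  have hB : lin R (bd R) (B w L T K) = ∑ p ∈ anti w,
      lin R (fun K' => spineRel R p.1 L T K') (ins (rightOp R p.2) K) := by
    simp only [B, map_sum, lin_lin]
    exact sum_congr rfl fun p _ => lin_congr fun L' hL' => lin_bd_spineOp _ _ hT _
  have hC : lin R (bd R) (C w L T K) = lin R (fun U => spineRel R w L U K) (T.bd R) := by
    simp only [C, lin_lin]
    exact lin_congr fun U hU => lin_bd_spineOp _ _ (stable_of_mem_bd hT hU) _
  have hM : lin R (bd R) (M w L T K) = ∑ p ∈ anti w, cutSum L fun a a' =>
      cutSum K fun b b' => lin R (fun U => spineRel R p.1 a' U b') (spineOp R p.2 a T b) := by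
    simp only [M, map_sum, map_cutSum, lin_lin]
    refine sum_congr rfl fun p _ => cutSum_congr fun a a' ha => cutSum_congr fun b b' hb =>
      lin_congr fun U hU => lin_bd_spineOp _ _ (stable_of_mem_spineOp (fun x hx => hL x ?_) hT
        (fun x hx => hK x ?_) hU) _
    · rw [← ha]; simp [hx]
    · rw [← hb]; simp [hx]
  -- Expanding above the lower of two spine vertices means expanding the tree with root the upper
  -- vertex; this produces the partners of the other terms.
  have hMC : ∑ p ∈ anti w, cutSum L (fun a a' => cutSum K fun b b' =>
      lin R (fun U => C p.1 a' U b') (spineOp R p.2 a T b)) =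
      ∑ p ∈ anti w, cutSum L (fun a a' => cutSum K fun b b' =>
      lin R (fun U => spineOp R p.1 a' U b') (spineRel R p.2 a T b)) := by
    refine sum_congr rfl fun p _ => cutSum_congr fun a a' ha => cutSum_congr fun b b' hb => ?_
    simp only [C]
    rw [← lin_lin, lin_bd_spineOp _ _ hT]
  have hAA : ∑ p ∈ anti w, lin R (fun L' => A p.1 L' T K) (ins (leftOp R p.2) L) = 0 := by
    simp only [A, lin_sum]
    rw [← anti_assoc w fun i j k => lin R (fun L' => lin R (fun L' => spineOp R i L' T K)
      (ins (leftOp R j) L')) (ins (leftOp R k) L)]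
    refine sum_eq_zero fun p _ => ?_
    simp only [← lin_lin, ← map_sum]
    rw [sum_ins_leftOp_ins _ hL, map_zero]
  have hBB : ∑ p ∈ anti w, lin R (fun K' => B p.1 L T K') (ins (rightOp R p.2) K) = 0 := by
    simp only [B, lin_sum]
    rw [← anti_assoc w fun i j k => lin R (fun L' => lin R (fun L' => spineOp R i L T L')
      (ins (rightOp R j) L')) (ins (rightOp R k) K)]
    refine sum_eq_zero fun p _ => ?_
    simp only [← lin_lin, ← map_sum]
    rw [sum_ins_rightOp_ins _ hK, map_zero]
  have hAB : ∑ p ∈ anti w, lin R (fun L' => B p.1 L' T K) (ins (leftOp R p.2) L) =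
      ∑ p ∈ anti w, lin R (fun K' => A p.1 L T K') (ins (rightOp R p.2) K) := by
    simp only [A, B, lin_sum]
    rw [← anti_assoc w fun i j k => lin R (fun L' => lin R (fun K' => spineOp R i L' T K')
      (ins (rightOp R j) K)) (ins (leftOp R k) L), ← anti_assoc w fun i j k => lin R
      (fun K' => lin R (fun L' => spineOp R i L' T K') (ins (leftOp R j) L)) (ins (rightOp R k) K)]
    refine sum_congr rfl fun p _ => ?_
    rw [anti_swap' p.2 fun j k => lin R (fun L' => lin R (fun K' =>
      spineOp R p.1 L' T K') (ins (rightOp R j) K)) (ins (leftOp R k) L)]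
    exact sum_congr rfl fun q _ => lin_comm _ _ _
  have hAC : ∑ p ∈ anti w, lin R (fun L' => C p.1 L' T K) (ins (leftOp R p.2) L) =
      lin R (fun U => A w L U K) (T.bd R) := by
    simp only [A, C, lin_sum]
    exact sum_congr rfl fun q _ => lin_comm _ _ _
  have hBC : ∑ p ∈ anti w, lin R (fun K' => C p.1 L T K') (ins (rightOp R p.2) K) =
      lin R (fun U => B w L U K) (T.bd R) := by
    simp only [B, C, lin_sum]
    exact sum_congr rfl fun q _ => lin_comm _ _ _
  have hCC : lin R (fun U => C w L U K) (T.bd R) = 0 := by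
    simp only [C]
    rw [← lin_lin, hb, map_zero]
  have hCM : ∑ p ∈ anti w, cutSum L (fun a a' => cutSum K fun b b' =>
      lin R (fun U => spineOp R p.1 a' U b') (C p.2 a T b)) =
      lin R (fun U => M w L U K) (T.bd R) := by
    simp only [C, M, lin_sum, cutSum_lin, lin_lin]
  have hAM : ∑ p ∈ anti w, lin R (fun L' => M p.1 L' T K) (ins (leftOp R p.2) L) =
      ∑ p ∈ anti w, cutSum L (fun a a' => cutSum K fun b b' =>
        lin R (fun U => A p.1 a' U b') (spineOp R p.2 a T b)) +
      ∑ p ∈ anti w, cutSum L (fun a a' => cutSum K fun b b' =>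
        lin R (fun U => spineOp R p.1 a' U b') (A p.2 a T b)) := by
    simp only [A, M, lin_sum, lin_cutSum_ins, sum_add_distrib]
    rw [add_comm]
    refine congrArg₂ (· + ·) ?_ ?_
    · simp only [cutSum_lin, cutSum_sum]
      rw [← anti_assoc w fun i j k => cutSum L fun a a' => cutSum K fun b b' =>
        lin R (fun L' => lin R (fun U => spineOp R i L' U b') (spineOp R j a T b))
          (ins (leftOp R k) a'), ← anti_assoc w fun i j k => cutSum L fun a a' =>
          cutSum K fun b b' => lin R (fun U => lin R (fun L' => spineOp R i L' U b')
          (ins (leftOp R j) a')) (spineOp R k a T b)]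
      refine sum_congr rfl fun p _ => ?_
      rw [anti_swap' p.2 fun j k => cutSum L fun a a' => cutSum K fun b b' =>
        lin R (fun L' => lin R (fun U => spineOp R p.1 L' U b') (spineOp R j a T b))
          (ins (leftOp R k) a')]
      exact sum_congr rfl fun q _ => cutSum_congr fun a a' _ => cutSum_congr fun b b' _ =>
        lin_comm _ _ _
    · simp only [cutSum_lin, cutSum_sum, map_sum, lin_lin]
      rw [anti_assoc w fun i j k => cutSum L fun a a' => cutSum K fun b b' =>
        lin R (fun L' => lin R (fun U => spineOp R i a' U b') (spineOp R j L' T b))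
          (ins (leftOp R k) a)]
  have hBM : ∑ p ∈ anti w, lin R (fun K' => M p.1 L T K') (ins (rightOp R p.2) K) =
      ∑ p ∈ anti w, cutSum L (fun a a' => cutSum K fun b b' =>
        lin R (fun U => B p.1 a' U b') (spineOp R p.2 a T b)) +
      ∑ p ∈ anti w, cutSum L (fun a a' => cutSum K fun b b' =>
        lin R (fun U => spineOp R p.1 a' U b') (B p.2 a T b)) := by
    simp only [B, M, lin_sum, cutSum_lin, lin_cutSum_ins, cutSum_add, sum_add_distrib]
    rw [add_comm]
    refine congrArg₂ (· + ·) ?_ ?_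
    · simp only [cutSum_sum]
      rw [← anti_assoc w fun i j k => cutSum L fun a a' => cutSum K fun b b' =>
        lin R (fun L' => lin R (fun U => spineOp R i a' U L') (spineOp R j a T b))
          (ins (rightOp R k) b'), ← anti_assoc w fun i j k => cutSum L fun a a' =>
          cutSum K fun b b' => lin R (fun U => lin R (fun L' => spineOp R i a' U L')
          (ins (rightOp R j) b')) (spineOp R k a T b)]
      refine sum_congr rfl fun p _ => ?_
      rw [anti_swap' p.2 fun j k => cutSum L fun a a' => cutSum K fun b b' =>
        lin R (fun L' => lin R (fun U => spineOp R p.1 a' U L') (spineOp R j a T b))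
          (ins (rightOp R k) b')]
      exact sum_congr rfl fun q _ => cutSum_congr fun a a' _ => cutSum_congr fun b b' _ =>
        lin_comm _ _ _
    · simp only [cutSum_sum, map_sum, lin_lin]
      rw [anti_assoc w fun i j k => cutSum L fun a a' => cutSum K fun b b' =>
        lin R (fun L' => lin R (fun U => spineOp R i a' U b') (spineOp R j a T L'))
          (ins (rightOp R k) b)]
  have hMM : ∑ p ∈ anti w, cutSum L (fun a a' => cutSum K fun b b' =>
        lin R (fun U => M p.1 a' U b') (spineOp R p.2 a T b)) =
      ∑ p ∈ anti w, cutSum L (fun a a' => cutSum K fun b b' =>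
        lin R (fun U => spineOp R p.1 a' U b') (M p.2 a T b)) := by
    simp only [M, lin_sum, cutSum_lin, cutSum_sum, map_sum, map_cutSum, lin_lin]
    rw [← anti_assoc w fun i j k => cutSum L fun a a' => cutSum K fun b b' =>
      cutSum a' fun c c' => cutSum b' fun d d' => lin R (fun U => lin R (fun U => spineOp R i c' U d')
        (spineOp R j c U d)) (spineOp R k a T b)]
    refine sum_congr rfl fun p _ => sum_congr rfl fun q _ => ?_
    simp only [cutSum_comm K]
    rw [cutSum_assoc L fun a c c' => cutSum K fun b b' => cutSum b' fun d d' =>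
      lin R (fun U => lin R (fun U => spineOp R p.1 c' U d') (spineOp R q.1 c U d))
        (spineOp R q.2 a T b)]
    refine cutSum_congr fun a a' _ => cutSum_congr fun c c' _ => ?_
    rw [cutSum_assoc K fun b d d' => lin R (fun U => lin R (fun U => spineOp R p.1 a' U d')
      (spineOp R q.1 c' U d)) (spineOp R q.2 c T b)]
  rw [hrel, map_add, map_add, map_add, hA, hB, hC, hM]
  simp only [hrel, lin_add, sum_add_distrib, cutSum_add]
  rw [hMC]
  simp only [hrel, map_add, sum_add_distrib, cutSum_add]
  rw [hAA, hBB, hAB, hAC, hBC, hCC, hCM, hAM, hBM, hMM]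
  abel_nf
  simp only [two_smul, two]

lemma lin_bd_bd [CharP R 2] {T : BTree I J} (hT : T.Stable) : lin R (bd R) (T.bd R) = 0 := by
  induction T with
  | strand => simp [bd]
  | node w L T K ih =>
    rw [bd_node _ hT.1]
    refine lin_bd_spineRel w ?_ hT.2.1 ?_ (ih hT.2.1)
    · simpa [XTree.Stable] using (stableList_iff _).1 hT.2.2.1
    · simpa [XTree.Stable] using (stableList_iff _).1 hT.2.2.2

end BdBd

end BTree

namespace BTree

/-! ### Additive invariants of bimodule trees -/

section Attr

variable {I J : Type}

lemma ofSnd_add (v w : J → ℕ) : (ofSnd (v + w) : I ⊎ J) = ofSnd v + ofSnd w := by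
  aesop

lemma ofFst_add (v w : I → ℕ) : (ofFst (v + w) : I ⊎ J) = ofFst v + ofFst w := by
  aesop

lemma ofFst_zero : (ofFst 0 : I ⊎ J) = 0 := by
  aesop

/-- The contribution of a forest left of the spine to the invariants of a bimodule tree. -/
def leftAttr : ℕ × (J → ℕ) × ℤ →+ ℕ × ℕ × I ⊎ J × ℤ where
  toFun a := (a.1, 0, ofSnd a.2.1, a.2.2)
  map_zero' := by aesop
  map_add' a b := by simp [ofSnd_add]

/-- The contribution of a forest right of the spine to the invariants of a bimodule tree. -/
def rightAttr : ℕ × (I → ℕ) × ℤ →+ ℕ × ℕ × I ⊎ J × ℤ where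
  toFun a := (0, a.1, ofFst a.2.1, a.2.2)
  map_zero' := by simp [ofFst_zero]
  map_add' a b := by simp [ofFst_add]

variable [Fintype I] [Fintype J]

/-- The dimension of a bimodule tree. -/
def dim : BTree I J → ℤ
  | strand => 0
  | node w L T K => T.dim + (attrs (L.map .tree)).2.2 + (attrs (K.map .tree)).2.2
      + (2 * (size w : ℤ) - 1)

/-- The additive invariants of a bimodule tree: the numbers of left and of right inputs, the weight
and the dimension. -/
def attr (T : BTree I J) : ℕ × ℕ × I ⊎ J × ℤ :=
  (T.leftInputs, T.rightInputs, T.weight, T.dim)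

lemma attr_strand : (strand : BTree I J).attr = 0 := rfl

lemma attr_node (w : I ⊎ J) (L : List (WTree J)) (T : BTree I J)
    (K : List (WTree I)) : (node w L T K).attr =
      T.attr + leftAttr (attrs (L.map .tree)) + rightAttr (attrs (K.map .tree))
        + (0, 0, w, 2 * (size w : ℤ) - 1) := by
  refine Prod.ext ?_ (Prod.ext ?_ (Prod.ext ?_ rfl))
  · simp [attr, leftAttr, rightAttr, attrs_map, leftInputs]
  · simp [attr, leftAttr, rightAttr, attrs_map, rightInputs]
  · simp only [attr, leftAttr, rightAttr, attrs_map, weight, AddMonoidHom.coe_mk,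
      ZeroHom.coe_mk, Prod.snd_add, Prod.fst_add]
    funext i
    cases i
    · simp [ofSnd, ofFst]; ring
    · simp [ofSnd, ofFst]; ring

lemma attr_of_join {w : I ⊎ J} {L : List (XTree J)} {T U : BTree I J}
    {K : List (XTree I)} (h : join w L T K = some U) : U.attr =
      T.attr + leftAttr (attrs L) + rightAttr (attrs K)
        + (0, 0, w, 2 * (size w : ℤ) - 1) := by
  have top₁ : leftAttr (I := I) (XTree.attr (.top : XTree J)) = (0, 0, 0, 1) := by
    aesop
  have top₂ : rightAttr (J := J) (XTree.attr (.top : XTree I)) = (0, 0, 0, 1) := by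
    aesop
  rcases eq_map_or_split L with ⟨L, rfl⟩ | ⟨l₁, l₂, rfl⟩
  · rcases eq_map_or_split K with ⟨K, rfl⟩ | ⟨l₁, l₂, rfl⟩
    · grind [join_map, attr_node]
    · rw [join_top_right _ _ _ (by simp)] at h
      split_ifs at h with hw
      cases h
      obtain ⟨rfl, hw⟩ := hw
      simp only [length_append, length_cons, List.length_map] at hw
      obtain rfl : L = [] := length_eq_zero_iff.1 (by omega)
      obtain rfl : l₁ = [] := length_eq_zero_iff.1 (by omega)
      simp_all [length_eq_zero_iff, nil_append, attrs_cons, map_add, add_assoc]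
  · rw [join_top_left _ (by simp)] at h
    split_ifs at h with hw
    cases h
    obtain ⟨rfl, hw⟩ := hw
    simp only [length_append, length_cons] at hw
    obtain rfl : K = [] := length_eq_zero_iff.1 (by omega)
    obtain rfl : l₁ = [] := length_eq_zero_iff.1 (by omega)
    simp_all [length_eq_zero_iff, nil_append, attrs_cons, map_add, add_assoc]

end Attr


-- Gluing at the left and right inputs of bimodule trees

section Graft

variable {I J : Type}

lemma stable_map_left {w : I ⊎ J} {L : List (WTree J)} {T : BTree I J}
    {K : List (WTree I)} (h : (node w L T K).Stable) : ∀ x ∈ L.map tree, x.Stable := by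
  simpa [XTree.Stable] using (stableList_iff _).1 h.2.2.1

lemma stable_map_right {w : I ⊎ J} {L : List (WTree J)} {T : BTree I J}
    {K : List (WTree I)} (h : (node w L T K).Stable) : ∀ x ∈ K.map tree, x.Stable := by
  simpa [XTree.Stable] using (stableList_iff _).1 h.2.2.2

variable [Fintype I] [Fintype J]

lemma _root_.WeightedTrees.XTree.top_mem_graftForest {ι : Type} [Fintype ι]
    {l l' : List (XTree ι)} {i : ℕ} {S : XTree ι} (h : graftForest l i S = some l')
    (ht : .top ∈ l) : .top ∈ l' := by
  obtain ⟨l₁, x, l₂, j, x', rfl, -, -, hx', rfl⟩ := graftForest_eq_some h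
  aesop

lemma _root_.WeightedTrees.XTree.graftForest_of_top_mem {ι : Type} [Fintype ι]
    {l : List (XTree ι)} (i : ℕ) (S : XTree ι) (ht : .top ∈ l) (h : l.length ≤ 1) :
    graftForest l i S = none := by
  rcases l with _ | ⟨x, _ | ⟨y, l⟩⟩
  · simp at ht
  · aesop
  · simp at h

lemma graftLeft_node (w : I ⊎ J) (L : List (WTree J)) (T : BTree I J)
    (K : List (WTree I)) (i : ℕ) (S : XTree J) : (node w L T K).graftLeft i S =
      if i < T.leftInputs then
        (T.graftLeft i S).bind fun T' => join w (L.map .tree) T' (K.map .tree)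
      else (graftForest (L.map .tree) (i - T.leftInputs) S).bind
        fun L' => join w L' T (K.map .tree) := by
  rw [graftLeft, graftList_eq]
  simp only [join_map]
  split_ifs
  · cases T.graftLeft i S <;> rfl
  · rfl

lemma graftLeft_eq_none (T : BTree I J) (i : ℕ) (S : XTree J) (h : T.leftInputs ≤ i) :
    T.graftLeft i S = none := by
  cases T with
  | strand => rfl
  | node w L T K =>
    rw [leftInputs] at h
    rw [graftLeft_node, if_neg (by omega), graftForest_eq_none]
    · rfl
    · rw [forestInputs_map]
      omega

/-- If a `⊤` is present, the vertex is nonzero only when that `⊤` is the single side input, and then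
there is no other side subtree to glue into. So gluing into `L` gives zero on both sides and only
gluing into `T` remains. -/
lemma bind_graftLeft_join (w : I ⊎ J) (L : List (XTree J)) (T : BTree I J)
    (K : List (XTree I)) (i : ℕ) (S : XTree J) :
    (join w L T K).bind (fun U => U.graftLeft i S) =
      if i < T.leftInputs then (T.graftLeft i S).bind fun T' => join w L T' K
      else (graftForest L (i - T.leftInputs) S).bind fun L' => join w L' T K := by
  have key : (top ∈ L ∨ top ∈ K) → (join w L T K).bind (fun U => U.graftLeft i S) =
      if i < T.leftInputs then (T.graftLeft i S).bind fun T' => join w L T' K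
      else (graftForest L (i - T.leftInputs) S).bind fun L' => join w L' T K := by
    intro h
    have hj : ∀ U : BTree I J, join w L U K =
        if w = 0 ∧ L.length + K.length = 1 then some U else none := fun U => by
      grind [join_top_left, join_top_right]
    have hj' : (graftForest L (i - T.leftInputs) S).bind (fun L' => join w L' T K) = none := by
      rcases hg : graftForest L (i - T.leftInputs) S with _ | L'
      · rfl
      · have hlen := length_graftForest hg
        rcases h with h | h
        · rw [bind_some, join_top_left w (XTree.top_mem_graftForest hg h), if_neg]
          grind [XTree.graftForest_of_top_mem]
        · rw [bind_some, join_top_right w _ _ h, if_neg]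
          rintro ⟨-, hc⟩
          have := List.length_pos_of_mem h
          obtain rfl : L = [] := length_eq_zero_iff.1 (by omega)
          cases hg
    rw [hj']
    simp only [hj]
    by_cases hw : w = 0 ∧ L.length + K.length = 1
    · simp_all [and_self, if_true, bind_some, graftLeft_eq_none]
    · simp [hw]
  rcases eq_map_or_split L with ⟨L, rfl⟩ | ⟨l₁, l₂, rfl⟩
  · rcases eq_map_or_split K with ⟨K, rfl⟩ | ⟨l₁, l₂, rfl⟩
    · rw [join_map, bind_some, graftLeft_node]
    grind
  grind

lemma attr_graftLeft {T U : BTree I J} {i : ℕ} {S : XTree J}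
    (h : T.graftLeft i S = some U) : U.attr + (1, 0, 0, 1) = T.attr + leftAttr S.attr := by
  induction T generalizing i U with
  | strand => cases h
  | node w L T K ih =>
    rw [graftLeft_node] at h
    split_ifs at h
    · obtain ⟨T', hT', hU⟩ := Option.bind_eq_some_iff.1 h
      have := ih hT'
      rw [attr_of_join hU, attr_node]
      grind
    · obtain ⟨L', hL', hU⟩ := Option.bind_eq_some_iff.1 h
      obtain ⟨l₁, x, l₂, j, x', h, -, -, hx', rfl⟩ := graftForest_eq_some hL'
      have := congrArg (leftAttr (I := I)) (attr_graft hx')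
      rw [map_add, map_add, show leftAttr (I := I) ((1, 0, 1) : ℕ × (J → ℕ) × ℤ) = (1, 0, 0, 1)
        by simp [leftAttr, ofSnd_eq_zero.2]] at this
      rw [attr_of_join hU, attr_node, h]
      simp only [attrs_append, attrs_cons, map_add]
      grind

lemma leftInputs_graftLeft {T U : BTree I J} {i : ℕ} {S : XTree J}
    (h : T.graftLeft i S = some U) : U.leftInputs + 1 = T.leftInputs + S.inputs := by
  simpa [attr, leftAttr, XTree.attr] using congrArg fst (attr_graftLeft h)

lemma rightInputs_graftLeft {T U : BTree I J} {i : ℕ} {S : XTree J}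
    (h : T.graftLeft i S = some U) : U.rightInputs = T.rightInputs := by
  simpa [attr, leftAttr, XTree.attr] using congrArg (fun a => a.2.1) (attr_graftLeft h)

lemma stable_of_join {w : I ⊎ J} {L : List (XTree J)} {T U : BTree I J}
    {K : List (XTree I)} (hL : ∀ x ∈ L, x.Stable) (hT : T.Stable) (hK : ∀ x ∈ K, x.Stable)
    (hw : StableVertex (L.length + 1 + K.length) w) (h : join w L T K = some U) : U.Stable := by
  refine stable_of_mem_spineOp (R := ℤ) (w := w) (L := L) (K := K) hL hT hK ?_
  rw [spineOp, if_pos hw, h]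
  simp

lemma stable_graftLeft {T U : BTree I J} {i : ℕ} {S : XTree J}
    (h : T.graftLeft i S = some U) (hT : T.Stable) (hS : S.Stable) : U.Stable := by
  induction T generalizing i U with
  | strand => cases h
  | node w L T K ih =>
    have hw : StableVertex ((L.map tree).length + 1 + (K.map tree).length) w := by
      simpa using hT.1
    rw [graftLeft_node] at h
    split_ifs at h
    · obtain ⟨T', hT', hU⟩ := Option.bind_eq_some_iff.1 h
      exact stable_of_join (stable_map_left hT) (ih hT' hT.2.1) (stable_map_right hT) hw hU
    · obtain ⟨L', hL', hU⟩ := Option.bind_eq_some_iff.1 h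
      rw [← length_graftForest hL'] at hw
      refine stable_of_join ?_ hT.2.1 (stable_map_right hT) hw hU
      have hL := stable_map_left hT
      obtain ⟨l₁, x, l₂, j, x', h, -, -, hx', rfl⟩ := graftForest_eq_some hL'
      grind [List.mem_append, List.mem_cons, stable_graft]

lemma graftLeft_seq (T : BTree I J) (i : ℕ) (S : XTree J) (k : ℕ) (U : XTree J)
    (hi : i < T.leftInputs) (hk : k < S.inputs) :
    (T.graftLeft i S).bind (fun u => u.graftLeft (i + k) U) =
      (S.graft k U).bind (fun v => T.graftLeft i v) := by
  induction T generalizing i with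
  | strand => simp [leftInputs] at hi
  | node w L T K ih =>
    rw [leftInputs] at hi
    simp only [graftLeft_node]
    split_ifs with h
    · rw [bassoc, ← bassoc (S.graft k U), ← ih i h, bassoc]
      refine bcongr fun T' hT' => ?_
      have := leftInputs_graftLeft hT'
      rw [bind_graftLeft_join, if_pos (by omega)]
    · have e := forest_seq (l := L.map .tree) hk
        (fun x _ i hi => graft_seq x i S k U hi hk) (i := i - T.leftInputs)
        (by rw [forestInputs_map]; omega)
      rw [bassoc, ← bassoc (S.graft k U), ← e, bassoc]
      refine bcongr fun L' hL' => ?_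
      rw [bind_graftLeft_join, if_neg (by omega),
        show i + k - T.leftInputs = i - T.leftInputs + k by omega]

lemma graftLeft_par (T : BTree I J) (i : ℕ) (S : XTree J) (k : ℕ) (U : XTree J)
    (hik : i < k) (hk : k < T.leftInputs) :
    (T.graftLeft i S).bind (fun u => u.graftLeft (k + S.inputs - 1) U) =
      (T.graftLeft k U).bind (fun v => v.graftLeft i S) := by
  induction T generalizing i k with
  | strand => aesop
  | node w L T K ih =>
    rw [leftInputs] at hk
    simp only [graftLeft_node]
    by_cases h : k < T.leftInputs
    · rw [if_pos (by omega), if_pos h, bassoc, bassoc]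
      have e1 := fun T' (hT' : T' ∈ T.graftLeft i S) =>
        bind_graftLeft_join w (L.map .tree) T' (K.map .tree) (k + S.inputs - 1) U
      have e2 := fun T' (hT' : T' ∈ T.graftLeft k U) =>
        bind_graftLeft_join w (L.map .tree) T' (K.map .tree) i S
      rw [bcongr e1, bcongr e2]
      have e3 : ∀ T' ∈ T.graftLeft i S, k + S.inputs - 1 < T'.leftInputs := fun T' hT' => by
        have := leftInputs_graftLeft hT'
        omega
      have e4 : ∀ T' ∈ T.graftLeft k U, i < T'.leftInputs := fun T' hT' => by
        have := leftInputs_graftLeft hT'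
        omega
      rw [bcongr fun T' hT' => if_pos (e3 T' hT'),
        bcongr fun T' hT' => if_pos (e4 T' hT'), ← bassoc,
        ← bassoc, ih i k hik h]
    · by_cases hi : i < T.leftInputs
      · rw [if_pos hi, if_neg h, bassoc, bassoc]
        have e1 : ∀ T' ∈ T.graftLeft i S, (join w (L.map .tree) T' (K.map .tree)).bind
            (fun u => u.graftLeft (k + S.inputs - 1) U) =
            (graftForest (L.map .tree) (k - T.leftInputs) U).bind
              fun L' => join w L' T' (K.map .tree) := fun T' hT' => by
          have := leftInputs_graftLeft hT'
          rw [bind_graftLeft_join, if_neg (by omega),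
            show k + S.inputs - 1 - T'.leftInputs = k - T.leftInputs by omega]
        rw [bcongr e1]
        simp only [bind_graftLeft_join, hi, if_true]
        cases T.graftLeft i S <;> cases graftForest (L.map .tree) (k - T.leftInputs) U <;>
          simp
      · have e := forest_par (l := L.map .tree) (S := S) (U := U)
          (fun x _ i k => graft_par x i S k U) (i := i - T.leftInputs)
          (k := k - T.leftInputs) (by omega) (by rw [forestInputs_map]; omega)
        rw [if_neg hi, if_neg h, bassoc, bassoc]
        simp only [bind_graftLeft_join, hi, if_false]
        rw [← bassoc, ← e, bassoc]
        grind

/-- Both sides number inputs away from the spine, so no reversal of indices occurs under reflection.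
Everything about right inputs is transported along this identity. -/
lemma graftRight_eq (T : BTree I J) (i : ℕ) (S : XTree I) :
    T.graftRight i S = (T.mirror.graftLeft i S).map mirror := by
  induction T generalizing i with
  | strand => rfl
  | node w L T K ih =>
    rw [mirror, graftRight, graftLeft, leftInputs_mirror]
    split_ifs
    · rw [ih]
      simp [Option.map_map, Function.comp_def, mirror]
    · rw [mbind]
      refine bcongr fun K' _ => ?_
      have := congrArg (Option.map mirror) (join_mirror w (L.map .tree) T K')
      aesop

lemma bind_graftRight_join (w : I ⊎ J) (L : List (XTree J)) (T : BTree I J)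
    (K : List (XTree I)) (i : ℕ) (S : XTree I) :
    (join w L T K).bind (fun U => U.graftRight i S) =
      if i < T.rightInputs then (T.graftRight i S).bind fun T' => join w L T' K
      else (graftForest K (i - T.rightInputs) S).bind fun K' => join w L T K' := by
  have h := congrArg (Option.map mirror) (bind_graftLeft_join (swapWeight w) K T.mirror L i S)
  rw [join_mirror, Option.bind_map, leftInputs_mirror, mbind] at h
  simp only [Function.comp_def] at h
  simp only [graftRight_eq]
  rw [h]
  have e : ∀ (T : BTree I J) K, (join (swapWeight w) K T.mirror L).map mirror = join w L T K := by
    intro T K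
    rw [join_mirror, Option.map_map, show (mirror ∘ mirror : BTree I J → _) = id from
      funext mirror_mirror, Option.map_id, id]
  grind [mbind, Option.bind_map, bcongr, join, swapWeight, mirror,
    mirror_mirror]

/-- Gluing on one side does not change the numbering on the other, so at each spine vertex the same
branch is chosen in either order. -/
lemma graftLeft_graftRight (T : BTree I J) (i : ℕ) (S : XTree J) (j : ℕ) (U : XTree I) :
    (T.graftLeft i S).bind (fun V => V.graftRight j U) =
      (T.graftRight j U).bind fun V => V.graftLeft i S := by
  induction T generalizing i j with
  | strand => rfl
  | node w L T K ih =>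
    have hr : ∀ T' ∈ T.graftLeft i S, T'.rightInputs = T.rightInputs := fun T' h =>
      rightInputs_graftLeft h
    have hl : ∀ T' ∈ T.graftRight j U, T'.leftInputs = T.leftInputs := fun T' h => by
      rw [graftRight_eq] at h
      obtain ⟨V, hV, rfl⟩ := Option.map_eq_some_iff.1 h
      simpa using rightInputs_graftLeft hV
    have e1 := bind_graftLeft_join w (L.map .tree) T (K.map .tree) i S
    have e2 := bind_graftRight_join w (L.map .tree) T (K.map .tree) j U
    rw [join_map, bind_some] at e1 e2
    rw [e1, e2]
    by_cases hi : i < T.leftInputs <;> by_cases hj : j < T.rightInputs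
    · rw [if_pos hi, if_pos hj, bassoc, bassoc]
      have f1 : ∀ T' ∈ T.graftLeft i S, (join w (L.map .tree) T' (K.map .tree)).bind
          (fun V => V.graftRight j U) = (T'.graftRight j U).bind
          fun V => join w (L.map .tree) V (K.map .tree) := fun T' hT' => by
        rw [bind_graftRight_join, hr T' hT', if_pos hj]
      have f2 : ∀ T' ∈ T.graftRight j U, (join w (L.map .tree) T' (K.map .tree)).bind
          (fun V => V.graftLeft i S) = (T'.graftLeft i S).bind
          fun V => join w (L.map .tree) V (K.map .tree) := fun T' hT' => by
        rw [bind_graftLeft_join, hl T' hT', if_pos hi]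
      rw [bcongr f1, bcongr f2, ← bassoc, ih, bassoc]
    · rw [if_pos hi, if_neg hj, bassoc, bassoc]
      have f1 : ∀ T' ∈ T.graftLeft i S, (join w (L.map .tree) T' (K.map .tree)).bind
          (fun V => V.graftRight j U) = (graftForest (K.map .tree) (j - T.rightInputs) U).bind
          fun K' => join w (L.map .tree) T' K' := fun T' hT' => by
        rw [bind_graftRight_join, hr T' hT', if_neg hj]
      rw [bcongr f1]
      simp only [bind_graftLeft_join, hi, if_true]
      cases T.graftLeft i S <;> cases graftForest (K.map .tree) (j - T.rightInputs) U <;> simp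
    · rw [if_neg hi, if_pos hj, bassoc, bassoc]
      have f1 : ∀ T' ∈ T.graftRight j U, (join w (L.map .tree) T' (K.map .tree)).bind
          (fun V => V.graftLeft i S) = (graftForest (L.map .tree) (i - T.leftInputs) S).bind
          fun L' => join w L' T' (K.map .tree) := fun T' hT' => by
        rw [bind_graftLeft_join, hl T' hT', if_neg hi]
      rw [bcongr f1]
      simp only [bind_graftRight_join, hj, if_true]
      cases T.graftRight j U <;> cases graftForest (L.map .tree) (i - T.leftInputs) S <;> simp
    · rw [if_neg hi, if_neg hj, bassoc, bassoc]
      simp only [bind_graftLeft_join, bind_graftRight_join, hi, hj, if_false]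
      cases graftForest (K.map .tree) (j - T.rightInputs) U <;>
        cases graftForest (L.map .tree) (i - T.leftInputs) S <;> simp

lemma graftRight_seq (T : BTree I J) (i : ℕ) (S : XTree I) (k : ℕ) (U : XTree I)
    (hi : i < T.rightInputs) (hk : k < S.inputs) :
    (T.graftRight i S).bind (fun V => V.graftRight (i + k) U) =
      (S.graft k U).bind fun V => T.graftRight i V := by
  have := congrArg (Option.map mirror) (graftLeft_seq T.mirror i S k U (by simpa using hi) hk)
  simp_all [graftRight_eq, Option.bind_map, Function.comp_def, mirror_mirror, mbind]

lemma graftRight_par (T : BTree I J) (i : ℕ) (S : XTree I) (k : ℕ) (U : XTree I)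
    (hik : i < k) (hk : k < T.rightInputs) :
    (T.graftRight i S).bind (fun V => V.graftRight (k + S.inputs - 1) U) =
      (T.graftRight k U).bind fun V => V.graftRight i S := by
  have := congrArg (Option.map mirror) (graftLeft_par T.mirror i S k U hik (by simpa using hk))
  simp_all [graftRight_eq, Option.bind_map, Function.comp_def, mirror_mirror, mbind]

end Graft

end BTree

namespace BTree

-- Invariants under reflection and under the differential

section AttrBd

variable {R : Type*} [CommRing R] {I J : Type}

/-- Exchange of left and right in the invariants. -/
def swapAttr : ℕ × ℕ × I ⊎ J × ℤ →+ ℕ × ℕ × (J ⊕ I → ℕ) × ℤ where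
  toFun a := (a.2.1, a.1, swapWeight a.2.2.1, a.2.2.2)
  map_zero' := rfl
  map_add' _ _ := rfl

lemma swapAttr_leftAttr (a : ℕ × (I → ℕ) × ℤ) :
    swapAttr (leftAttr (I := J) a) = rightAttr a := by
  aesop

lemma swapAttr_rightAttr (a : ℕ × (I → ℕ) × ℤ) :
    swapAttr (rightAttr (J := J) a) = leftAttr a := by
  aesop

variable [Fintype I] [Fintype J]

lemma attr_mirror (T : BTree I J) : T.mirror.attr = swapAttr T.attr := by
  induction T with
  | strand => rfl
  | node w L T K ih =>
    rw [mirror, attr_node, attr_node, map_add, map_add, map_add, swapAttr_leftAttr,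
      swapAttr_rightAttr, ih, size_swapWeight, add_right_comm _ (rightAttr _) (leftAttr _)]
    rfl

lemma attr_graftRight {T U : BTree I J} {i : ℕ} {S : XTree I}
    (h : T.graftRight i S = some U) : U.attr + (0, 1, 0, 1) = T.attr + rightAttr S.attr := by
  rw [graftRight_eq] at h
  obtain ⟨V, hV, rfl⟩ := Option.map_eq_some_iff.1 h
  have := congrArg swapAttr (attr_graftLeft hV)
  rwa [map_add, map_add, swapAttr_leftAttr, ← attr_mirror, ← attr_mirror, mirror_mirror] at this

lemma rightInputs_graftRight {T U : BTree I J} {i : ℕ} {S : XTree I}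
    (h : T.graftRight i S = some U) : U.rightInputs + 1 = T.rightInputs + S.inputs := by
  simpa [attr, rightAttr, XTree.attr] using congrArg (fun a => a.2.1) (attr_graftRight h)

lemma leftInputs_graftRight {T U : BTree I J} {i : ℕ} {S : XTree I}
    (h : T.graftRight i S = some U) : U.leftInputs = T.leftInputs := by
  simpa [attr, rightAttr, XTree.attr] using congrArg fst (attr_graftRight h)

lemma stable_graftRight {T U : BTree I J} {i : ℕ} {S : XTree I}
    (h : T.graftRight i S = some U) (hT : T.Stable) (hS : S.Stable) : U.Stable := by
  grind [graftRight_eq, map_eq_some_iff, stable_mirror, stable_graftLeft]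

/-- The contribution of a vertex of weight `w` on the spine. -/
def vertexAttr (w : I ⊎ J) : ℕ × ℕ × I ⊎ J × ℤ := (0, 0, w, 2 * (size w : ℤ) - 1)

/-- The contribution of a bounding edge. -/
def edgeAttr : ℕ × ℕ × I ⊎ J × ℤ := (0, 0, 0, 1)

/-- Splitting a vertex in two costs one unit of dimension, recorded by `edgeAttr`; this is the whole
numerical content of an edge expansion. -/
lemma vertexAttr_add (v w : I ⊎ J) :
    vertexAttr v + vertexAttr w + edgeAttr = vertexAttr (v + w) := by
  simp only [vertexAttr, edgeAttr, Prod.mk_add_mk, size_add, add_zero]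
  grind

lemma attr_of_mem_spineOp {w : I ⊎ J} {L : List (XTree J)} {T U : BTree I J}
    {K : List (XTree I)} (h : U ∈ (spineOp R w L T K).support) : U.attr =
      T.attr + leftAttr (attrs L) + rightAttr (attrs K) + vertexAttr w := by
  rw [spineOp] at h
  split_ifs at h
  · exact attr_of_join (mem_ofOption h)
  · simp at h

variable [DecidableEq I] [DecidableEq J] [CharP R 2]

lemma attr_of_mem_ins_leftOp {u : I ⊎ J} {l l' : List (XTree J)}
    (hl : ∀ x ∈ l, x.Stable) (h : l' ∈ (ins (leftOp R u) l).support) :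
    leftAttr (I := I) (attrs l') =
      leftAttr (attrs l) + vertexAttr u := by
  by_cases hu : u ∘ inl = 0
  · rw [show leftOp R u = treeOp R (u ∘ inr) from funext fun _ => if_pos hu] at h
    obtain ⟨a, b, c, x, rfl, hx, rfl⟩ := mem_support_ins h
    have h1 := attr_of_mem_treeOp (fun x hx y hy =>
      (XTree.attr_of_mem_bd (hl x (by simp [hx])) hy).1) hx
    have h2 : x.attr = attrs b + (0, u ∘ inr, 2 * (size (u ∘ inr) : ℤ) - 1) := by
      have h3 : ((0, 0, 1) : ℕ × (J → ℕ) × ℤ) + (0, 0, -1) = 0 := rfl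
      rw [← add_zero x.attr, ← h3, ← add_assoc, h1, add_assoc]
      rfl
    have h4 : leftAttr (I := I) ((0, u ∘ inr, 2 * (size (u ∘ inr) : ℤ) - 1) :
        ℕ × (J → ℕ) × ℤ) = vertexAttr u := by
      have h5 : size u = size (u ∘ inr) := by
        simp only [size, Fintype.sum_sum_type]
        rw [show ∑ i, u (inl i) = 0 from sum_eq_zero fun i _ => congrFun hu i, zero_add]
        rfl
      rw [vertexAttr, h5]
      simp only [leftAttr, AddMonoidHom.coe_mk, ZeroHom.coe_mk]
      rw [← eq_ofSnd_of_comp_inl hu]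
    simp only [attrs_append, attrs_cons, map_add, h2, h4]
    abel
  · rw [ins_eq_zero fun _ _ _ _ => by exact if_neg hu] at h
    simp at h

lemma attr_of_mem_ins_rightOp {u : I ⊎ J} {l l' : List (XTree I)}
    (hl : ∀ x ∈ l, x.Stable) (h : l' ∈ (ins (rightOp R u) l).support) :
    rightAttr (J := J) (attrs l') =
      rightAttr (attrs l) + vertexAttr u := by
  have := congrArg swapAttr (attr_of_mem_ins_leftOp hl h)
  rw [map_add, swapAttr_leftAttr, swapAttr_leftAttr] at this
  rw [this]
  congr 1
  rw [vertexAttr, vertexAttr, size_swapWeight]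
  aesop

lemma attr_of_mem_bd {T U : BTree I J} (hT : T.Stable) (hU : U ∈ (T.bd R).support) :
    U.attr + edgeAttr = T.attr := by
  classical
  induction T generalizing U with
  | strand => simp [bd] at hU
  | node w L T K ih =>
    have hv : (node w L T K).attr = T.attr + leftAttr (attrs (L.map .tree))
      + rightAttr (attrs (K.map .tree)) + vertexAttr w := attr_node _ _ _ _
    rw [bd_node _ hT.1, spineRel] at hU
    rw [hv]
    rcases mem_add hU with hU | hU
    · rcases mem_add hU with hU | hU
      · rcases mem_add hU with hU | hU
        · obtain ⟨p, hp, hU⟩ := mem_support_finsetSum _ hU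
          obtain ⟨L', hL', hU⟩ := mem_lin hU
          rw [attr_of_mem_spineOp hU, attr_of_mem_ins_leftOp (stable_map_left hT) hL',
            ← mem_anti.1 hp, ← vertexAttr_add]
          abel
        · obtain ⟨p, hp, hU⟩ := mem_support_finsetSum _ hU
          obtain ⟨L', hL', hU⟩ := mem_lin hU
          rw [attr_of_mem_spineOp hU, attr_of_mem_ins_rightOp (stable_map_right hT) hL',
            ← mem_anti.1 hp, ← vertexAttr_add]
          abel
      · obtain ⟨T', hT', hU⟩ := mem_lin hU
        rw [attr_of_mem_spineOp hU, ← ih hT.2.1 hT']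
        abel
    · obtain ⟨p, hp, hU⟩ := mem_support_finsetSum _ hU
      obtain ⟨a, a', ha, hU⟩ := mem_cutSum hU
      obtain ⟨b, b', hb, hU⟩ := mem_cutSum hU
      obtain ⟨T', hT', hU⟩ := mem_lin hU
      rw [attr_of_mem_spineOp hU, attr_of_mem_spineOp hT', ← mem_anti.1 hp,
        ← vertexAttr_add, ← ha, ← hb, attrs_append, attrs_append, map_add, map_add]
      abel

lemma leftInputs_of_mem_bd {T U : BTree I J} (hT : T.Stable) (hU : U ∈ (T.bd R).support) :
    U.leftInputs = T.leftInputs := by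
  simpa [attr, edgeAttr] using congrArg fst (attr_of_mem_bd hT hU)

lemma rightInputs_of_mem_bd {T U : BTree I J} (hT : T.Stable) (hU : U ∈ (T.bd R).support) :
    U.rightInputs = T.rightInputs := by
  simpa [attr, edgeAttr] using congrArg (fun a => a.2.1) (attr_of_mem_bd hT hU)

end AttrBd

/-! ### The Leibniz rule for bimodule trees -/

section Leibniz

variable {R : Type*} [CommRing R] {I J : Type} [Fintype I] [Fintype J]

lemma lin_graftLeft_spineOp (w : I ⊎ J) (L : List (XTree J)) (T : BTree I J)
    (K : List (XTree I)) (i : ℕ) (S : XTree J) :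
    lin R (fun U => ofOption R (U.graftLeft i S)) (spineOp R w L T K) =
      if i < T.leftInputs then lin R (fun T' => spineOp R w L T' K) (ofOption R (T.graftLeft i S))
      else lin R (fun L' => spineOp R w L' T K)
        (ofOption R (graftForest L (i - T.leftInputs) S)) := by
  by_cases hv : StableVertex (L.length + 1 + K.length) w
  · rw [spineOp, if_pos hv, ← ofOption_bind, bind_graftLeft_join]
    split_ifs
    · rw [ofOption_bind]
      exact lin_congr fun T' _ => (if_pos hv).symm
    · rw [ofOption_bind]
      refine lin_congr fun L' hL' => ?_
      rw [spineOp, length_graftForest (mem_ofOption hL'), if_pos hv]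
  · rw [spineOp, if_neg hv, map_zero]
    split_ifs
    · exact (lin_eq_zero fun T' _ => if_neg hv).symm
    · refine (lin_eq_zero fun L' hL' => ?_).symm
      rw [spineOp, length_graftForest (mem_ofOption hL'), if_neg hv]

/-- Cutting a forest after grafting into it. -/
lemma lin_cutSum_graftForest {ι : Type} [Fintype ι] {V : Type*} [AddCommGroup V] [Module R V]
    (l : List (XTree ι)) (F : List (XTree ι) → List (XTree ι) → V) {i : ℕ} (S : XTree ι)
    (hi : i < forestInputs l) :
    lin R (fun l' => cutSum l' F) (ofOption R (graftForest l i S)) =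
      cutSum l fun a a' => if i < forestInputs a then
        lin R (fun b => F b a') (ofOption R (graftForest a i S))
      else lin R (fun b => F a b)
        (ofOption R (graftForest a' (i - forestInputs a) S)) := by
  obtain ⟨l₁, x, l₂, j, rfl, rfl, hj⟩ := exists_split hi
  rw [graftForest_append_cons _ _ _ hj, ofOption_map, lin_lin, cutSum_append_cons]
  simp only [lin_one, cutSum_append_cons, lin_add, cutSum_lin]
  congr 1
  · refine cutSum_congr fun a c h => ?_
    rw [← h, forestInputs_append, if_neg (by omega),
      show forestInputs a + forestInputs c + j - forestInputs a =
        forestInputs c + j by omega, graftForest_append_cons _ _ _ hj, ofOption_map,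
      lin_lin]
    simp
  · refine cutSum_congr fun a c _ => ?_
    rw [if_pos (by simp; omega), graftForest_append_cons _ _ _ hj, ofOption_map, lin_lin]
    simp

variable [DecidableEq I] [DecidableEq J] [CharP R 2]

lemma lin_ins_leftOp_graftForest {l : List (XTree J)} (hs : ∀ x ∈ l, x.Stable)
    (S : XTree J) (u : I ⊎ J) {i : ℕ} (hi : i < forestInputs l) :
    lin R (ins (leftOp R u)) (ofOption R (graftForest l i S)) =
      lin R (fun l' => ofOption R (graftForest l' i S)) (ins (leftOp R u) l)
        + if u = 0 then lin R (fun S' => ofOption R (graftForest l i S')) (S.bd R)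
          else 0 := by
  by_cases hu : u ∘ inl = 0
  · rw [show leftOp R u = treeOp R (u ∘ inr) from funext fun _ => if_pos hu,
      lin_ins_graftForest hs S _ hi]
    grind [eq_ofSnd_of_comp_inl, ofSnd_eq_zero]
  · have h0 : ∀ l, ins (leftOp R u) l = 0 := fun l => ins_eq_zero fun _ _ _ _ => by exact if_neg hu
    have hu' : u ≠ 0 := by
      aesop
    simp_all [map_zero, if_neg, add_zero, lin_eq_zero]

/-- The Leibniz rule at the left inputs. -/
lemma lin_bd_graftLeft {T : BTree I J} (hT : T.Stable) {S : XTree J} (hS : S.Stable) {i : ℕ}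
    (hi : i < T.leftInputs) : lin R (bd R) (ofOption R (T.graftLeft i S)) =
      lin R (fun U => ofOption R (U.graftLeft i S)) (T.bd R)
        + lin R (fun S' => ofOption R (T.graftLeft i S')) (S.bd R) := by
  induction T generalizing i with
  | strand => simp [leftInputs] at hi
  | node w L T K ih =>
    rw [leftInputs] at hi
    have hL := stable_map_left hT
    have hw := hT.1
    have hsT := hT.2.1
    have e : ∀ S : XTree J, ofOption R ((node w L T K).graftLeft i S) =
        lin R (fun U => ofOption R (U.graftLeft i S))
          (spineOp R w (L.map .tree) T (K.map .tree)) := fun S => by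
      rw [spineOp_map, if_pos hw, lin_one]
    have hbl : ∀ U ∈ (T.bd R).support, U.leftInputs = T.leftInputs := fun U hU =>
      leftInputs_of_mem_bd hsT hU
    have hsl : ∀ (w : I ⊎ J) a b, ∀ U ∈ (spineOp R w a T b).support,
        U.leftInputs = T.leftInputs + forestInputs a := fun w a b U hU => by
      simpa [attr, leftAttr, rightAttr, vertexAttr, forestInputs] using
        congrArg fst (attr_of_mem_spineOp hU)
    rw [bd_node _ hw]
    simp only [e, lin_graftLeft_spineOp]
    generalize hL' : L.map tree = L' at *
    generalize K.map tree = K' at *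
    have hi : i < T.leftInputs + forestInputs L' := by
      rwa [← hL', forestInputs_map]
    by_cases h : i < T.leftInputs
    · simp only [h, if_true]
      rw [lin_lin, lin_congr fun T' hT' => lin_bd_spineOp w L'
        (stable_graftLeft (mem_ofOption hT') hsT hS) K']
      simp only [spineRel, map_add, map_sum, map_cutSum, lin_lin, lin_graftLeft_spineOp, h, if_true,
        lin_add, lin_sum, cutSum_lin]
      have hA := fun p : I ⊎ J × (I ⊎ J) => lin_comm (fun T' L'' => spineOp R p.1 L'' T' K')
        (ofOption R (T.graftLeft i S)) (ins (leftOp R p.2) L')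
      have hB := fun p : I ⊎ J × (I ⊎ J) => lin_comm (fun T' L'' => spineOp R p.1 L' T' L'')
        (ofOption R (T.graftLeft i S)) (ins (rightOp R p.2) K')
      have hC : lin R (fun a => lin R (fun U => spineOp R w L' U K') (bd R a))
          (ofOption R (T.graftLeft i S)) = lin R (fun U => if i < U.leftInputs then
            lin R (fun T' => spineOp R w L' T' K')
          (ofOption R (U.graftLeft i S)) else lin R (fun L'' => spineOp R w L'' U K')
          (ofOption R (graftForest L' (i - U.leftInputs) S))) (T.bd R) + lin R (fun S' =>
            lin R (fun U => spineOp R w L' U K') (ofOption R (T.graftLeft i S'))) (S.bd R) := by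
        rw [lin_congr (x := T.bd R) fun U hU => by rw [hbl U hU, if_pos h], ← lin_lin, ih hsT h,
          map_add, lin_lin, lin_lin]
      -- After splitting on the spine, `T` sits in the upper vertex and its inputs still come first,
      -- so the input `i` belongs to the upper vertex for every cut.
      have hM : ∀ p ∈ anti w, cutSum L' (fun a c => cutSum K' fun b d => lin R (fun U =>
          if i < U.leftInputs then lin R (fun T' => spineOp R p.1 c T' d)
            (ofOption R (U.graftLeft i S))
          else lin R (fun L' => spineOp R p.1 L' U d)
            (ofOption R (graftForest c (i - U.leftInputs) S))) (spineOp R p.2 a T b)) =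
          cutSum L' fun a c => cutSum K' fun b d => lin R (fun T' => lin R (fun U =>
            spineOp R p.1 c U d) (spineOp R p.2 a T' b)) (ofOption R (T.graftLeft i S)) :=
        fun p _ => cutSum_congr fun a c _ => cutSum_congr fun b d _ => by
          rw [lin_congr (x := spineOp R p.2 a T b) fun U hU => by
            rw [hsl _ _ _ U hU, if_pos (by omega)], ← lin_lin, lin_graftLeft_spineOp, if_pos h,
            lin_lin]
      simp only [hA, hB]
      rw [hC, sum_congr rfl hM]
      abel
    · simp only [h, if_false]
      rw [lin_lin, lin_congr fun L'' _ => lin_bd_spineOp w L'' hsT K']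
      have hj : i - T.leftInputs < forestInputs L' := by omega
      simp only [spineRel, map_add, map_sum, map_cutSum, lin_lin, lin_graftLeft_spineOp, h, if_false,
        lin_add, lin_sum]
      simp only [← lin_lin (spineOp R w · T K'), ← lin_lin (spineOp R _ · T K')]
      simp only [lin_ins_leftOp_graftForest hL S _ hj, map_add, sum_add_distrib]
      have hA : ∑ p ∈ anti w, lin R (fun L'' => spineOp R p.1 L'' T K')
          (if p.2 = 0 then lin R (fun S' => ofOption R (graftForest L' (i - T.leftInputs) S'))
            (S.bd R) else 0) = lin R (fun L'' => spineOp R w L'' T K')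
          (lin R (fun S' => ofOption R (graftForest L' (i - T.leftInputs) S')) (S.bd R)) := by
        rw [← anti_ite_snd w fun u => lin R (fun L'' => spineOp R u L'' T K')
          (lin R (fun S' => ofOption R (graftForest L' (i - T.leftInputs) S')) (S.bd R))]
        grind
      have hB := fun p : I ⊎ J × (I ⊎ J) => lin_comm (fun L'' K'' =>
        spineOp R p.1 L'' T K'') (ofOption R (graftForest L' (i - T.leftInputs) S))
        (ins (rightOp R p.2) K')
      have hC : lin R (fun U => if i < U.leftInputs then
            lin R (fun T' => spineOp R w L' T' K')
          (ofOption R (U.graftLeft i S)) else lin R (fun L'' => spineOp R w L'' U K')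
          (ofOption R (graftForest L' (i - U.leftInputs) S))) (T.bd R) =
          lin R (fun L'' => lin R (fun U => spineOp R w L'' U K') (T.bd R))
            (ofOption R (graftForest L' (i - T.leftInputs) S)) := by
        rw [lin_comm]
        exact lin_congr fun U hU => by grind
      -- Now the input lies in the forest `L'`. Whether it goes to the upper or the lower of the two
      -- spine vertices depends on the cut, and `lin_cutSum_graftForest` makes the same distinction.
      have hM : ∀ p ∈ anti w, cutSum L' (fun a c => cutSum K' fun b d => lin R (fun U =>
          if i < U.leftInputs then lin R (fun T' => spineOp R p.1 c T' d)
            (ofOption R (U.graftLeft i S))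
          else lin R (fun L' => spineOp R p.1 L' U d)
            (ofOption R (graftForest c (i - U.leftInputs) S))) (spineOp R p.2 a T b)) =
          lin R (fun L'' => cutSum L'' fun a c => cutSum K' fun b d => lin R (fun U =>
            spineOp R p.1 c U d) (spineOp R p.2 a T b))
            (ofOption R (graftForest L' (i - T.leftInputs) S)) := by
        intro p _
        rw [lin_cutSum_graftForest _ _ _ hj]
        refine cutSum_congr fun a c _ => ?_
        by_cases ha : i - T.leftInputs < forestInputs a
        · rw [if_pos ha, cutSum_lin]
          refine cutSum_congr fun b d _ => ?_
          rw [lin_congr (x := spineOp R p.2 a T b) fun U hU => by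
            rw [hsl _ _ _ U hU, if_pos (by omega)], ← lin_lin, lin_graftLeft_spineOp, if_neg h,
            lin_lin]
        · rw [if_neg ha, cutSum_lin]
          refine cutSum_congr fun b d _ => ?_
          rw [lin_comm]
          refine lin_congr fun U hU => ?_
          grind
      simp only [hB]
      rw [hA, hC, sum_congr rfl hM]
      abel

/-- The Leibniz rule at the right inputs. -/
lemma lin_bd_graftRight {T : BTree I J} (hT : T.Stable) {S : XTree I} (hS : S.Stable) {i : ℕ}
    (hi : i < T.rightInputs) : lin R (bd R) (ofOption R (T.graftRight i S)) =
      lin R (fun U => ofOption R (U.graftRight i S)) (T.bd R)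
        + lin R (fun S' => ofOption R (T.graftRight i S')) (S.bd R) := by
  have h := congrArg (mapDomain mirror)
    (lin_bd_graftLeft (R := R) (stable_mirror.2 hT) hS (i := i) (by simpa using hi))
  simp only [bd_mirror hT, map_eq_lin, map_add, lin_lin, lin_one] at h
  simp only [graftRight_eq, ofOption_map, lin_lin, lin_one]
  grind [lin_congr, bd_mirror, stable_graftLeft, mem_ofOption, stable_mirror, map_eq_lin]

end Leibniz

/-! ### Joining along the spine -/

section Plug

variable {R : Type*} [CommRing R] {I J : Type}

@[simp] lemma plug_strand (T : BTree I J) : T.plug strand = T := by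
  induction T with
  | strand => rfl
  | node w L T K ih => rw [plug, ih]

lemma plug_assoc (T U V : BTree I J) : (T.plug U).plug V = T.plug (U.plug V) := by
  induction T with
  | strand => rfl
  | node w L T K ih => simp [plug, ih]

lemma stable_plug {T U : BTree I J} (hT : T.Stable) (hU : U.Stable) : (T.plug U).Stable := by
  induction T with
  | strand => exact hU
  | node w L T K ih => exact ⟨hT.1, ih hT.2.1, hT.2.2.1, hT.2.2.2⟩

lemma mirror_plug (T U : BTree I J) : (T.plug U).mirror = T.mirror.plug U.mirror := by
  induction T with
  | strand => rfl
  | node w L T K ih => simp [plug, mirror, ih]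

lemma centralJoin_append (l m : List (BTree I J)) :
    centralJoin (l ++ m) = (centralJoin m).plug (centralJoin l) := by
  have key : ∀ (m : List (BTree I J)) (U : BTree I J),
      m.foldl (fun acc T => T.plug acc) U = (centralJoin m).plug U := by
    intro m
    induction m with
    | nil => intro U; rfl
    | cons T m ih =>
      grind [centralJoin, plug, plug_strand, List.foldl_cons, plug_assoc]
  rw [centralJoin, List.foldl_append, key]
  rfl

@[simp] lemma centralJoin_nil : centralJoin ([] : List (BTree I J)) = strand := rfl

lemma centralJoin_cons (T : BTree I J) (m : List (BTree I J)) :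
    centralJoin (T :: m) = (centralJoin m).plug T := by
  rw [← List.singleton_append, centralJoin_append]
  simp [centralJoin]

lemma stable_centralJoin {l : List (BTree I J)} (h : ∀ T ∈ l, T.Stable) :
    (centralJoin l).Stable := by
  induction l with
  | nil => trivial
  | cons T l ih =>
    simp_all [centralJoin_cons, stable_plug]

variable [Fintype I] [Fintype J]

lemma attr_plug (T U : BTree I J) : (T.plug U).attr = T.attr + U.attr := by
  induction T with
  | strand => rw [attr_strand, zero_add, plug]
  | node w L T K ih =>
    grind [plug, attr_node]

lemma attr_centralJoin (l : List (BTree I J)) : (centralJoin l).attr = (l.map attr).sum := by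
  induction l with
  | nil => rfl
  | cons T l ih => rw [centralJoin_cons, attr_plug, ih, map_cons, sum_cons, add_comm]

lemma join_plug (w : I ⊎ J) (L : List (XTree J)) (T U : BTree I J)
    (K : List (XTree I)) : join w L (T.plug U) K = (join w L T K).map (·.plug U) := by
  unfold join
  aesop

/-- The spine of `U` is nearer to the distinguished input, so the inputs of `U` are numbered before
those of `T`. -/
lemma graftLeft_plug (T U : BTree I J) (i : ℕ) (S : XTree J) :
    (T.plug U).graftLeft i S = if i < U.leftInputs then (U.graftLeft i S).map T.plug
      else (T.graftLeft (i - U.leftInputs) S).map (·.plug U) := by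
  have hl : ∀ T : BTree I J, (T.plug U).leftInputs = T.leftInputs + U.leftInputs := fun T => by
    simpa [attr] using congrArg fst (attr_plug T U)
  induction T with
  | strand =>
    split_ifs with h
    · aesop
    grind [plug, graftLeft_eq_none]
  | node w L T K ih =>
    rw [plug, graftLeft_node, graftLeft_node, ih, hl]
    by_cases h : i < U.leftInputs
    · rw [if_pos (by omega), if_pos h, if_pos h, Option.bind_map]
      simp only [Function.comp_def, join_map]
      cases U.graftLeft i S <;> rfl
    · rw [if_neg h, if_neg h]
      by_cases h' : i < T.leftInputs + U.leftInputs
      · rw [if_pos h', if_pos (by omega), Option.bind_map, mbind]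
        simp [bcongr, join_plug]
      · rw [if_neg h', if_neg (by omega), mbind,
          show i - (T.leftInputs + U.leftInputs) = i - U.leftInputs - T.leftInputs by omega]
        simp [bcongr, join_plug]

lemma graftRight_plug (T U : BTree I J) (i : ℕ) (S : XTree I) :
    (T.plug U).graftRight i S = if i < U.rightInputs then (U.graftRight i S).map T.plug
      else (T.graftRight (i - U.rightInputs) S).map (·.plug U) := by
  rw [graftRight_eq, mirror_plug, graftLeft_plug, leftInputs_mirror]
  split_ifs
  · rw [graftRight_eq, Option.map_map, Option.map_map]
    congr 1
    funext V
    simp [mirror_plug]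
  · rw [graftRight_eq, Option.map_map, Option.map_map]
    congr 1
    funext V
    simp [mirror_plug]

lemma spineOp_plug (w : I ⊎ J) (L : List (XTree J)) (T U : BTree I J)
    (K : List (XTree I)) : spineOp R w L (T.plug U) K =
      (spineOp R w L T K).mapDomain (·.plug U) := by
  grind [spineOp, join_plug, ofOption_map, map_eq_lin]

variable [DecidableEq I] [DecidableEq J] [CharP R 2]

/-- Each expansion takes place at one vertex, which belongs either to `T` or to `U`. -/
lemma bd_plug {T U : BTree I J} (hT : T.Stable) (hU : U.Stable) : (T.plug U).bd R =
    (T.bd R).mapDomain (·.plug U) + (U.bd R).mapDomain T.plug := by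
  induction T with
  | strand =>
    simp only [plug, bd, mapDomain_zero, zero_add]
    exact Finsupp.mapDomain_id.symm
  | node w L T K ih =>
    rw [plug, bd_node _ hT.1, bd_node _ hT.1, spineRel, spineRel, ih hT.2.1]
    have e : lin R (fun V => spineOp R w (L.map .tree) (T.plug V) (K.map .tree)) (U.bd R) =
        (U.bd R).mapDomain (node w L T K).plug := by
      rw [map_eq_lin]
      refine lin_congr fun V _ => ?_
      rw [spineOp_map, if_pos hT.1, plug]
    have key : ∀ x y z t u : BTree I J →₀ R, x + y + (z + t) + u = x + y + z + u + t := by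
      intros
      abel
    rw [map_add, lin_mapDomain, lin_mapDomain, e, key]
    refine congrArg₂ (· + ·) ?_ rfl
    simp only [spineOp_plug, map_eq_lin, map_add, map_sum, map_cutSum, lin_lin, lin_one]

end Plug

end BTree

namespace BTree

/-! ### Contraction of edges at the spine -/

section Contract

variable {I J : Type} [Fintype I] [Fintype J]

/-- Contraction of an edge joining a spine vertex to its only right subtree, or else to its only left
subtree. -/
def rootContract (w : I ⊎ J) (L : List (WTree J)) (K : List (WTree I)) :
    Option (I ⊎ J × List (WTree J) × List (WTree I)) :=
  match K, L with
  | [.node u ds], L => if w ∘ inl = 0 then some (w + ofFst u, L, ds) else none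
  | K, [.node u ds] => if w = 0 ∧ K.length ≤ 1 then some (ofSnd u, ds, K) else none
  | _, _ => none

/-- Contraction of an edge at the first spine vertex, from the output on, which is not of the form
`Ψ_{a|b}^0` with `a, b ≤ 1`. -/
def contract : BTree I J → Option (BTree I J)
  | strand => none
  | node w L T K =>
    match rootContract w L K with
    | some q => some (node q.1 q.2.1 T q.2.2)
    | none => if w = 0 ∧ L.length ≤ 1 ∧ K.length ≤ 1 then
        (contract T).map fun U => node w L U K else none

/-- A spine vertex `Ψ_{a|b}^0` with `a, b ≤ 1` and leaves glued to its inputs. -/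
def Elementary (w : I ⊎ J) (L : List (WTree J)) (K : List (WTree I)) : Prop :=
  w = 0 ∧ (L = [] ∨ L = [.leaf]) ∧ (K = [] ∨ K = [.leaf])

/-- A spine vertex which arises by contraction. -/
def Reduced (w : I ⊎ J) (L : List (WTree J)) (K : List (WTree I)) : Prop :=
  StableVertex K.length (w ∘ inl) ∨
    w ∘ inl = 0 ∧ (K = [] ∨ K = [.leaf]) ∧ StableVertex L.length (w ∘ inr)

lemma rootContract_eq_some {w : I ⊎ J} {L : List (WTree J)} {K : List (WTree I)}
    {q : I ⊎ J × List (WTree J) × List (WTree I)} : rootContract w L K = some q ↔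
      (∃ u ds, K = [.node u ds] ∧ w ∘ inl = 0 ∧ (w + ofFst u, L, ds) = q) ∨
      ∃ u ds, L = [.node u ds] ∧ w = 0 ∧ (K = [] ∨ K = [.leaf]) ∧ (ofSnd u, ds, K) = q := by
  unfold rootContract
  split
  · simp
  · rename_i hK
    rcases K with _ | ⟨_ | ⟨u, ds⟩, _ | _⟩ <;> simp at hK ⊢
  simp_all

lemma sum_ext_zero {w : I ⊎ J} (h₁ : w ∘ inl = 0) (h₂ : w ∘ inr = 0) : w = 0 := by
  funext i
  cases i with
  | inl i => exact congrFun h₁ i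
  | inr i => exact congrFun h₂ i

lemma Reduced.not_elementary {w : I ⊎ J} {L : List (WTree J)} {K : List (WTree I)}
    (h : Reduced w L K) : ¬ (w = 0 ∧ L.length ≤ 1 ∧ K.length ≤ 1) := by
  rintro ⟨rfl, h1, h2⟩
  rcases h with (h | h) | ⟨-, -, h | h⟩
  · exact h rfl
  · omega
  · exact h rfl
  · omega

lemma Reduced.rootContract {w : I ⊎ J} {L : List (WTree J)} {K : List (WTree I)}
    (h : Reduced w L K) : rootContract w L K = none := by
  rw [Option.eq_none_iff_forall_ne_some]
  intro q hq
  rcases rootContract_eq_some.1 hq with ⟨u, ds, rfl, hw, -⟩ | ⟨u, ds, rfl, rfl, hK, -⟩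
  · rcases h with (h | h) | ⟨-, h | h, -⟩
    · exact h hw
    · simp at h
    · simp at h
    · simp at h
  · refine h.not_elementary ⟨rfl, by simp, ?_⟩
    grind

lemma Reduced.contract {w : I ⊎ J} {L : List (WTree J)} {K : List (WTree I)}
    (h : Reduced w L K) (T : BTree I J) : (node w L T K).contract = none := by
  rw [BTree.contract, h.rootContract]
  exact if_neg h.not_elementary

lemma Elementary.contract {w : I ⊎ J} {L : List (WTree J)} {K : List (WTree I)}
    (h : Elementary w L K) (T : BTree I J) :
    (node w L T K).contract = T.contract.map fun U => node w L U K := by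
  obtain ⟨rfl, rfl | rfl, rfl | rfl⟩ := h <;> simp [BTree.contract, BTree.rootContract]

lemma contract_of_rootContract {w : I ⊎ J} {L : List (WTree J)} {K : List (WTree I)}
    {q : I ⊎ J × List (WTree J) × List (WTree I)} (h : rootContract w L K = some q)
    (T : BTree I J) : (node w L T K).contract = some (node q.1 q.2.1 T q.2.2) := by
  rw [contract, h]

/-- These are the three roles in the matching: an elementary vertex is passed over and the matching
goes on above it, a reduced vertex is the result of a contraction, and at any other vertex an edge
is contracted. -/
lemma elementary_or_reduced (w : I ⊎ J) (L : List (WTree J)) (K : List (WTree I)) :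
    Elementary w L K ∨ Reduced w L K ∨ ∃ q, rootContract w L K = some q := by
  simp only [rootContract_eq_some]
  by_cases h : StableVertex K.length (w ∘ inl)
  · exact .inr (.inl (.inl h))
  have h1 : w ∘ inl = 0 := by
    by_contra h1
    exact h (.inl h1)
  have h2 : ¬ 2 ≤ K.length := fun h2 => h (.inr h2)
  by_cases hK : K = [] ∨ K = [.leaf]
  · by_cases h' : StableVertex L.length (w ∘ inr)
    · exact .inr (.inl (.inr ⟨h1, hK, h'⟩))
    have h3 : w = 0 := sum_ext_zero h1 (by
      by_contra h1
      exact h' (.inl h1))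
    have h4 : ¬ 2 ≤ L.length := fun h2 => h' (.inr h2)
    rcases L with _ | ⟨_ | ⟨u, ds⟩, _ | ⟨t, L⟩⟩
    · exact .inl ⟨h3, .inl rfl, hK⟩
    · exact .inl ⟨h3, .inr rfl, hK⟩
    · simp at h4
    · simp_all
    · simp at h4
  · rcases K with _ | ⟨_ | ⟨u, ds⟩, _ | ⟨t, K⟩⟩
    · simp at hK
    · simp at hK
    · simp at h2
    · simp_all
    · simp at h2

lemma ofSnd_comp_inl (u : J → ℕ) : (ofSnd u : I ⊎ J) ∘ inl = 0 := rfl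

lemma add_ofFst_comp_inl {w : I ⊎ J} (h : w ∘ inl = 0) (u : I → ℕ) :
    (w + ofFst u) ∘ inl = u := by
  funext i
  simpa [ofFst] using congrFun h i

lemma add_ofFst_inj {w w' : I ⊎ J} (h : w ∘ inl = 0) (h' : w' ∘ inl = 0)
    {u u' : I → ℕ} (e : w + ofFst u = w' + ofFst u') : w = w' ∧ u = u' := by
  have hu : u = u' := by rw [← add_ofFst_comp_inl h u, e, add_ofFst_comp_inl h']
  simp_all

lemma reduced_of_rootContract {w : I ⊎ J} {L : List (WTree J)} {K : List (WTree I)}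
    (hL : StableList L) (hK : StableList K)
    {q : I ⊎ J × List (WTree J) × List (WTree I)} (h : rootContract w L K = some q) :
    Reduced q.1 q.2.1 q.2.2 := by
  rcases rootContract_eq_some.1 h with ⟨u, ds, rfl, hw, rfl⟩ | ⟨u, ds, rfl, rfl, hK', rfl⟩
  · refine .inl ?_
    rw [add_ofFst_comp_inl hw]
    exact hK.1.1
  · exact .inr ⟨rfl, hK', hL.1.1⟩

/-- Two contractions of the same kind are undone uniquely: all right subtrees and the whole weight
in the first weight space, respectively all left subtrees and the whole weight, are moved to a new
vertex. Contractions of different kinds cannot agree: a left one leaves no weight in the first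
weight space and at most a leaf on the right, which the vertex contracted on the right could not
have been by stability. -/
lemma rootContract_injective {w w' : I ⊎ J} {L L' : List (WTree J)} {K K' : List (WTree I)}
    (hK : StableList K) (hK' : StableList K')
    {q : I ⊎ J × List (WTree J) × List (WTree I)} (h : rootContract w L K = some q)
    (h' : rootContract w' L' K' = some q) : w = w' ∧ L = L' ∧ K = K' := by
  have key : ∀ {u : I → ℕ} {ds : List (WTree I)}, StableVertex ds.length u → u = 0 →
      (ds = [] ∨ ds = [.leaf]) → False := by
    rintro u ds (h | h) rfl (rfl | rfl)
    · exact h rfl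
    · exact h rfl
    · simp at h
    · simp at h
  rcases rootContract_eq_some.1 h with ⟨u, ds, rfl, hw, rfl⟩ | ⟨u, ds, rfl, rfl, hs, rfl⟩ <;>
    rcases rootContract_eq_some.1 h' with ⟨u', ds', rfl, hw', e⟩ | ⟨u', ds', rfl, rfl, hs', e⟩ <;>
    simp only [Prod.mk.injEq] at e
  · grind [add_ofFst_inj]
  · obtain ⟨e1, rfl, rfl⟩ := e
    refine (key hK.1.1 ?_ hs').elim
    rw [← add_ofFst_comp_inl hw u, ← e1, ofSnd_comp_inl]
  · obtain ⟨e1, rfl, rfl⟩ := e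
    refine (key hK'.1.1 ?_ hs).elim
    rw [← add_ofFst_comp_inl hw' u', e1, ofSnd_comp_inl]
  · obtain ⟨e1, rfl, rfl⟩ := e
    refine ⟨rfl, ?_, rfl⟩
    rw [show u = u' from congrArg (· ∘ inr) e1.symm]

lemma contract_stable {T U : BTree I J} (hT : T.Stable) (h : T.contract = some U) :
    U.Stable ∧ U.attr = T.attr + edgeAttr := by
  induction T generalizing U with
  | strand => simp [contract] at h
  | node w L T K ih =>
    rcases elementary_or_reduced w L K with he | hr | ⟨q, hq⟩
    · rw [he.contract, map_eq_some_iff] at h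
      obtain ⟨V, hV, rfl⟩ := h
      obtain ⟨h1, h2⟩ := ih hT.2.1 hV
      refine ⟨⟨hT.1, h1, hT.2.2⟩, ?_⟩
      grind [attr_node]
    · rw [hr.contract] at h
      cases h
    · rw [contract_of_rootContract hq] at h
      cases h
      have h3 : ∀ u : I → ℕ, rightAttr (J := J) (0, u, 2 * (size u : ℤ) - 1) =
          vertexAttr (ofFst u) := fun u => by
        simp [rightAttr, vertexAttr, size, ofFst]
      have h4 : ∀ u : J → ℕ, leftAttr (I := I) (0, u, 2 * (size u : ℤ) - 1) =
          vertexAttr (ofSnd u) := fun u => by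
        simp [leftAttr, vertexAttr, size, ofSnd]
      rcases rootContract_eq_some.1 hq with ⟨u, ds, rfl, hw, rfl⟩ | ⟨u, ds, rfl, rfl, hs, rfl⟩
      · refine ⟨⟨?_, hT.2.1, hT.2.2.1, hT.2.2.2.1.2⟩, ?_⟩
        · rcases hT.2.2.2.1.1 with h | h
          · refine .inl fun e => h ?_
            rw [← add_ofFst_comp_inl hw u]
            simp_all
          · exact .inr (by simp only; omega)
        · change (node (w + ofFst u) L T ds).attr = _
          rw [attr_node, attr_node, List.map_singleton, attrs_cons, XTree.attr_node,
            attrs_nil, add_zero, map_add, h3, ← vertexAttr, ← vertexAttr, ← vertexAttr_add]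
          abel
      · refine ⟨⟨?_, hT.2.1, hT.2.2.1.1.2, hT.2.2.2⟩, ?_⟩
        · rcases hT.2.2.1.1.1 with h | h
          · exact .inl fun e => h (ofSnd_eq_zero.1 e)
          · exact .inr (by simp only; omega)
        · change (node (ofSnd u) ds T K).attr = _
          rw [attr_node, attr_node, List.map_singleton, attrs_cons, XTree.attr_node,
            attrs_nil, add_zero, map_add, h4, ← vertexAttr, ← vertexAttr]
          conv_lhs => rw [← zero_add (ofSnd u), ← vertexAttr_add]
          abel

/-- The part of the tree above the first spine vertex. -/
def above : BTree I J → BTree I J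
  | strand => strand
  | node _ _ T _ => T

/-- A contraction at the root leaves a reduced root, one higher up leaves an elementary root, so the
place of contraction can be read off. For two contractions at the root `rootContract_injective`
applies; for two above it, equality of `above` identifies the trees once their elementary roots
agree. -/
lemma contract_injective {T U V : BTree I J} (hT : T.Stable) (hU : U.Stable)
    (h : T.above = U.above) (hTV : T.contract = some V) (hUV : U.contract = some V) : T = U := by
  have key : ∀ {w w' : I ⊎ J} {L L' : List (WTree J)} {K K' : List (WTree I)}
      {T V : BTree I J}, (node w L T K).Stable → Elementary w' L' K' →
      (node w L T K).contract = some V → (T.contract.map fun U => node w' L' U K') = some V →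
      w = w' ∧ L = L' ∧ K = K' := by
    intro w w' L L' K K' T V hs he h h'
    rcases elementary_or_reduced w L K with he' | hr | ⟨q, hq⟩
    · rw [he'.contract] at h
      aesop
    · rw [hr.contract] at h
      cases h
    · rw [contract_of_rootContract hq] at h
      cases h
      obtain ⟨Y, -, e⟩ := Option.map_eq_some_iff.1 h'
      cases e
      refine ((reduced_of_rootContract hs.2.2.1 hs.2.2.2 hq).not_elementary ⟨he.1, ?_, ?_⟩).elim
      · rcases he.2.1 with h | h <;> simp [h]
      · rcases he.2.2 with h | h <;> simp [h]
  cases T with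
  | strand => simp [contract] at hTV
  | node w L T K =>
    cases U with
    | strand => simp [contract] at hUV
    | node w' L' U K' =>
      obtain rfl : T = U := h
      rcases elementary_or_reduced w L K with he | hr | ⟨q, hq⟩
      · obtain ⟨rfl, rfl, rfl⟩ := key hU he hUV (he.contract T ▸ hTV)
        rfl
      · rw [hr.contract] at hTV
        cases hTV
      · rcases elementary_or_reduced w' L' K' with he' | hr' | ⟨q', hq'⟩
        · obtain ⟨rfl, rfl, rfl⟩ := key hT he' hTV (he'.contract T ▸ hUV)
          rfl
        · rw [hr'.contract] at hUV
          cases hUV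
        · rw [contract_of_rootContract hq] at hTV
          rw [contract_of_rootContract hq', ← hTV] at hUV
          simp only [Option.some.injEq, node.injEq] at hUV
          obtain rfl : q' = q := Prod.ext hUV.1 (Prod.ext hUV.2.1 hUV.2.2.2)
          obtain ⟨rfl, rfl, rfl⟩ := rootContract_injective hT.2.2.2 hU.2.2.2 hq hq'
          rfl

/-- A vertex created on the right is contracted again exactly if it took all right subtrees and left
no weight in the first weight space behind. Otherwise the root is reduced already. -/
lemma contract_append_right (v : I ⊎ J) (L : List (WTree J)) (T : BTree I J)
    (K₁ K₂ ds : List (WTree I)) (u : I → ℕ) :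
    (node v L T (K₁ ++ .node u ds :: K₂)).contract =
      if v ∘ inl = 0 ∧ K₁ = [] ∧ K₂ = [] then some (node (v + ofFst u) L T ds) else none := by
  split_ifs with h
  · simp_all [contract_of_rootContract, rootContract_eq_some]
  · refine Reduced.contract (.inl ?_) T
    by_cases hv : v ∘ inl = 0
    · refine .inr ?_
      rcases K₁ with _ | ⟨_, K₁⟩ <;> rcases K₂ with _ | ⟨_, K₂⟩ <;> (simp_all; try omega)
    · exact .inl hv

lemma contract_append_left (v : I ⊎ J) (L₁ L₂ ds : List (WTree J)) (u : J → ℕ)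
    (T : BTree I J) {K : List (WTree I)} (hK : K = [] ∨ K = [.leaf]) (hv : v ∘ inl = 0) :
    (node v (L₁ ++ .node u ds :: L₂) T K).contract =
      if v ∘ inr = 0 ∧ L₁ = [] ∧ L₂ = [] then some (node (v + ofSnd u) ds T K) else none := by
  split_ifs with h
  · obtain ⟨h, rfl, rfl⟩ := h
    obtain rfl := sum_ext_zero hv h
    rw [zero_add]
    exact contract_of_rootContract (rootContract_eq_some.2 (.inr ⟨u, ds, rfl, rfl, hK, rfl⟩)) T
  · refine Reduced.contract (.inr ⟨hv, hK, ?_⟩) T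
    by_cases hv : v ∘ inr = 0
    · refine .inr ?_
      rcases L₁ with _ | ⟨_, L₁⟩ <;> rcases L₂ with _ | ⟨_, L₂⟩ <;> (simp_all; try omega)
    · exact .inl hv

end Contract

end BTree

namespace BTree

-- The contraction homotopy against expansions beside the spine

section Splits

variable (R : Type*) [CommRing R] {I J : Type} [Fintype I] [Fintype J] [DecidableEq I]
  [DecidableEq J]

/-- The edge expansions of a spine vertex whose new edge lies right of the spine. -/
def splitRight (w : I ⊎ J) (L : List (WTree J)) (T : BTree I J) (K : List (WTree I)) :
    BTree I J →₀ R :=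
  ∑ w' ∈ Icc 0 (w ∘ inl), ∑ a ∈ range (K.length + 1),
    ∑ b ∈ range (K.length - a + 1),
      if StableVertex b w' ∧
          StableVertex (L.length + 1 + (K.length - b + 1)) (w - ofFst w') then
        single (node (w - ofFst w') L T
          (K.take a ++ .node w' ((K.drop a).take b) :: K.drop (a + b))) 1
      else 0

/-- The edge expansions of a spine vertex whose new edge lies on the spine. -/
def splitMiddle (w : I ⊎ J) (L : List (WTree J)) (T : BTree I J) (K : List (WTree I)) :
    BTree I J →₀ R :=
  ∑ w' ∈ Icc 0 w, ∑ a ∈ range (L.length + 1), ∑ b ∈ range (K.length + 1),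
      if StableVertex (a + 1 + b) w' ∧
          StableVertex (L.length - a + 1 + (K.length - b)) (w - w') then
        single
          (node (w - w') (L.drop a) (node w' (L.take a) T (K.take b)) (K.drop b)) 1
      else 0

/-- The edge expansions of `node w L T K` at and above the inputs of the root vertex other than the
spine. -/
def sideBd (w : I ⊎ J) (L : List (WTree J)) (T : BTree I J) (K : List (WTree I)) :
    BTree I J →₀ R :=
  splitLeft R w L T K + splitRight R w L T K
    + (bdList R L).mapDomain (fun L' => node w L' T K)
    + (bdList R K).mapDomain (fun K' => node w L T K')

variable {R}

lemma bd_node_eq_sideBd (w : I ⊎ J) (L : List (WTree J)) (T : BTree I J)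
    (K : List (WTree I)) : (node w L T K).bd R = sideBd R w L T K
      + (T.bd R).mapDomain (fun U => node w L U K) + splitMiddle R w L T K := by
  rw [bd, show splitSpine R w L T K = splitLeft R w L T K + splitRight R w L T K
    + splitMiddle R w L T K from rfl, sideBd]
  abel

lemma bdList_leaf {ι : Type} [Fintype ι] [DecidableEq ι] {K : List (WTree ι)}
    (hK : K = [] ∨ K = [.leaf]) : bdList R K = 0 := by
  rcases hK with rfl | rfl <;> simp [bdList, WTree.bd]

lemma mem_support_ite_single {α : Type*} {p : Prop} [Decidable p] {a b : α}
    (h : b ∈ (if p then single a (1 : R) else 0).support) : p ∧ b = a := by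
  grind [support_single_subset]

lemma mem_support_splitMiddle {w : I ⊎ J} {L : List (WTree J)} {T U : BTree I J}
    {K : List (WTree I)} (h : U ∈ (splitMiddle R w L T K).support) :
    ∃ v v', v + v' = w ∧ ∃ L₁ L₂, L₁ ++ L₂ = L ∧ ∃ K₁ K₂, K₁ ++ K₂ = K ∧
      StableVertex (L₁.length + 1 + K₁.length) v' ∧ StableVertex (L₂.length + 1 + K₂.length) v ∧
      U = node v L₂ (node v' L₁ T K₁) K₂ := by
  classical
  obtain ⟨w', hw', h⟩ := mem_support_finsetSum _ h
  obtain ⟨a, ha, h⟩ := mem_support_finsetSum _ h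
  obtain ⟨b, hb, h⟩ := mem_support_finsetSum _ h
  obtain ⟨hs, rfl⟩ := mem_support_ite_single h
  rw [mem_range] at ha hb
  have h1 : (L.take a).length = a := by simp; omega
  have h2 : (K.take b).length = b := by simp; omega
  refine ⟨_, w', tsub_add_cancel_of_le (mem_Icc.1 hw').2, _, _, take_append_drop a L, _,
    _, take_append_drop b K, ?_, ?_, rfl⟩
  · grind
  grind

lemma above_of_mem_sideBd {w : I ⊎ J} {L : List (WTree J)} {T U : BTree I J}
    {K : List (WTree I)} (h : U ∈ (sideBd R w L T K).support) : U.above = T := by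
  classical
  rcases mem_add h with h | h
  · rcases mem_add h with h | h
    · rcases mem_add h with h | h
      all_goals
        obtain ⟨w', hw', h⟩ := mem_support_finsetSum _ h
        obtain ⟨a, ha, h⟩ := mem_support_finsetSum _ h
        obtain ⟨b, hb, h⟩ := mem_support_finsetSum _ h
        obtain ⟨h, rfl⟩ := mem_support_ite_single h
        rfl
    · obtain ⟨L', -, rfl⟩ := mem_image.1 (mapDomain_support h)
      rfl
  · obtain ⟨L', -, rfl⟩ := mem_image.1 (mapDomain_support h)
    rfl

lemma splitLeft_eq_zero {w : I ⊎ J} {L : List (WTree J)} (T : BTree I J)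
    (K : List (WTree I)) (hw : w ∘ inr = 0) (hL : L.length ≤ 1) : splitLeft R w L T K = 0 := by
  refine sum_eq_zero fun w' hw' => sum_eq_zero fun a ha =>
    sum_eq_zero fun b hb => if_neg fun h => ?_
  rw [hw, Finset.Icc_self, mem_singleton] at hw'
  rw [mem_range] at hb
  rcases h.1 with h | h
  · exact h hw'
  · omega

lemma splitRight_eq_zero {w : I ⊎ J} (L : List (WTree J)) (T : BTree I J)
    {K : List (WTree I)} (hw : w ∘ inl = 0) (hK : K.length ≤ 1) : splitRight R w L T K = 0 := by
  refine sum_eq_zero fun w' hw' => sum_eq_zero fun a ha =>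
    sum_eq_zero fun b hb => if_neg fun h => ?_
  rw [hw, Finset.Icc_self, mem_singleton] at hw'
  rw [mem_range] at hb
  rcases h.1 with h | h
  · exact h hw'
  · omega

/-- A vertex off the spine would have weight zero and at most one input, hence be unstable, and
leaves have no expansions. -/
lemma Elementary.sideBd {w : I ⊎ J} {L : List (WTree J)} {K : List (WTree I)}
    (h : Elementary w L K) (T : BTree I J) : sideBd R w L T K = 0 := by
  obtain ⟨rfl, hL, hK⟩ := h
  rw [BTree.sideBd, splitLeft_eq_zero _ _ rfl, splitRight_eq_zero _ _ rfl, bdList_leaf hL,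
    bdList_leaf hK]
  · simp
  · grind
  grind

variable (R) in
/-- The linear extension of the contraction of edges at the spine. -/
def contractMap : (BTree I J →₀ R) →ₗ[R] (BTree I J →₀ R) := lin R fun T => ofOption R T.contract

lemma contractMap_ite {p : Prop} [Decidable p] (T : BTree I J) :
    contractMap R (if p then single T 1 else 0) = if p then ofOption R T.contract else 0 := by
  split_ifs
  · exact lin_one _ _
  · exact map_zero _

lemma contractMap_mapDomain_eq_zero {α : Type*} {f : α → BTree I J} {x : α →₀ R}
    (h : ∀ a ∈ x.support, (f a).contract = none) : contractMap R (x.mapDomain f) = 0 := by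
  simp_all [contractMap, lin_mapDomain, lin_eq_zero]

lemma StableVertex_of_bdList {ι : Type} [Fintype ι] [DecidableEq ι] {K K' : List (WTree ι)}
    {w : ι → ℕ} (h : K' ∈ (bdList R K).support) (hK : StableVertex K.length w) :
    StableVertex K'.length w := by
  rwa [length_of_mem_bdList h]

/-- Exactly one expansion beside the spine is contractible, and contracting it gives back the tree:
the one moving to the new vertex everything on the right if that is stable, and otherwise everything
on the left. All other expansions leave a reduced root. -/
lemma Reduced.contractMap_sideBd {w : I ⊎ J} {L : List (WTree J)} {K : List (WTree I)}
    (h : Reduced w L K) (T : BTree I J) :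
    contractMap R (sideBd R w L T K) = single (node w L T K) 1 := by
  rcases h with hK | ⟨hw, hK, hL⟩
  · have e1 : contractMap R (splitLeft R w L T K) = 0 := by
      simp only [splitLeft, map_sum, contractMap_ite]
      refine sum_eq_zero fun w' _ => sum_eq_zero fun a _ =>
        sum_eq_zero fun b _ => ?_
      rw [Reduced.contract (.inl _), ofOption_none, ite_self]
      exact hK
    have e2 : contractMap R (splitRight R w L T K) = single (node w L T K) 1 := by
      simp only [splitRight, map_sum, contractMap_ite, contract_append_right]
      -- The surviving term moves the full weight `w ∘ inl` and the block of all of `K`, starting at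
      -- position `0`.
      rw [sum_eq_single (w ∘ inl), sum_eq_single 0,
        sum_eq_single K.length]
      · have h1 : (w - ofFst (w ∘ inl)) ∘ inl = 0 := by
          funext i
          simp [ofFst]
        have h2 : w - ofFst (w ∘ inl) + ofFst (w ∘ inl) = w := by
          funext i
          cases i <;> simp [ofFst]
        rw [if_pos ⟨hK, .inr (by omega)⟩, if_pos ⟨h1, by simp, by simp⟩, h2]
        simp
      · intro b hb hb'
        rw [mem_range] at hb
        rw [if_neg (c := _ ∧ _ ∧ _), ofOption_none, ite_self]
        grind [List.drop_eq_nil_iff]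
      · simp
      · intro a ha ha'
        refine sum_eq_zero fun b hb => ?_
        aesop
      · simp
      · intro w' hw' hne
        refine sum_eq_zero fun a _ => sum_eq_zero fun b _ => ?_
        rw [if_neg (c := _ ∧ _ ∧ _), ofOption_none, ite_self]
        rintro ⟨h, -⟩
        refine hne (le_antisymm (mem_Icc.1 hw').2 fun i => ?_)
        have := congrFun h i
        simp_all [ofFst, Nat.sub_eq_zero_iff_le]
      simp
    rw [sideBd, map_add, map_add, map_add, e1, e2, contractMap_mapDomain_eq_zero,
      contractMap_mapDomain_eq_zero]
    · simp
    · exact fun K' hK' => Reduced.contract (.inl (StableVertex_of_bdList hK' hK)) T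
    · exact fun L' _ => Reduced.contract (.inl hK) T
  · have e1 : contractMap R (splitLeft R w L T K) = single (node w L T K) 1 := by
      have hv : ∀ w' : J → ℕ, (w - ofSnd w') ∘ inl = 0 := fun w' => by
        aesop
      simp only [splitLeft, map_sum, contractMap_ite, contract_append_left _ _ _ _ _ _ hK (hv _)]
      rw [sum_eq_single (w ∘ inr), sum_eq_single 0,
        sum_eq_single L.length]
      · have h1 : (w - ofSnd (w ∘ inr)) ∘ inr = 0 := by
          funext i
          simp [ofSnd]
        have h2 : w - ofSnd (w ∘ inr) + ofSnd (w ∘ inr) = w := by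
          funext i
          cases i <;> simp [ofSnd]
        rw [if_pos ⟨hL, .inr (by omega)⟩, if_pos ⟨h1, by simp, by simp⟩, h2]
        simp
      · intro b hb hb'
        rw [mem_range] at hb
        rw [if_neg (c := _ ∧ _ ∧ _), ofOption_none, ite_self]
        grind [List.drop_eq_nil_iff]
      · simp
      · intro a ha ha'
        refine sum_eq_zero fun b hb => ?_
        rw [mem_range] at ha
        rw [if_neg (c := _ ∧ _ ∧ _), ofOption_none, ite_self]
        aesop
      · simp
      · intro w' hw' hne
        refine sum_eq_zero fun a _ => sum_eq_zero fun b _ => ?_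
        rw [if_neg (c := _ ∧ _ ∧ _), ofOption_none, ite_self]
        rintro ⟨h, -⟩
        refine hne (le_antisymm (mem_Icc.1 hw').2 fun i => ?_)
        have := congrFun h i
        simp_all [ofSnd, Nat.sub_eq_zero_iff_le]
      simp
    rw [sideBd, map_add, map_add, map_add, e1, splitRight_eq_zero _ _ hw, bdList_leaf hK,
      contractMap_mapDomain_eq_zero]
    · simp
    · exact fun L' hL' => Reduced.contract (.inr ⟨hw, hK, StableVertex_of_bdList hL' hL⟩) T
    grind

end Splits

end BTree

/-! ### Reduction to words -/

/-- Where a partial map is injective, no cancellation can occur between images of different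
generators. -/
lemma eq_none_of_lin_injOn {R : Type*} [CommRing R] {α β : Type*} {f : α → Option β} {x : α →₀ R}
    (hf : ∀ a ∈ x.support, ∀ b ∈ x.support, ∀ c, f a = some c → f b = some c → a = b)
    (hx : lin R (fun a => ofOption R (f a)) x = 0) : ∀ a ∈ x.support, f a = none := by
  classical
  intro a ha
  rw [Option.eq_none_iff_forall_ne_some]
  intro c hc
  have h := DFunLike.congr_fun hx c
  rw [lin, linearCombination_apply, Finsupp.sum, finsetSum_apply,
    sum_eq_single a] at h
  · simp_all
  · intro b hb hne
    rw [Finsupp.smul_apply]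
    cases hfb : f b with
    | none => simp [ofOption]
    | some d =>
      have : d ≠ c := by
        grind
      aesop
  simp_all

/-- Every stable tree has an input or a vertex of nonzero weight. This makes `mass` drop strictly on
passing above a stable spine vertex. -/
lemma WTree.inputs_add_size_weight_pos {ι : Type} [Fintype ι] {t : WTree ι} (h : t.Stable) :
    0 < t.inputs + size t.weight := by
  induction t using WTree.ind with
  | leaf => simp [inputs]
  | node w cs ih =>
    rw [inputs, weight, size_add]
    rcases h.1 with hw | hc
    · grind [size, size_eq_zero]
    · rcases cs with _ | ⟨t, cs⟩
      · simp at hc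
      · have := ih t (by simp) h.2.1
        rw [inputsList, weightList, size_add]
        omega

lemma WTree.inputsList_add_size_weightList_pos {ι : Type} [Fintype ι] {l : List (WTree ι)}
    (h : StableList l) (hl : l ≠ []) : 0 < inputsList l + size (weightList l) := by
  cases l with
  | nil => exact (hl rfl).elim
  | cons t l =>
    have := WTree.inputs_add_size_weight_pos h.1
    rw [inputsList, weightList, size_add]
    omega

namespace BTree

section Words

variable {R : Type*} [CommRing R] [CharP R 2] {I J : Type} [Fintype I] [Fintype J]
  [DecidableEq I] [DecidableEq J]

/-- The number of inputs other than the distinguished one plus the size of the weight. -/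
def mass (T : BTree I J) : ℕ := T.leftInputs + T.rightInputs + size T.weight

lemma mass_eq_of_attr {T U : BTree I J} {d : ℤ} (h : U.attr + (0, 0, 0, d) = T.attr) :
    U.mass = T.mass := by
  simp_all [congrArg, fst, attr, mass]

/-- The new upper vertex is stable, so it takes weight or a side subtree with it, and the part above
the root grows. This drives the inner induction of `mem_reducible`. -/
lemma mass_lt_of_splitMiddle {w : I ⊎ J} {L : List (WTree J)} {T U : BTree I J}
    {K : List (WTree I)} (hs : (node w L T K).Stable)
    (h : U ∈ (splitMiddle R w L T K).support) : U.Stable ∧ T.mass < U.above.mass := by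
  obtain ⟨v, v', rfl, L₁, L₂, rfl, K₁, K₂, rfl, h1, h2, rfl⟩ := mem_support_splitMiddle h
  have hL := (stableList_iff _).1 hs.2.2.1
  have hK := (stableList_iff _).1 hs.2.2.2
  have hL₁ : StableList L₁ := (stableList_iff _).2 fun t ht => hL t (by simp [ht])
  have hK₁ : StableList K₁ := (stableList_iff _).2 fun t ht => hK t (by simp [ht])
  refine ⟨⟨h2, ⟨h1, hs.2.1, hL₁, hK₁⟩, (stableList_iff _).2 fun t ht => hL t (by simp [ht]),
    (stableList_iff _).2 fun t ht => hK t (by simp [ht])⟩, ?_⟩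
  have e : size (Sum.elim (weightList K₁) (weightList L₁) : I ⊎ J) =
      size (weightList K₁) + size (weightList L₁) := by
    simp [size]
  rw [above, mass, mass, leftInputs, rightInputs, weight, size_add, size_add, e]
  rcases h1 with h | h
  · grind [size, size_eq_zero]
  · by_cases hl : L₁ = []
    · have hk : K₁ ≠ [] := by
        grind
      have := WTree.inputsList_add_size_weightList_pos hK₁ hk
      omega
    · have := WTree.inputsList_add_size_weightList_pos hL₁ hl
      omega

lemma mass_above_le (T : BTree I J) : T.above.mass ≤ T.mass := by
  cases T with
  | strand => exact le_rfl
  | node w L T K =>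
    grind [above, mass, leftInputs, rightInputs, weight, size_add]

lemma mass_above_contract {T U : BTree I J} (hT : T.Stable) (h : T.contract = some U) :
    U.above.mass = T.above.mass := by
  cases T with
  | strand => cases h
  | node w L T K =>
    rcases elementary_or_reduced w L K with he | hr | ⟨q, hq⟩
    · rw [he.contract, map_eq_some_iff] at h
      obtain ⟨V, hV, rfl⟩ := h
      exact (mass_eq_of_attr (contract_stable hT.2.1 hV).2.symm).symm
    · rw [hr.contract] at h
      cases h
    · rw [contract_of_rootContract hq] at h
      cases h
      rfl

/-- A tree all of whose vertices are on the spine, of weight `0`, with at most one left and at most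
one right input. -/
def IsWord : BTree I J → Prop
  | strand => True
  | node w L T K => Elementary w L K ∧ T.IsWord

variable (R I J) in
/-- The linear combinations of stable trees. -/
def stableSpan : Submodule R (BTree I J →₀ R) := Finsupp.supported R R {T | T.Stable}

variable (R I J) in
/-- The linear combinations of words. -/
def wordSpan : Submodule R (BTree I J →₀ R) := Finsupp.supported R R {T | T.IsWord}

variable (R I J) in
/-- The sum of the identity and of the commutator of the differential with the contraction. -/
def wordMap : (BTree I J →₀ R) →ₗ[R] (BTree I J →₀ R) :=
  LinearMap.id + lin R (bd R) ∘ₗ contractMap R + contractMap R ∘ₗ lin R (bd R)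

lemma wordMap_apply (x : BTree I J →₀ R) :
    wordMap R I J x = x + lin R (bd R) (contractMap R x) + contractMap R (lin R (bd R) x) := rfl

lemma lin_bd_mem_stableSpan {x : BTree I J →₀ R} (hx : x ∈ stableSpan R I J) :
    lin R (bd R) x ∈ stableSpan R I J :=
  lin_mem fun _ hT => (Finsupp.mem_supported _ _).2 fun _ hU => stable_of_mem_bd (hx hT) hU

lemma contractMap_mem_stableSpan {x : BTree I J →₀ R} (hx : x ∈ stableSpan R I J) :
    contractMap R x ∈ stableSpan R I J :=
  lin_mem fun _ hT => (Finsupp.mem_supported _ _).2 fun _ hU =>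
    (contract_stable (hx hT) (mem_ofOption hU)).1

lemma wordMap_mem_stableSpan {x : BTree I J →₀ R} (hx : x ∈ stableSpan R I J) :
    wordMap R I J x ∈ stableSpan R I J :=
  add_mem (add_mem hx (lin_bd_mem_stableSpan (contractMap_mem_stableSpan hx)))
    (contractMap_mem_stableSpan (lin_bd_mem_stableSpan hx))

lemma lin_bd_lin_bd {x : BTree I J →₀ R} (hx : x ∈ stableSpan R I J) :
    lin R (bd R) (lin R (bd R) x) = 0 := by
  rw [lin_lin]
  exact lin_eq_zero fun T hT => lin_bd_bd (hx hT)

lemma wordMap_lin_bd {x : BTree I J →₀ R} (hx : x ∈ stableSpan R I J) :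
    wordMap R I J (lin R (bd R) x) = lin R (bd R) (wordMap R I J x) := by
  simp_all [wordMap_apply, map_add, lin_bd_lin_bd, contractMap_mem_stableSpan, map_zero, add_zero]

lemma iterate_wordMap_lin_bd (k : ℕ) {x : BTree I J →₀ R} (hx : x ∈ stableSpan R I J) :
    (wordMap R I J)^[k] (lin R (bd R) x) = lin R (bd R) ((wordMap R I J)^[k] x) := by
  induction k generalizing x with
  | zero => rfl
  | succ k ih =>
    simp_all [Function.iterate_succ_apply, wordMap_lin_bd, wordMap_mem_stableSpan]

lemma splitMiddle_of_elementary {L : List (WTree J)} {K : List (WTree I)} (T : BTree I J)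
    (hL : L = [] ∨ L = [.leaf]) (hK : K = [] ∨ K = [.leaf]) : splitMiddle R 0 L T K =
      if L ≠ [] ∧ K ≠ [] then single (node 0 [] (node 0 [.leaf] T []) [.leaf]) 1
        + single (node 0 [.leaf] (node 0 [] T [.leaf]) []) 1 else 0 := by
  have h : ∀ n : ℕ, StableVertex n (0 : I ⊎ J) ↔ 2 ≤ n := fun n => by simp [StableVertex]
  rcases hL with rfl | rfl <;> rcases hK with rfl | rfl <;>
    simp [splitMiddle, sum_range_succ, h, add_comm]

lemma Elementary.lin_bd {w : I ⊎ J} {L : List (WTree J)} {K : List (WTree I)}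
    (h : Elementary w L K) (x : BTree I J →₀ R) :
    lin R (bd R) (x.mapDomain fun T => node w L T K) =
      (lin R (bd R) x).mapDomain (fun T => node w L T K)
        + lin R (fun T => splitMiddle R w L T K) x := by
  rw [lin_mapDomain, map_eq_lin, lin_lin, ← lin_add]
  refine lin_congr fun T _ => ?_
  rw [bd_node_eq_sideBd, h.sideBd, zero_add, map_eq_lin]

lemma Elementary.contractMap {w : I ⊎ J} {L : List (WTree J)} {K : List (WTree I)}
    (h : Elementary w L K) (x : BTree I J →₀ R) :
    contractMap R (x.mapDomain fun T => node w L T K) =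
      (contractMap R x).mapDomain (fun T => node w L T K) := by
  rw [BTree.contractMap, lin_mapDomain, map_eq_lin, lin_lin]
  refine lin_congr fun T _ => ?_
  rw [h.contract, ofOption_map]

lemma Elementary.contractMap_splitMiddle {w : I ⊎ J} {L : List (WTree J)}
    {K : List (WTree I)} (h : Elementary w L K) (x : BTree I J →₀ R) :
    BTree.contractMap R (lin R (fun T => splitMiddle R w L T K) x) =
      lin R (fun T => splitMiddle R w L T K) (BTree.contractMap R x) := by
  obtain ⟨rfl, hL, hK⟩ := h
  simp only [splitMiddle_of_elementary _ hL hK]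
  by_cases hc : L ≠ [] ∧ K ≠ []
  · simp only [if_pos hc]
    rw [map_lin, BTree.contractMap, lin_lin]
    refine lin_congr fun T _ => ?_
    have e1 : Elementary (0 : I ⊎ J) [.leaf] [] := ⟨rfl, .inr rfl, .inl rfl⟩
    have e2 : Elementary (0 : I ⊎ J) [] [.leaf] := ⟨rfl, .inl rfl, .inr rfl⟩
    rw [map_add, lin_one, lin_one, e1.contract, e2.contract, e1.contract, e2.contract]
    cases T.contract <;> simp [ofOption]
  · simp only [if_neg hc, lin_zero, map_zero]

/-- Below an elementary root the contraction acts on the tree above, and the differential does so up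
to splittings of the root. These commute with the contraction, so they enter the commutator twice
and cancel. -/
lemma Elementary.wordMap {w : I ⊎ J} {L : List (WTree J)} {K : List (WTree I)}
    (h : Elementary w L K) (x : BTree I J →₀ R) :
    BTree.wordMap R I J (x.mapDomain fun T => node w L T K) =
      (BTree.wordMap R I J x).mapDomain (fun T => node w L T K) := by
  rw [wordMap_apply, wordMap_apply, h.contractMap, h.lin_bd, h.lin_bd, map_add, h.contractMap,
    h.contractMap_splitMiddle, mapDomain_add, mapDomain_add]
  have := add_self R
    (lin R (fun T => splitMiddle R w L T K) (BTree.contractMap R x))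
  grind

lemma IsWord.wordMap {T : BTree I J} (h : T.IsWord) :
    BTree.wordMap R I J (single T 1) = single T 1 := by
  induction T with
  | strand =>
    simp [wordMap_apply, lin_one, contractMap, contract, bd]
  | node w L T K ih =>
    have e : (single (node w L T K) (1 : R)) =
        (single T 1).mapDomain fun T => node w L T K := by
      simp
    rw [e, h.1.wordMap, ih h.2]

lemma wordMap_of_mem_wordSpan {x : BTree I J →₀ R} (hx : x ∈ wordSpan R I J) :
    wordMap R I J x = x := by
  conv_lhs => rw [← lin_single_id x]
  conv_rhs => rw [← lin_single_id x]
  rw [map_lin]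
  exact lin_congr fun T hT => IsWord.wordMap (hx hT)

lemma IsWord.bd {T : BTree I J} (h : T.IsWord) : T.bd R ∈ wordSpan R I J := by
  induction T with
  | strand => exact zero_mem _
  | node w L T K ih =>
    have h1 := h.1.lin_bd (single T (1 : R))
    rw [mapDomain_single, lin_one, lin_one, lin_one] at h1
    rw [h1]
    refine add_mem ?_ ?_
    · rw [map_eq_lin]
      exact lin_mem fun U hU => single_mem_supported _ _ (show IsWord (node w L U K) from ⟨h.1, ih h.2 hU⟩)
    · obtain ⟨⟨rfl, hL, hK⟩, hT⟩ := h
      rw [splitMiddle_of_elementary _ hL hK]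
      split_ifs
      · refine add_mem (single_mem_supported _ _ ?_) (single_mem_supported _ _ ?_)
        · exact ⟨⟨rfl, .inl rfl, .inr rfl⟩, ⟨rfl, .inr rfl, .inl rfl⟩, hT⟩
        · exact ⟨⟨rfl, .inr rfl, .inl rfl⟩, ⟨rfl, .inl rfl, .inr rfl⟩, hT⟩
      · exact zero_mem _

variable (R I J) in
/-- The elements taken to linear combinations of words by an iterate of `wordMap`. -/
def reducible : Submodule R (BTree I J →₀ R) where
  carrier := {x | ∃ k, (wordMap R I J)^[k] x ∈ wordSpan R I J}
  zero_mem' := ⟨0, zero_mem _⟩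
  add_mem' := by
    rintro x y ⟨k, hk⟩ ⟨l, hl⟩
    -- Words are fixed by `wordMap`, so the exponent may be increased to a common one.
    have key : ∀ (k l : ℕ) {x : BTree I J →₀ R},
        (wordMap R I J)^[k] x ∈ wordSpan R I J →
        (wordMap R I J)^[l + k] x ∈ wordSpan R I J := by
      simp_all [Function.iterate_add_apply, Function.iterate_fixed, wordMap_of_mem_wordSpan]
    refine ⟨k + l, ?_⟩
    rw [iterate_map_add]
    refine add_mem ?_ (key l k hl)
    grind
  smul_mem' := by
    rintro r x ⟨k, hk⟩
    refine ⟨k, ?_⟩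
    have : ∀ x, (wordMap R I J)^[k] x = ((wordMap R I J) ^ k : _ →ₗ[R] _) x := fun x =>
      (Module.End.pow_apply _ k x).symm
    aesop

/-- `wordMap` commutes with the differential, and the differential of a word is a combination of
words. -/
lemma lin_bd_mem_reducible {x : BTree I J →₀ R} (hx : x ∈ stableSpan R I J)
    (h : x ∈ reducible R I J) : lin R (bd R) x ∈ reducible R I J := by
  obtain ⟨k, hk⟩ := h
  refine ⟨k, ?_⟩
  rw [iterate_wordMap_lin_bd k hx]
  exact lin_mem fun T hT => IsWord.bd (hk hT)

lemma mem_reducible_of_support {x : BTree I J →₀ R}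
    (h : ∀ T ∈ x.support, single T (1 : R) ∈ reducible R I J) : x ∈ reducible R I J := by
  rw [← lin_single_id x]
  exact lin_mem h

lemma mem_reducible_of_elementary {w : I ⊎ J} {L : List (WTree J)} {T : BTree I J}
    {K : List (WTree I)} (h : Elementary w L K)
    (hT : single T (1 : R) ∈ reducible R I J) :
    single (node w L T K) (1 : R) ∈ reducible R I J := by
  obtain ⟨k, hk⟩ := hT
  refine ⟨k, ?_⟩
  have e : ∀ (k : ℕ) (x : BTree I J →₀ R),
      (BTree.wordMap R I J)^[k] (x.mapDomain fun T => node w L T K) =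
      ((BTree.wordMap R I J)^[k] x).mapDomain fun T => node w L T K := by
    intro k
    induction k with
    | zero => intro x; rfl
    | succ k ih =>
      intro x
      rw [Function.iterate_succ_apply, Function.iterate_succ_apply, h.wordMap, ih]
  rw [← mapDomain_single (f := fun T => node w L T K), e, map_eq_lin]
  exact lin_mem fun U hU => single_mem_supported _ _ (show IsWord (node w L U K) from ⟨h, hk hU⟩)

lemma mem_reducible_of_wordMap {x : BTree I J →₀ R}
    (h : wordMap R I J x ∈ reducible R I J) : x ∈ reducible R I J := by
  obtain ⟨k, hk⟩ := h
  exact ⟨k + 1, hk⟩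

lemma attr_of_mem_splitMiddle {w : I ⊎ J} {L : List (WTree J)} {T U : BTree I J}
    {K : List (WTree I)} (h : U ∈ (splitMiddle R w L T K).support) :
    U.attr + edgeAttr = (node w L T K).attr := by
  obtain ⟨v, v', rfl, L₁, L₂, rfl, K₁, K₂, rfl, h1, h2, rfl⟩ := mem_support_splitMiddle h
  rw [attr_node, attr_node, attr_node, map_append, map_append, attrs_append,
    attrs_append, map_add, map_add, ← vertexAttr, ← vertexAttr, ← vertexAttr,
    ← vertexAttr_add]
  abel

lemma mem_sideBd {w : I ⊎ J} {L : List (WTree J)} {T U : BTree I J}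
    {K : List (WTree I)} (hs : (node w L T K).Stable) (h : U ∈ (sideBd R w L T K).support) :
    U.Stable ∧ U.attr + edgeAttr = (node w L T K).attr := by
  classical
  have e : sideBd R w L T K = (node w L T K).bd R + (T.bd R).mapDomain (fun U => node w L U K)
      + splitMiddle R w L T K := by
    rw [bd_node_eq_sideBd]
    have h1 := add_self R ((T.bd R).mapDomain fun U => node w L U K)
    have h2 := add_self R (splitMiddle R w L T K)
    grind
  rw [e] at h
  rcases mem_add h with h | h
  · rcases mem_add h with h | h
    · exact ⟨stable_of_mem_bd hs h, attr_of_mem_bd hs h⟩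
    · obtain ⟨T', hT', rfl⟩ := mem_image.1 (mapDomain_support h)
      refine ⟨⟨hs.1, stable_of_mem_bd hs.2.1 hT', hs.2.2⟩, ?_⟩
      rw [attr_node, attr_node, ← attr_of_mem_bd hs.2.1 hT']
      abel
  · exact ⟨(mass_lt_of_splitMiddle hs h).1, attr_of_mem_splitMiddle h⟩

lemma mass_lt_of_node {w : I ⊎ J} {L : List (WTree J)} {T : BTree I J}
    {K : List (WTree I)} (hs : (node w L T K).Stable) : T.mass < (node w L T K).mass := by
  have e : size (Sum.elim (weightList K) (weightList L) : I ⊎ J) =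
      size (weightList K) + size (weightList L) := by
    simp [size]
  rw [mass, mass, leftInputs, rightInputs, weight, size_add, size_add, e]
  rcases hs.1 with h | h
  · grind [size, size_eq_zero]
  · by_cases hl : L = []
    · have hk : K ≠ [] := by
        grind
      have := WTree.inputsList_add_size_weightList_pos hs.2.2.2 hk
      omega
    · have := WTree.inputsList_add_size_weightList_pos hs.2.2.1 hl
      omega

/-- The outer induction is on `mass`, which the differential and the contraction preserve. The inner
one is on `n - T.above.mass`, which decreases when the part above the root grows. An elementary root
reduces to a tree of smaller mass, a reduced root is handled by `wordMap`, and a contractible tree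
is traded, through the boundary of its contraction, for trees already treated. -/
lemma mem_reducible {T : BTree I J} (hT : T.Stable) :
    single T (1 : R) ∈ reducible R I J := by
  classical
  generalize hn : T.mass = n
  induction n using Nat.strong_induction_on generalizing T with
  | _ n ihn =>
  generalize hm : n - T.above.mass = m
  induction m using Nat.strong_induction_on generalizing T with
  | _ m ihm =>
  have hlow : ∀ {A U : BTree I J}, n - A.mass = m → U.Stable → U.mass = n →
      A.mass < U.above.mass → single U (1 : R) ∈ reducible R I J := by
    grind [mass_above_le]
  -- For a reduced root, `contract` vanishes on the tree, and in the contraction of the differential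
  -- the side expansions reproduce the tree, which cancels the identity term. Only contractions of
  -- spine splittings remain, and these have a heavier part above the root.
  have hred : ∀ {w : I ⊎ J} {L : List (WTree J)} {A : BTree I J} {K : List (WTree I)},
      (node w L A K).Stable → (node w L A K).mass = n → n - A.mass = m → Reduced w L K →
      single (node w L A K) (1 : R) ∈ reducible R I J := by
    intro w L A K hs hmass hA hr
    refine mem_reducible_of_wordMap ?_
    rw [wordMap_apply, lin_one, bd_node_eq_sideBd, map_add, map_add, hr.contractMap_sideBd,
      contractMap, lin_one, hr.contract, ofOption_none, map_zero, add_zero, ← contractMap,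
      contractMap_mapDomain_eq_zero fun _ _ => hr.contract _, add_zero, ← add_assoc,
      add_self R, zero_add, contractMap]
    refine lin_mem fun U hU => ?_
    refine mem_reducible_of_support fun V hV => ?_
    have hUs := mass_lt_of_splitMiddle hs hU
    have hV := mem_ofOption hV
    have hVs := contract_stable hUs.1 hV
    refine hlow hA hVs.1 ?_ ?_
    · rw [← hmass, ← mass_eq_of_attr (attr_of_mem_splitMiddle hU)]
      exact (mass_eq_of_attr hVs.2.symm).symm
    grind [mass_above_contract]
  cases T with
  | strand => exact ⟨0, single_mem_supported _ _ (trivial : IsWord strand)⟩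
  | node w L A K =>
  rw [above] at hm
  rcases elementary_or_reduced w L K with he | hr | ⟨q, hq⟩
  · exact mem_reducible_of_elementary he (ihn _ (hn ▸ mass_lt_of_node hT) hT.2.1 rfl)
  · grind
  have hc := contract_of_rootContract hq A
  obtain ⟨hs, hattr⟩ := contract_stable hT hc
  have hqr := reduced_of_rootContract hT.2.2.1 hT.2.2.2 hq
  have hmass : (node q.1 q.2.1 A q.2.2).mass = n := hn ▸ (mass_eq_of_attr hattr.symm).symm
  -- The tree is the contractible side expansion of its contraction, so this sum is killed by the
  -- contraction map. Its trees share the part `A` above the root, where contraction is injective;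
  -- hence each of them is not contractible, and its root is elementary or reduced.
  have hZ : sideBd R q.1 q.2.1 A q.2.2 + single (node w L A K) 1 ∈ reducible R I J := by
    have hsup : ∀ U ∈ (sideBd R q.1 q.2.1 A q.2.2 + single (node w L A K) 1).support,
        U.Stable ∧ U.mass = n ∧ U.above = A := by
      intro U hU
      rcases mem_add hU with hU | hU
      · have := mem_sideBd hs hU
        exact ⟨this.1, hmass ▸ mass_eq_of_attr this.2, above_of_mem_sideBd hU⟩
      · obtain rfl : U = node w L A K := by grind
        exact ⟨hT, hn, rfl⟩
    have hnone := eq_none_of_lin_injOn (f := contract)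
      (x := sideBd R q.1 q.2.1 A q.2.2 + single (node w L A K) 1)
      (fun U hU V hV c hUc hVc => contract_injective (hsup U hU).1 (hsup V hV).1
        ((hsup U hU).2.2.trans (hsup V hV).2.2.symm) hUc hVc) (by
        rw [← contractMap, map_add, hqr.contractMap_sideBd, contractMap, lin_one, hc]
        exact add_self R _)
    refine mem_reducible_of_support fun U hU => ?_
    obtain ⟨hUs, hUm, hUa⟩ := hsup U hU
    have hUn := hnone U hU
    cases U with
    | strand => exact ⟨0, single_mem_supported _ _ (trivial : IsWord strand)⟩
    | node w' L' A' K' =>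
    obtain rfl : A' = A := hUa
    rcases elementary_or_reduced w' L' K' with he | hr | ⟨q', hq'⟩
    · exact mem_reducible_of_elementary he (ihn _ (hUm ▸ mass_lt_of_node hUs) hUs.2.1 rfl)
    · grind
    grind [contract_of_rootContract]
  -- The boundary of the contraction is solved for the given tree. The other terms have a reduced
  -- root with unchanged mass above it, a heavier part above the root, or belong to `hZ`.
  have e : single (node w L A K) (1 : R) =
      lin R (bd R) (single (node q.1 q.2.1 A q.2.2) 1)
      + (A.bd R).mapDomain (fun U => node q.1 q.2.1 U q.2.2) + splitMiddle R q.1 q.2.1 A q.2.2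
      + (sideBd R q.1 q.2.1 A q.2.2 + single (node w L A K) 1) := by
    rw [lin_one, bd_node_eq_sideBd]
    have h1 := add_self R ((A.bd R).mapDomain fun U => node q.1 q.2.1 U q.2.2)
    have h2 := add_self R (splitMiddle R q.1 q.2.1 A q.2.2)
    have h3 := add_self R (sideBd R q.1 q.2.1 A q.2.2)
    grind
  rw [e]
  refine add_mem (add_mem (add_mem ?_ ?_) ?_) hZ
  · exact lin_bd_mem_reducible (single_mem_supported _ _ hs) (hred hs hmass hm hqr)
  · rw [map_eq_lin]
    refine lin_mem fun U hU => hred ⟨hs.1, stable_of_mem_bd hs.2.1 hU, hs.2.2⟩ ?_ ?_ hqr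
    · rw [← hmass]
      refine mass_eq_of_attr (d := 1) ?_
      have := attr_of_mem_bd hs.2.1 hU
      rw [attr_node, attr_node, ← this, edgeAttr]
      abel
    · rw [mass_eq_of_attr (attr_of_mem_bd hs.2.1 hU), hm]
  · refine mem_reducible_of_support fun U hU => ?_
    have hUs := mass_lt_of_splitMiddle hs hU
    exact hlow hm hUs.1 (hmass ▸ mass_eq_of_attr (attr_of_mem_splitMiddle hU)) hUs.2

end Words

end BTree

/-! ### Pairs -/

section MapPairs

variable {R : Type*} [CommRing R] {A B : Type*}

lemma bdPair_eq_lin (d : A → (A →₀ R)) (d' : B → (B →₀ R)) (x : A × B →₀ R) :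
    bdPair d d' x = lin R (fun g => (d g.1).mapDomain (fun a => (a, g.2))
      + (d' g.2).mapDomain fun b => (g.1, b)) x := rfl

variable (R) in
/-- `f ⊗ 1`. -/
def mapFst (f : A → (A →₀ R)) : (A × B →₀ R) →ₗ[R] (A × B →₀ R) :=
  lin R fun g => (f g.1).mapDomain fun a => (a, g.2)

variable (R) in
/-- `1 ⊗ f`. -/
def mapSnd (f : B → (B →₀ R)) : (A × B →₀ R) →ₗ[R] (A × B →₀ R) :=
  lin R fun g => (f g.2).mapDomain fun b => (g.1, b)

lemma bdPair_eq (d : A → (A →₀ R)) (d' : B → (B →₀ R)) (x : A × B →₀ R) :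
    bdPair d d' x = mapFst R d x + mapSnd R d' x := by
  rw [bdPair_eq_lin, lin_add]
  rfl

lemma mapFst_mapFst (f g : A → (A →₀ R)) (x : A × B →₀ R) :
    mapFst R f (mapFst R g x) = mapFst R (fun a => lin R f (g a)) x := by
  simp only [mapFst, lin_lin, map_eq_lin, lin_one]

lemma mapSnd_mapSnd (f g : B → (B →₀ R)) (x : A × B →₀ R) :
    mapSnd R f (mapSnd R g x) = mapSnd R (fun a => lin R f (g a)) x := by
  simp only [mapSnd, lin_lin, map_eq_lin, lin_one]

lemma mapSnd_mapFst (f : A → (A →₀ R)) (g : B → (B →₀ R)) (x : A × B →₀ R) :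
    mapSnd R g (mapFst R f x) = mapFst R f (mapSnd R g x) := by
  simp only [mapFst, mapSnd, lin_lin, map_eq_lin, lin_one]
  exact lin_congr fun a _ => lin_comm _ _ _

lemma mem_support_mapSnd {f : B → (B →₀ R)} {x : A × B →₀ R} {g : A × B}
    (h : g ∈ (mapSnd R f x).support) : ∃ g' ∈ x.support, g'.1 = g.1 ∧ g.2 ∈ (f g'.2).support := by
  classical
  obtain ⟨g', hg', h⟩ := mem_lin h
  obtain ⟨a, ha, rfl⟩ := mem_image.1 (mapDomain_support h)
  grind

lemma lin_ofOption_apply {α β : Type*} {f : α → Option β} {x : α →₀ R} {a : α} {c : β}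
    (hf : ∀ b ∈ x.support, f b = some c → b = a) (hc : f a = some c) :
    lin R (fun a => ofOption R (f a)) x c = x a := by
  classical
  rw [lin, linearCombination_apply, Finsupp.sum, finsetSum_apply,
    sum_eq_single a]
  · simp_all
  · intro b hb hne
    rw [Finsupp.smul_apply]
    cases hfb : f b with
    | none => simp [ofOption]
    | some d =>
      have : d ≠ c := by
        grind
      aesop
  simp_all

end MapPairs

-- Reducing cycles of pairs to words

section PairComplex

variable {R : Type*} [CommRing R] [CharP R 2] {I J : Type} [Fintype I] [Fintype J]
  [DecidableEq I] [DecidableEq J]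

variable (R I J) in
/-- The differential on the pairs of an extended tree and a bimodule tree. -/
def pairBd : (I ⨳ J →₀ R) →ₗ[R] (I ⨳ J →₀ R) :=
  mapFst R (XTree.bd R) + mapSnd R (BTree.bd R)

lemma pairBd_apply (x : I ⨳ J →₀ R) :
    pairBd R I J x = mapFst R (XTree.bd R) x + mapSnd R (BTree.bd R) x := rfl

lemma bdPair_eq_pairBd (x : I ⨳ J →₀ R) :
    bdPair (XTree.bd R) (BTree.bd R) x = pairBd R I J x := bdPair_eq _ _ _

lemma pairBd_pairBd {x : I ⨳ J →₀ R}
    (hx : ∀ g ∈ x.support, g.1.Stable ∧ g.2.Stable) : pairBd R I J (pairBd R I J x) = 0 := by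
  rw [pairBd_apply, pairBd_apply, map_add, map_add, mapFst_mapFst, mapSnd_mapSnd, mapSnd_mapFst]
  have h1 : mapFst R (fun S => lin R (XTree.bd R) (XTree.bd R S)) x = 0 := lin_eq_zero fun g hg => by
    grind [XTree.lin_bd_bd, mapDomain_zero]
  have h2 : mapSnd R (fun S => lin R (BTree.bd R) (BTree.bd R S)) x = 0 := lin_eq_zero fun g hg => by
    grind [BTree.lin_bd_bd, mapDomain_zero]
  rw [h1, h2, zero_add, add_zero, add_self R]

/-- A pair of stable trees, the inputs of the first matching the left inputs of the second, of total
degree `N` and dimension `d`. -/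
structure IsGoodPair (N : ℕ) (d : ℤ) (g : I ⨳ J) : Prop where
  stable_fst : g.1.Stable
  stable_snd : g.2.Stable
  inputs_eq : g.1.inputs = g.2.leftInputs
  degree_eq : g.2.leftInputs + g.2.rightInputs + 2 * (size g.1.weight + size g.2.weight) = N
  dim_eq : g.1.dim + g.2.dim = d

lemma IsGoodPair.snd {N : ℕ} {d d' : ℤ} {S : XTree I} {T U : BTree I J}
    (h : IsGoodPair N d (S, T)) (hU : U.Stable) (ha : U.attr = T.attr + (0, 0, 0, d')) :
    IsGoodPair N (d + d') (S, U) := by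
  have h1 := congrArg fst ha
  have h2 := congrArg (fun x => x.2.1) ha
  have h3 := congrArg (fun x => x.2.2.1) ha
  have h4 := congrArg (fun x => x.2.2.2) ha
  simp only [BTree.attr, Prod.fst_add, Prod.snd_add, add_zero] at h1 h2 h3 h4
  have h5 := h.3
  have h6 := h.4
  have h7 := h.5
  simp only at h5 h6 h7
  refine ⟨h.1, hU, ?_, ?_, ?_⟩
  · simp only
    omega
  · simp_all
  grind

variable (R I J) in
/-- The contraction of spine edges in the second factor. -/
def pairContract : (I ⨳ J →₀ R) →ₗ[R] (I ⨳ J →₀ R) :=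
  mapSnd R fun T => ofOption R T.contract

variable (R I J) in
/-- The map `wordMap` in the second factor. -/
def pairWordMap : (I ⨳ J →₀ R) →ₗ[R] (I ⨳ J →₀ R) :=
  mapSnd R fun T => wordMap R I J (single T 1)

/-- The differential of the first factor commutes with the contraction of the second, so it occurs
twice in the commutator and drops out. -/
lemma pairWordMap_eq (x : I ⨳ J →₀ R) : pairWordMap R I J x =
    x + pairBd R I J (pairContract R I J x) + pairContract R I J (pairBd R I J x) := by
  have h1 : pairWordMap R I J x = x + mapSnd R (BTree.bd R) (pairContract R I J x)
      + pairContract R I J (mapSnd R (BTree.bd R) x) := by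
    rw [pairContract, mapSnd_mapSnd, mapSnd_mapSnd, pairWordMap]
    conv_rhs => rw [← lin_single_id x]
    simp only [mapSnd, ← lin_add, lin_lin, lin_one]
    refine lin_congr fun g _ => ?_
    simp [wordMap_apply, contractMap, lin_one, mapDomain_add, mapDomain_single]
  rw [h1, pairBd_apply, pairBd_apply, map_add]
  rw [show mapFst R (XTree.bd R) (pairContract R I J x) =
    pairContract R I J (mapFst R (XTree.bd R) x) from (mapSnd_mapFst _ _ _).symm]
  rw [show ∀ a b c d : I ⨳ J →₀ R, a + (b + c) + (b + d) = a + c + d + (b + b) by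
    intros
    abel, add_self R, add_zero]

lemma isGoodPair_pairWordMap {N : ℕ} {d : ℤ} {x : I ⨳ J →₀ R}
    (hx : ∀ g ∈ x.support, IsGoodPair N d g) :
    ∀ g ∈ (pairWordMap R I J x).support, IsGoodPair N d g := by
  classical
  rintro ⟨S, U⟩ hg
  obtain ⟨⟨S, T⟩, hT, rfl, hU⟩ := mem_support_mapSnd hg
  have hT := hx _ hT
  simp only at hU ⊢
  suffices h : U.Stable ∧ U.attr = T.attr by
    simpa using hT.snd (d' := 0) h.1 (h.2.trans (add_zero _).symm)
  rw [wordMap_apply, contractMap, lin_one, lin_one] at hU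
  rcases mem_add hU with hU | hU
  · rcases mem_add hU with hU | hU
    · obtain rfl : U = T := by grind
      exact ⟨hT.2, rfl⟩
    · obtain ⟨V, hV, hU⟩ := mem_lin hU
      have hV := contract_stable hT.2 (mem_ofOption hV)
      grind [stable_of_mem_bd, BTree.attr_of_mem_bd, add_right_cancel]
  · obtain ⟨V, hV, hU⟩ := mem_lin hU
    have hVs := stable_of_mem_bd hT.2 hV
    have hU := contract_stable hVs (mem_ofOption hU)
    exact ⟨hU.1, by rw [hU.2, BTree.attr_of_mem_bd hT.2 hV]⟩

lemma pairWordMap_iterate_single (k : ℕ) (S : XTree I) (x : BTree I J →₀ R) :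
    (pairWordMap R I J)^[k] (x.mapDomain fun T => (S, T)) =
      ((wordMap R I J)^[k] x).mapDomain fun T => (S, T) := by
  induction k generalizing x with
  | zero => rfl
  | succ k ih =>
    rw [Function.iterate_succ_apply, Function.iterate_succ_apply, ← ih]
    congr 1
    rw [pairWordMap, mapSnd, lin_mapDomain]
    conv_rhs => rw [← lin_single_id x]
    simp [map_lin, map_eq_lin, lin_lin, lin_congr]

/-- Every cycle is homologous to a linear combination of pairs whose second factor is a word. -/
lemma exists_pairBd_add_word {N : ℕ} {d : ℤ} {z : I ⨳ J →₀ R}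
    (hz : ∀ g ∈ z.support, IsGoodPair N d g) (hc : pairBd R I J z = 0) :
    ∃ x y, z = x + pairBd R I J y ∧ pairBd R I J x = 0 ∧
      (∀ g ∈ x.support, IsGoodPair N d g ∧ g.2.IsWord) ∧
      ∀ g ∈ y.support, IsGoodPair N (d + 1) g ∧ g.2 ≠ .strand := by
  classical
  have key : ∀ (k : ℕ) {z : I ⨳ J →₀ R}, (∀ g ∈ z.support, IsGoodPair N d g) →
      pairBd R I J z = 0 → ∃ y, z = (pairWordMap R I J)^[k] z + pairBd R I J y ∧
      pairBd R I J ((pairWordMap R I J)^[k] z) = 0 ∧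
      (∀ g ∈ ((pairWordMap R I J)^[k] z).support, IsGoodPair N d g) ∧
      ∀ g ∈ y.support, IsGoodPair N (d + 1) g ∧ g.2 ≠ .strand := by
    intro k
    induction k with
    | zero => exact fun hz hc => ⟨0, by simp, hc, hz, by simp⟩
    | succ k ih =>
      intro z hz hc
      have hcon : ∀ g ∈ (pairContract R I J z).support, IsGoodPair N (d + 1) g ∧ g.2 ≠ .strand := by
        rintro ⟨S, U⟩ hg
        obtain ⟨⟨S, T⟩, hT, rfl, hU⟩ := mem_support_mapSnd hg
        have hU := mem_ofOption hU
        simp only at hU ⊢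
        have h := contract_stable (hz _ hT).2 hU
        refine ⟨(hz _ hT).snd h.1 h.2, ?_⟩
        rintro rfl
        cases T with
        | strand => cases hU
        | node w L T K =>
          simp only [contract] at hU
          split at hU
          · cases hU
          · split_ifs at hU
            obtain ⟨V, -, hV⟩ := Option.map_eq_some_iff.1 hU
            cases hV
      have e : pairWordMap R I J z = z + pairBd R I J (pairContract R I J z) := by
        rw [pairWordMap_eq, hc, map_zero, add_zero]
      obtain ⟨y, h1, h2, h3, h4⟩ := ih (isGoodPair_pairWordMap hz) (by
        rw [e, map_add, hc, zero_add]
        exact pairBd_pairBd fun g hg => ⟨(hcon g hg).1.1, (hcon g hg).1.2⟩)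
      -- On a cycle, `pairWordMap` changes `z` only by the boundary of its contraction; the
      -- corrections of the successive iterations add up.
      refine ⟨y + pairContract R I J z, ?_, h2, h3, ?_⟩
      · rw [Function.iterate_succ_apply, map_add, ← add_assoc, ← h1, e, add_assoc,
          add_self R, add_zero]
      · intro g hg
        rcases mem_add hg with hg | hg
        · exact h4 g hg
        · exact hcon g hg
  have hk : ∀ g : z.support, ∃ k, (wordMap R I J)^[k] (single g.1.2 1) ∈
      wordSpan R I J := fun g => mem_reducible (hz _ g.2).2
  choose k hk using hk
  -- One exponent serves for all terms, since the support is finite and words are fixed by further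
  -- iterations.
  obtain ⟨m, hm⟩ : ∃ m, ∀ g, k g ≤ m :=
    ⟨∑ g, k g, fun g => Finset.single_le_sum (fun _ _ => Nat.zero_le _) (mem_univ g)⟩
  obtain ⟨y, h1, h2, h3, h4⟩ := key m hz hc
  refine ⟨_, y, h1, h2, fun g hg => ⟨h3 g hg, ?_⟩, h4⟩
  rw [← lin_single_id z, ← Module.End.pow_apply, map_lin] at hg
  obtain ⟨g', hg', hg⟩ := mem_lin hg
  rw [Module.End.pow_apply, show (single g' (1 : R)) =
    (single g'.2 1).mapDomain (fun T => (g'.1, T)) by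
      simp, pairWordMap_iterate_single] at hg
  obtain ⟨T, hT, rfl⟩ := mem_image.1 (mapDomain_support hg)
  rw [← Nat.sub_add_cancel (hm ⟨g', hg'⟩), Function.iterate_add_apply,
    Function.iterate_fixed (wordMap_of_mem_wordSpan (hk ⟨g', hg'⟩))] at hT
  exact hk ⟨g', hg'⟩ hT

end PairComplex

namespace BTree

/-! ### Cycles of words -/

section LeftWords

variable {I J : Type}

/-- A word all of whose vertices have a left input. -/
def IsLeftWord : BTree I J → Prop
  | strand => True
  | node w L T K => w = 0 ∧ L = [.leaf] ∧ (K = [] ∨ K = [.leaf]) ∧ T.IsLeftWord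

lemma IsWord.mirror {T : BTree I J} (h : T.IsWord) : T.mirror.IsWord := by
  induction T with
  | strand => trivial
  | node w L T K ih =>
    obtain ⟨⟨rfl, hL, hK⟩, hT⟩ := h
    exact ⟨⟨rfl, hK, hL⟩, ih hT⟩

variable [Fintype I] [Fintype J]

lemma attr_elementary (L : List (WTree J)) (T : BTree I J) (K : List (WTree I))
    (hL : L = [] ∨ L = [.leaf]) (hK : K = [] ∨ K = [.leaf]) : (node 0 L T K).attr =
      T.attr + (L.length, K.length, 0, (L.length : ℤ) + K.length - 1) := by
  have h1 : leftAttr (I := I) (attrs (L.map .tree)) = (L.length, 0, 0, (L.length : ℤ)) := by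
    rcases hL with rfl | rfl
    · aesop
    · rw [List.map_singleton, attrs_cons, attr_leaf, attrs_nil, add_zero]
      aesop
  have h2 : rightAttr (J := J) (attrs (K.map .tree)) = (0, K.length, 0, (K.length : ℤ)) := by
    rcases hK with rfl | rfl
    · aesop
    · rw [List.map_singleton, attrs_cons, attr_leaf, attrs_nil, add_zero]
      aesop
  rw [attr_node, h1, h2, add_assoc, add_assoc, size_zero]
  aesop

/-- By stability a vertex of a word has a leaf on at least one side. It contributes `1` to the
dimension if it has both leaves and `0` otherwise, so the dimension counts the vertices with two
leaves. Equality with the number of right inputs excludes vertices with a right leaf only. -/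
lemma IsWord.attr {T : BTree I J} (h : T.IsWord) (hT : T.Stable) : T.weight = 0 ∧ 0 ≤ T.dim ∧
    T.dim ≤ T.leftInputs ∧ T.dim ≤ T.rightInputs ∧ (T.dim = T.rightInputs → T.IsLeftWord) := by
  induction T with
  | strand => aesop
  | node w L T K ih =>
    obtain ⟨⟨rfl, hL, hK⟩, hw⟩ := h
    obtain ⟨h1, h2, h3, h4, h5⟩ := ih hw hT.2.1
    have ha := attr_elementary L T K hL hK
    have a1 := congrArg fst ha
    have a2 := congrArg (fun x => x.2.1) ha
    have a3 := congrArg (fun x => x.2.2.1) ha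
    have a4 := congrArg (fun x => x.2.2.2) ha
    simp only [BTree.attr, Prod.fst_add, Prod.snd_add, add_zero] at a1 a2 a3 a4
    rw [a1, a2, a3, a4]
    have hs : 2 ≤ L.length + 1 + K.length := by simpa [StableVertex] using hT.1
    refine ⟨h1, ?_⟩
    rcases hL with rfl | rfl <;> rcases hK with rfl | rfl <;>
      simp only [List.length_nil, List.length_singleton] at hs ⊢
    · omega
    · grind
    · push_cast
      refine ⟨by omega, by omega, by omega, fun h => ⟨rfl, rfl, .inl rfl, h5 (by omega)⟩⟩
    · push_cast
      refine ⟨by omega, by omega, by omega, fun h => ⟨rfl, rfl, .inr rfl, h5 (by omega)⟩⟩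

variable {R : Type*} [CommRing R] [CharP R 2] [DecidableEq I] [DecidableEq J]

lemma bd_elementary (L : List (WTree J)) (T : BTree I J) (K : List (WTree I))
    (hL : L = [] ∨ L = [.leaf]) (hK : K = [] ∨ K = [.leaf]) : (node 0 L T K).bd R =
      (T.bd R).mapDomain (fun T => node 0 L T K) +
      if L ≠ [] ∧ K ≠ [] then single (node 0 [] (node 0 [.leaf] T []) [.leaf]) 1
        + single (node 0 [.leaf] (node 0 [] T [.leaf]) []) 1 else 0 := by
  rw [bd_node_eq_sideBd, Elementary.sideBd ⟨rfl, hL, hK⟩, zero_add, splitMiddle_of_elementary T hL hK]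

/-- The tree above a root vertex with one left and one right leaf. -/
def stripBoth : BTree I J → Option (BTree I J)
  | node _ [.leaf] T [.leaf] => some T
  | _ => none

/-- The tree above two vertices with one right and one left leaf. -/
def stripTwo : BTree I J → Option (BTree I J)
  | node _ [] (node _ [.leaf] T []) [.leaf] => some T
  | _ => none

/-- The tree above a root vertex with one left leaf. -/
def stripLeft : BTree I J → Option (BTree I J)
  | node _ [.leaf] T [] => some T
  | _ => none

/-- A root with only a right leaf is not allowed in a left word, so it arises in the differential
only by splitting a root with both leaves. It therefore detects such roots. -/
lemma IsLeftWord.stripTwo_bd {T : BTree I J} (h : T.IsLeftWord) :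
    lin R (fun U => ofOption R U.stripTwo) (T.bd R) = ofOption R T.stripBoth := by
  cases T with
  | strand => simp [bd, stripBoth]
  | node w L T K =>
    obtain ⟨rfl, rfl, rfl | rfl, -⟩ := h
    · rw [bd_elementary _ _ _ (.inr rfl) (.inl rfl), map_add, lin_mapDomain,
        lin_eq_zero fun U _ => by simp [stripTwo]]
      simp [stripBoth]
    · rw [bd_elementary _ _ _ (.inr rfl) (.inr rfl), map_add, lin_mapDomain,
        lin_eq_zero fun U _ => by simp [stripTwo], if_pos ⟨by simp, by simp⟩, map_add,
        lin_one, lin_one]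
      simp [stripBoth, stripTwo]

lemma IsLeftWord.stripLeft_bd {T : BTree I J} (h : T.IsLeftWord) (h' : T.stripBoth = none) :
    lin R (fun U => ofOption R U.stripLeft) (T.bd R) =
      lin R (bd R) (ofOption R T.stripLeft) := by
  cases T with
  | strand => simp [bd, stripLeft]
  | node w L T K =>
    obtain ⟨rfl, rfl, rfl | rfl, -⟩ := h
    · rw [bd_elementary _ _ _ (.inr rfl) (.inl rfl), map_add, lin_mapDomain]
      simp [stripLeft, ofOption, lin_one, lin_single_id]
    · cases h'

/-- By `stripTwo_bd` no term of the cycle has a root with both leaves. All roots then have a left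
leaf only; removing them gives a cycle of shorter left words, and induction applies. -/
lemma IsLeftWord.rightInputs_eq_zero {T : BTree I J} {x : BTree I J →₀ R}
    (hx : ∀ U ∈ x.support, U.IsLeftWord) (hc : lin R (bd R) x = 0) (hT : T ∈ x.support) :
    T.rightInputs = 0 := by
  induction T generalizing x with
  | strand => rfl
  | node w L T K ih =>
    have hb : ∀ U ∈ x.support, U.stripBoth = none := by
      refine eq_none_of_lin_injOn ?_ ?_
      · intro U hU V hV W hUW hVW
        rcases U with _ | ⟨_, _, _, _⟩
        · cases hUW
        rcases V with _ | ⟨_, _, _, _⟩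
        · cases hVW
        obtain ⟨rfl, rfl, rfl | rfl, -⟩ := hx _ hU
        · cases hUW
        obtain ⟨rfl, rfl, rfl | rfl, -⟩ := hx _ hV
        · cases hVW
        cases hUW
        cases hVW
        rfl
      · rw [← lin_congr fun U hU => IsLeftWord.stripTwo_bd (R := R) (hx U hU), ← lin_lin, hc,
          map_zero]
    have hn := hb _ hT
    obtain ⟨rfl, rfl, rfl | rfl, -⟩ := hx _ hT
    · have hl : ∀ U ∈ x.support, ∀ V, U.stripLeft = some V → U = node 0 [.leaf] V [] := by
        intro U hU V hUV
        rcases U with _ | ⟨_, _, _, _⟩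
        · cases hUV
        obtain ⟨rfl, rfl, rfl | rfl, -⟩ := hx _ hU
        · cases hUV
          rfl
        · cases hUV
      rw [rightInputs, inputsList, add_zero]
      refine ih (x := lin R (fun U => ofOption R U.stripLeft) x) ?_ ?_ ?_
      · intro V hV
        obtain ⟨U, hU, hV⟩ := mem_lin hV
        have := hx _ hU
        rw [hl U hU V (mem_ofOption hV)] at this
        exact this.2.2.2
      · rw [lin_lin, ← lin_congr fun U hU => IsLeftWord.stripLeft_bd (R := R) (hx U hU) (hb U hU),
          ← lin_lin, hc, map_zero]
      · rw [mem_support_iff] at hT ⊢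
        rwa [lin_ofOption_apply (a := node 0 [.leaf] T []) (fun U hU h => hl U hU T h) rfl]
    · cases hn

lemma leftInputs_eq_zero {T : BTree I J} {x : BTree I J →₀ R}
    (hx : ∀ U ∈ x.support, U.mirror.IsLeftWord ∧ U.Stable) (hc : lin R (bd R) x = 0)
    (hT : T ∈ x.support) : T.leftInputs = 0 := by
  classical
  rw [← rightInputs_mirror]
  refine IsLeftWord.rightInputs_eq_zero (x := x.mapDomain mirror) ?_ ?_ ?_
  · intro U hU
    obtain ⟨V, hV, rfl⟩ := mem_image.1 (mapDomain_support hU)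
    exact (hx V hV).1
  · rw [lin_mapDomain, lin_congr fun U hU => bd_mirror (hx U hU).2]
    simp only [map_eq_lin]
    rw [← lin_lin, hc, map_zero]
  grind [mem_support_iff, Finsupp.mapDomain_apply, mirror_injective]

end LeftWords

end BTree

/-! ### Expansions of a corolla -/

section Corolla

variable {R : Type*} [CommRing R] {ι : Type} [Fintype ι] [DecidableEq ι]

/-- The two corollas of degree two, `Ψ_2^0` and `Ψ_0^ε` with `ε` a basis weight, cannot be expanded;
from degree three on there is always room for an edge. -/
lemma exists_split_corolla {n : ℕ} {w : ι → ℕ} (h : 3 ≤ n + 2 * size w) :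
    ∃ b u, b ≤ n ∧ u ≤ w ∧ StableVertex b u ∧ StableVertex (n - b + 1) (w - u) := by
  by_cases hw : w = 0
  · subst hw
    rw [size_zero] at h
    exact ⟨2, 0, by omega, le_rfl, .inr le_rfl, .inr (by omega)⟩
  · by_cases hn : 1 ≤ n
    · exact ⟨0, w, by omega, le_rfl, .inl hw, .inr (by omega)⟩
    · obtain ⟨i, hi⟩ : ∃ i, w i ≠ 0 := by
        by_contra h
        push Not at h
        exact hw (funext h)
      have hle : Pi.single i 1 ≤ w := by
        intro j
        grind
      have hs : size (Pi.single i 1 : ι → ℕ) = 1 := by simp [size]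
      refine ⟨0, Pi.single i 1, by omega, hle, .inl ?_, .inl ?_⟩
      · simp
      · intro e
        have := congrArg size (tsub_add_cancel_of_le hle)
        grind [zero_add]

lemma bdList_replicate_leaf (n : ℕ) :
    bdList R (replicate n (.leaf : WTree ι)) = 0 := by
  induction n with
  | zero => rfl
  | succ n ih => simp [replicate_succ, bdList, WTree.bd, ih]

lemma exists_bd_corolla_apply {n : ℕ} {w : ι → ℕ} (h : 3 ≤ n + 2 * size w) :
    ∃ S : XTree ι, (tree (.corolla n w)).bd R S = 1 := by
  classical
  obtain ⟨b, u, hb, hu, h1, h2⟩ := exists_split_corolla h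
  -- The new vertex is put in the first position. Position, number of inputs and weight can then be
  -- recovered from the tree, so exactly one expansion produces it and its coefficient is `1`.
  refine ⟨.tree (.node (w - u) (.node u (replicate b .leaf) :: replicate (n - b) .leaf)),
    ?_⟩
  rw [XTree.bd, Finsupp.mapDomain_apply fun _ _ h => tree.inj h, WTree.corolla, WTree.bd,
    bdList_replicate_leaf, mapDomain_zero, add_zero, splitRoot]
  simp only [finsetSum_apply, List.length_replicate]
  rw [sum_eq_single u, sum_eq_single 0, sum_eq_single b]
  · simp_all
  · aesop
  · simp_all
  · intro a ha hne
    refine sum_eq_zero fun b' _ => ?_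
    split_ifs
    · rw [Finsupp.single_apply, if_neg]
      intro e
      obtain ⟨a, rfl⟩ := Nat.exists_eq_succ_of_ne_zero hne
      grind
    · rfl
  · simp
  · intro w' hw' hne
    refine sum_eq_zero fun a _ => sum_eq_zero fun b' _ => ?_
    split_ifs
    · rw [Finsupp.single_apply, if_neg]
      intro e
      simp only [WTree.node.injEq] at e
      refine hne ?_
      rw [← tsub_tsub_cancel_of_le (mem_Icc.1 hw').2, e.1, tsub_tsub_cancel_of_le hu]
    · rfl
  aesop

lemma eq_corolla_of_verticesList {w : ι → ℕ} {cs : List (WTree ι)}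
    (h : verticesList cs = 0) :
    WTree.node w cs = .corolla (inputsList cs) w ∧ weightList cs = 0 := by
  have key : cs = replicate (inputsList cs) .leaf ∧ weightList cs = 0 := by
    induction cs with
    | nil => exact ⟨rfl, rfl⟩
    | cons t cs ih =>
      cases t with
      | leaf =>
        simp only [verticesList, vertices, zero_add] at h
        obtain ⟨h1, h2⟩ := ih h
        simp only [inputsList, WTree.inputs, weightList, WTree.weight, zero_add]
        grind
      | node w ts => simp [verticesList, vertices] at h
  exact ⟨congrArg _ key.1, key.2⟩

end Corolla

/-! ### Acyclicity -/

section Acyclic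

variable {R : Type*} [CommRing R] [CharP R 2] {I J : Type} [Fintype I] [Fintype J]
  [DecidableEq I] [DecidableEq J]

lemma XTree.bd_leaf : (tree .leaf : XTree I).bd R = 0 := by
  aesop

/-- The pairs of degree `N ≥ 3` and dimension `N - 2` whose second factor is a word. -/
lemma IsGoodPair.word_cases {N : ℕ} (hN : 3 ≤ N) {S : XTree I} {T : BTree I J}
    (h : IsGoodPair N (N - 2) (S, T)) (hw : T.IsWord) :
    (S = .tree .leaf ∧ T.mirror.IsLeftWord ∧ T.leftInputs = 1) ∨
      ∃ n w, S = .tree (.corolla n w) ∧ S.inputs = n ∧ S.weight = w ∧ StableVertex n w ∧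
        S.dim = n + 2 * size w - 2 ∧ n + 2 * size w + T.rightInputs = N ∧ T.IsLeftWord := by
  obtain ⟨h1, h2, h3, h4, h5⟩ := h
  have hm := (hw.mirror.attr (stable_mirror.2 h2)).2.2.2.2
  have hd : T.mirror.dim = T.dim := by
    have := congrArg (fun x => x.2.2.2) (attr_mirror T)
    exact this
  rw [hd, rightInputs_mirror] at hm
  obtain ⟨a1, a2, a3, a4, a5⟩ := hw.attr h2
  simp only at h3 h4 h5
  rw [a1, size_zero, add_zero] at h4
  cases S with
  -- With first factor `⊤` there are no left inputs, so the word has dimension `0` and degree `2`,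
  -- contrary to `N ≥ 3`.
  | top =>
    grind [XTree.inputs, XTree.weight, size_zero, XTree.dim]
  | tree S =>
    cases S with
    | leaf =>
      grind [XTree.inputs, XTree.weight, WTree.inputs, WTree.weight, size_zero, XTree.dim,
        WTree.dim, vertices]
    | node w cs =>
      simp only [XTree.inputs, XTree.weight, WTree.inputs, XTree.dim, WTree.dim,
        vertices] at h3 h4 h5
      push_cast at h5
      -- The dimension of the word is at most the number of its right inputs, so to reach the total
      -- `N - 2` the first tree can have only one vertex, and equality holds for the word.
      have hv : verticesList cs = 0 := by omega
      obtain ⟨e1, e2⟩ := eq_corolla_of_verticesList (w := w) hv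
      have hl : cs.length = inputsList cs := by
        have := congrArg (fun t => match t with
          | .leaf => 0
          | .node _ cs => cs.length) e1
        simpa [WTree.corolla] using this
      rw [WTree.weight, e2, add_zero] at h4 h5
      refine .inr ⟨inputsList cs, w, by rw [← e1], rfl, ?_, ?_, ?_, ?_, a5 ?_⟩
      · rw [XTree.weight, WTree.weight, e2, add_zero]
      · rw [← hl]
        exact h1.1
      · grind [XTree.dim, WTree.dim, WTree.weight, add_zero, vertices, WTree.inputs]
      · omega
      · omega

/-- No first factor occurs in the differential of another, so for each first factor the words paired
with it form a cycle by themselves. This excludes `↓` and all right inputs. What remains are pairs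
whose first factor is a corolla of degree `N`, and the differential of that corolla cannot be
cancelled. -/
lemma eq_zero_of_word {N : ℕ} (hN : 3 ≤ N) {x : I ⨳ J →₀ R}
    (hx : ∀ g ∈ x.support, IsGoodPair N (N - 2) g ∧ g.2.IsWord) (hc : pairBd R I J x = 0) :
    x = 0 := by
  classical
  have hcases : ∀ g ∈ x.support, _ := fun g hg => (hx g hg).1.word_cases hN (hx g hg).2
  -- the first factors do not occur in each other's differentials
  have hne : ∀ g ∈ x.support, ∀ g' ∈ x.support, ∀ S ∈ ((g.1).bd R).support,
      ∀ S' , S' = g'.1 → S ≠ S' := by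
    rintro g hg g' hg' S hS _ rfl rfl
    obtain ⟨ha, -⟩ := XTree.attr_of_mem_bd (hx g hg).1.1 hS
    have h1 := congrArg fst ha
    have h2 := congrArg (fun x => x.2.1) ha
    have h3 := congrArg (fun x => x.2.2) ha
    simp only [XTree.attr, Prod.fst_add, Prod.snd_add, add_zero] at h1 h2 h3
    rcases hcases g hg with ⟨e, -⟩ | ⟨n, w, -, rfl, rfl, -, hd, -⟩
    · rw [e, XTree.bd_leaf] at hS
      simp at hS
    · rcases hcases g' hg' with ⟨e, -⟩ | ⟨n, w, -, rfl, rfl, -, hd', -⟩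
      · have k1 : g'.1.inputs = 1 := by rw [e]; rfl
        have k2 : g'.1.weight = 0 := by rw [e]; rfl
        grind [XTree.dim, WTree.dim, WTree.inputs, WTree.weight, vertices, size_zero]
      grind
  -- The component of the boundary with first factor `S` involves only the differential of second
  -- factors, by `hne`.
  have hslice : ∀ S : XTree I, (∃ T, (S, T) ∈ x.support) →
      ∃ y : BTree I J →₀ R, (∀ T, y T = x (S, T)) ∧ lin R (BTree.bd R) y = 0 := by
    rintro S ⟨T₀, hT₀⟩
    set f : I ⨳ J → Option (BTree I J) :=
      fun g => if g.1 = S then some g.2 else none with hf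
    refine ⟨lin R (fun g => ofOption R (f g)) x, fun T => ?_, ?_⟩
    · refine lin_ofOption_apply (a := (S, T)) ?_ (if_pos rfl)
      grind
    · have := congrArg (lin R fun g => ofOption R (f g)) hc
      rw [map_zero, pairBd_apply, map_add, mapFst, mapSnd, lin_lin, lin_lin] at this
      rw [lin_eq_zero fun g hg => ?_, zero_add] at this
      · rw [lin_lin, ← this]
        refine lin_congr fun g hg => ?_
        rw [lin_mapDomain]
        by_cases h : g.1 = S
        · simp [hf, h, ofOption, lin_one, lin_single_id]
        · simp [hf, h, lin_zero]
      · rw [lin_mapDomain]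
        refine lin_eq_zero fun S' hS' => ?_
        rw [hf]
        simp only
        rw [if_neg (hne g hg _ hT₀ S' hS' S rfl)]
        rfl
  have hleaf : ∀ g ∈ x.support, ∃ n w, g.1 = .tree (.corolla n w) ∧ g.1.inputs = n ∧
      g.1.weight = w ∧ StableVertex n w ∧ g.1.dim = n + 2 * size w - 2 ∧ n + 2 * size w = N ∧
      g.2.IsLeftWord ∧ g.2.rightInputs = 0 := by
    rintro ⟨S, T⟩ hg
    obtain ⟨y, hy, hyc⟩ := hslice S ⟨T, hg⟩
    have hys : ∀ U ∈ y.support, (S, U) ∈ x.support := fun U hU => by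
      grind
    have hTy : T ∈ y.support := by
      grind
    rcases hcases _ hg with ⟨rfl, -, h⟩ | ⟨n, w, h1, h2, h3, h4, h5, h6, -⟩
    · have := leftInputs_eq_zero (x := y) (fun U hU => ⟨?_, (hx _ (hys U hU)).1.2⟩) hyc hTy
      · grind
      · rcases hcases _ (hys U hU) with ⟨-, h, -⟩ | ⟨_, _, e, -⟩
        · exact h
        · cases e
    · have h7 := IsLeftWord.rightInputs_eq_zero (x := y) (fun U hU => ?_) hyc hTy
      · rcases hcases _ hg with ⟨e, -⟩ | ⟨_, _, -, -, -, -, -, -, h8⟩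
        · cases h1.symm.trans e
        grind
      · rcases hcases _ (hys U hU) with ⟨e, -⟩ | ⟨_, _, -, -, -, -, -, -, h⟩
        · cases h1.symm.trans e
        · exact h
  rw [← Finsupp.support_eq_empty, Finset.eq_empty_iff_forall_notMem]
  rintro ⟨S, T⟩ hg
  obtain ⟨n, w, h1, h2, h3, h4, h5, h6, h7, h8⟩ := hleaf _ hg
  simp only at h1 h2 h3 h4 h5 h6 h7 h8
  subst h1
  obtain ⟨S', hS'⟩ := exists_bd_corolla_apply (R := R) (n := n) (w := w) (by omega)
  have hmem : S' ∈ ((tree (.corolla n w)).bd R).support := by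
    grind
  have hval := DFunLike.congr_fun hc (S', T)
  rw [pairBd_apply, Finsupp.add_apply] at hval
  have e2 : mapSnd R (BTree.bd R) x (S', T) = 0 := by
    by_contra h
    obtain ⟨g, hg', e, -⟩ := mem_support_mapSnd (mem_support_iff.2 h)
    grind
  -- The inputs and the weight of `S'` determine the corolla from which it is expanded, so a single
  -- term contributes, with coefficient `1`.
  have e1 : mapFst R (XTree.bd R) x (S', T) = x (.tree (.corolla n w), T) := by
    rw [mapFst, lin, linearCombination_apply, Finsupp.sum, finsetSum_apply,
      sum_eq_single (.tree (.corolla n w), T)]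
    · rw [Finsupp.smul_apply]
      simp only
      rw [show (S', T) = (fun a => (a, T)) S' from rfl,
        Finsupp.mapDomain_apply fun _ _ h => (Prod.mk.inj h).1, hS', smul_eq_mul, mul_one]
    · rintro ⟨S'', T''⟩ hg' hne'
      rw [Finsupp.smul_apply]
      by_contra h
      have hne0 := right_ne_zero_of_smul h
      obtain ⟨y, hy, e⟩ := mem_image.1
        (mapDomain_support (mem_support_iff.2 hne0))
      cases e
      obtain ⟨n', w', k1, k2, k3, k4, k5, k6, k7, k8⟩ := hleaf _ hg'
      simp only at k1 k2 k3 k4 k5 k6 k7 k8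
      subst k1
      refine hne' ?_
      have a1 := (XTree.attr_of_mem_bd (hx _ hg).1.1 hmem).1
      have a2 := (XTree.attr_of_mem_bd (hx _ hg').1.1 hy).1
      rw [a1] at a2
      have b1 := congrArg fst a2
      have b2 := congrArg (fun x => x.2.1) a2
      simp only [XTree.attr] at b1 b2
      grind
    grind
  grind

/-- A cycle is homologous to a cycle of words, which is zero in this extremal dimension. -/
lemma exists_pairBd_eq {N : ℕ} (hN : 3 ≤ N) {z : I ⨳ J →₀ R}
    (hz : ∀ g ∈ z.support, IsGoodPair N (N - 2) g) (hc : pairBd R I J z = 0) :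
    ∃ y, pairBd R I J y = z ∧ ∀ g ∈ y.support, IsGoodPair N (N - 1) g ∧ g.2 ≠ .strand := by
  obtain ⟨x, y, h1, h2, h3, h4⟩ := exists_pairBd_add_word hz hc
  grind [eq_zero_of_word, zero_add]

end Acyclic

/-! ### Actions of a nonsymmetric operad -/

/-- A complex with an action of a nonsymmetric operad by insertions `act x i y` of `y` at the `i`-th
input of `x`, on bases. -/
structure OperadAction (R : Type*) [CommRing R] (X Y : Type*) where
  arity : X → ℕ
  arity' : Y → ℕ
  act : X → ℕ → Y → Option X
  comp : Y → ℕ → Y → Option Y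
  dX : X → X →₀ R
  dY : Y → Y →₀ R
  good : X → Prop
  good' : Y → Prop
  arity_act : ∀ {x i y z}, act x i y = some z → arity z + 1 = arity x + arity' y
  good_act : ∀ {x i y z}, good x → good' y → act x i y = some z → good z
  seq : ∀ {x i y k} z, good x → good' y → i < arity x → k < arity' y →
    (act x i y).bind (fun u => act u (i + k) z) = (comp y k z).bind fun v => act x i v
  par : ∀ {x i y k} z, good x → good' y → i < k → k < arity x →
    (act x i y).bind (fun u => act u (k + arity' y - 1) z) = (act x k z).bind fun u => act u i y
  leibniz : ∀ {x i y}, good x → good' y → i < arity x → lin R dX (ofOption R (act x i y)) =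
    lin R (fun x' => ofOption R (act x' i y)) (dX x) +
      lin R (fun y' => ofOption R (act x i y')) (dY y)
  arity_d : ∀ {x x'}, good x → x' ∈ (dX x).support → arity x' = arity x

namespace OperadAction

variable {R : Type*} [CommRing R] {X Y : Type*} (A : OperadAction R X Y)

/-- The sum of all insertions of `a` into `x`. -/
def insert (a : Y →₀ R) (x : X) : X →₀ R :=
  ∑ i ∈ range (A.arity x), lin R (fun y => ofOption R (A.act x i y)) a

/-- The sum of all insertions of `b` into `a`. -/
def circ (a b : Y →₀ R) : Y →₀ R :=
  lin R (fun y => ∑ k ∈ range (A.arity' y), lin R (fun z => ofOption R (A.comp y k z)) b) a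

/-- The sum of all insertions of `a` and `b` into different inputs of `x`, that of `a` coming
first. -/
def insertBoth (a b : Y →₀ R) (x : X) : X →₀ R :=
  ∑ k ∈ range (A.arity x), ∑ i ∈ range k,
    lin R (fun y => lin R (fun z => ofOption R ((A.act x k z).bind fun u => A.act u i y)) b) a

lemma insert_sum {I : Type*} (s : Finset I) (a : I → Y →₀ R) (x : X) :
    A.insert (∑ i ∈ s, a i) x = ∑ i ∈ s, A.insert (a i) x := by
  simp only [insert, map_sum]
  exact sum_comm

lemma insert_zero (x : X) : A.insert 0 x = 0 := by simp [insert]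

lemma circ_zero (a : Y →₀ R) : A.circ a 0 = 0 := by simp [circ, lin_zero]

lemma zero_circ (a : Y →₀ R) : A.circ 0 a = 0 := by simp [circ]

/-- The inputs of `x ∘_i y` are the inputs of `x` before `i`, those of `y`, and those of `x` after
`i`. The sequential axiom treats the second group, the parallel axiom the third. -/
lemma sum_act {x : X} {y : Y} (hx : A.good x) (hy : A.good' y) {i : ℕ} (hi : i < A.arity x)
    (z : Y) : (A.act x i y).elim 0
        (fun u => ∑ j ∈ range (A.arity u), ofOption R (A.act u j z)) =
      (∑ k ∈ range (A.arity' y), ofOption R ((A.comp y k z).bind fun v => A.act x i v))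
      + ∑ j ∈ range i, ofOption R ((A.act x i y).bind fun u => A.act u j z)
      + ∑ k ∈ Ico (i + 1) (A.arity x),
        ofOption R ((A.act x k z).bind fun u => A.act u i y) := by
  have e1 : ∀ k ∈ range (A.arity' y),
      ofOption R ((A.comp y k z).bind fun v => A.act x i v) =
        ofOption R ((A.act x i y).bind fun u => A.act u (i + k) z) := fun k hk => by
    rw [A.seq z hx hy hi (mem_range.1 hk)]
  have e2 : ∀ k ∈ Ico (i + 1) (A.arity x),
      ofOption R ((A.act x k z).bind fun u => A.act u i y) =
        ofOption R ((A.act x i y).bind fun u => A.act u (k + A.arity' y - 1) z) := fun k hk => by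
    obtain ⟨h1, h2⟩ := Finset.mem_Ico.1 hk
    rw [A.par z hx hy h1 h2]
  rw [sum_congr rfl e1, sum_congr rfl e2]
  rcases h : A.act x i y with _ | u
  · simp
  · have := A.arity_act h
    simp only [Option.elim_some, bind_some]
    obtain ⟨n, hn⟩ := Nat.exists_eq_add_of_le (Nat.succ_le_of_lt hi)
    rw [show A.arity u = i + A.arity' y + n by omega, Finset.sum_range_add, Finset.sum_range_add,
      hn, Finset.sum_Ico_eq_sum_range, add_comm (∑ j ∈ range i, _),
      show i.succ + n - (i + 1) = n by omega]
    congr 1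
    refine sum_congr rfl fun k _ => ?_
    rw [show i + 1 + k + A.arity' y - 1 = i + A.arity' y + k by omega]

lemma lin_insert_act {b : Y →₀ R} {x : X} {y : Y} (hx : A.good x) (hy : A.good' y) {i : ℕ}
    (hi : i < A.arity x) : lin R (A.insert b) (ofOption R (A.act x i y)) =
      ∑ k ∈ range (A.arity' y),
        lin R (fun z => ofOption R ((A.comp y k z).bind fun v => A.act x i v)) b
      + ∑ j ∈ range i, lin R (fun z => ofOption R ((A.act x i y).bind fun u => A.act u j z)) b
      + ∑ k ∈ Ico (i + 1) (A.arity x),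
        lin R (fun z => ofOption R ((A.act x k z).bind fun u => A.act u i y)) b := by
  rw [← lin_sum, ← lin_sum, ← lin_sum, ← lin_add, ← lin_add,
    lin_ofOption]
  refine Eq.trans ?_ (lin_congr fun z _ => A.sum_act hx hy hi z)
  cases A.act x i y with
  | none => exact (lin_zero (V := X →₀ R) b).symm
  | some u =>
    simp only [Option.elim_some, lin_sum]
    rfl

lemma lin_act_circ (a b : Y →₀ R) (x : X) (i : ℕ) :
    lin R (fun v => ofOption R (A.act x i v)) (A.circ a b) =
      lin R (fun y => ∑ k ∈ range (A.arity' y),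
        lin R (fun z => ofOption R ((A.comp y k z).bind fun v => A.act x i v)) b) a := by
  rw [circ, lin_lin]
  refine lin_congr fun y _ => ?_
  rw [map_sum]
  refine sum_congr rfl fun k _ => ?_
  rw [lin_lin]
  refine lin_congr fun z _ => ?_
  rw [ofOption_bind]

lemma lin_insert_lin_act {a b : Y →₀ R} {x : X} (hx : A.good x)
    (ha : ∀ y ∈ a.support, A.good' y) {i : ℕ} (hi : i < A.arity x) :
    lin R (A.insert b) (lin R (fun y => ofOption R (A.act x i y)) a) =
      lin R (fun v => ofOption R (A.act x i v)) (A.circ a b)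
      + ∑ j ∈ range i, lin R (fun z => lin R (fun y => ofOption R
          ((A.act x i y).bind fun u => A.act u j z)) a) b
      + ∑ k ∈ Ico (i + 1) (A.arity x), lin R (fun y => lin R (fun z => ofOption R
          ((A.act x k z).bind fun u => A.act u i y)) b) a := by
  rw [lin_lin, lin_congr fun y hy => A.lin_insert_act hx (ha y hy) hi,
    lin_add, lin_add, lin_sum _ _ a, lin_sum _ _ a, lin_act_circ]
  congr 2
  refine sum_congr rfl fun j _ => ?_
  exact lin_comm (fun y z => ofOption R ((A.act x i y).bind fun u => A.act u j z)) a b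

/-- The second insertion is made inside the first, or at an input before or after it. Summed
symmetrically over families, the last two kinds cancel. -/
lemma lin_insert_insert {a b : Y →₀ R} {x : X} (hx : A.good x) (ha : ∀ y ∈ a.support, A.good' y) :
    lin R (A.insert b) (A.insert a x) =
      A.insert (A.circ a b) x + A.insertBoth b a x + A.insertBoth a b x := by
  have e : A.insertBoth a b x = ∑ i ∈ range (A.arity x), ∑ k ∈ Ico (i + 1) (A.arity x),
      lin R (fun y => lin R (fun z => ofOption R
          ((A.act x k z).bind fun u => A.act u i y)) b) a :=
    Finset.sum_comm' fun k i => by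
      simp only [mem_range, Finset.mem_Ico]
      omega
  rw [e, insert, map_sum, insert, insertBoth, ← sum_add_distrib, ← sum_add_distrib]
  exact sum_congr rfl fun i hi => A.lin_insert_lin_act hx ha (mem_range.1 hi)

lemma lin_dX_insert {a : Y →₀ R} {x : X} (hx : A.good x) (ha : ∀ y ∈ a.support, A.good' y) :
    lin R A.dX (A.insert a x) = lin R (A.insert a) (A.dX x) + A.insert (lin R A.dY a) x := by
  have : lin R (A.insert a) (A.dX x) = ∑ i ∈ range (A.arity x),
      lin R (fun x' => lin R (fun y => ofOption R (A.act x' i y)) a) (A.dX x) := by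
    rw [← lin_sum]
    exact lin_congr fun x' hx' => by rw [insert, A.arity_d hx hx']
  rw [this, insert, insert, map_sum, ← sum_add_distrib]
  refine sum_congr rfl fun i hi => ?_
  rw [lin_comm, lin_lin, lin_lin, ← lin_add]
  exact lin_congr fun y hy => A.leibniz hx (ha y hy) (mem_range.1 hi)

/-- The square of the total differential of a family solving the Maurer–Cartan equation. -/
lemma sum_insert [CharP R 2] {φ : ℕ → Y →₀ R} (hφ : ∀ d, ∀ y ∈ (φ d).support, A.good' y)
    (h : ∀ d, lin R A.dY (φ d) = ∑ p ∈ anti d, A.circ (φ p.1) (φ p.2)) {x : X}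
    (hx : A.good x) (d : ℕ) :
    lin R A.dX (A.insert (φ d) x) + lin R (A.insert (φ d)) (A.dX x) +
      ∑ p ∈ anti d, lin R (A.insert (φ p.1)) (A.insert (φ p.2) x) = 0 := by
  simp only [A.lin_dX_insert hx (hφ d), A.lin_insert_insert hx (hφ _), sum_add_distrib]
  rw [anti_swap' d fun i j => A.insertBoth (φ j) (φ i) x, add_assoc,
    add_assoc (∑ p ∈ anti d, A.insert _ x), add_self R, add_zero, h,
    insert_sum, anti_swap' d fun i j => A.insert (A.circ (φ i) (φ j)) x,
    add_comm (lin R _ _) (∑ p ∈ anti d, _), add_self R]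

lemma mem_support_insert {a : Y →₀ R} {x u : X} (hu : u ∈ (A.insert a x).support) :
    ∃ i, ∃ y ∈ a.support, A.act x i y = some u := by
  classical
  obtain ⟨i, -, hu⟩ := mem_biUnion.1 (support_finsetSum hu)
  obtain ⟨y, hy, hu⟩ := mem_lin hu
  exact ⟨i, y, hy, mem_ofOption hu⟩

end OperadAction

/-! ### Sums over the fibres of a grading -/

/-- A sum over decompositions of multigraded indices is regrouped by total degree. This passes
between relations indexed by weights or corollas and relations indexed by a single natural number.
-/
lemma sum_fiber_antidiagonal {M V : Type*} [AddCommMonoid M] [Finset.HasAntidiagonal M]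
    [AddCommMonoid V] {deg : M → ℕ} (hdeg : ∀ a b, deg (a + b) = deg a + deg b)
    {fib : ℕ → Finset M} (hfib : ∀ d m, m ∈ fib d ↔ deg m = d) (d : ℕ) (F : M → M → V) :
    ∑ m ∈ fib d, ∑ p ∈ anti m, F p.1 p.2 =
      ∑ q ∈ anti d, ∑ a ∈ fib q.1, ∑ b ∈ fib q.2, F a b := by
  simp only [← Finset.sum_product' (f := F)]
  rw [sum_sigma', sum_sigma']
  refine sum_bij' (fun x _ => ⟨(deg x.2.1, deg x.2.2), x.2⟩)
    (fun x _ => ⟨x.2.1 + x.2.2, x.2⟩) ?_ ?_ ?_ ?_ ?_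
  · rintro ⟨m, p⟩ h
    simp only [mem_sigma, mem_anti, hfib, mem_product] at h ⊢
    obtain ⟨rfl, rfl⟩ := h
    simp [hdeg]
  · rintro ⟨m, p⟩ h
    simp only [mem_sigma, mem_anti, hfib, mem_product] at h ⊢
    simp [hdeg, h]
  · rintro ⟨m, p⟩ h
    simp only [mem_sigma, mem_anti] at h
    obtain ⟨-, rfl⟩ := h
    rfl
  · rintro ⟨⟨m, n⟩, p⟩ h
    simp only [mem_sigma, mem_anti, hfib, mem_product] at h
    obtain ⟨-, rfl, rfl⟩ := h
    rfl
  · simp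

/-! ### The actions on pairs of trees -/

section Tmul

variable {R : Type*} [CommRing R] {A B α β : Type*}

/-- The pair of two optional generators. -/
def both (o : Option A) (p : Option B) : Option (A × B) := o.bind fun a => p.map fun b => (a, b)

lemma both_eq_some {o : Option A} {p : Option B} {z : A × B} (h : both o p = some z) :
    o = some z.1 ∧ p = some z.2 := by
  obtain ⟨a, ha, h⟩ := Option.bind_eq_some_iff.1 h
  aesop

lemma both_bind (o : Option A) (p : Option B) (f : A → Option α) (g : B → Option β) :
    ((both o p).bind fun u => both (f u.1) (g u.2)) = both (o.bind f) (p.bind g) := by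
  cases o <;> cases p <;> simp [both]

/-- `x ⊗ y`. -/
def tmul (x : A →₀ R) (y : B →₀ R) : A × B →₀ R :=
  lin R (fun a => lin R (fun b => single (a, b) 1) y) x

lemma ofOption_both (o : Option A) (p : Option B) :
    ofOption R (both o p) = tmul (ofOption R o) (ofOption R p) := by
  cases o <;> cases p <;> simp [both, tmul]

lemma lin_both_left (f : α → Option A) (p : Option B) (x : α →₀ R) :
    lin R (fun a => ofOption R (both (f a) p)) x =
      tmul (lin R (fun a => ofOption R (f a)) x) (ofOption R p) := by
  simp only [ofOption_both, tmul, lin_lin]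

lemma lin_both_right (o : Option A) (f : β → Option B) (x : β →₀ R) :
    lin R (fun a => ofOption R (both o (f a))) x =
      tmul (ofOption R o) (lin R (fun a => ofOption R (f a)) x) := by
  simp only [ofOption_both, tmul, lin_lin]
  rw [lin_comm]

/-- The differential of a tensor product, on generators. -/
def pairD (d : A → A →₀ R) (d' : B → B →₀ R) (g : A × B) : A × B →₀ R :=
  (d g.1).mapDomain (fun a => (a, g.2)) + (d' g.2).mapDomain fun b => (g.1, b)

lemma lin_pairD_tmul (d : A → A →₀ R) (d' : B → B →₀ R) (x : A →₀ R) (y : B →₀ R) :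
    lin R (pairD d d') (tmul x y) = tmul (lin R d x) y + tmul x (lin R d' y) := by
  simp only [tmul, lin_lin, lin_one, pairD, lin_add, map_eq_lin]
  congr 1
  exact lin_congr fun a _ => lin_comm _ _ _

lemma lin_pairD_both {A' B' : Type*} (f : A → Option A') (f' : B → Option B') (d : A → A →₀ R)
    (d' : B → B →₀ R) (g : A × B) :
    lin R (fun z => ofOption R (both (f z.1) (f' z.2))) (pairD d d' g) =
      tmul (lin R (fun a => ofOption R (f a)) (d g.1)) (ofOption R (f' g.2)) +
      tmul (ofOption R (f g.1)) (lin R (fun b => ofOption R (f' b)) (d' g.2)) := by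
  rw [pairD, map_add, lin_mapDomain, lin_mapDomain]
  dsimp only
  rw [lin_both_left, lin_both_right]

lemma tmul_add (x : A →₀ R) (y z : B →₀ R) : tmul x (y + z) = tmul x y + tmul x z := by
  simp [tmul, lin_add]

lemma add_tmul (x y : A →₀ R) (z : B →₀ R) : tmul (x + y) z = tmul x z + tmul y z := by
  simp [tmul]

lemma mem_support_pairD {d : A → A →₀ R} {d' : B → B →₀ R} {g z : A × B}
    (h : z ∈ (pairD d d' g).support) :
    z.1 ∈ (d g.1).support ∧ z.2 = g.2 ∨ z.1 = g.1 ∧ z.2 ∈ (d' g.2).support := by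
  classical
  rcases mem_add h with h | h
  · obtain ⟨a, ha, rfl⟩ := mem_image.1 (mapDomain_support h)
    simp_all
  · obtain ⟨a, ha, rfl⟩ := mem_image.1 (mapDomain_support h)
    simp_all

end Tmul

section Actions

variable (R : Type*) [CommRing R] [CharP R 2] (I J : Type) [Fintype I] [Fintype J]
  [DecidableEq I] [DecidableEq J]

/-- The action of pairs of extended trees on pairs of an extended tree and a bimodule tree by
simultaneous gluing at the inputs of the first and the left inputs of the second tree. -/
def leftAction : OperadAction R (I ⨳ J) (XTree I × XTree J) where
  arity g := g.1.inputs
  arity' h := h.1.inputs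
  act g i h := both (g.1.graft i h.1) (g.2.graftLeft i h.2)
  comp h i h' := both (h.1.graft i h'.1) (h.2.graft i h'.2)
  dX := pairD (XTree.bd R) (BTree.bd R)
  dY := pairD (XTree.bd R) (XTree.bd R)
  good g := g.1.Stable ∧ g.2.Stable ∧ g.1.inputs = g.2.leftInputs
  good' h := h.1.Stable ∧ h.2.Stable ∧ h.1.inputs = h.2.inputs
  arity_act h := inputs_graft (both_eq_some h).1
  good_act := by
    rintro x i y z ⟨h1, h2, h3⟩ ⟨h4, h5, h6⟩ h
    grind [both_eq_some, stable_graft, stable_graftLeft, inputs_graft,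
      leftInputs_graftLeft]
  seq := by
    rintro x i y k z ⟨-, -, h3⟩ ⟨-, -, h6⟩ hi hk
    rw [both_bind _ _ (fun u : XTree I => u.graft (i + k) z.1)
        (fun u : BTree I J => u.graftLeft (i + k) z.2),
      both_bind _ _ (fun v : XTree I => x.1.graft i v) (fun v : XTree J => x.2.graftLeft i v),
      graft_seq _ _ _ _ _ hi hk, graftLeft_seq _ _ _ _ _ (by omega) (by omega)]
  par := by
    rintro x i y k z ⟨-, -, h3⟩ ⟨-, -, h6⟩ hi hk
    rw [both_bind _ _ (fun u : XTree I => u.graft (k + y.1.inputs - 1) z.1)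
        (fun u : BTree I J => u.graftLeft (k + y.1.inputs - 1) z.2),
      both_bind _ _ (fun v : XTree I => v.graft i y.1) (fun v : BTree I J => v.graftLeft i y.2),
      graft_par _ _ _ _ _ hi hk, h6, graftLeft_par _ _ _ _ _ hi (by omega)]
  leibniz := by
    rintro x i y ⟨h1, h2, h3⟩ ⟨-, h5, -⟩ hi
    rw [ofOption_both, lin_pairD_tmul, lin_bd_graft h1 hi, lin_bd_graftLeft h2 h5 (h3 ▸ hi),
      lin_pairD_both (fun a : XTree I => a.graft i y.1) (fun b : BTree I J => b.graftLeft i y.2),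
      lin_pairD_both (fun a : XTree I => x.1.graft i a) (fun b : XTree J => x.2.graftLeft i b), tmul_add,
      add_tmul]
    grind
  arity_d := by
    rintro x x' ⟨h1, -, -⟩ h
    rcases mem_support_pairD h with ⟨h, -⟩ | ⟨h, -⟩
    · simpa [XTree.attr] using congrArg fst (XTree.attr_of_mem_bd h1 h).1
    · rw [h]

/-- The action of extended trees on pairs of an extended tree and a bimodule tree by gluing at the
right inputs of the second tree. -/
def rightAction : OperadAction R (I ⨳ J) (XTree I) where
  arity g := g.2.rightInputs
  arity' h := h.inputs
  act g i h := both (some g.1) (g.2.graftRight i h)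
  comp h i h' := h.graft i h'
  dX := pairD (XTree.bd R) (BTree.bd R)
  dY := XTree.bd R
  good g := g.1.Stable ∧ g.2.Stable ∧ g.1.inputs = g.2.leftInputs
  good' h := h.Stable
  arity_act h := rightInputs_graftRight (both_eq_some h).2
  good_act := by
    grind [both_eq_some, Option.some_injective, leftInputs_graftRight,
      stable_graftRight]
  seq := by
    rintro x i y k z - - hi hk
    rw [both_bind _ _ (fun u : XTree I => some u) (fun u : BTree I J => u.graftRight (i + k) z),
      graftRight_seq _ _ _ _ _ hi hk]
    cases y.graft k z <;> rfl
  par := by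
    rintro x i y k z - - hi hk
    rw [both_bind _ _ (fun u : XTree I => some u)
        (fun u : BTree I J => u.graftRight (k + y.inputs - 1) z),
      both_bind _ _ (fun u : XTree I => some u) (fun v : BTree I J => v.graftRight i y),
      graftRight_par _ _ _ _ _ hi hk]
  leibniz := by
    rintro x i y ⟨-, h2, -⟩ h5 hi
    rw [ofOption_both, lin_pairD_tmul, lin_bd_graftRight h2 h5 hi,
      lin_pairD_both (fun a : XTree I => some a) (fun b : BTree I J => b.graftRight i y),
      lin_both_right, tmul_add, ← add_assoc, ofOption_some, lin_one]
    congr 3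
    exact (lin_single_id _).symm
  arity_d := by
    rintro x x' ⟨-, h2, -⟩ h
    rcases mem_support_pairD h with ⟨-, h⟩ | ⟨-, h⟩
    · rw [h]
    · exact rightInputs_of_mem_bd h2 h

lemma leftAct_rightAct (g : I ⨳ J) (i : ℕ) (h : XTree I × XTree J) (j : ℕ)
    (S : XTree I) : (((leftAction R I J).act g i h).bind fun u => (rightAction R I J).act u j S) =
      ((rightAction R I J).act g j S).bind fun u => (leftAction R I J).act u i h := by
  have e1 := both_bind (g.1.graft i h.1) (g.2.graftLeft i h.2) (fun u : XTree I => some u)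
    (fun u : BTree I J => u.graftRight j S)
  have e2 := both_bind (some g.1) (g.2.graftRight j S) (fun u : XTree I => u.graft i h.1)
    (fun u : BTree I J => u.graftLeft i h.2)
  rw [graftLeft_graftRight] at e1
  rw [bind_some] at e2
  refine e1.trans (Eq.trans ?_ e2.symm)
  simp

/-- Insertions on the left and on the right commute. -/
lemma lin_insert_left_right (a : XTree I × XTree J →₀ R) (b : XTree I →₀ R)
    (g : I ⨳ J) :
    lin R ((rightAction R I J).insert b) ((leftAction R I J).insert a g) =
      lin R ((leftAction R I J).insert a) ((rightAction R I J).insert b g) := by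
  have e1 : lin R ((rightAction R I J).insert b) ((leftAction R I J).insert a g) =
      ∑ i ∈ range g.1.inputs, ∑ j ∈ range g.2.rightInputs,
        lin R (fun h => lin R (fun S => ofOption R (((leftAction R I J).act g i h).bind
          fun u => (rightAction R I J).act u j S)) b) a := by
    rw [OperadAction.insert, map_sum]
    refine sum_congr rfl fun i _ => ?_
    rw [lin_lin, ← lin_sum]
    refine lin_congr fun h _ => ?_
    rw [lin_ofOption]
    rcases e : (leftAction R I J).act g i h with _ | u
    · simp [lin_zero]
    · have : u.2.rightInputs = g.2.rightInputs :=
        rightInputs_graftLeft (both_eq_some e).2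
      rw [← this]
      rfl
  have e2 : lin R ((leftAction R I J).insert a) ((rightAction R I J).insert b g) =
      ∑ j ∈ range g.2.rightInputs, ∑ i ∈ range g.1.inputs,
        lin R (fun S => lin R (fun h => ofOption R (((rightAction R I J).act g j S).bind
          fun u => (leftAction R I J).act u i h)) a) b := by
    rw [OperadAction.insert, map_sum]
    refine sum_congr rfl fun i _ => ?_
    rw [lin_lin, ← lin_sum]
    refine lin_congr fun h _ => ?_
    rw [lin_ofOption]
    rcases e : (rightAction R I J).act g i h with _ | u
    · simp [lin_zero]
    · have : g.1 = u.1 := Option.some_injective _ (both_eq_some (o := some g.1) e).1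
      rw [this]
      rfl
  rw [e1, e2, sum_comm]
  refine sum_congr rfl fun j _ => sum_congr rfl fun i _ => ?_
  rw [lin_comm]
  simp [lin_congr, leftAct_rightAct]

end Actions

/-! ### Derivations of operations on words -/

section Words

variable {R : Type*} [CommRing R]

/-- If inserting into a letter of `l` amounts to inserting into `C l`, then insertion is a derivation
of `C`. -/
lemma OperadAction.lin_insert_word {X Y : Type*} (A : OperadAction R X Y) {G : X → Prop}
    {C : List X → X →₀ R}
    (har : ∀ l, (∀ x ∈ l, G x) → ∀ u ∈ (C l).support, A.arity u = (l.map A.arity).sum)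
    (hC : ∀ l₁ x l₂, (∀ z ∈ l₁ ++ x :: l₂, G z) → ∀ j < A.arity x, ∀ y,
      lin R (fun u => ofOption R (A.act u ((l₁.map A.arity).sum + j) y)) (C (l₁ ++ x :: l₂)) =
        lin R (fun x' => C (l₁ ++ x' :: l₂)) (ofOption R (A.act x j y)))
    (a : Y →₀ R) {l : List X} (hl : ∀ x ∈ l, G x) :
    lin R (A.insert a) (C l) = lin R C (ins (letterPart (A.insert a)) l) := by
  have key : ∀ m l₁, (∀ z ∈ l₁ ++ m, G z) →
      ∑ i ∈ range (m.map A.arity).sum, lin R (fun y => lin R (fun u =>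
        ofOption R (A.act u ((l₁.map A.arity).sum + i) y)) (C (l₁ ++ m))) a =
      lin R (fun m' => C (l₁ ++ m')) (ins (letterPart (A.insert a)) m) := by
    intro m
    induction m with
    | nil => simp [ins_letterPart_nil]
    | cons x m ih =>
      intro l₁ hG
      have h2 := ih (l₁ ++ [x]) (by simpa using hG)
      simp only [List.append_assoc, List.singleton_append, map_append, List.sum_append,
        map_cons, List.map_nil, sum_cons, List.sum_nil, add_zero, add_assoc] at h2
      rw [ins_letterPart_cons, map_add, lin_mapDomain, lin_mapDomain, map_cons, sum_cons,
        Finset.sum_range_add, h2, OperadAction.insert, map_sum]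
      congr 1
      refine sum_congr rfl fun j hj => ?_
      rw [lin_lin]
      grind
  refine Eq.trans ?_ (key l [] hl)
  have : lin R (A.insert a) (C l) = lin R (fun u => ∑ i ∈ range (l.map A.arity).sum,
      lin R (fun y => ofOption R (A.act u i y)) a) (C l) :=
    lin_congr fun u hu => by rw [OperadAction.insert, har l hl u hu]
  rw [this, lin_sum]
  refine sum_congr rfl fun i _ => ?_
  rw [lin_comm]
  simp

lemma tmul_single {A B : Type*} (x : A →₀ R) (b : B) :
    tmul x (single b 1) = x.mapDomain fun a => (a, b) := by
  simp only [tmul, lin_one, map_eq_lin]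

/-- The differential of a tensor product, applied letter by letter. -/
lemma lin_tmul_ins_pairD {A B A' B' : Type*} (d : A → A →₀ R) (d' : B → B →₀ R)
    (f : List A → A' →₀ R) (g : List B → B' →₀ R) (l : List (A × B)) :
    lin R (fun l => tmul (f (l.map fst)) (g (l.map snd))) (ins (letterPart (pairD d d')) l) =
      tmul (lin R f (ins (letterPart d) (l.map fst))) (g (l.map snd)) +
        tmul (f (l.map fst)) (lin R g (ins (letterPart d') (l.map snd))) := by
  induction l generalizing f g with
  | nil => simp [ins_letterPart_nil, tmul, lin_zero]
  | cons x l ih =>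
    have h := ih (fun m => f (x.1 :: m)) fun m => g (x.2 :: m)
    simp only [map_cons, ins_letterPart_cons, map_add, lin_mapDomain, add_tmul, tmul_add]
    rw [h, pairD, map_add, lin_mapDomain, lin_mapDomain]
    have h1 : lin R (fun a => tmul (f (a :: l.map fst)) (g (x.2 :: l.map snd))) (d x.1) =
        tmul (lin R (fun a => f (a :: l.map fst)) (d x.1)) (g (x.2 :: l.map snd)) := by
      simp only [tmul, lin_lin]
    have h2 : lin R (fun b => tmul (f (x.1 :: l.map fst)) (g (b :: l.map snd))) (d' x.2) =
        tmul (f (x.1 :: l.map fst)) (lin R (fun b => g (b :: l.map snd)) (d' x.2)) := by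
      simp only [tmul, lin_lin]
      rw [lin_comm]
    grind

end Words

/-! ### The operations `CR` on pairs -/

section Central

variable {R : Type*} [CommRing R] {I J : Type} [Fintype I] [Fintype J]

namespace BTree

lemma leftInputs_plug (T U : BTree I J) : (T.plug U).leftInputs = T.leftInputs + U.leftInputs := by
  simpa [attr] using congrArg fst (attr_plug T U)

lemma rightInputs_plug (T U : BTree I J) :
    (T.plug U).rightInputs = T.rightInputs + U.rightInputs := by
  simpa [attr] using congrArg (fun a => a.2.1) (attr_plug T U)

lemma leftInputs_centralJoin (l : List (BTree I J)) :
    (centralJoin l).leftInputs = (l.map leftInputs).sum := by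
  induction l with
  | nil => rfl
  | cons T l ih => rw [centralJoin_cons, leftInputs_plug, ih, map_cons, sum_cons, add_comm]

lemma rightInputs_centralJoin (l : List (BTree I J)) :
    (centralJoin l).rightInputs = (l.map rightInputs).sum := by
  induction l with
  | nil => rfl
  | cons T l ih => rw [centralJoin_cons, rightInputs_plug, ih, map_cons, sum_cons, add_comm]

lemma centralJoin_middle (l₁ : List (BTree I J)) (T : BTree I J) (l₂ : List (BTree I J)) :
    centralJoin (l₁ ++ T :: l₂) = (centralJoin l₂).plug (T.plug (centralJoin l₁)) := by
  rw [centralJoin_append, centralJoin_cons, plug_assoc]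

lemma graftLeft_centralJoin (l₁ : List (BTree I J)) (T : BTree I J)
    (l₂ : List (BTree I J)) {j : ℕ} (hj : j < T.leftInputs) (S : XTree J) :
    (centralJoin (l₁ ++ T :: l₂)).graftLeft ((l₁.map leftInputs).sum + j) S =
      (T.graftLeft j S).map fun T' => centralJoin (l₁ ++ T' :: l₂) := by
  simp only [centralJoin_middle]
  rw [← leftInputs_centralJoin, graftLeft_plug, if_pos (by rw [leftInputs_plug]; omega),
    graftLeft_plug, if_neg (by omega), Nat.add_sub_cancel_left, Option.map_map]
  rfl

lemma graftRight_centralJoin (l₁ : List (BTree I J)) (T : BTree I J)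
    (l₂ : List (BTree I J)) {j : ℕ} (hj : j < T.rightInputs) (S : XTree I) :
    (centralJoin (l₁ ++ T :: l₂)).graftRight ((l₁.map rightInputs).sum + j) S =
      (T.graftRight j S).map fun T' => centralJoin (l₁ ++ T' :: l₂) := by
  simp only [centralJoin_middle]
  rw [← rightInputs_centralJoin, graftRight_plug, if_pos (by rw [rightInputs_plug]; omega),
    graftRight_plug, if_neg (by omega), Nat.add_sub_cancel_left, Option.map_map]
  rfl

end BTree

variable (R) in
/-- The operation `CR^v`, on stable corollas only. -/
def crOp (v : I → ℕ) (l : List (I ⨳ J)) : I ⨳ J →₀ R :=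
  tmul (corollaOp R v (l.map fst)) (single (centralJoin (l.map snd)) 1)

lemma mem_support_tmul_single {A B : Type*} {x : A →₀ R} {b : B} {z : A × B}
    (h : z ∈ (tmul x (single b 1)).support) : z.1 ∈ x.support ∧ z.2 = b := by
  classical
  rw [tmul_single] at h
  obtain ⟨a, ha, rfl⟩ := mem_image.1 (mapDomain_support h)
  exact ⟨ha, rfl⟩

lemma mem_support_crOp {v : I → ℕ} {l : List (I ⨳ J)}
    {z : I ⨳ J} (h : z ∈ (crOp R v l).support) : StableVertex l.length v ∧
      XTree.join v (l.map fst) = some z.1 ∧ z.2 = centralJoin (l.map snd) := by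
  obtain ⟨h1, h2⟩ := mem_support_tmul_single h
  grind [corollaOp, mem_ofOption]

/-- Joining along spines is associative, so the second factor is the same for every block and the
composition happens in the first factor alone. -/
lemma lin_crOp_crOp (v w : I → ℕ) (l : List (I ⨳ J)) :
    lin R (crOp R v) (ins (crOp R w) l) =
      tmul (lin R (corollaOp R v) (ins (corollaOp R w) (l.map fst)))
        (single (centralJoin (l.map snd)) 1) := by
  rw [lin_ins, lin_ins, threeSum_map, tmul_single, map_eq_lin, map_threeSum]
  refine threeSum_congr fun a b c h => ?_
  rw [crOp, tmul_single, lin_mapDomain, lin_lin]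
  refine lin_congr fun S _ => ?_
  rw [crOp, tmul_single, map_eq_lin]
  have : centralJoin (List.map snd (a ++ (S, centralJoin (b.map snd)) :: c)) =
      centralJoin (l.map snd) := by
    grind [map_append, map_cons, centralJoin_append, centralJoin_cons,
      plug_assoc]
  rw [this]
  simp

section Bd

variable [DecidableEq I] [DecidableEq J] [CharP R 2]

lemma BTree.bd_centralJoin {l : List (BTree I J)} (hl : ∀ T ∈ l, T.Stable) :
    (centralJoin l).bd R =
      lin R (fun l' => single (centralJoin l') 1) (ins (letterPart (bd R)) l) := by
  induction l with
  | nil => aesop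
  | cons T l ih =>
    rw [centralJoin_cons, bd_plug (stable_centralJoin fun U hU => hl U (by simp [hU]))
      (hl T (by simp)), ih fun U hU => hl U (by simp [hU]), ins_letterPart_cons, map_add,
      lin_mapDomain, lin_mapDomain, add_comm]
    simp only [map_eq_lin, lin_lin, lin_one, centralJoin_cons]

/-- The joining along spines obeys the Leibniz rule without extra terms. The corolla in the first
factor has besides its expansions, which are compositions of two operations `CR`. -/
lemma lin_pairD_crOp (v : I → ℕ) {l : List (I ⨳ J)} (hl : ∀ g ∈ l, g.2.Stable) :
    lin R (pairD (XTree.bd R) (BTree.bd R)) (crOp R v l) =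
      lin R (crOp R v) (ins (letterPart (pairD (XTree.bd R) (BTree.bd R))) l) +
        ∑ p ∈ anti v, lin R (crOp R p.1) (ins (crOp R p.2) l) := by
  have h1 : lin R (XTree.bd R) (corollaOp R v (l.map fst)) =
      lin R (corollaOp R v) (ins (letterPart (XTree.bd R)) (l.map fst)) +
        ∑ p ∈ anti v, lin R (corollaOp R p.1) (ins (corollaOp R p.2) (l.map fst)) := by
    rw [lin_bd_corollaOp, ← anti_ite_snd v fun u =>
      lin R (corollaOp R u) (ins (letterPart (XTree.bd R)) (l.map fst)),
      ← sum_add_distrib]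
    refine sum_congr rfl fun p _ => ?_
    rw [show ins (treeOp R p.2) (l.map fst) = _ from ins_add _ _ _, map_add, add_comm]
    congr 1
    split_ifs with h
    · rw [show letterPart (bdOp R p.2) = letterPart (XTree.bd R) from
        funext fun l => by rw [letterPart_bdOp, if_pos h]]
    simp_all [ins_eq_zero, letterPart_bdOp, if_neg, map_zero]
  have h2 : ∑ p ∈ anti v, lin R (crOp R p.1) (ins (crOp R p.2) l) =
      tmul (∑ p ∈ anti v, lin R (corollaOp R p.1) (ins (corollaOp R p.2) (l.map fst)))
        (single (centralJoin (l.map snd)) 1) := by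
    simp only [lin_crOp_crOp, tmul_single, map_eq_lin, map_sum]
  rw [h2, crOp, lin_pairD_tmul, h1, lin_one,
    BTree.bd_centralJoin (by grind), add_tmul,
    show lin R (crOp R v) (ins _ l) = _ from lin_tmul_ins_pairD (XTree.bd R) (BTree.bd R)
      (corollaOp R v) (fun m => single (centralJoin m) 1) l]
  grind

lemma lin_leftAct_tmul (x : XTree I →₀ R) (T : BTree I J) (k : ℕ) (y : XTree I × XTree J) :
    lin R (fun u => ofOption R ((leftAction R I J).act u k y)) (tmul x (single T 1)) =
      tmul (lin R (fun S => ofOption R (S.graft k y.1)) x) (ofOption R (T.graftLeft k y.2)) := by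
  rw [tmul_single, lin_mapDomain, ← lin_both_left]
  rfl

lemma lin_rightAct_tmul (x : XTree I →₀ R) (T : BTree I J) (k : ℕ) (y : XTree I) :
    lin R (fun u => ofOption R ((rightAction R I J).act u k y)) (tmul x (single T 1)) =
      tmul x (ofOption R (T.graftRight k y)) := by
  have h := lin_both_left (R := R) (fun S : XTree I => some S) (T.graftRight k y) x
  rw [show lin R (fun a => ofOption R (some a)) x = x from lin_single_id x] at h
  rw [tmul_single, lin_mapDomain, ← h]
  rfl

/-- Inputs of the first factors match left inputs of the second factors letter by letter, so the
input with a given number lies in the same letter on both sides of the tensor product. -/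
lemma lin_leftInsert_crOp (v : I → ℕ) (a : XTree I × XTree J →₀ R)
    {l : List (I ⨳ J)} (hl : ∀ g ∈ l, g.1.inputs = g.2.leftInputs) :
    lin R ((leftAction R I J).insert a) (crOp R v l) =
      lin R (crOp R v) (ins (letterPart ((leftAction R I J).insert a)) l) := by
  have hs : ∀ l : List (I ⨳ J), forestInputs (l.map fst) =
      (l.map (leftAction R I J).arity).sum := fun l => by
    induction l with
    | nil => rfl
    | cons x l ih => aesop
  refine OperadAction.lin_insert_word _ ?_ ?_ a hl
  · intro l _ u hu
    rw [← hs]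
    exact inputs_join (mem_support_crOp hu).2.1
  · intro l₁ x l₂ hG j hj y
    have e : ((l₁.map snd).map leftInputs).sum = forestInputs (l₁.map fst) := by
      rw [hs, List.map_map]
      refine congrArg List.sum (List.map_congr_left fun g hg => ?_)
      exact (hG g (by simp [hg])).symm
    have hx := hG x (by simp)
    have h1 := graftForest_append_cons (l₁.map fst) x.1 (l₂.map fst) hj y.1
    have h2 := graftLeft_centralJoin (l₁.map snd) x.2 (l₂.map snd) (j := j)
      (hx ▸ hj) y.2
    rw [e] at h2
    rw [← hs, crOp, lin_leftAct_tmul, lin_graft_corollaOp, map_append, map_append,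
      map_cons, map_cons, h2, h1, show (leftAction R I J).act x j y =
        both (x.1.graft j y.1) (x.2.graftLeft j y.2) from rfl]
    cases x.1.graft j y.1 <;> cases x.2.graftLeft j y.2 <;>
      simp [both, crOp, tmul, lin_zero]

lemma lin_rightInsert_crOp (v : I → ℕ) (a : XTree I →₀ R) (l : List (I ⨳ J)) :
    lin R ((rightAction R I J).insert a) (crOp R v l) =
      lin R (crOp R v) (ins (letterPart ((rightAction R I J).insert a)) l) := by
  refine OperadAction.lin_insert_word (G := fun _ => True) _ ?_ ?_ a fun _ _ => trivial
  · intro l _ u hu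
    change u.2.rightInputs = _
    rw [(mem_support_crOp hu).2.2, rightInputs_centralJoin, List.map_map]
    rfl
  · intro l₁ x l₂ _ j hj y
    have h2 := graftRight_centralJoin (l₁.map snd) x.2 (l₂.map snd) (j := j) hj y
    rw [List.map_map] at h2
    rw [crOp, lin_rightAct_tmul, map_append, map_append, map_cons, map_cons,
      show (l₁.map (rightAction R I J).arity).sum = (l₁.map (rightInputs ∘ snd)).sum
        from rfl, h2, show (rightAction R I J).act x j y =
        both (some x.1) (x.2.graftRight j y) from rfl]
    cases x.2.graftRight j y <;>
      simp [both, crOp, tmul, lin_zero]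

end Bd

end Central

/-! ### The homotopy-associative structure on pairs -/

section Structure

variable {ι : Type} [Fintype ι]

lemma apply_le_size (w : ι → ℕ) (i : ι) : w i ≤ size w :=
  Finset.single_le_sum (f := w) (fun _ _ => Nat.zero_le _) (mem_univ i)

variable [DecidableEq ι]

/-- The weights of degree `d`. -/
def weightFiber (ι : Type) [Fintype ι] [DecidableEq ι] (d : ℕ) : Finset (ι → ℕ) :=
  (Icc 0 fun _ => d).filter fun w => 2 * size w = d

lemma mem_weightFiber (d : ℕ) (w : ι → ℕ) : w ∈ weightFiber ι d ↔ 2 * size w = d := by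
  rw [weightFiber, mem_filter, mem_Icc, and_iff_right_iff_imp]
  exact fun h => ⟨zero_le, fun i => by have := apply_le_size w i; simp only; omega⟩

lemma anti_nat_ite_fst {V : Type*} [AddCommMonoid V] (d : ℕ) (f : ℕ → V) :
    ∑ p ∈ anti d, (if p.1 = 0 then f p.2 else 0) = f d := by
  cases d with
  | zero => simp
  | succ d => simp [Finset.Nat.sum_antidiagonal_succ]

variable {R : Type*} [CommRing R] [CharP R 2] {I J : Type} [Fintype I] [Fintype J]
  [DecidableEq I] [DecidableEq J] (φ : ℕ → XTree I × XTree J →₀ R) (ρ : ℕ → XTree I →₀ R)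
  (κ : (I → ℕ) → R)

/-- The sum of the operations `κ^v CR^v` of degree `d`. -/
def crSum (d : ℕ) (l : List (I ⨳ J)) : I ⨳ J →₀ R :=
  ∑ v ∈ weightFiber I d, κ v • crOp R v l

/-- The unary operations of degree `d`: the differential and the insertions of `φ` and `ρ`. -/
def unary (d : ℕ) (g : I ⨳ J) : I ⨳ J →₀ R :=
  (if d = 0 then pairD (XTree.bd R) (BTree.bd R) g else 0)
    + ((leftAction R I J).insert (φ d) g + (rightAction R I J).insert (ρ d) g)

/-- All operations of degree `d`. -/
def totalOp (d : ℕ) (l : List (I ⨳ J)) : I ⨳ J →₀ R :=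
  crSum κ d l + letterPart (unary φ ρ d) l

lemma lin_unary (d : ℕ) (x : I ⨳ J →₀ R) : lin R (unary φ ρ d) x =
    (if d = 0 then lin R (pairD (XTree.bd R) (BTree.bd R)) x else 0)
      + (lin R ((leftAction R I J).insert (φ d)) x
        + lin R ((rightAction R I J).insert (ρ d)) x) := by
  unfold unary
  rw [lin_add, lin_add]
  split_ifs with h
  · rfl
  · rw [lin_zero]

/-- Pairs of stable trees with matching inputs. -/
def StablePair (g : I ⨳ J) : Prop :=
  g.1.Stable ∧ g.2.Stable ∧ g.1.inputs = g.2.leftInputs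

variable {φ ρ κ}

lemma lin_pairD_pairD {g : I ⨳ J} (hg : StablePair g) :
    lin R (pairD (XTree.bd R) (BTree.bd R)) (pairD (XTree.bd R) (BTree.bd R) g) = 0 := by
  have := pairBd_pairBd (R := R) (x := single g 1) fun z hz => by
    rw [mem_singleton.1 (support_single_subset hz)]
    exact ⟨hg.1, hg.2.1⟩
  rwa [← bdPair_eq_pairBd, ← bdPair_eq_pairBd, bdPair_eq_lin, bdPair_eq_lin, lin_one] at this

/-- Each one-sided insertion, combined with the differential, squares to zero by `sum_insert`, and
the mixed terms cancel because insertions on different sides commute. -/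
lemma sum_unary_unary (hφ : ∀ d, ∀ y ∈ (φ d).support, (leftAction R I J).good' y)
    (hφ' : ∀ d, lin R (leftAction R I J).dY (φ d) =
      ∑ p ∈ anti d, (leftAction R I J).circ (φ p.1) (φ p.2))
    (hρ : ∀ d, ∀ y ∈ (ρ d).support, (rightAction R I J).good' y)
    (hρ' : ∀ d, lin R (rightAction R I J).dY (ρ d) =
      ∑ p ∈ anti d, (rightAction R I J).circ (ρ p.1) (ρ p.2))
    {g : I ⨳ J} (hg : StablePair g) (d : ℕ) :
    ∑ p ∈ anti d, lin R (unary φ ρ p.1) (unary φ ρ p.2 g) = 0 := by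
  have hL := (leftAction R I J).sum_insert hφ hφ' hg d
  have hR := (rightAction R I J).sum_insert hρ hρ' hg d
  set L := fun d => (leftAction R I J).insert (φ d)
  set Q := fun d => (rightAction R I J).insert (ρ d)
  set D := pairD (XTree.bd R) (BTree.bd R) (A := XTree I) (B := BTree I J)
  have e : ∀ p ∈ anti d, lin R (unary φ ρ p.1) (unary φ ρ p.2 g) =
      (if p.1 = 0 then lin R D (L p.2 g) + lin R D (Q p.2 g) else 0)
      + (if p.2 = 0 then lin R (L p.1) (D g) + lin R (Q p.1) (D g) else 0)
      + (lin R (L p.1) (L p.2 g) + lin R (Q p.1) (Q p.2 g)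
        + (lin R (L p.1) (Q p.2 g) + lin R (L p.2) (Q p.1 g))) := by
    rintro ⟨i, j⟩ -
    have hc : lin R (Q i) (L j g) = lin R (L j) (Q i g) := lin_insert_left_right R I J _ _ g
    rw [lin_unary]
    simp only [unary, map_add]
    change (if i = 0 then lin R D (if j = 0 then D g else 0) + (lin R D (L j g) + lin R D (Q j g))
      else 0) + (lin R (L i) (if j = 0 then D g else 0) + (lin R (L i) (L j g) + lin R (L i) (Q j g))
        + (lin R (Q i) (if j = 0 then D g else 0) + (lin R (Q i) (L j g) + lin R (Q i) (Q j g)))) = _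
    rw [hc]
    have hD : lin R D (if j = 0 then D g else 0) = 0 := by
      grind [lin_pairD_pairD]
    grind
  rw [sum_congr rfl e]
  simp only [sum_add_distrib]
  rw [anti_nat_ite_fst d fun j => lin R D (L j g) + lin R D (Q j g),
    anti_swap' d fun i j => if j = 0 then lin R (L i) (D g) + lin R (Q i) (D g) else 0,
    anti_nat_ite_fst d fun j => lin R (L j) (D g) + lin R (Q j) (D g),
    anti_swap' d fun i j => lin R (L j) (Q i g), add_self R, add_zero,
    show ∀ a b a' b' c c' : I ⨳ J →₀ R, a + b + (a' + b') + (c + c') =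
      (a + a' + c) + (b + b' + c') by intros; abel]
  exact (congrArg₂ _ hL hR).trans (add_zero 0)

lemma ins_smul {X : Type*} (r : R) (f : List X → X →₀ R) (l : List X) :
    ins (fun b => r • f b) l = r • ins f l := by
  refine Eq.trans ?_ (map_threeSum (DistribSMul.toAddMonoidHom (List X →₀ R) r) _ _).symm
  exact threeSum_congr fun a b c _ => Finsupp.mapDomain_smul _ _

lemma lin_unary_crOp (i : ℕ) (v : I → ℕ) {l : List (I ⨳ J)}
    (hl : ∀ g ∈ l, g.2.Stable ∧ g.1.inputs = g.2.leftInputs) :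
    lin R (unary φ ρ i) (crOp R v l) = lin R (crOp R v) (ins (letterPart (unary φ ρ i)) l) +
      if i = 0 then ∑ p ∈ anti v, lin R (crOp R p.1) (ins (crOp R p.2) l) else 0 := by
  have hu : letterPart (unary φ ρ i) = fun l : List (I ⨳ J) =>
      letterPart (fun g => if i = 0 then pairD (XTree.bd R) (BTree.bd R) g else 0) l +
        (letterPart ((leftAction R I J).insert (φ i)) l
          + letterPart ((rightAction R I J).insert (ρ i)) l) := by
    funext l
    rw [← letterPart_add, ← letterPart_add]
    rfl
  rw [hu, ins_add, ins_add, map_add, map_add, ← lin_leftInsert_crOp v _ fun g hg => (hl g hg).2,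
    ← lin_rightInsert_crOp, lin_unary]
  by_cases hi : i = 0
  · simp only [hi, if_true]
    grind [lin_pairD_crOp, add_right_comm]
  simp_all [if_false, ins_eq_zero, letterPart_zero, map_zero, add_zero]

/-- The relation between the operations. -/
lemma sum_totalOp (hφ : ∀ d, ∀ y ∈ (φ d).support, (leftAction R I J).good' y)
    (hφ' : ∀ d, lin R (leftAction R I J).dY (φ d) =
      ∑ p ∈ anti d, (leftAction R I J).circ (φ p.1) (φ p.2))
    (hρ : ∀ d, ∀ y ∈ (ρ d).support, (rightAction R I J).good' y)
    (hρ' : ∀ d, lin R (rightAction R I J).dY (ρ d) =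
      ∑ p ∈ anti d, (rightAction R I J).circ (ρ p.1) (ρ p.2))
    (hκ : ∀ v w, κ (v + w) = κ v * κ w) {l : List (I ⨳ J)}
    (hl : ∀ g ∈ l, StablePair g) (d : ℕ) :
    ∑ p ∈ anti d, lin R (totalOp φ ρ κ p.1) (ins (totalOp φ ρ κ p.2) l) = 0 := by
  have h0 : letterPart (fun x => ∑ p ∈ anti d, lin R (unary φ ρ p.1) (unary φ ρ p.2 x)) l =
      0 := by
    match l with
    | [] => rfl
    | [x] => exact sum_unary_unary hφ hφ' hρ hρ' (hl x (by simp)) d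
    | _ :: _ :: _ => rfl
  -- The unary operations are derivations of `CR`, except that the differential also expands the
  -- corolla; multiplicativity of `κ` gives the expansion the right coefficient.
  have h1 : ∀ i j, lin R (unary φ ρ i) (crSum κ j l) =
      lin R (crSum κ j) (ins (letterPart (unary φ ρ i)) l) +
        if i = 0 then ∑ v ∈ weightFiber I j, ∑ p ∈ anti v,
          (κ p.1 * κ p.2) • lin R (crOp R p.1) (ins (crOp R p.2) l) else 0 := by
    intro i j
    unfold crSum
    rw [map_sum, lin_sum]
    simp only [map_smul, lin_unary_crOp i _ fun g hg => (hl g hg).2, smul_add, lin_smul,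
      sum_add_distrib]
    congr 1
    split_ifs
    · refine sum_congr rfl fun v _ => ?_
      rw [smul_sum]
      grind [sum_congr, mem_anti]
    · simp
  have h2 : ∀ i j, lin R (crSum κ i) (ins (fun b => crSum κ j b + letterPart (unary φ ρ j) b) l) =
      lin R (crSum κ i) (ins (crSum κ j) l) +
        lin R (crSum κ i) (ins (letterPart (unary φ ρ j)) l) := fun i j => by
    rw [ins_add, map_add]
  -- Compositions of two operations `CR` are regrouped by weight, to be matched with the expansions
  -- in `h1`.
  have h3 : ∑ p ∈ anti d, lin R (crSum κ p.1) (ins (crSum κ p.2) l) =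
      ∑ v ∈ weightFiber I d, ∑ p ∈ anti v,
          (κ p.1 * κ p.2) • lin R (crOp R p.1) (ins (crOp R p.2) l) := by
    rw [sum_fiber_antidiagonal (deg := fun v => 2 * size v) (fun a b => by rw [size_add]; ring)
      mem_weightFiber d fun v w => (κ v * κ w) • lin R (crOp R v) (ins (crOp R w) l)]
    refine sum_congr rfl fun p _ => ?_
    unfold crSum
    rw [lin_sum]
    refine sum_congr rfl fun v _ => ?_
    rw [ins_sum, map_sum]
    refine sum_congr rfl fun w _ => ?_
    rw [lin_smul, ins_smul, map_smul, smul_smul]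
  have h4 := sum_lin_ins_add_letterPart d (unary φ ρ) (crSum κ) l
  rw [h0, add_zero] at h4
  refine h4.trans ?_
  simp only [h1, h2, sum_add_distrib, h3]
  rw [anti_nat_ite_fst d fun j => ∑ v ∈ weightFiber I j, ∑ p ∈ anti v,
      (κ p.1 * κ p.2) • lin R (crOp R p.1) (ins (crOp R p.2) l),
    anti_swap' d fun i j => lin R (crSum κ j) (ins (letterPart (unary φ ρ i)) l),
    show ∀ a b : I ⨳ J →₀ R, a + b + (b + a) = (a + b) + (a + b) by intros; abel,
    add_self R]

end Structure

/-! ### Families indexed by corollas -/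

section Families

instance {A B : Type*} [AddMonoid A] [AddMonoid B] [Finset.HasAntidiagonal A]
    [Finset.HasAntidiagonal B] : Finset.HasAntidiagonal (A × B) where
  antidiagonal n := (anti n.1 ×ˢ anti n.2).map
    (Equiv.prodProdProdComm A A B B).toEmbedding
  mem_antidiagonal := by
    simp

lemma anti_prod {A B V : Type*} [AddMonoid A] [AddMonoid B]
    [Finset.HasAntidiagonal A] [Finset.HasAntidiagonal B] [AddCommMonoid V] (n : A × B)
    (f : A × B → A × B → V) : ∑ p ∈ anti n, f p.1 p.2 =
      ∑ p ∈ anti n.1, ∑ q ∈ anti n.2, f (p.1, q.1) (p.2, q.2) := by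
  rw [← Finset.sum_product']
  exact Finset.sum_map _ _ _

variable {R : Type*} [CommRing R] {X Y : Type*} (A : OperadAction R X Y) {ι : Type} [Fintype ι]
  [DecidableEq ι]

/-- The corollas of degree `d`. -/
def corollaFiber (ι : Type) [Fintype ι] [DecidableEq ι] (d : ℕ) : Finset (ℕ × (ι → ℕ)) :=
  (range (d + 1) ×ˢ Icc 0 fun _ => d).filter fun m => m.1 + 2 * size m.2 = d

lemma mem_corollaFiber (d : ℕ) (m : ℕ × (ι → ℕ)) :
    m ∈ corollaFiber ι d ↔ m.1 + 2 * size m.2 = d := by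
  rw [corollaFiber, mem_filter, mem_product, mem_range, mem_Icc,
    and_iff_right_iff_imp]
  exact fun h => ⟨by omega, zero_le, fun i => by have := apply_le_size m.2 i; simp only; omega⟩

/-- The sum of the elements of degree `d + 1` of a family. -/
def familySum (γ : ℕ × (ι → ℕ) → Y →₀ R) (d : ℕ) : Y →₀ R := ∑ m ∈ corollaFiber ι (d + 1), γ m

/-- A family solving the Maurer–Cartan equation, collected by degree. -/
lemma lin_dY_familySum {γ : ℕ × (ι → ℕ) → Y →₀ R} (h0 : γ 0 = 0)
    (har : ∀ n w, ∀ y ∈ (γ (n, w)).support, A.arity' y = n)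
    (h : ∀ n w, lin R A.dY (γ (n, w)) = ∑ p ∈ anti (n + 1, w), A.circ (γ p.1) (γ p.2))
    (d : ℕ) : lin R A.dY (familySum γ d) =
      ∑ p ∈ anti d, A.circ (familySum γ p.1) (familySum γ p.2) := by
  have circ_sum : ∀ (s t : Finset (ℕ × (ι → ℕ))), A.circ (∑ m ∈ s, γ m) (∑ m ∈ t, γ m) =
      ∑ a ∈ s, ∑ b ∈ t, A.circ (γ a) (γ b) := fun s t => by
    unfold OperadAction.circ
    rw [map_sum]
    refine sum_congr rfl fun a _ => ?_
    rw [← lin_sum]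
    refine lin_congr fun y _ => ?_
    simp only [map_sum]
    exact sum_comm
  have hz : ∀ w b, A.circ (γ (0, w)) b = 0 := fun w b => lin_eq_zero fun y hy => by
    rw [har 0 w y hy, Finset.range_zero, Finset.sum_empty]
  set G : ℕ × (ι → ℕ) → Y →₀ R := fun m => ∑ p ∈ anti m, A.circ (γ p.1) (γ p.2)
  have hG : ∀ w, G (0, w) = 0 := fun w => sum_eq_zero fun p hp => by
    aesop
  have e0 : familySum γ d = ∑ m ∈ corollaFiber ι (d + 1), γ m := rfl
  have e1 : lin R A.dY (familySum γ d) = ∑ m ∈ corollaFiber ι (d + 2), G m := by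
    rw [e0, map_sum, sum_congr rfl fun m _ => h m.1 m.2]
    change ∑ m ∈ corollaFiber ι (d + 1), G (m.1 + 1, m.2) = _
    -- Gluing uses up one input, hence the shift of `n`. The indices `(0, w)` missed by it
    -- contribute nothing, since nothing can be glued into an element without inputs.
    refine Finset.sum_bij_ne_zero (fun m _ _ => (m.1 + 1, m.2)) ?_ ?_ ?_ ?_
    · grind [mem_corollaFiber]
    · simp_all
    · rintro ⟨n, w⟩ hm hne
      rcases n with _ | n
      · grind
      · refine ⟨(n, w), ?_, hne, rfl⟩
        grind [mem_corollaFiber]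
    simp
  have hf0 : ∑ m ∈ corollaFiber ι 0, γ m = 0 := sum_eq_zero fun m hm => by
    rw [mem_corollaFiber] at hm
    rw [show m = 0 from Prod.ext (by simp_all)
      (size_eq_zero.1 (by omega)), h0]
  rw [e1, sum_fiber_antidiagonal (deg := fun m : ℕ × (ι → ℕ) => m.1 + 2 * size m.2)
    (fun a b => by simp only [Prod.fst_add, Prod.snd_add, size_add]; ring) mem_corollaFiber (d + 2)
    fun a b => A.circ (γ a) (γ b)]
  simp only [← circ_sum]
  rw [Finset.Nat.sum_antidiagonal_succ, hf0, OperadAction.zero_circ, zero_add,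
    Finset.Nat.sum_antidiagonal_succ', hf0, OperadAction.circ_zero, zero_add]
  rfl

end Families

/-! ### The differential of a corolla -/

section Corolla

variable {R : Type*} [CommRing R] {ι : Type}

/-- The corolla of weight `u` with `b` inputs glued to a corolla of weight `v` with `a + 1 + c`
inputs. -/
def twoVertex (a b c : ℕ) (v u : ι → ℕ) : WTree ι :=
  .node v (replicate a .leaf ++ .corolla b u :: replicate c .leaf)

lemma inputs_corolla (n : ℕ) (w : ι → ℕ) : (WTree.corolla n w).inputs = n := by
  rw [WTree.corolla, WTree.inputs]
  induction n with
  | zero => rfl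
  | succ n ih => rw [replicate_succ, inputsList, ih, WTree.inputs, add_comm]

lemma isGenerator_corolla {n : ℕ} {w : ι → ℕ} (h : StableVertex n w) :
    (WTree.corolla n w).IsGenerator := by
  refine ⟨(stable_node _ _).2 ⟨by simpa using h, fun t ht => ?_⟩, by simp [WTree.corolla]⟩
  rw [List.eq_of_mem_replicate ht]
  trivial

variable [Fintype ι]

lemma graft_corolla {p a : ℕ} (h : a < p) (v u : ι → ℕ) (b : ℕ) :
    (WTree.corolla p v).graft a (.tree (.corolla b u)) =
      some (.tree (twoVertex a b (p - 1 - a) v u)) := by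
  have h1 := graftForest_append_cons (replicate a (.tree .leaf)) (.tree .leaf)
    (replicate (p - 1 - a) (.tree (.leaf : WTree ι))) (j := 0) (by simp [XTree.inputs, WTree.inputs])
    (.tree (.corolla b u))
  have h2 : forestInputs (replicate a (tree (.leaf : WTree ι))) = a := by
    have := forestInputs_map (replicate a (.leaf : WTree ι))
    rw [List.map_replicate] at this
    rw [this]
    simpa [WTree.corolla, WTree.inputs] using inputs_corolla a (0 : ι → ℕ)
  rw [h2, ← replicate_succ, List.replicate_append_replicate,
    show a + (p - 1 - a + 1) = p by omega, add_zero] at h1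
  change (tree (.node v _)).graft a _ = _
  rw [graft_node, List.map_replicate, h1, graft_leaf, if_pos rfl, Option.map_some,
    bind_some, twoVertex]
  have := XTree.join_map v (replicate a .leaf ++ .corolla b u :: replicate (p - 1 - a) .leaf)
  simpa using this

variable [DecidableEq ι]

/-- The new vertex takes `p.2` of the inputs and the old one keeps `p.1 = n - p.2 + 1`, with the new
edge at position `a`. In this form `d Ψ` is visibly the sum of all `Ψ ∘_a Ψ`. -/
lemma bd_corolla (n : ℕ) (w : ι → ℕ) : (WTree.corolla n w).bd R =
    ∑ p ∈ anti (n + 1), ∑ q ∈ anti w, ∑ a ∈ range p.1,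
      if StableVertex p.2 q.2 ∧ StableVertex p.1 q.1 then
        single (twoVertex a p.2 (p.1 - 1 - a) q.1 q.2) 1 else 0 := by
  have hl : bdList R (replicate n (.leaf : WTree ι)) = 0 := by
    induction n with
    | zero => rfl
    | succ n ih => rw [replicate_succ, bdList, ih]; simp [WTree.bd]
  rw [WTree.corolla, WTree.bd, hl, mapDomain_zero, add_zero, splitRoot,
    List.length_replicate, sum_comm (s := anti (n + 1)) (t := anti w),
    anti_eq_sum_Icc w fun v u => ∑ p ∈ anti (n + 1),
        ∑ a ∈ range p.1, if StableVertex p.2 u ∧ StableVertex p.1 v then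
        single (twoVertex a p.2 (p.1 - 1 - a) v u) (1 : R) else 0]
  refine sum_congr rfl fun u _ => ?_
  rw [sum_sigma', sum_sigma']
  refine sum_bij' (fun x _ => ⟨(n - x.2 + 1, x.2), x.1⟩) (fun x _ => ⟨x.2, x.1.2⟩) ?_ ?_ ?_ ?_ ?_
  · grind [mem_sigma, mem_range, mem_anti]
  · grind [mem_sigma, mem_range, mem_anti]
  · exact fun _ _ => rfl
  · rintro ⟨⟨p, b⟩, a⟩ h
    simp only [mem_sigma, mem_range, mem_anti] at h
    grind
  grind [mem_sigma, mem_range, twoVertex, WTree.corolla, List.take_replicate, List.drop_replicate,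
    min_eq_left]

end Corolla

/-! ### The families attached to a weighted algebra diagonal -/

section StableFamily

variable {R : Type*} [CommRing R] {X Y : Type*} (A : OperadAction R X Y) {ι : Type} [Fintype ι]
  [DecidableEq ι] (γ : ℕ → (ι → ℕ) → Y →₀ R)

/-- The stable members of a family. -/
def stablePart (m : ℕ × (ι → ℕ)) : Y →₀ R := if StableVertex m.1 m.2 then γ m.1 m.2 else 0

variable {γ}

lemma stable_of_mem_stablePart {m : ℕ × (ι → ℕ)} {y : Y} (h : y ∈ (stablePart γ m).support) :
    StableVertex m.1 m.2 ∧ y ∈ (γ m.1 m.2).support := by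
  grind [stablePart]

lemma mem_support_familySum {d : ℕ} {y : Y} (h : y ∈ (familySum (stablePart γ) d).support) :
    ∃ n w, StableVertex n w ∧ n + 2 * size w = d + 1 ∧ y ∈ (γ n w).support := by
  classical
  obtain ⟨m, hm, h⟩ := mem_biUnion.1 (support_finsetSum h)
  obtain ⟨hs, h⟩ := stable_of_mem_stablePart h
  grind [mem_corollaFiber]

lemma lin_dY_stablePart (har : ∀ n w, StableVertex n w → ∀ y ∈ (γ n w).support, A.arity' y = n)
    (h : ∀ n w, StableVertex n w → lin R A.dY (γ n w) =
      ∑ p ∈ anti (n + 1), ∑ q ∈ anti w, ∑ a ∈ range p.1,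
        if StableVertex p.2 q.2 ∧ StableVertex p.1 q.1 then
          lin R (fun y => lin R (fun z => ofOption R (A.comp y a z)) (γ p.2 q.2)) (γ p.1 q.1) else 0)
    (d : ℕ) : lin R A.dY (familySum (stablePart γ) d) = ∑ p ∈ anti d,
      A.circ (familySum (stablePart γ) p.1) (familySum (stablePart γ) p.2) := by
  have us : ∀ n ≤ 1, stablePart γ (n, 0) = 0 := fun n hn => if_neg (by simp [StableVertex]; omega)
  refine lin_dY_familySum A (us 0 zero_le_one) (fun n w y hy => ?_) (fun n w => ?_) d
  · obtain ⟨hs, hy⟩ := stable_of_mem_stablePart hy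
    grind
  rw [anti_prod (n + 1, w) fun a b => A.circ (stablePart γ a) (stablePart γ b)]
  by_cases hs : StableVertex n w
  · rw [stablePart, if_pos hs, h n w hs]
    refine sum_congr rfl fun p _ => sum_congr rfl fun q _ => ?_
    by_cases h1 : StableVertex p.1 q.1
    · by_cases h2 : StableVertex p.2 q.2
      · simp only [h1, h2, and_self, if_true, stablePart]
        rw [← lin_sum]
        exact lin_congr fun y hy => by rw [har _ _ h1 y hy]
      · simp [h2, stablePart, OperadAction.circ_zero]
    · simp [h1, stablePart, OperadAction.zero_circ]
  · rw [stablePart, if_neg hs, map_zero]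
    obtain ⟨rfl, hn⟩ : w = 0 ∧ n < 2 := by
      simpa only [StableVertex, not_or, not_not, not_le] using hs
    refine (sum_eq_zero fun p hp => sum_eq_zero fun q hq => ?_).symm
    have hp := mem_anti.1 hp
    have hq := mem_anti.1 hq
    simp only at hp hq
    obtain ⟨h1, h2⟩ : q.1 = 0 ∧ q.2 = 0 := by simpa using hq
    grind [le_or_gt, OperadAction.zero_circ, OperadAction.circ_zero]

end StableFamily

section Diagonal

variable {R₀ : Type*} [CommRing R₀] [CharP R₀ 2] {I J : Type} [Fintype I] [DecidableEq I]
  [Fintype J] [DecidableEq J] {c : I ⊕ J → R₀} (D : WeightedAlgebraDiagonal R₀ I J c)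

local notation "𝓡" => GroundRing R₀ I J

/-- The coefficient attached to a weight of the first weight space. -/
def rightCoeff (c : I ⊕ J → R₀) (v : I → ℕ) : 𝓡 := seedCoeff c (ofFst v)

lemma rightCoeff_add (c : I ⊕ J → R₀) (v w : I → ℕ) :
    rightCoeff c (v + w) = rightCoeff c v * rightCoeff c w := by
  simp only [rightCoeff, seedCoeff, ofFst_add, Pi.add_apply, pow_add, Finset.prod_mul_distrib]

/-- The elements `κ^u Ψ_j^u`. -/
def corollaTerm (c : I ⊕ J → R₀) (j : ℕ) (u : I → ℕ) : XTree I →₀ 𝓡 :=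
  rightCoeff c u • single (.tree (.corolla j u)) 1

/-- The left operations, by degree. -/
def leftFamily : ℕ → XTree I × XTree J →₀ 𝓡 := familySum (stablePart D.γ)

/-- The right operations, by degree. -/
def rightFamily (c : I ⊕ J → R₀) : ℕ → XTree I →₀ 𝓡 := familySum (stablePart (corollaTerm c))

lemma eq_of_mem_corollaTerm {j : ℕ} {u : I → ℕ} {S : XTree I}
    (h : S ∈ (corollaTerm c j u).support) : S = .tree (.corolla j u) :=
  mem_singleton.1 (support_single_subset (Finsupp.support_smul h))

lemma good_leftFamily (d : ℕ) : ∀ y ∈ (leftFamily D d).support, (leftAction 𝓡 I J).good' y := by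
  intro y hy
  obtain ⟨n, w, hs, -, hy⟩ := mem_support_familySum hy
  obtain ⟨h1, h2, h3, h4⟩ := D.target _ (isGenerator_corolla hs) y hy
  exact ⟨h1, h2, h3.trans h4.symm⟩

lemma good_rightFamily (d : ℕ) :
    ∀ y ∈ (rightFamily c d).support, (rightAction 𝓡 I J).good' y := by
  intro y hy
  obtain ⟨n, w, hs, -, hy⟩ := mem_support_familySum hy
  rw [eq_of_mem_corollaTerm hy]
  exact (isGenerator_corolla hs).1

/-- `Γ` is applied to the differential of a corolla: the chain map property gives the left hand
side, compatibility with stacking the right hand side. -/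
lemma lin_dY_leftFamily (d : ℕ) : lin 𝓡 (leftAction 𝓡 I J).dY (leftFamily D d) =
    ∑ p ∈ anti d, (leftAction 𝓡 I J).circ (leftFamily D p.1) (leftFamily D p.2) := by
  refine lin_dY_stablePart (leftAction 𝓡 I J) (fun n w hs y hy => ?_) (fun n w hs => ?_) d
  · exact ((D.target _ (isGenerator_corolla hs) y hy).2.2.1).trans (inputs_corolla n w)
  · have h := D.chain _ (isGenerator_corolla hs)
    rw [bdPair_eq_lin] at h
    refine h.symm.trans ?_
    rw [bd_corolla]
    simp only [map_sum]
    refine sum_congr rfl fun p _ => sum_congr rfl fun q _ =>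
      sum_congr rfl fun a ha => ?_
    split_ifs with hst
    · have ha := mem_range.1 ha
      rw [D.stacking _ _ _ (isGenerator_corolla hst.2) (isGenerator_corolla hst.1) a
        (by rwa [inputs_corolla]) (graft_corolla ha _ _ _), compPair, bilin_eq_lin]
      rfl
    · exact map_zero _

lemma lin_dY_rightFamily (d : ℕ) : lin 𝓡 (rightAction 𝓡 I J).dY (rightFamily c d) =
    ∑ p ∈ anti d, (rightAction 𝓡 I J).circ (rightFamily c p.1) (rightFamily c p.2) := by
  refine lin_dY_stablePart (rightAction 𝓡 I J) (fun n w _ y hy => ?_) (fun n w _ => ?_) d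
  · rw [eq_of_mem_corollaTerm hy]
    exact inputs_corolla n w
  · rw [corollaTerm, map_smul, lin_one]
    change rightCoeff c w • mapDomain tree ((WTree.corolla n w).bd 𝓡) = _
    rw [bd_corolla]
    simp only [mapDomain_finsetSum, smul_sum]
    refine sum_congr rfl fun p _ => sum_congr rfl fun q hq =>
      sum_congr rfl fun a ha => ?_
    split_ifs with hst
    · rw [← mem_anti.1 hq, rightCoeff_add, corollaTerm, corollaTerm, map_smul, lin_one,
        map_smul, lin_one, smul_smul, mapDomain_single,
        show (rightAction 𝓡 I J).comp (.tree (.corolla p.1 q.1)) a (.tree (.corolla p.2 q.2)) = _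
          from graft_corolla (mem_range.1 ha) _ _ _]
      rfl
    simp

/-! ### Grading -/

/-- The grading `(n, j, w)` of a pair. -/
def grade (g : I ⨳ J) : ℕ × ℕ × (I ⊎ J) :=
  (g.2.leftInputs, g.2.rightInputs, ofFst g.1.weight + g.2.weight)

/-- The total degree `n + j + 2|w|`. -/
def gradeDegree (m : ℕ × ℕ × (I ⊎ J)) : ℕ := m.1 + m.2.1 + 2 * size m.2.2

lemma size_ofFst (v : I → ℕ) : size (ofFst v : I ⊎ J) = size v := by
  simp [size, ofFst]

lemma isGoodPair_iff {N : ℕ} {d : ℤ} {g : I ⨳ J} : IsGoodPair N d g ↔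
    StablePair g ∧ gradeDegree (grade g) = N ∧ g.1.dim + g.2.dim = d := by
  have : gradeDegree (grade g) = g.2.leftInputs + g.2.rightInputs +
      2 * (size g.1.weight + size g.2.weight) := by
    rw [gradeDegree, grade, size_add, size_ofFst]
  rw [this]
  exact ⟨fun h => ⟨⟨h.1, h.2, h.3⟩, h.4, h.5⟩, fun h => ⟨h.1.1, h.1.2.1, h.1.2.2, h.2.1, h.2.2⟩⟩

lemma grade_pairD {g z : I ⨳ J} (hg : StablePair g)
    (hz : z ∈ (pairD (XTree.bd 𝓡) (BTree.bd 𝓡) g).support) :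
    StablePair z ∧ grade z = grade g ∧ z.1.dim + z.2.dim + 1 = g.1.dim + g.2.dim := by
  obtain ⟨h1, h2, h3⟩ := hg
  rcases mem_support_pairD hz with ⟨h, e⟩ | ⟨e, h⟩
  · obtain ⟨ha, hs⟩ := XTree.attr_of_mem_bd h1 h
    simp only [XTree.attr, Prod.mk_add_mk, Prod.mk.injEq, add_zero] at ha
    refine ⟨⟨hs, e ▸ h2, by rw [ha.1, h3, e]⟩, by rw [grade, grade, e, ha.2.1], ?_⟩
    grind
  · have ha := BTree.attr_of_mem_bd h2 h
    simp only [BTree.attr, edgeAttr, Prod.mk_add_mk, Prod.mk.injEq, add_zero] at ha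
    refine ⟨⟨e ▸ h1, stable_of_mem_bd h2 h, by rw [e, h3, ha.1]⟩, ?_, ?_⟩
    · simp_all [grade]
    grind

lemma attrs_replicate {ι : Type} [Fintype ι] (n : ℕ) :
    attrs ((replicate n (.leaf : WTree ι)).map .tree) = (n, 0, (n : ℤ)) := by
  induction n with
  | zero => rfl
  | succ n ih =>
    rw [replicate_succ, map_cons, attrs_cons, ih, attr_leaf]
    simp [add_comm]

lemma dim_corolla {ι : Type} [Fintype ι] (n : ℕ) (w : ι → ℕ) :
    (WTree.corolla n w).dim = n + 2 * size w - 2 ∧ (WTree.corolla n w).weight = w := by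
  have h := XTree.attr_node w (replicate n .leaf)
  rw [attrs_replicate] at h
  simp only [XTree.attr, Prod.mk_add_mk, Prod.mk.injEq, zero_add] at h
  refine ⟨?_, h.2.1⟩
  change (tree (.node w (replicate n .leaf)) : XTree ι).dim = _
  linarith [h.2.2]

lemma attr_corolla (n j : ℕ) (w : I ⊎ J) :
    (BTree.corolla n j w).attr = (n, j, w, (n : ℤ) + j + (2 * size w - 1)) := by
  rw [BTree.corolla, BTree.attr_node, attrs_replicate, attrs_replicate, attr_strand]
  simp [leftAttr, rightAttr, ofSnd_eq_zero.2, ofFst_zero]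

lemma grade_corolla {S : XTree I} (hS : S.weight = 0) (n j : ℕ) (w : I ⊎ J) :
    grade (S, BTree.corolla n j w) = (n, j, w) := by
  have h := attr_corolla n j w
  simp_all [BTree.attr, Prod.mk.injEq, grade, ofFst_zero]

lemma grade_leftAct {g z : I ⨳ J} {i n : ℕ} {w : I ⊎ J}
    {h : XTree I × XTree J} (hw : StableVertex n w) (hh : h ∈ (D.γ n w).support)
    (hz : (leftAction 𝓡 I J).act g i h = some z) : grade z + (1, 0, 0) = grade g + (n, 0, w) ∧
      z.1.dim + z.2.dim = g.1.dim + g.2.dim + (n + 2 * size w - 2) := by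
  have hgen := isGenerator_corolla hw
  obtain ⟨-, -, h3, h4⟩ := D.target _ hgen h hh
  have h5 := D.dim_eq _ hgen h hh
  -- Any monomial of the coefficient will do: the weight condition fixes the weights of both factors
  -- as the two components of `w`, independently of the monomial.
  obtain ⟨m, hm⟩ := MvPolynomial.support_nonempty.2 (mem_support_iff.1 hh)
  obtain ⟨h6, h7⟩ := D.weight_eq _ hgen h hh m hm
  rw [(dim_corolla n w).2] at h6 h7
  rw [(dim_corolla n w).1] at h5
  rw [inputs_corolla] at h3 h4
  obtain ⟨e1, e2⟩ := both_eq_some hz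
  have a1 := attr_graft e1
  have a2 := attr_graftLeft e2
  simp only [XTree.attr, BTree.attr, leftAttr, AddMonoidHom.coe_mk, ZeroHom.coe_mk,
    Prod.mk_add_mk, Prod.mk.injEq, add_zero] at a1 a2
  refine ⟨?_, by grind⟩
  simp only [grade, Prod.mk_add_mk, Prod.mk.injEq, add_zero]
  refine ⟨by omega, a2.2.1, ?_⟩
  rw [a1.2.1, a2.2.2.1, ofFst_add]
  have : ofFst h.1.weight + ofSnd h.2.weight = w := by
    funext i
    cases i with
    | inl i => simpa [ofFst, ofSnd] using congrFun h6 (inl i)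
    | inr i => simpa [ofFst, ofSnd] using congrFun h7 (inr i)
  grind

lemma grade_rightAct {g z : I ⨳ J} {i j : ℕ} {u : I → ℕ}
    (hz : (rightAction 𝓡 I J).act g i (.tree (.corolla j u)) = some z) :
    grade z + (0, 1, 0) = grade g + (0, j, ofFst u) ∧
      z.1.dim + z.2.dim = g.1.dim + g.2.dim + (j + 2 * size u - 2) := by
  obtain ⟨e1, e2⟩ := both_eq_some (o := some g.1) hz
  have a2 := attr_graftRight e2
  have h5 : (tree (.corolla j u)).dim = _ := (dim_corolla j u).1
  have h6 : (tree (.corolla j u)).weight = u := (dim_corolla j u).2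
  have h7 : (tree (.corolla j u)).inputs = j := inputs_corolla j u
  simp only [XTree.attr, BTree.attr, rightAttr, AddMonoidHom.coe_mk, ZeroHom.coe_mk,
    Prod.mk_add_mk, Prod.mk.injEq, add_zero, h5, h6, h7] at a2
  rw [← Option.some_injective _ e1]
  refine ⟨?_, by linarith [a2.2.2.2]⟩
  simp_all [grade, Prod.mk_add_mk, Prod.mk.injEq, add_zero, Option.some_injective, add_assoc]

lemma grade_crOp {v : I → ℕ} {l : List (I ⨳ J)} {z : I ⨳ J}
    (hl : ∀ g ∈ l, StablePair g) (hz : z ∈ (crOp 𝓡 v l).support) :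
    StablePair z ∧ grade z = (0, 0, ofFst v) + (l.map grade).sum ∧
      z.1.dim + z.2.dim = (l.map fun g => g.1.dim + g.2.dim + 1).sum + (2 * size v - 2) := by
  obtain ⟨h1, h2, h3⟩ := mem_support_crOp hz
  have a1 := attr_join h2
  have a2 := congrArg BTree.attr h3
  rw [attr_centralJoin] at a2
  have key : ∀ l : List (I ⨳ J), (∀ g ∈ l, StablePair g) →
      (attrs (l.map fst)).1 = ((l.map snd).map BTree.attr).sum.1 ∧
      (l.map grade).sum = (((l.map snd).map BTree.attr).sum.1,
        ((l.map snd).map BTree.attr).sum.2.1, ofFst (attrs (l.map fst)).2.1 +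
          ((l.map snd).map BTree.attr).sum.2.2.1) ∧
      (l.map fun g => g.1.dim + g.2.dim + 1).sum = (attrs (l.map fst)).2.2 +
        ((l.map snd).map BTree.attr).sum.2.2.2 := by
    intro l hl
    induction l with
    | nil =>
      refine ⟨rfl, Prod.ext rfl (Prod.ext rfl ?_), rfl⟩
      funext i
      cases i <;> rfl
    | cons g l ih =>
      obtain ⟨i1, i2, i3⟩ := ih fun g hg => hl g (by simp [hg])
      have hg := (hl g (by simp)).2.2
      simp only [map_cons, sum_cons, attrs_cons, i2, i3]
      refine ⟨?_, ?_, ?_⟩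
      · simp only [Prod.fst_add, i1, XTree.attr, BTree.attr, hg]
      · simp [grade, XTree.attr, BTree.attr, Prod.mk_add_mk, Prod.fst_add, Prod.snd_add,
          ofFst_add, Prod.mk.injEq, true_and, add_add_add_comm]
      · simp only [XTree.attr, BTree.attr, Prod.snd_add]
        ring
  obtain ⟨k1, k2, k3⟩ := key l hl
  simp only [XTree.attr, BTree.attr] at a1 a2
  obtain ⟨b1, b2, b3⟩ : z.1.inputs = (attrs (l.map fst)).1 ∧
      z.1.weight = (attrs (l.map fst)).2.1 + v ∧
      z.1.dim + 1 = (attrs (l.map fst)).2.2 + (2 * (size v : ℤ) - 1) :=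
    ⟨congrArg fst a1, congrArg (fun a => a.2.1) a1, congrArg (fun a => a.2.2) a1⟩
  refine ⟨⟨stable_join h2 (by simpa using h1) (by simpa using fun a b h => (hl (a, b) h).1),
    h3 ▸ stable_centralJoin (by simpa using fun b a h => (hl (a, b) h).2.1),
    by rw [b1, k1, ← a2]⟩, ?_, ?_⟩
  · rw [k2, ← a2, grade, b2, ofFst_add]
    simp only [Prod.mk_add_mk, zero_add, Prod.mk.injEq, true_and]
    grind
  grind

end Diagonal

/-! ### Low degrees -/

section Small

variable {ι : Type} [Fintype ι] [DecidableEq ι] {V : Type*} [AddCommMonoid V]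

lemma size_eq_one {w : ι → ℕ} (h : size w = 1) : ∃ i, w = Pi.single i 1 := by
  obtain ⟨i, hi⟩ : ∃ i, w i ≠ 0 := by
    by_contra! hc
    rw [size_eq_zero.2 (funext hc)] at h
    cases h
  refine ⟨i, funext fun j => ?_⟩
  have h1 := Finset.add_sum_erase Finset.univ w (mem_univ i)
  have h2 : w i + ∑ j ∈ Finset.univ.erase i, w j = 1 := h1.trans h
  grind [Pi.single_eq_same, Pi.single_eq_of_ne, Finset.sum_eq_zero_iff]

lemma size_single (i : ι) : size (Pi.single i 1 : ι → ℕ) = 1 := by simp [size]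

lemma sum_weightFiber_two (F : (ι → ℕ) → V) :
    ∑ w ∈ weightFiber ι 2, F w = ∑ i, F (Pi.single i 1) := by
  refine (Finset.sum_bij (fun i _ => Pi.single i 1) ?_ ?_ ?_ fun _ _ => rfl).symm
  · intro i _
    rw [mem_weightFiber, size_single]
  · intro i _ j _ h
    by_contra hij
    simpa [Pi.single_eq_of_ne hij] using congrFun h i
  · intro w hw
    rw [mem_weightFiber] at hw
    obtain ⟨i, rfl⟩ := size_eq_one (by omega : size w = 1)
    simp

lemma sum_corollaFiber_two (F : ℕ × (ι → ℕ) → V) :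
    ∑ m ∈ corollaFiber ι 2, F m = F (2, 0) + ∑ i, F (0, Pi.single i 1) := by
  have : corollaFiber ι 2 = insert (2, 0) ((weightFiber ι 2).map (.sectR 0 _)) := by
    ext ⟨n, w⟩
    simp only [mem_corollaFiber, Finset.mem_insert, Finset.mem_map, mem_weightFiber,
      Function.Embedding.sectR_apply, Prod.mk.injEq]
    grind [Nat.eq_zero_or_pos, size, size_eq_zero]
  simp_all [Finset.sum_insert, Finset.sum_map, sum_weightFiber_two]

lemma sum_Icc_single (i : ι) (F : (ι → ℕ) → V) :
    ∑ w ∈ Icc 0 (Pi.single i 1), F w = F 0 + F (Pi.single i 1) := by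
  have : Icc 0 (Pi.single i 1 : ι → ℕ) = {0, Pi.single i 1} := by
    ext w
    simp only [mem_Icc, zero_le, true_and, Finset.mem_insert, mem_singleton]
    constructor
    · intro h
      by_cases hw : w = 0
      · exact .inl hw
      · right
        have h1 : size w ≤ 1 := (Finset.sum_le_sum fun j _ => h j).trans (size_single i).le
        have h2 : size w ≠ 0 := fun h0 => hw (size_eq_zero.1 h0)
        obtain ⟨j, rfl⟩ := size_eq_one (by omega : size w = 1)
        have := h j
        grind
    aesop
  rw [this, Finset.sum_pair]
  intro h
  simpa using congrFun h i

end Small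

-- Differentials of the smallest bimodule corollas

section SmallBd

variable {R : Type*} [CommRing R] {I J : Type} [Fintype I] [DecidableEq I] [Fintype J]
  [DecidableEq J]

namespace BTree

lemma bd_corolla_one_zero : (corolla 1 0 0 : BTree I J).bd R = 0 := by
  simp [corolla, bd, splitSpine, StableVertex, bdList, WTree.bd, sum_range_succ]

lemma bd_corolla_zero_one : (corolla 0 1 0 : BTree I J).bd R = 0 := by
  simp [corolla, bd, splitSpine, StableVertex, bdList, WTree.bd, sum_range_succ]

lemma bd_corolla_two_zero : (corolla 2 0 0 : BTree I J).bd R =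
    single (node 0 [.corolla 2 0] strand []) 1
      + single (node 0 [.leaf] (corolla 1 0 0) []) 1 := by
  simp [corolla, bd, splitSpine, StableVertex, bdList, WTree.bd, sum_range_succ,
    WTree.corolla]

lemma bd_corolla_one_one : (corolla 1 1 0 : BTree I J).bd R =
    single (node 0 [.leaf] (corolla 0 1 0) []) 1
      + single (node 0 [] (corolla 1 0 0) [.leaf]) 1 := by
  simp [corolla, bd, splitSpine, StableVertex, bdList, WTree.bd, sum_range_succ]

lemma bd_corolla_zero_two : (corolla 0 2 0 : BTree I J).bd R =
    single (node 0 [] strand [.corolla 2 0]) 1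
      + single (node 0 [] (corolla 0 1 0) [.leaf]) 1 := by
  simp [corolla, bd, splitSpine, StableVertex, bdList, WTree.bd, sum_range_succ,
    WTree.corolla]

lemma bd_corolla_inl (i : I) : (corolla 0 0 (Pi.single (.inl i) 1) : BTree I J).bd R =
    single (node 0 [] strand [.corolla 0 (Pi.single i 1)]) 1 := by
  have h1 : (Pi.single (inl i) 1 : I ⊎ J) ∘ inl = Pi.single i 1 := by
    grind
  have h2 : (Pi.single (inl i) 1 : I ⊎ J) ∘ inr = 0 := by
    funext j
    simp
  have h3 : (ofFst (Pi.single i 1) : I ⊎ J) = Pi.single (inl i) 1 := by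
    simp [ofFst, Pi.single_apply]
  simp [corolla, bd, splitSpine, StableVertex, bdList, WTree.corolla, h1, h2, h3,
    sum_Icc_single]

lemma bd_corolla_inr (i : J) : (corolla 0 0 (Pi.single (.inr i) 1) : BTree I J).bd R =
    single (node 0 [.corolla 0 (Pi.single i 1)] strand []) 1 := by
  have h1 : (Pi.single (inr i) 1 : I ⊎ J) ∘ inl = 0 := by
    funext j
    simp
  have h2 : (Pi.single (inr i) 1 : I ⊎ J) ∘ inr = Pi.single i 1 := by
    grind
  have h3 : (ofSnd (Pi.single i 1) : I ⊎ J) = Pi.single (inr i) 1 := by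
    simp [ofSnd, Pi.single_apply]
  simp [corolla, bd, splitSpine, StableVertex, bdList, WTree.corolla, h1, h2, h3,
    sum_Icc_single]

end BTree

end SmallBd

/-! ### Construction of the primitive -/

section Construction

variable {R₀ : Type*} [CommRing R₀] [CharP R₀ 2] {I J : Type} [Fintype I] [DecidableEq I]
  [Fintype J] [DecidableEq J] {c : I ⊕ J → R₀} (D : WeightedAlgebraDiagonal R₀ I J c)

local notation "𝓡" => GroundRing R₀ I J

/-- The operations attached to a weighted algebra diagonal. -/
def diagonalOp : ℕ → List (I ⨳ J) → I ⨳ J →₀ 𝓡 :=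
  totalOp (leftFamily D) (rightFamily c) (rightCoeff c)

lemma sum_diagonalOp (d : ℕ) (l : List (I ⨳ J)) (hl : ∀ g ∈ l, StablePair g) :
    ∑ p ∈ anti d, lin 𝓡 (diagonalOp D p.1) (ins (diagonalOp D p.2) l) = 0 :=
  sum_totalOp (good_leftFamily D) (lin_dY_leftFamily D) good_rightFamily lin_dY_rightFamily
    (rightCoeff_add c) hl d

lemma weightFiber_zero (ι : Type) [Fintype ι] [DecidableEq ι] : weightFiber ι 0 = {0} := by
  grind [mem_weightFiber, mem_singleton, size_eq_zero]

lemma weightFiber_one (ι : Type) [Fintype ι] [DecidableEq ι] : weightFiber ι 1 = ∅ := by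
  ext w
  simp [mem_weightFiber, Finset.notMem_empty, iff_false]

lemma rightCoeff_zero : rightCoeff c 0 = 1 := by
  simp [rightCoeff, seedCoeff, ofFst_zero]

lemma crSum_zero (l : List (I ⨳ J)) : crSum (rightCoeff c) 0 l = crOp 𝓡 0 l := by
  rw [crSum, weightFiber_zero, Finset.sum_singleton, rightCoeff_zero, one_smul]

lemma familySum_zero {Y : Type*} {ι : Type} [Fintype ι] [DecidableEq ι]
    (γ : ℕ → (ι → ℕ) → Y →₀ 𝓡) : familySum (stablePart γ) 0 = 0 := by
  refine sum_eq_zero fun m hm => if_neg ?_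
  rw [mem_corollaFiber] at hm
  simp only [StableVertex, not_or, not_not, not_le, ← size_eq_zero]
  omega

lemma unary_zero (g : I ⨳ J) :
    unary (leftFamily D) (rightFamily c) 0 g = pairD (XTree.bd 𝓡) (BTree.bd 𝓡) g := by
  simp [unary, if_pos, leftFamily, rightFamily, familySum_zero, OperadAction.insert_zero, add_zero]

lemma diagonalOp_zero_singleton (g : I ⨳ J) :
    diagonalOp D 0 [g] = pairD (XTree.bd 𝓡) (BTree.bd 𝓡) g := by
  simp [diagonalOp, totalOp, crSum_zero, letterPart_singleton, unary_zero, crOp, corollaOp,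
    if_neg, StableVertex, tmul]

lemma lin_diagonalOp_zero (x : I ⨳ J →₀ 𝓡) :
    lin 𝓡 (fun g => diagonalOp D 0 [g]) x = pairBd 𝓡 I J x := by
  simp only [diagonalOp_zero_singleton]
  rw [← bdPair_eq_pairBd]
  rfl

lemma gradeDegree_add (a b : ℕ × ℕ × (I ⊎ J)) :
    gradeDegree (a + b) = gradeDegree a + gradeDegree b := by
  simp only [gradeDegree, Prod.fst_add, Prod.snd_add, size_add]
  ring

lemma good_letters {l : List (I ⨳ J)} {s : List ℕ}
    (h : List.Forall₂ (fun g n => IsGoodPair n (n - 1) g) l s) : (∀ g ∈ l, StablePair g) ∧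
      gradeDegree (l.map grade).sum = s.sum ∧
      (l.map fun g => g.1.dim + g.2.dim + 1).sum = (s.sum : ℤ) := by
  induction h with
  | nil => simp [gradeDegree]
  | cons hx _ ih =>
    simp_all [isGoodPair_iff, map_cons, sum_cons, gradeDegree_add]

/-- The operations respect degree and dimension. -/
lemma isGoodPair_of_mem_maurerCartan {P : ℕ → I ⨳ J →₀ 𝓡}
    (hP : ∀ n, ∀ g ∈ (P n).support, IsGoodPair n (n - 1) g) {N : ℕ} {z : I ⨳ J}
    (hz : z ∈ (maurerCartan (diagonalOp D) P N).support) : IsGoodPair N (N - 2) z := by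
  classical
  obtain ⟨⟨d, a⟩, hda, hz⟩ := mem_biUnion.1 (support_finsetSum hz)
  have hda := mem_anti.1 hda
  simp only at hda hz
  obtain ⟨l, hl, hz⟩ := mem_lin hz
  obtain ⟨s, hs, hf⟩ := mem_support_geom (G := fun n => {g | IsGoodPair n (n - 1) g}) hP hl
  obtain ⟨k1, k2, k3⟩ := good_letters hf
  rw [hs] at k2 k3
  rw [isGoodPair_iff]
  rcases mem_add hz with hz | hz
  · obtain ⟨v, hv, hz⟩ := mem_biUnion.1 (support_finsetSum hz)
    rw [mem_weightFiber] at hv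
    obtain ⟨g1, g2, g3⟩ := grade_crOp k1 (Finsupp.support_smul hz)
    refine ⟨g1, ?_, ?_⟩
    · rw [g2, gradeDegree_add, k2, gradeDegree, size_ofFst]
      simp only
      omega
    -- Letters of degree `n` have dimension `n - 1`, and the sum of the numbers `dim + 1` over the
    -- letters is their total degree; the operation `CR^v` adds `2|v| - 2` to it.
    · rw [g3, k3]
      push_cast [← hda, ← hv]
      ring
  · rcases l with _ | ⟨g, _ | ⟨_, _⟩⟩
    · simp at hz
    swap
    · simp [letterPart] at hz
    have hg : StablePair g := k1 g (by simp)
    simp only [map_cons, List.map_nil, sum_cons, List.sum_nil, add_zero] at k2 k3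
    rw [letterPart_singleton, unary] at hz
    rcases mem_add hz with hz | hz
    · split_ifs at hz with hd
      · obtain ⟨g1, g2, g3⟩ := grade_pairD hg hz
        refine ⟨g1, by rw [g2]; omega, ?_⟩
        grind
      · simp at hz
    rcases mem_add hz with hz | hz
    · obtain ⟨i, y, hy, hz⟩ := OperadAction.mem_support_insert _ hz
      have h0 := (leftAction 𝓡 I J).good_act hg (good_leftFamily D d y hy) hz
      obtain ⟨n, w, hst, hd, hy⟩ := mem_support_familySum hy
      obtain ⟨g1, g2⟩ := grade_leftAct D hst hy hz
      have g3 := congrArg gradeDegree g1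
      rw [gradeDegree_add, gradeDegree_add, k2] at g3
      simp only [gradeDegree, size_zero] at g3 ⊢
      refine ⟨h0, by omega, ?_⟩
      rw [g2]
      have : (n : ℤ) + 2 * size w = d + 1 := by exact_mod_cast hd
      push_cast [← hda]
      linarith
    · obtain ⟨i, y, hy, hz⟩ := OperadAction.mem_support_insert _ hz
      have h0 := (rightAction 𝓡 I J).good_act hg (good_rightFamily d y hy) hz
      obtain ⟨n, w, hst, hd, hy⟩ := mem_support_familySum hy
      rw [eq_of_mem_corollaTerm hy] at hz
      obtain ⟨g1, g2⟩ := grade_rightAct hz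
      have g3 := congrArg gradeDegree g1
      rw [gradeDegree_add, gradeDegree_add, k2] at g3
      simp only [gradeDegree, size_zero, size_ofFst] at g3 ⊢
      refine ⟨h0, by omega, ?_⟩
      rw [g2]
      have : (n : ℤ) + 2 * size w = d + 1 := by exact_mod_cast hd
      push_cast [← hda]
      linarith

/-- The coefficient attached to a basis weight. -/
def basisCoeff (c : I ⊕ J → R₀) (i : I ⊕ J) : 𝓡 := MvPolynomial.C (c i) * MvPolynomial.X i

/-- The parts of degrees one and two of the primitive. -/
def lowPart (c : I ⊕ J → R₀) : ℕ → I ⨳ J →₀ 𝓡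
  | 1 => single (.tree .leaf, .corolla 1 0 0) 1 + single (.top, .corolla 0 1 0) 1
  | 2 => single (.tree (.corolla 2 0), .corolla 2 0 0) 1
      + single (.tree .leaf, .corolla 1 1 0) 1
      + single (.top, .corolla 0 2 0) 1
      + ∑ i, single (.top, .corolla 0 0 (Pi.single i 1)) (basisCoeff c i)
  | _ => 0

/-- An approximation of the primitive up to degree `N`. -/
structure IsApprox (N : ℕ) (P : ℕ → I ⨳ J →₀ 𝓡) : Prop where
  good : ∀ n, ∀ g ∈ (P n).support, IsGoodPair n (n - 1) g ∧ g.2 ≠ .strand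
  eq_zero : ∀ M ≤ N, maurerCartan (diagonalOp D) P M = 0
  tail : ∀ n > N, P n = 0

/-- The obstruction in degree `N + 1` is a cycle by the Bianchi identity and bounds by
`exists_pairBd_eq`. Adding the bounding element changes the equation in degree `N + 1` by the
obstruction itself and leaves the lower degrees alone. -/
lemma IsApprox.succ {N : ℕ} (hN : 2 ≤ N) {P : ℕ → I ⨳ J →₀ 𝓡}
    (h : IsApprox D N P) : ∃ y, IsApprox D (N + 1) (Function.update P (N + 1) y) := by
  have hz := lin_maurerCartan_eq_zero (diagonalOp D) P {g | StablePair g}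
    (fun n g hg => (isGoodPair_iff.1 (h.good n g hg).1).1) (sum_diagonalOp D) (N + 1)
    fun M hM => h.eq_zero M (by omega)
  rw [lin_diagonalOp_zero] at hz
  obtain ⟨y, hy, hs⟩ := exists_pairBd_eq (N := N + 1) (by omega)
    (fun g hg => isGoodPair_of_mem_maurerCartan D (fun n g hg => (h.good n g hg).1) hg) hz
  refine ⟨y, ?_, ?_, ?_⟩
  · intro n
    by_cases hn : n = N + 1
    · subst hn
      rw [Function.update_self]
      exact hs
    · rw [Function.update_of_ne hn]
      exact h.good n
  · intro M hM
    rcases Nat.lt_or_ge N M with hlt | hle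
    · obtain rfl : M = N + 1 := by omega
      rw [maurerCartan_update _ _ _ _ (h.tail _ (by omega)), lin_diagonalOp_zero, hy,
        add_self 𝓡]
    · rw [maurerCartan_congr (Q := P) _ fun n hn => Function.update_of_ne (by omega) _ _]
      exact h.eq_zero M hle
  · intro n hn
    rw [Function.update_of_ne (by omega)]
    exact h.tail n (by omega)

lemma exists_maurerCartan_eq_zero (h : IsApprox D 2 (lowPart c)) :
    ∃ P : ℕ → I ⨳ J →₀ 𝓡, P 0 = 0 ∧ P 1 = lowPart c 1 ∧ P 2 = lowPart c 2 ∧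
      (∀ n, ∀ g ∈ (P n).support, IsGoodPair n (n - 1) g ∧ g.2 ≠ .strand) ∧
      ∀ N, maurerCartan (diagonalOp D) P N = 0 := by
  choose y hy using fun (k : ℕ) (P : {P // IsApprox D (k + 2) P}) => P.2.succ D (Nat.le_add_left 2 k)
  -- Each approximation changes only the next degree, so the diagonal sequence `(F n).1 n` agrees
  -- with `F k` in all degrees up to `k + 2`.
  let F : (k : ℕ) → {P // IsApprox D (k + 2) P} :=
    fun k => Nat.rec ⟨lowPart c, h⟩ (fun k P => ⟨_, hy k P⟩) k
  have hF : ∀ k n, n ≤ k + 2 → ∀ m, (F (k + m)).1 n = (F k).1 n := by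
    intro k n hn m
    induction m with
    | zero => rfl
    | succ m ih =>
      have h' : n ≠ k + m + 2 + 1 := by omega
      exact (Function.update_of_ne h' _ _).trans ih
  have hc : ∀ k n, n ≤ k + 2 → (F n).1 n = (F k).1 n := by
    intro k n hn
    rcases le_total k n with h | h
    · grind [Nat.exists_eq_add_of_le]
    · obtain ⟨m, rfl⟩ := Nat.exists_eq_add_of_le h
      simp_all
  refine ⟨fun n => (F n).1 n, rfl, hc 0 1 (by omega), hc 0 2 le_rfl, fun n => (F n).2.good n,
    fun N => ?_⟩
  rw [maurerCartan_congr (N := N) (Q := (F N).1) _ fun n hn => hc N n (by omega)]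
  exact (F N).2.eq_zero N (by omega)

end Construction

/-! ### The Maurer–Cartan equation in low degrees -/

section Low

variable {R₀ : Type*} [CommRing R₀] [CharP R₀ 2] {I J : Type} [Fintype I] [DecidableEq I]
  [Fintype J] [DecidableEq J] {c : I ⊕ J → R₀} (D : WeightedAlgebraDiagonal R₀ I J c)

local notation "𝓡" => GroundRing R₀ I J

lemma rightCoeff_single (i : I) : rightCoeff c (Pi.single i 1) = basisCoeff c (.inl i) := by
  have h3 : (ofFst (Pi.single i 1) : I ⊎ J) = Pi.single (inl i) 1 := by
    simp [ofFst, Pi.single_apply]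
  rw [rightCoeff, seedCoeff, h3, Finset.prod_eq_single (inl i)]
  · aesop
  · simp_all
  · simp

local notation "𝔞" => ((tree leaf, BTree.corolla 1 0 0) : I ⨳ J)
local notation "𝔟" => ((top, BTree.corolla 0 1 0) : I ⨳ J)

lemma crOp_two : crOp 𝓡 0 [𝔞, 𝔞] =
      single (.tree (.corolla 2 0), .node 0 [.leaf] (.corolla 1 0 0) []) 1 ∧
    crOp 𝓡 0 [𝔞, 𝔟] = single (.tree .leaf, .node 0 [] (.corolla 1 0 0) [.leaf]) 1 ∧
    crOp 𝓡 0 [𝔟, 𝔞] = single (.tree .leaf, .node 0 [.leaf] (.corolla 0 1 0) []) 1 ∧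
    crOp 𝓡 0 [𝔟, 𝔟] = single (.top, .node 0 [] (.corolla 0 1 0) [.leaf]) 1 := by
  simp [crOp, corollaOp, StableVertex, XTree.join, trees?, tmul, centralJoin,
    BTree.corolla, plug, WTree.corolla]

lemma pairBd_lowPart : pairBd 𝓡 I J (lowPart c 1) = 0 ∧ pairBd 𝓡 I J (lowPart c 2) =
    single (.tree (.corolla 2 0), .node 0 [.corolla 2 0] .strand []) 1
    + single (.tree (.corolla 2 0), .node 0 [.leaf] (.corolla 1 0 0) []) 1
    + (single (.tree .leaf, .node 0 [.leaf] (.corolla 0 1 0) []) 1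
      + single (.tree .leaf, .node 0 [] (.corolla 1 0 0) [.leaf]) 1)
    + (single (.top, .node 0 [] .strand [.corolla 2 0]) 1
      + single (.top, .node 0 [] (.corolla 0 1 0) [.leaf]) 1)
    + (∑ i : I, single (.top, .node 0 [] .strand [.corolla 0 (Pi.single i 1)])
        (basisCoeff c (.inl i))
      + ∑ i : J, single (.top, .node 0 [.corolla 0 (Pi.single i 1)] .strand [])
        (basisCoeff c (.inr i))) := by
  have h1 : XTree.bd 𝓡 (.tree .leaf : XTree I) = 0 := by aesop
  have h2 : XTree.bd 𝓡 (.top : XTree I) = 0 := rfl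
  have h3 : XTree.bd 𝓡 (.tree (.corolla 2 0) : XTree I) = 0 := by
    simp [XTree.bd, WTree.corolla, WTree.bd, bdList, splitRoot, StableVertex,
      sum_range_succ]
  constructor
  · simp [lowPart, pairBd_apply, mapFst, mapSnd, h1, h2, bd_corolla_one_zero,
      bd_corolla_zero_one]
  · simp [lowPart, pairBd_apply, mapFst, mapSnd, h1, h2, h3, bd_corolla_two_zero,
      bd_corolla_one_one, bd_corolla_zero_two, bd_corolla_inl,
      bd_corolla_inr, Fintype.sum_sum_type, mapDomain_add, mapDomain_single]

/-- Degree one of the left family consists of `Γ(Ψ_2^0)` and the seeds. For a seed attached to `e_i`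
the factor `⊤` is glued into `Ψ_{1|0}^0` and leaves the strand; for one attached to `f_i` the strand
`↓` becomes `⊤`. -/
lemma unary_one_left : unary (leftFamily D) (rightFamily c) 1 𝔞 =
    single (.tree (.corolla 2 0), .node 0 [.corolla 2 0] .strand []) 1
    + (∑ i : I, single (.tree (.corolla 0 (Pi.single i 1)), .strand) (basisCoeff c (.inl i))
      + ∑ i : J, single (.top, .node 0 [.corolla 0 (Pi.single i 1)] .strand [])
        (basisCoeff c (.inr i))) := by
  have e : leftFamily D 1 = single (.tree (.corolla 2 0), .tree (.corolla 2 0)) 1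
      + (∑ i : I, single (.tree (.corolla 0 (Pi.single i 1)), .top) (basisCoeff c (.inl i))
        + ∑ i : J, single (.top, .tree (.corolla 0 (Pi.single i 1)))
          (basisCoeff c (.inr i))) := by
    rw [leftFamily, familySum, sum_corollaFiber_two, Fintype.sum_sum_type]
    simp [stablePart, StableVertex, WeightedAlgebraDiagonal.γ, D.nondeg, D.seed_left, D.seed_right,
      basisCoeff]
  have h : ∀ y : XTree I × XTree J, (leftAction 𝓡 I J).act 𝔞 0 y =
      (BTree.join 0 [y.2] .strand []).map fun T => (y.1, T) := by
    aesop
  rw [unary, if_neg one_ne_zero, OperadAction.insert, OperadAction.insert,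
    show (leftAction 𝓡 I J).arity 𝔞 = 1 from rfl, show (rightAction 𝓡 I J).arity 𝔞 = 0 from rfl,
    Finset.sum_range_one, e]
  simp [h, BTree.join, trees?]

lemma unary_one_right : unary (leftFamily D) (rightFamily c) 1 𝔟 =
    single (.top, .node 0 [] .strand [.corolla 2 0]) 1
    + ∑ i : I, single (.top, .node 0 [] .strand [.corolla 0 (Pi.single i 1)])
        (basisCoeff c (.inl i)) := by
  have e : rightFamily c 1 = single (.tree (.corolla 2 0)) 1
      + ∑ i : I, single (.tree (.corolla 0 (Pi.single i 1))) (basisCoeff c (.inl i)) := by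
    rw [rightFamily, familySum, sum_corollaFiber_two]
    simp [stablePart, StableVertex, corollaTerm, rightCoeff_zero, rightCoeff_single]
  have h : ∀ y : XTree I, (rightAction 𝓡 I J).act 𝔟 0 y =
      (BTree.join 0 [] .strand [y]).map fun T => (.top, T) := by
    aesop
  rw [unary, if_neg one_ne_zero, OperadAction.insert, OperadAction.insert,
    show (leftAction 𝓡 I J).arity 𝔟 = 0 from rfl, show (rightAction 𝓡 I J).arity 𝔟 = 1 from rfl,
    Finset.sum_range_one, e]
  simp [h, BTree.join, trees?]

lemma diagonalOp_two_nil : diagonalOp D 2 [] =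
    ∑ i : I, single (.tree (.corolla 0 (Pi.single i 1)), .strand)
      (basisCoeff c (.inl i)) := by
  rw [diagonalOp, totalOp, letterPart_nil, add_zero, crSum, sum_weightFiber_two]
  simp [crOp, corollaOp, StableVertex, XTree.join, trees?, tmul, rightCoeff_single,
    WTree.corolla]

/-- In degree two the contributions are the words of two letters, the differential of the part of
degree two, the unary operation of degree one on `𝔞` and `𝔟`, and the curvature. -/
lemma maurerCartan_lowPart (M : ℕ) (hM : M ≤ 2) :
    maurerCartan (diagonalOp D) (lowPart c) M = 0 := by
  have h0 : diagonalOp D 0 [] = 0 := by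
    simp [diagonalOp, totalOp, crSum_zero, letterPart_nil, crOp, corollaOp, if_neg, StableVertex,
      tmul]
  have h1 : ∀ l : List (I ⨳ J), diagonalOp D 1 l =
      letterPart (unary (leftFamily D) (rightFamily c) 1) l := fun l => by
    rw [diagonalOp, totalOp, crSum, weightFiber_one, Finset.sum_empty, zero_add]
  have g1 : geom (lowPart c) 1 = (lowPart c 1).mapDomain fun x => [x] := by
    rw [geom_succ, map_eq_lin]
    simp
  have hs : ∀ n, lin 𝓡 (diagonalOp D 0) ((lowPart c n).mapDomain fun x => [x]) =
      pairBd 𝓡 I J (lowPart c n) := fun n => by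
    rw [lin_mapDomain, lin_diagonalOp_zero]
  obtain ⟨b1, b2⟩ := pairBd_lowPart (c := c)
  interval_cases M
  · simp [maurerCartan, h0]
  · simp_all [maurerCartan, Finset.Nat.sum_antidiagonal_succ]
  · have g2 : geom (lowPart c) 2 = lin 𝓡 (fun x => (lowPart c 1).mapDomain fun y => [x, y])
        (lowPart c 1) + (lowPart c 2).mapDomain fun x => [x] := by
      rw [geom_succ, map_eq_lin, Finset.Nat.sum_antidiagonal_succ, g1]
      simp [← mapDomain_comp, Function.comp_def]
    have hc : lin 𝓡 (diagonalOp D 0) (lin 𝓡 (fun x => (lowPart c 1).mapDomain fun y => [x, y])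
        (lowPart c 1)) = crOp 𝓡 0 [𝔞, 𝔞] + crOp 𝓡 0 [𝔞, 𝔟] + (crOp 𝓡 0 [𝔟, 𝔞] + crOp 𝓡 0 [𝔟, 𝔟]) := by
      simp [diagonalOp, crOp, totalOp, crSum_zero, letterPart_eq_zero, add_zero, lowPart,
        mapDomain_add, mapDomain_single]
    have hu : lin 𝓡 (diagonalOp D 1) (geom (lowPart c) 1) =
        unary (leftFamily D) (rightFamily c) 1 𝔞 + unary (leftFamily D) (rightFamily c) 1 𝔟 := by
      rw [g1, lin_mapDomain]
      simp [lowPart, h1]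
    obtain ⟨c1, c2, c3, c4⟩ := crOp_two (R₀ := R₀) (I := I) (J := J)
    rw [maurerCartan, Finset.Nat.sum_antidiagonal_succ, Finset.Nat.sum_antidiagonal_succ,
      Finset.Nat.antidiagonal_zero, Finset.sum_singleton]
    simp only [zero_add, Nat.reduceAdd]
    rw [hu, g2, map_add, hc, hs, b2, unary_one_left, unary_one_right, geom_zero, lin_one,
      diagonalOp_two_nil, c1, c2, c3, c4]
    -- Each of the nine kinds of terms occurs twice. The letter `i` is the curvature, cancelled by
    -- the seeds of the first weight space inserted into `𝔞`.
    have key : ∀ a b c d e f g h i : I ⨳ J →₀ 𝓡,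
        b + d + (c + f) + (a + b + (c + d) + (e + f) + (g + h))
          + (a + (i + h) + (e + g) + i) = 0 := by
      intro a b c d e f g h i
      rw [show b + d + (c + f) + (a + b + (c + d) + (e + f) + (g + h))
          + (a + (i + h) + (e + g) + i) = (a + b + c + d + e + f + g + h + i) +
            (a + b + c + d + e + f + g + h + i) by abel, add_self 𝓡]
    simp_all

lemma isGoodPair_corolla {S : XTree I} {n j : ℕ} {w : I ⊎ J} {N : ℕ} (hS : S.Stable)
    (hi : S.inputs = n) (hw : S.weight = 0) (hd : S.dim = 0) (hv : StableVertex (n + 1 + j) w)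
    (hN : n + j + 2 * size w = N) :
    IsGoodPair N (N - 1) (S, BTree.corolla n j w) ∧ BTree.corolla n j w ≠ .strand := by
  have h := attr_corolla n j w
  have hg := grade_corolla hw n j w
  simp only [BTree.attr, Prod.mk.injEq] at h
  refine ⟨isGoodPair_iff.2 ⟨⟨hS, ⟨by simpa using hv, trivial, ?_, ?_⟩, hi.trans h.1.symm⟩,
    by aesop, ?_⟩, by simp [BTree.corolla]⟩
  · exact (stableList_iff _).2 fun x hx => List.eq_of_mem_replicate hx ▸ trivial
  · exact (stableList_iff _).2 fun x hx => List.eq_of_mem_replicate hx ▸ trivial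
  grind

lemma isApprox_lowPart : IsApprox D 2 (lowPart c) := by
  classical
  refine ⟨fun n => ?_, maurerCartan_lowPart D, fun n hn => ?_⟩
  · have hl : (tree (.leaf : WTree I)).dim = 0 := by
      simp [XTree.dim, WTree.dim, WTree.inputs, WTree.weight, vertices, size_zero]
    have hc : (tree (.corolla 2 0 : WTree I)).dim = 0 := by
      simp [XTree.dim, dim_corolla, size_zero]
    match n with
    | 0 => simp [lowPart]
    | 1 =>
      intro g hg
      rcases mem_add hg with hg | hg <;>
        obtain rfl := mem_singleton.1 (support_single_subset hg)
      · exact isGoodPair_corolla trivial rfl rfl hl (by simp [StableVertex]) (by simp [size_zero])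
      · exact isGoodPair_corolla trivial rfl rfl rfl (by simp [StableVertex]) (by simp [size_zero])
    | 2 =>
      intro g hg
      rcases mem_add hg with hg | hg
      · rcases mem_add hg with hg | hg
        · rcases mem_add hg with hg | hg <;>
            obtain rfl := mem_singleton.1 (support_single_subset hg)
          · exact isGoodPair_corolla (by simp [XTree.Stable, WTree.corolla, WTree.Stable,
              StableList, StableVertex]) rfl (dim_corolla 2 0).2 hc
              (by simp [StableVertex]) (by simp [size_zero])
          · exact isGoodPair_corolla trivial rfl rfl hl (by simp [StableVertex])
              (by simp [size_zero])
        · obtain rfl := mem_singleton.1 (support_single_subset hg)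
          exact isGoodPair_corolla trivial rfl rfl rfl (by simp [StableVertex])
            (by simp [size_zero])
      · obtain ⟨i, _, hg⟩ := mem_biUnion.1 (support_finsetSum hg)
        obtain rfl := mem_singleton.1 (support_single_subset hg)
        refine isGoodPair_corolla trivial rfl rfl rfl (.inl fun h => ?_) (by simp [size_single])
        simp_all
    | n + 3 => simp [lowPart]
  · match n, hn with
    | n + 3, _ => rfl

end Low

/-! ### Coefficients of words -/

section Words

variable {R : Type*} [CommRing R] {X V : Type*} [AddCommGroup V] [Module R V]

open scoped Classical in
/-- The part of a linear combination supported on a set of generators. -/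
def select (p : X → Prop) : (X →₀ R) →ₗ[R] (X →₀ R) :=
  lin R fun a => if p a then single a 1 else 0

open scoped Classical in
lemma select_apply (p : X → Prop) (x : X →₀ R) (a : X) :
    select p x a = if p a then x a else 0 := by
  induction x using Finsupp.induction_linear with
  | zero => simp
  | add x y hx hy => aesop
  | single b r =>
    rw [select, lin_single]
    by_cases hb : b = a
    · aesop
    aesop

/-- A homogeneous map commutes with taking homogeneous components. -/
lemma select_lin {Y : Type*} {f : X → Y →₀ R} {x : X →₀ R} {p : X → Prop} {q : Y → Prop}
    (h : ∀ a ∈ x.support, ∀ b ∈ (f a).support, q b ↔ p a) :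
    select q (lin R f x) = lin R f (select p x) := by
  classical
  rw [map_lin, show lin R f (select p x) = _ from lin_lin _ _ _]
  refine lin_congr fun a ha => Finsupp.ext fun b => ?_
  rw [select_apply]
  by_cases hb : f a b = 0
  · aesop
  · have := h a ha b (mem_support_iff.2 hb)
    by_cases hp : p a <;> simp [hp, this]

lemma select_lin_eq_zero {Y : Type*} {f : X → Y →₀ R} {x : X →₀ R} {q : Y → Prop}
    (h : ∀ a ∈ x.support, ∀ b ∈ (f a).support, ¬q b) : select q (lin R f x) = 0 := by
  rw [select_lin (p := fun _ => False) fun a ha b hb => iff_false_intro (h a ha b hb)]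
  simp [select, lin_zero]

lemma lin_cons_apply (x : X →₀ R) (y : List X →₀ R) (a : X) (l : List X) :
    lin R (fun b => y.mapDomain (b :: ·)) x (a :: l) = x a * y l := by
  induction x using Finsupp.induction_linear with
  | zero => simp
  | add x x' hx hx' => simp_all [map_add, Finsupp.add_apply, add_mul]
  | single b r =>
    rw [lin_single, Finsupp.smul_apply, smul_eq_mul]
    by_cases hb : b = a
    · simp_all
    grind [Finsupp.mapDomain_of_notMem_range, Finsupp.single_eq_of_ne', mul_zero, zero_mul,
      List.cons.inj]

lemma lin_cons_nil (x : X →₀ R) (y : List X →₀ R) :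
    lin R (fun b => y.mapDomain (b :: ·)) x [] = 0 := by
  induction x using Finsupp.induction_linear with
  | zero => simp
  | add x x' hx hx' => simp_all
  | single b r =>
    simp [lin_single, Finsupp.smul_apply, Finsupp.mapDomain_of_notMem_range, smul_zero]

lemma listTensor_cons (x : X →₀ R) (xs : List (X →₀ R)) :
    listTensor (x :: xs) = lin R (fun b => (listTensor xs).mapDomain (b :: ·)) x := by
  simp [listTensor, bilin_eq_lin, map_eq_lin]

lemma length_of_mem_listTensor {xs : List (X →₀ R)} {l : List X}
    (h : l ∈ (listTensor xs).support) : l.length = xs.length := by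
  classical
  induction xs generalizing l with
  | nil =>
    rw [mem_singleton.1 (support_single_subset h)]
    rfl
  | cons x xs ih =>
    rw [listTensor_cons] at h
    obtain ⟨b, -, h⟩ := mem_lin h
    obtain ⟨m, hm, rfl⟩ := mem_image.1 (mapDomain_support h)
    simp_all

lemma listTensor_ofFn_apply {k : ℕ} (x : Fin k → X →₀ R) (g : Fin k → X) :
    listTensor (ofFn x) (ofFn g) = ∏ i, x i (g i) := by
  induction k with
  | zero => simp [listTensor]
  | succ k ih =>
    rw [List.ofFn_succ, List.ofFn_succ, listTensor_cons, lin_cons_apply, ih, Fin.prod_univ_succ]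

variable {P : ℕ → X →₀ R} {deg : X → ℕ}

/-- Each letter occurs in one part of `P` only, so a word arises in one way, and its coefficient is
the product of those of its letters. -/
lemma geom_apply (h0 : P 0 = 0) (hP : ∀ n, ∀ x ∈ (P n).support, deg x = n) (n : ℕ) (l : List X) :
    geom P n l = if (l.map deg).sum = n then (l.map fun x => P (deg x) x).prod else 0 := by
  have hP' : ∀ n x, deg x ≠ n → P n x = 0 := fun n x h => by
    grind
  induction l generalizing n with
  | nil =>
    cases n with
    | zero => simp
    | succ n =>
      simp [geom_succ, finsetSum_apply, sum_eq_zero, lin_cons_nil]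
  | cons x l ih =>
    simp only [map_cons, sum_cons, List.prod_cons]
    cases n with
    | zero =>
      simp_all
    | succ n =>
      rw [geom_succ, finsetSum_apply]
      simp only [lin_cons_apply, ih]
      split_ifs with h
      · rcases Nat.eq_zero_or_pos (deg x) with hx | hx
        · simp_all
        · rw [sum_eq_single (deg x - 1, (l.map deg).sum)]
          · grind
          · grind
          grind [absurd, mem_anti]
      · refine sum_eq_zero fun p hp => ?_
        rw [mem_anti] at hp
        grind

lemma lin_letterPart_geom (h0 : P 0 = 0) (f : X → V) (n : ℕ) :
    lin R (letterPart f) (geom P n) = lin R f (P n) := by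
  cases n with
  | zero => simp [h0]
  | succ n =>
    have hn : ∀ m, geom P (m + 1) [] = 0 := fun m => by
      rw [geom_succ, finsetSum_apply, sum_eq_zero fun p _ => lin_cons_nil _ _]
    have key : ∀ (x : X) (y : List X →₀ R), lin R (fun l => letterPart f (x :: l)) y = y [] • f x := by
      intro x y
      induction y using Finsupp.induction_linear with
      | zero => simp
      | add y y' h h' => rw [map_add, h, h', Finsupp.add_apply, add_smul]
      | single l r =>
        rw [lin_single]
        cases l with
        | nil => simp
        | cons a l => simp [letterPart_eq_zero]
    rw [geom_succ, map_sum]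
    simp only [lin_lin, lin_mapDomain, key]
    rw [sum_eq_single (n, 0)]
    · simp
    · rintro ⟨a, b⟩ hp hne
      rw [mem_anti] at hp
      cases b with
      | zero => simp_all
      | succ b => simp [hn, lin_zero]
    simp

end Words

/-! ### The family of graded pieces -/

section Pieces

variable {R₀ : Type*} [CommRing R₀] [CharP R₀ 2] {I J : Type} [Fintype I] [DecidableEq I]
  [Fintype J] [DecidableEq J] {c : I ⊕ J → R₀} (D : WeightedAlgebraDiagonal R₀ I J c)

local notation "𝓡" => GroundRing R₀ I J
local notation "𝓖" => ℕ × ℕ × (I ⊎ J)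

/-- The homogeneous pieces of a sequence of linear combinations of pairs of trees. -/
def piece (P : ℕ → I ⨳ J →₀ 𝓡) (a : 𝓖) : I ⨳ J →₀ 𝓡 :=
  select (fun g => grade g = a) (P (gradeDegree a))

/-- Here `σ m` is the grade of the inserted corolla, `e` that of the input used up by gluing, and `τ
m` the grade that must be present before insertion to reach `b`. The left and the right insertions
are both instances. -/
lemma select_insert_familySum {Y : Type*} (A : OperadAction 𝓡 (I ⨳ J) Y)
    {ι : Type} [Fintype ι] [DecidableEq ι] {γ : ℕ → (ι → ℕ) → Y →₀ 𝓡}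
    (P : ℕ → I ⨳ J →₀ 𝓡) {b e : 𝓖} {σ τ : ℕ × (ι → ℕ) → 𝓖}
    {S : Finset (ℕ × (ι → ℕ))} {N : ℕ} (hN : gradeDegree b = N) (he : gradeDegree e = 1)
    (hσ : ∀ m, gradeDegree (σ m) = m.1 + 2 * size m.2)
    (hact : ∀ {g z i m y}, StableVertex m.1 m.2 → y ∈ (γ m.1 m.2).support →
      A.act g i y = some z → grade z + e = grade g + σ m)
    (hS : ∀ m a, a + σ m = b + e → m ∈ S) (hτ : ∀ m ∈ S, τ m + σ m = b + e) :
    ∑ p ∈ anti N, select (fun z => grade z = b)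
      (lin 𝓡 (A.insert (familySum (stablePart γ) p.1)) (P p.2)) =
    ∑ m ∈ S with StableVertex m.1 m.2, lin 𝓡 (A.insert (γ m.1 m.2)) (piece P (τ m)) := by
  have hdeg : ∀ m ∈ S, gradeDegree (τ m) + (m.1 + 2 * size m.2) = N + 1 := fun m hm => by
    rw [← hσ, ← gradeDegree_add, hτ m hm, gradeDegree_add, hN, he]
  have hpos : ∀ m : ℕ × (ι → ℕ), StableVertex m.1 m.2 → 1 ≤ m.1 + 2 * size m.2 := fun m hm => by
    rcases hm with h | h
    · grind [size, size_eq_zero]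
    · omega
  have hmem : ∀ {g z m}, z ∈ (A.insert (γ m.1 m.2) g).support → StableVertex m.1 m.2 →
      grade z + e = grade g + σ m := fun hz hm => by
    grind [OperadAction.mem_support_insert]
  rw [← Finset.sum_fiberwise_of_maps_to (g := fun m : ℕ × (ι → ℕ) => m.1 + 2 * size m.2 - 1)
    (t := range (N + 1)), Finset.Nat.sum_antidiagonal_eq_sum_range_succ_mk]
  swap
  · grind
  refine sum_congr rfl fun d hd => ?_
  rw [mem_range] at hd
  have : lin 𝓡 (A.insert (familySum (stablePart γ) d)) (P (N - d)) =
      ∑ m ∈ corollaFiber ι (d + 1), lin 𝓡 (A.insert (stablePart γ m)) (P (N - d)) := by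
    rw [← lin_sum]
    exact lin_congr fun g _ => OperadAction.insert_sum _ _ _ _
  simp only [this, map_sum]
  symm
  refine Finset.sum_subset_zero_on_sdiff ?_ ?_ ?_
  · intro m hm
    grind [mem_filter, mem_corollaFiber]
  · intro m hm
    simp only [Finset.mem_sdiff, mem_filter, mem_corollaFiber] at hm
    by_cases hs : StableVertex m.1 m.2
    · rw [stablePart, if_pos hs]
      refine select_lin_eq_zero fun g _ z hz hzb => hm.2 ⟨⟨hS m (grade g) ?_, hs⟩, by omega⟩
      grind
    · rw [stablePart, if_neg hs]
      simp [select_lin_eq_zero, OperadAction.insert_zero]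
  · intro m hm
    simp only [mem_filter] at hm
    obtain ⟨⟨hmS, hs⟩, hd⟩ := hm
    have h1 := hdeg m hmS
    have h2 := hpos m hs
    rw [stablePart, if_pos hs, piece, show gradeDegree (τ m) = N - d by omega]
    refine (select_lin fun g _ z hz => ?_).symm
    grind

lemma sum_range_Icc_filter {ι : Type} [Fintype ι] {V : Type*} [AddCommMonoid V] (n : ℕ) (w : ι → ℕ)
    [DecidableEq ι] (F : ℕ → ℕ → (ι → ℕ) → V) :
    ∑ p ∈ anti (n + 1), ∑ v ∈ (Icc 0 w).filter (StableVertex p.1), F p.1 p.2 v =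
      ∑ m ∈ (range (n + 2) ×ˢ Icc 0 w) with StableVertex m.1 m.2,
        F m.1 (n + 1 - m.1) m.2 := by
  simp [sum_filter, Finset.sum_product, Finset.Nat.sum_antidiagonal_eq_sum_range_succ_mk]

lemma mem_support_piece {P : ℕ → I ⨳ J →₀ 𝓡} {a : 𝓖} {g : I ⨳ J}
    (h : g ∈ (piece P a).support) :
    grade g = a ∧ g ∈ (P (gradeDegree a)).support := by
  simp_all [mem_support_iff, piece, select_apply, absurd]

lemma sumL_piece {P : ℕ → I ⨳ J →₀ 𝓡}
    (hP : ∀ n, ∀ g ∈ (P n).support, StablePair g) (n j : ℕ) (w : I ⊎ J) :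
    sumL D (fun n j w => piece P (n, j, w)) n j w =
      ∑ p ∈ anti (gradeDegree (n, j, w)), select (fun z => grade z = (n, j, w))
        (lin 𝓡 ((leftAction 𝓡 I J).insert (leftFamily D p.1)) (P p.2)) := by
  refine Eq.trans ?_ (select_insert_familySum (leftAction 𝓡 I J) (γ := D.γ) P (e := (1, 0, 0))
    (σ := fun m => (m.1, 0, m.2)) (τ := fun m => (n + 1 - m.1, j, w - m.2))
    (S := range (n + 2) ×ˢ Icc 0 w) rfl (by simp [gradeDegree])
    (fun m => by simp [gradeDegree]) (fun hs hy h => (grade_leftAct D hs hy h).1) ?_ ?_).symm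
  · rw [sumL, sum_range_Icc_filter n w fun a b v =>
      ∑ i ∈ range b, compL i (piece P (b, j, w - v)) (D.γ a v)]
    refine sum_congr rfl fun m _ => ?_
    simp only [compL, bilin_eq_lin]
    rw [← lin_sum]
    refine lin_congr fun g hg => ?_
    obtain ⟨h1, h2⟩ := mem_support_piece hg
    rw [OperadAction.insert, show (leftAction 𝓡 I J).arity g = n + 1 - m.1 from
      (hP _ g h2).2.2.trans (congrArg fst h1)]
    rfl
  · intro m a h
    have h1 := congrArg fst h
    have h2 := congrArg (fun x => x.2.2) h
    grind [Prod.fst_add, Prod.snd_add, add_zero, mem_product, mem_range, mem_Icc, zero_le,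
      le_add_self]
  · intro m hm
    rw [mem_product, mem_range, mem_Icc] at hm
    simp only [Prod.mk_add_mk, add_zero, Prod.mk.injEq, true_and]
    exact ⟨by omega, tsub_add_cancel_of_le hm.2.2⟩

lemma sumR_piece (P : ℕ → I ⨳ J →₀ 𝓡)
    (n j : ℕ) (w : I ⊎ J) :
    sumR c (fun n j w => piece P (n, j, w)) n j w =
      ∑ p ∈ anti (gradeDegree (n, j, w)), select (fun z => grade z = (n, j, w))
        (lin 𝓡 ((rightAction 𝓡 I J).insert (rightFamily c p.1)) (P p.2)) := by
  refine Eq.trans ?_ (select_insert_familySum (rightAction 𝓡 I J) (γ := corollaTerm c) P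
    (e := (0, 1, 0)) (σ := fun m => (0, m.1, ofFst m.2))
    (τ := fun m => (n, j + 1 - m.1, w - ofFst m.2))
    (S := range (j + 2) ×ˢ Icc 0 (w ∘ inl)) rfl (by simp [gradeDegree])
    (fun m => by simp [gradeDegree, size_ofFst]) (fun hs hy h => ?_) ?_ ?_).symm
  · rw [sumR, sum_range_Icc_filter j (w ∘ inl) fun a b v => ∑ i ∈ range b,
      seedCoeff c (ofFst v) • compR i (piece P (n, b, w - ofFst v)) (.tree (.corolla a v))]
    refine sum_congr rfl fun m _ => ?_
    have : ∀ i (x : I ⨳ J →₀ 𝓡),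
        seedCoeff c (ofFst m.2) • compR i x (.tree (.corolla m.1 m.2)) =
        lin 𝓡 (fun g => lin 𝓡 (fun y => ofOption 𝓡 ((rightAction 𝓡 I J).act g i y))
          (corollaTerm c m.1 m.2)) x := fun i x => by
      simp only [corollaTerm, map_smul, lin_one, lin_smul]
      rfl
    simp only [this]
    rw [← lin_sum]
    refine lin_congr fun g hg => ?_
    obtain ⟨h1, h2⟩ := mem_support_piece hg
    rw [OperadAction.insert, show (rightAction 𝓡 I J).arity g = j + 1 - m.1 from
      congrArg (fun a => a.2.1) h1]
  · rw [eq_of_mem_corollaTerm hy] at h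
    exact (grade_rightAct h).1
  · intro m a h
    have h1 := congrArg (fun x => x.2.1) h
    have h2 := congrArg (fun x => x.2.2) h
    simp only [Prod.fst_add, Prod.snd_add, add_zero] at h1 h2
    rw [mem_product, mem_range, mem_Icc]
    refine ⟨by omega, zero_le, fun i => ?_⟩
    have := congrFun h2 (inl i)
    simp only [Pi.add_apply, ofFst, Sum.elim_inl] at this
    grind
  · intro m hm
    rw [mem_product, mem_range, mem_Icc] at hm
    simp only [Prod.mk_add_mk, add_zero, Prod.mk.injEq, true_and]
    refine ⟨by omega, tsub_add_cancel_of_le fun i => ?_⟩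
    cases i with
    | inl i => exact hm.2.2 i
    | inr i => exact zero_le

end Pieces

/-! ### Existence of the primitive -/

section Primitive

variable {R₀ : Type*} [CommRing R₀] [CharP R₀ 2] {I J : Type} [Fintype I] [DecidableEq I]
  [Fintype J] [DecidableEq J] {c : I ⊕ J → R₀} (D : WeightedAlgebraDiagonal R₀ I J c)

local notation "𝓡" => GroundRing R₀ I J
local notation "𝓖" => ℕ × ℕ × (I ⊎ J)

lemma CR_eq_lin {v : I → ℕ} {xs : List (I ⨳ J →₀ 𝓡)}
    (h : StableVertex xs.length v) : CR v xs = lin 𝓡 (crOp 𝓡 v) (listTensor xs) := by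
  refine (?_ : _ = lin 𝓡 (fun l => ofOption 𝓡 ((XTree.join v (l.map fst)).map
    fun S => (S, centralJoin (l.map snd)))) (listTensor xs)).trans
      (lin_congr fun l hl => ?_)
  · rfl
  · rw [crOp, corollaOp, List.length_map, length_of_mem_listTensor hl, if_pos h, tmul_single]
    cases XTree.join v (l.map fst) <;> simp [ofOption]

lemma lin_crOp_listTensor_eq_zero {v : I → ℕ} {xs : List (I ⨳ J →₀ 𝓡)}
    (h : ¬StableVertex xs.length v) : lin 𝓡 (crOp 𝓡 v) (listTensor xs) = 0 :=
  lin_eq_zero fun l hl => by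
    rw [crOp, corollaOp, List.length_map, length_of_mem_listTensor hl, if_neg h]
    simp [tmul]

lemma gradeDegree_sum (l : List 𝓖) : gradeDegree l.sum = (l.map gradeDegree).sum := by
  induction l with
  | nil => simp [gradeDegree]
  | cons a l ih => grind [sum_cons, gradeDegree_add, map_cons]

/-- Coefficients of a fixed word are compared. Only the tuple `f` of the grades of its letters can
contribute; conversely a word with nonzero coefficient in the series has no letter of grade zero,
and this bounds its length. -/
lemma select_geom_ofFn {P : ℕ → I ⨳ J →₀ 𝓡} (h0 : P 0 = 0)
    (hP : ∀ n, ∀ g ∈ (P n).support, gradeDegree (grade g) = n) (n j : ℕ) (w : I ⊎ J)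
    (v : I → ℕ) :
    ∑ k ∈ range (n + j + size w + 1),
      ∑ f ∈ (Fintype.piFinset fun _ : Fin k =>
          range (n + 1) ×ˢ range (j + 1) ×ˢ Icc 0 w).filter
          (fun f => (∀ a, f a ≠ 0) ∧ (0, 0, ofFst v) + ∑ a, f a = (n, j, w)),
        listTensor (ofFn fun a => piece P (f a)) =
    select (fun l => (0, 0, ofFst v) + (l.map grade).sum = (n, j, w))
      (geom P (gradeDegree (n, j, w) - 2 * size v)) := by
  classical
  refine Finsupp.ext fun l => ?_
  obtain ⟨k, g, rfl⟩ : ∃ (k : ℕ) (g : Fin k → I ⨳ J), l = ofFn g :=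
    ⟨_, _, (List.ofFn_get l).symm⟩
  have hf : ∀ f : Fin k → 𝓖, listTensor (ofFn fun a => piece P (f a)) (ofFn g) =
      if f = fun a => grade (g a) then ∏ a, P (gradeDegree (grade (g a))) (g a) else 0 := by
    intro f
    rw [listTensor_ofFn_apply]
    split_ifs with h
    · subst h
      simp [Finset.prod_congr, piece, select_apply, if_pos]
    · obtain ⟨a, ha⟩ := Function.ne_iff.1 h
      exact Finset.prod_eq_zero (mem_univ a)
        (by rw [piece, select_apply, if_neg fun h => ha h.symm])
  have hk : ∀ k', k' ≠ k → ∀ f : Fin k' → 𝓖,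
      listTensor (ofFn fun a => piece P (f a)) (ofFn g) = 0 := by
    intro k' hk' f
    by_contra h
    have := length_of_mem_listTensor (mem_support_iff.2 h)
    rw [List.length_ofFn, List.length_ofFn] at this
    exact hk' this.symm
  have hsum : ((ofFn g).map grade).sum = ∑ a, grade (g a) := by
    rw [List.map_ofFn, List.sum_ofFn]
    rfl
  have hR : select (fun l => (0, 0, ofFst v) + (l.map grade).sum = (n, j, w))
      (geom P (gradeDegree (n, j, w) - 2 * size v)) (ofFn g) =
      if (0, 0, ofFst v) + ∑ a, grade (g a) = (n, j, w) then
        ∏ a, P (gradeDegree (grade (g a))) (g a) else 0 := by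
    rw [select_apply, hsum]
    refine ite_congr rfl (fun h => ?_) fun _ => rfl
    have h1 := congrArg gradeDegree h
    rw [gradeDegree_add, ← hsum, gradeDegree_sum, List.map_map] at h1
    rw [geom_apply (deg := fun g => gradeDegree (grade g)) h0 hP, if_pos, List.map_ofFn,
      List.prod_ofFn]
    · rfl
    · rw [← h1, gradeDegree, size_ofFst, zero_add, zero_add, Nat.add_sub_cancel_left]
      rfl
  rw [hR, finsetSum_apply]
  simp only [finsetSum_apply]
  by_cases hprod : ∏ a, P (gradeDegree (grade (g a))) (g a) = 0
  · rw [hprod, ite_self]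
    refine sum_eq_zero fun k' _ => sum_eq_zero fun f _ => ?_
    by_cases h : k' = k
    · subst h
      rw [hf, hprod, ite_self]
    · exact hk k' h f
  have hne : ∀ a, grade (g a) ≠ 0 := fun a ha => hprod <| Finset.prod_eq_zero (mem_univ a) <| by
    rw [ha, show gradeDegree (0 : 𝓖) = 0 by simp [gradeDegree], h0, Finsupp.zero_apply]
  -- This height is at least `1` on each nonzero grade, hence a word has at most `n + j + |w|`
  -- letters, which is the range of `k` in `sumCR`.
  let ht : 𝓖 →+ ℕ :=
    { toFun := fun a => a.1 + a.2.1 + size a.2.2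
      map_zero' := by simp
      map_add' := fun a b => by
        simp only [Prod.fst_add, Prod.snd_add, size_add]
        ring }
  have hmem : (0, 0, ofFst v) + ∑ a, grade (g a) = (n, j, w) → k < n + j + size w + 1 := by
    intro h
    have h1 := congrArg ht h
    rw [map_add, map_sum] at h1
    have h2 : ∑ _a : Fin k, 1 ≤ ∑ a, ht (grade (g a)) := Finset.sum_le_sum fun a _ => by
      by_contra hc
      have h3 : (grade (g a)).1 + (grade (g a)).2.1 + size (grade (g a)).2.2 < 1 := not_le.1 hc
      exact hne a (Prod.ext (show _ = 0 by omega)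
        (Prod.ext (show _ = 0 by omega) (size_eq_zero.1 (by omega))))
    have h3 : ht (n, j, w) = n + j + size w := rfl
    rw [Finset.sum_const, Finset.card_univ, Fintype.card_fin, smul_eq_mul, mul_one] at h2
    omega
  have hbound : (0, 0, ofFst v) + ∑ a, grade (g a) = (n, j, w) → (fun a => grade (g a)) ∈
      (Fintype.piFinset fun _ : Fin k =>
        range (n + 1) ×ˢ range (j + 1) ×ˢ Icc 0 w).filter
        (fun f => (∀ a, f a ≠ 0) ∧ (0, 0, ofFst v) + ∑ a, f a = (n, j, w)) := by
    intro h
    refine mem_filter.2 ⟨Fintype.mem_piFinset.2 fun a => ?_, hne, h⟩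
    have h1 : grade (g a) ≤ (n, j, w) :=
      (Finset.single_le_sum (f := fun a => grade (g a)) (fun _ _ => zero_le)
        (mem_univ a)).trans (h ▸ le_add_self)
    simp only [mem_product, mem_range, mem_Icc, Nat.lt_succ_iff]
    exact ⟨h1.1, h1.2.1, zero_le, h1.2.2⟩
  by_cases hc : (0, 0, ofFst v) + ∑ a, grade (g a) = (n, j, w)
  · rw [if_pos hc, Finset.sum_eq_single_of_mem k (mem_range.2 (hmem hc))
      fun k' _ h => sum_eq_zero fun f _ => hk k' h f]
    simp only [hf]
    rw [Finset.sum_ite_eq', if_pos (hbound hc)]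
  · rw [if_neg hc]
    refine sum_eq_zero fun k' _ => sum_eq_zero fun f hfm => ?_
    by_cases h : k' = k
    · subst h
      rw [hf, if_neg]
      rintro rfl
      exact hc (mem_filter.1 hfm).2.2
    · exact hk k' h f

/-- `CR^v` adds `v` to the weights of its arguments, so the component of grade `(n, j, w)` comes
from the words of complementary grade; the weights `v` are then collected by their degree `2|v|`. -/
lemma sumCR_piece {P : ℕ → I ⨳ J →₀ 𝓡} (h0 : P 0 = 0)
    (hP : ∀ n, ∀ g ∈ (P n).support, StablePair g ∧ gradeDegree (grade g) = n) (n j : ℕ)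
    (w : I ⊎ J) : sumCR c (fun n j w => piece P (n, j, w)) n j w =
      ∑ p ∈ anti (gradeDegree (n, j, w)), select (fun z => grade z = (n, j, w))
        (lin 𝓡 (crSum (rightCoeff c) p.1) (geom P p.2)) := by
  have hstable : ∀ {m l}, l ∈ (geom P m).support → ∀ g ∈ l, StablePair g := by
    intro m l hl
    obtain ⟨s, -, hs⟩ := mem_support_geom (G := fun _ => {g | StablePair g})
      (fun n g hg => (hP n g hg).1) hl
    clear hl
    induction hs with
    | nil => simp
    | cons h _ ih => grind
  have hle : ∀ {v : I → ℕ} {a : 𝓖}, (0, 0, ofFst v) + a = (n, j, w) → v ≤ w ∘ inl := by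
    intro v a h i
    have := congrFun (congrArg (fun a => a.2.2) h) (inl i)
    simp only [Prod.snd_add, Pi.add_apply, ofFst, Sum.elim_inl] at this
    grind
  have hfrozen : sumCR c (fun n j w => piece P (n, j, w)) n j w =
      ∑ v ∈ Icc 0 (w ∘ inl), rightCoeff c v • lin 𝓡 (crOp 𝓡 v)
        (select (fun l => (0, 0, ofFst v) + (l.map grade).sum = (n, j, w))
          (geom P (gradeDegree (n, j, w) - 2 * size v))) := by
    simp only [sumCR, sum_filter]
    rw [sum_comm]
    refine sum_congr rfl fun v _ => ?_
    rw [← select_geom_ofFn h0 fun n g hg => (hP n g hg).2]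
    simp only [map_sum, smul_sum]
    refine sum_congr rfl fun k _ => ?_
    rw [← sum_filter]
    by_cases hs : StableVertex k v
    · rw [if_pos hs]
      exact sum_congr rfl fun f _ => by rw [CR_eq_lin (by rwa [List.length_ofFn]), rightCoeff]
    · rw [if_neg hs]
      exact (sum_eq_zero fun f _ => by
        rw [lin_crOp_listTensor_eq_zero (by rwa [List.length_ofFn]), smul_zero]).symm
  have hsize : ∀ v ∈ Icc 0 (w ∘ inl), 2 * size v ≤ gradeDegree (n, j, w) := by
    intro v hv
    have h1 : size v ≤ size w := by
      rw [← size_ofFst (J := J)]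
      refine Finset.sum_le_sum fun i _ => ?_
      cases i with
      | inl i => exact (mem_Icc.1 hv).2 i
      | inr i => exact zero_le
    simp only [gradeDegree]
    omega
  rw [hfrozen, ← Finset.sum_fiberwise_of_maps_to (g := fun v => 2 * size v)
    (t := range (gradeDegree (n, j, w) + 1))
    fun v hv => mem_range.2 (Nat.lt_succ_of_le (hsize v hv)),
    Finset.Nat.sum_antidiagonal_eq_sum_range_succ_mk]
  refine sum_congr rfl fun d hd => ?_
  unfold crSum
  simp only [lin_sum, lin_smul, map_sum, map_smul]
  refine Finset.sum_subset_zero_on_sdiff ?_ ?_ ?_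
  · grind [mem_weightFiber, mem_filter]
  · intro v hv
    simp only [Finset.mem_sdiff, mem_filter, mem_weightFiber, mem_Icc] at hv
    rw [select_lin_eq_zero, smul_zero]
    intro l hl z hz hzb
    rw [(grade_crOp (hstable hl) hz).2.1] at hzb
    exact hv.2 ⟨⟨zero_le, hle hzb⟩, hv.1⟩
  · intro v hv
    rw [← (mem_filter.1 hv).2]
    refine congrArg _ (select_lin fun l hl z hz => ?_).symm
    rw [(grade_crOp (hstable hl) hz).2.1]

lemma piece_eq_single {P : ℕ → I ⨳ J →₀ 𝓡} {N : ℕ} {a : 𝓖}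
    (hN : gradeDegree a = N) {x : I ⨳ J →₀ 𝓡} (h : P N = lowPart c N)
    (hx : select (fun g => grade g = a) (lowPart c N) = x) : piece P a = x := by
  rw [piece, hN, h, hx]

lemma select_single {X : Type*} {p : X → Prop} {a : X} (r : 𝓡) [Decidable (p a)] :
    select p (single a r) = if p a then single a r else 0 := by
  simp [select, lin_single]

/-- The primitive consists of the homogeneous components of the solution of the Maurer–Cartan
equation. All operations respect the grading, so the compatibility equations are the components of
that equation, and the base cases are components of `lowPart`. -/
lemma exists_isBimoduleDiagonalPrimitive :
    ∃ p : PrimitiveFamily R₀ I J, IsBimoduleDiagonalPrimitive D p := by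
  obtain ⟨P, h0, h1, h2, hP, hMC⟩ := exists_maurerCartan_eq_zero D (isApprox_lowPart D)
  have hP' : ∀ n, ∀ g ∈ (P n).support, StablePair g ∧ gradeDegree (grade g) = n := fun n g hg =>
    have h := isGoodPair_iff.1 (hP n g hg).1
    ⟨h.1, h.2.1⟩
  have hi : ∀ i k : I ⊕ J, (Pi.single i 1 : I ⊎ J) = Pi.single k 1 ↔ i = k := fun i k => by
    constructor
    · intro h
      by_contra hne
      simpa [Pi.single_eq_of_ne hne] using congrFun h i
    grind
  have g1 : ∀ n j w, grade ((.tree .leaf, .corolla n j w) : I ⨳ J) = (n, j, w) :=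
    grade_corolla rfl
  have g2 : ∀ n j w, grade ((.top, .corolla n j w) : I ⨳ J) = (n, j, w) :=
    grade_corolla rfl
  have g3 : ∀ n j w, grade ((.tree (.corolla 2 0), .corolla n j w) : I ⨳ J) =
      (n, j, w) := grade_corolla (dim_corolla 2 0).2
  refine ⟨fun n j w => piece P (n, j, w), ?_, ?_, ?_, ?_, ?_⟩
  · intro n j w g hg
    obtain ⟨hg1, hg2⟩ := mem_support_piece hg
    obtain ⟨⟨s1, s2, s3⟩, -⟩ := hP' _ g hg2
    obtain ⟨rfl, rfl, rfl⟩ : g.2.leftInputs = n ∧ g.2.rightInputs = j ∧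
        ofFst g.1.weight + g.2.weight = w :=
      ⟨congrArg fst hg1, congrArg (fun a => a.2.1) hg1, congrArg (fun a => a.2.2) hg1⟩
    exact ⟨s1, s3, ⟨s2, (hP _ g hg2).2⟩, rfl, rfl, le_rfl⟩
  · intro n j w
    have h := congrArg (select fun z => grade z = (n, j, w)) (hMC (gradeDegree (n, j, w)))
    rw [maurerCartan, map_zero, map_sum] at h
    have hd : ∀ d (y : List (I ⨳ J) →₀ 𝓡), lin 𝓡 (diagonalOp D d) y =
        lin 𝓡 (crSum (rightCoeff c) d) y +
          lin 𝓡 (letterPart (unary (leftFamily D) (rightFamily c) d)) y :=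
      fun d y => lin_add _ _ _
    -- Unary operations see only the one-letter words of the geometric series, that is, `P` itself.
    simp only [hd, lin_letterPart_geom h0, lin_unary, map_add, sum_add_distrib] at h
    rw [← sumCR_piece h0 hP', ← sumL_piece D fun n g hg => (hP' n g hg).1, ← sumR_piece] at h
    have hbd : ∑ p ∈ anti (gradeDegree (n, j, w)), select (fun z => grade z = (n, j, w))
        (if p.1 = 0 then lin 𝓡 (pairD (XTree.bd 𝓡) (BTree.bd 𝓡)) (P p.2) else 0) =
        bdPair (XTree.bd 𝓡) (BTree.bd 𝓡) (piece P (n, j, w)) := by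
      simp only [apply_ite (select _), map_zero]
      rw [anti_nat_ite_fst _ fun m => select (fun z => grade z = (n, j, w))
        (lin 𝓡 (pairD (XTree.bd 𝓡) (BTree.bd 𝓡)) (P m)), select_lin (p := fun g => grade g = (n, j, w))]
      · rfl
      · intro g hg z hz
        rw [(grade_pairD (hP' _ g hg).1 hz).2.1]
    rw [hbd] at h
    -- The Maurer–Cartan equation has all terms on one side; in characteristic two moving the
    -- differential across changes no sign.
    refine eq_of_add_eq_zero_of_charTwo 𝓡 ?_
    rw [← h]
    abel
  · refine piece_eq_single (N := 1) (c := c) (by simp [gradeDegree]) h1 ?_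
    simp [lowPart, select_single, g1, g2]
  · refine piece_eq_single (N := 1) (c := c) (by simp [gradeDegree]) h1 ?_
    simp [lowPart, select_single, g1, g2]
  · intro i
    refine piece_eq_single (N := 2) (c := c) (by simp [gradeDegree, size_single]) h2 ?_
    change select _ (lowPart c 2) = single _ (basisCoeff c i)
    simp [lowPart, select_single, g1, g2, g3, hi, -Fintype.sum_sum_type]

end Primitive

end WeightedTrees

end

theorem mainTheorem4 {R₀ : Type*} [CommRing R₀] [CharP R₀ 2] (r s : ℕ)
    (c : Fin r ⊕ Fin s → R₀)
    (D : WeightedTrees.WeightedAlgebraDiagonal R₀ (Fin r) (Fin s) c) :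
    ∃ p : WeightedTrees.PrimitiveFamily R₀ (Fin r) (Fin s),
      WeightedTrees.IsBimoduleDiagonalPrimitive D p :=
  WeightedTrees.exists_isBimoduleDiagonalPrimitive D
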